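/- **Definitions.** A *chord diagram* is an oriented circle with finitely many chords with distinct endpoints, up to orientation-preserving homeomorphism; it is described by the cyclic word of the labels of its chords, up to relabelling. Let $A(i,j)$, $1\le i<j\le m$, be the horizontal chord joining the strands $i$ and $j$ of the identity $m$-braid. A word $W$ in the $A(i,j)$ is an *$m$-braiding* of a chord diagram $D$ if $D$ is obtained by adjoining $\delta=\sigma_{m-1}^{-1}\cdots\sigma_1^{-1}$ below $W$ and closing up; so the circle runs through the strands $1,2,\dots,m$ of $W$ in this order. *Cyclic permutation* replaces $W'A(i,j)$ with $A(i+1,j+1)W'$ if $j<m$, and $W'A(i,m)$ with $A(1,i+1)W'$; words are *cyclically equivalent* if they are related by such moves and their inverses. A *singular knot* is an immersion of the oriented circle in $S^3$ whose only singularities are finitely many transverse double points; it *respects* $D$ if the pairs of points of the circle that it identifies are the chords of $D$. An isotopy of singular knots is a smooth path of singular knots along which the identified pairs do not change, up to an orientation-preserving change of the parameter. The *standard knot* of $W$ is the closure of the singular braid obtained from $W\delta$ by replacing each $A(i,j)$ with the pure braid generator $$A_{ij}=\sigma_{j-1}^{-1}\cdots\sigma_{i+1}^{-1}\,\sigma_i^2\,\sigma_{i+1}\cdots\sigma_{j-1}$$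 in which one of the two crossings of $\sigma_i^2$, no matter which, is replaced with a double point. A *braid-preserving flype* relates the closures of the singular 3-braids $XRY\sigma_2^{\varepsilon}$ and $X\sigma_2^{\varepsilon}YR$, where $\varepsilon=\pm1$, $X$ and $Y$ are singular braids on the first two strands, and $R$ is a singular braid on the last two strands. **Corollary 4.3.** Let $D$ be a chord diagram that has a 3-braiding (for example, any chord diagram of braid index 3, that is, one for which 3 is the least $m$ such that it has an $m$-braiding). Then choosing the standard knot of a 3-braiding of $D$ as the singular knot that respects $D$ is well defined: if $V$ and $W$ are 3-braidings of $D$, then their standard knots (for any choices of the smashed crossings) are singular knots that respect $D$, and they are isotopic. More precisely, with $a=A(1,2)$ and $c=A(1,3)$, either 1. $V$ and $W$ are cyclically equivalent, and the singular braids of their standard knots have the same closed braid (they are conjugate in the singular braid monoid), or 2. there are $l,p,n\ge 0$ such that $V$ is cyclically equivalent to $a^lc^pa^n$ and $W$ to $a^lc^na^p$, and the two standard knots are related, up to conjugation, by a braid-preserving flype. -/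

import Mathlib

open scoped ContDiff

/-! ### Chord diagrams

A chord diagram is recorded by a name: the list of the labels of the chords, in the order in which
their endpoints are passed along the oriented circle. -/

/-- Every label that occurs, occurs exactly twice. -/
def IsName (l : List ℕ) : Prop := ∀ k ∈ l, l.count k = 2

abbrev Name := {l : List ℕ // IsName l}

/-- Two names describe the same chord diagram when they agree after relabelling the chords and
changing the starting point on the circle (but not its orientation). -/
instance Name.setoid : Setoid Name where
  r l l' := ∃ f : Equiv.Perm ℕ, l.1.map f ~r l'.1
  iseqv :=
    { refl := fun l => ⟨Equiv.refl ℕ, by simp [List.IsRotated.refl]⟩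
      symm := by
        rintro l l' ⟨f, h⟩
        refine ⟨f.symm, ?_⟩
        have := (h.map f.symm).symm
        simpa using this
      trans := by
        rintro l l' l'' ⟨f, h⟩ ⟨g, h'⟩
        refine ⟨f.trans g, ?_⟩
        have := (h.map g).trans h'
        simpa using this }

/-- Chord diagrams, with any number of chords. -/
def ChordDiagram := Quotient Name.setoid

/-! ### Braided chord diagrams -/

/-- A generator `A(i,j)` of the chord algebra `C_m`: a horizontal chord joining two of the `m`
vertical strands (numbered from `0`). -/
structure Chord (m : ℕ) where
  i : Fin m
  j : Fin m
  lt : i < j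

/-- Words in the generators of `C_m`, read from top to bottom. -/
abbrev ChordWord (m : ℕ) := List (Chord m)

/-- The labels of the chords that have an endpoint on the strand `p`, from top to bottom; chords are
labelled by their place in the word. -/
def ChordWord.strandLabels {m : ℕ} (W : ChordWord m) (p : Fin m) : List ℕ :=
  (W.zipIdx.filter fun g => g.1.i = p ∨ g.1.j = p).map Prod.snd

/-- The name read from the closure of a word: the closing braid leads the bottom of each strand to
the top of the next one, so that the circle runs through the strands from left to right. -/
def ChordWord.readName {m : ℕ} (W : ChordWord m) : List ℕ :=
  (List.finRange m).flatMap W.strandLabels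

open scoped Classical in
theorem ChordWord.isName_readName {m : ℕ} (W : ChordWord m) : IsName W.readName := by
  intro k hk
  have hnd : ∀ p, (W.strandLabels p).count k =
      if ∃ g : Chord m, (g, k) ∈ W.zipIdx ∧ (g.i = p ∨ g.j = p) then 1 else 0 := by
    intro p
    have hsub : (W.strandLabels p).Nodup := by
      have h1 : (W.strandLabels p).Sublist (W.zipIdx.map Prod.snd) :=
        List.filter_sublist.map _
      refine h1.nodup ?_
      simpa [List.zipIdx_map_snd] using List.nodup_range' (s := 0) (n := W.length)
    rw [hsub.count]
    refine if_congr ?_ rfl rfl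
    simp [ChordWord.strandLabels]
  simp only [ChordWord.readName, List.mem_flatMap, ChordWord.strandLabels, List.mem_map,
    List.mem_filter] at hk
  obtain ⟨-, -, ⟨g, k'⟩, ⟨hg, -⟩, rfl⟩ := hk
  have huniq : ∀ g', (g', k') ∈ W.zipIdx → g' = g := by
    intro g' hg'
    rw [List.mem_zipIdx_iff_getElem?] at hg hg'
    simp_all
  have hnd' : ∀ p, (W.strandLabels p).count k' = if g.i = p ∨ g.j = p then 1 else 0 := by
    intro p
    rw [hnd]
    refine if_congr ⟨?_, fun h => ⟨g, hg, h⟩⟩ rfl rfl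
    rintro ⟨g', h1, h2⟩
    rwa [huniq g' h1] at h2
  have hs : W.readName.count k' = ∑ p : Fin m, (W.strandLabels p).count k' := by
    rw [ChordWord.readName, List.count_flatMap, ← List.ofFn_eq_map, List.sum_ofFn]
    rfl
  have hcard : (Finset.univ.filter fun p : Fin m => g.i = p ∨ g.j = p) = {g.i, g.j} := by
    ext p
    simp [eq_comm]
  show W.readName.count k' = 2
  rw [hs, Finset.sum_congr rfl fun p _ => hnd' p, ← Finset.card_filter, hcard,
    Finset.card_pair g.lt.ne]

/-- The chord diagram represented by the closure of a word in `C_m`. The word `W` is an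
`m`-braiding of the diagram `D` when `W.diagram = D`. -/
def ChordWord.diagram {m : ℕ} (W : ChordWord m) : ChordDiagram :=
  Quotient.mk _ ⟨W.readName, W.isName_readName⟩

/-- `A(i,j)` slid around the closure: it becomes `A(i+1,j+1)`, and `A(i,m)` becomes `A(1,i+1)`
(numbering the strands from `1`). -/
def Chord.slide {m : ℕ} (g : Chord m) : Chord m :=
  if h : g.j.1 + 1 < m then
    ⟨⟨g.i + 1, lt_of_le_of_lt (Nat.succ_le_of_lt g.lt) g.j.2⟩, ⟨g.j + 1, h⟩,
      Nat.succ_lt_succ g.lt⟩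
  else
    ⟨⟨0, Nat.zero_lt_of_lt g.i.2⟩, ⟨g.i + 1, lt_of_le_of_lt (Nat.succ_le_of_lt g.lt) g.j.2⟩,
      Nat.succ_pos _⟩

/-- Cyclic permutation: `W' A(i,j)` is replaced with `A(i+1,j+1) W'`. -/
def CyclicMove {m : ℕ} (V W : ChordWord m) : Prop :=
  ∃ (W' : ChordWord m) (g : Chord m), V = W' ++ [g] ∧ W = g.slide :: W'

/-- Cyclic equivalence of words. -/
def CyclicEquiv {m : ℕ} : ChordWord m → ChordWord m → Prop := Relation.EqvGen CyclicMove

/-- The word `a^l c^p a^n` in `C_3`, where `a = A(1,2)` and `c = A(1,3)`. -/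
def fanWord (l p n : ℕ) : ChordWord 3 :=
  List.replicate l ⟨0, 1, by decide⟩ ++ List.replicate p ⟨0, 2, by decide⟩ ++
    List.replicate n ⟨0, 1, by decide⟩

/-! ### Singular braids -/

/-- Letters of singular braid words on `m` strands: `pos k`, `neg k`, `sing k` are
`σ_{k+1}`, `σ_{k+1}⁻¹` and the double point `τ_{k+1}` between the strands `k` and `k+1`
(numbered from `0`). -/
inductive Letter (m : ℕ)
  | pos (k : Fin (m - 1))
  | neg (k : Fin (m - 1))
  | sing (k : Fin (m - 1))

namespace Letter

variable {m : ℕ}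

/-- The left one of the two positions that are exchanged. -/
def idx : Letter m → ℕ
  | pos k => k
  | neg k => k
  | sing k => k

/-- The position at the bottom of the strand that starts at the position `p`. -/
def act (g : Letter m) (p : ℕ) : ℕ := Equiv.swap g.idx (g.idx + 1) p

/-- The sign of a crossing, `0` for a double point. -/
def sign : Letter m → ℝ
  | pos _ => 1
  | neg _ => -1
  | sing _ => 0

/-- Geometric realization of a letter: the point at height `u` (from the top `0` to the bottom `1`)
of the strand that starts at the position `p`. The positions are the points `0, 1, 2, …` of the
complex plane; the strands `k` and `k+1` change places along a smooth path, the first one at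
the side of positive, the other at the side of negative imaginary part for `σ`, the other way round
for `σ⁻¹`, and through a transverse double point for `τ`. -/
noncomputable def path (g : Letter m) (p : ℕ) (u : ℝ) : ℂ :=
  let h : ℝ := Real.smoothTransition u
  if p = g.idx then ⟨g.idx + h, g.sign * (h * (1 - h))⟩
  else if p = g.idx + 1 then ⟨g.idx + 1 - h, -(g.sign * (h * (1 - h)))⟩
  else p

end Letter

/-- The `m`-braid `σ_{m-1}⁻¹ ⋯ σ_1⁻¹`, whose closure is an unknot. -/
def closingBraid (m : ℕ) : List (Letter m) := (List.finRange (m - 1)).reverse.map Letter.neg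

/-- The pure braid generator `A_ij = σ_{j-1}⁻¹ ⋯ σ_{i+1}⁻¹ σ_i² σ_{i+1} ⋯ σ_{j-1}`
with one of the two crossings of its full twist `σ_i²` smashed to a double point: the second one if
`b` is true and the first one otherwise. -/
def Chord.smashed {m : ℕ} (g : Chord m) (b : Bool) : List (Letter m) :=
  let k : Fin (m - 1) := ⟨g.i, by have := g.lt; have := g.j.2; omega⟩
  let between := (List.finRange (m - 1)).filter fun r => g.i.1 < r.1 ∧ r.1 < g.j.1
  between.reverse.map Letter.neg ++
    (if b then [Letter.pos k, Letter.sing k] else [Letter.sing k, Letter.pos k]) ++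
    between.map Letter.pos

/-- The singular braid word whose closure is the standard knot of the closure of `W`: every chord is
replaced with a smashed pure braid generator, and the closing braid is adjoined. For the chord
number `r` of `W`, the value `q r` tells which crossing is smashed. -/
def standardBraid {m : ℕ} (W : ChordWord m) (q : ℕ → Bool) : List (Letter m) :=
  (W.zipIdx.flatMap fun g => g.1.smashed (q g.2)) ++ closingBraid m

/-- The defining relations of the singular braid monoid on `m` strands. -/
inductive SingularBraidRel (m : ℕ) : FreeMonoid (Letter m) → FreeMonoid (Letter m) → Prop
  | pos_neg (i) : SingularBraidRel m (.of (.pos i) * .of (.neg i)) 1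
  | neg_pos (i) : SingularBraidRel m (.of (.neg i) * .of (.pos i)) 1
  | braid (i j) (h : i.1 + 1 = j.1 ∨ j.1 + 1 = i.1) : SingularBraidRel m
      (.of (.pos i) * .of (.pos j) * .of (.pos i)) (.of (.pos j) * .of (.pos i) * .of (.pos j))
  | far_pos (i j) (h : i.1 + 1 < j.1 ∨ j.1 + 1 < i.1) : SingularBraidRel m
      (.of (.pos i) * .of (.pos j)) (.of (.pos j) * .of (.pos i))
  | far_sing (i j) (h : i.1 + 1 < j.1 ∨ j.1 + 1 < i.1) : SingularBraidRel m
      (.of (.sing i) * .of (.sing j)) (.of (.sing j) * .of (.sing i))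
  | far_mixed (i j) (h : i.1 + 1 < j.1 ∨ j.1 + 1 < i.1) : SingularBraidRel m
      (.of (.pos i) * .of (.sing j)) (.of (.sing j) * .of (.pos i))
  | pos_sing (i) : SingularBraidRel m
      (.of (.pos i) * .of (.sing i)) (.of (.sing i) * .of (.pos i))
  | braid_sing (i j) (h : i.1 + 1 = j.1 ∨ j.1 + 1 = i.1) : SingularBraidRel m
      (.of (.pos i) * .of (.pos j) * .of (.sing i)) (.of (.sing j) * .of (.pos i) * .of (.pos j))

abbrev SingularBraidMonoid (m : ℕ) := PresentedMonoid (SingularBraidRel m)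

/-- The singular braid of a letter. -/
def sbGen {m : ℕ} (g : Letter m) : SingularBraidMonoid m := PresentedMonoid.of _ g

/-- The singular braid of a word. -/
def sbWord {m : ℕ} (w : List (Letter m)) : SingularBraidMonoid m := (w.map sbGen).prod

/-- Equality of the closed braids of two singular braids: they are related by conjugation, that is, by
moving a factor from the bottom to the top. -/
def ClosedBraidEquiv {m : ℕ} : SingularBraidMonoid m → SingularBraidMonoid m → Prop :=
  Relation.EqvGen fun x y => ∃ u v, x = u * v ∧ y = v * u

/-- The closures of the singular 3-braids `x` and `y` are related by a braid-preserving flype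
`X R Y σ₂^ε ⟷ X σ₂^ε Y R`, where `ε = ±1`, the blocks `X` and `Y` involve the first
two strands only, and the block `R` involves the last two strands only. -/
def BraidFlype (x y : SingularBraidMonoid 3) : Prop :=
  ∃ X ∈ Submonoid.closure ({sbGen (.pos 0), sbGen (.neg 0), sbGen (.sing 0)} :
      Set (SingularBraidMonoid 3)),
  ∃ Y ∈ Submonoid.closure ({sbGen (.pos 0), sbGen (.neg 0), sbGen (.sing 0)} :
      Set (SingularBraidMonoid 3)),
  ∃ R ∈ Submonoid.closure ({sbGen (.pos 1), sbGen (.neg 1), sbGen (.sing 1)} :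
      Set (SingularBraidMonoid 3)),
  ∃ e ∈ ({sbGen (.pos 1), sbGen (.neg 1)} : Set (SingularBraidMonoid 3)),
    ClosedBraidEquiv x (X * R * Y * e) ∧ ClosedBraidEquiv y (X * e * Y * R)

/-! ### Singular knots in the 3-sphere -/

/-- An oriented singular knot: an immersion of the circle `ℝ / ℤ` into the unit sphere of `ℂ²` whose
only singularities are finitely many transverse double points. -/
structure IsSingularKnot (γ : ℝ → ℂ × ℂ) : Prop where
  mem_sphere : ∀ t, ‖(γ t).1‖ ^ 2 + ‖(γ t).2‖ ^ 2 = 1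
  periodic : Function.Periodic γ 1
  smooth : ContDiff ℝ ∞ γ
  immersion : ∀ t, deriv γ t ≠ 0
  finite : {p : ℝ × ℝ | p.1 ∈ Set.Ico (0 : ℝ) 1 ∧ p.2 ∈ Set.Ico (0 : ℝ) 1 ∧
    p.1 ≠ p.2 ∧ γ p.1 = γ p.2}.Finite
  double : ∀ t ∈ Set.Ico (0 : ℝ) 1, ∀ u ∈ Set.Ico (0 : ℝ) 1, ∀ v ∈ Set.Ico (0 : ℝ) 1,
    γ t = γ u → γ u = γ v → t = u ∨ u = v ∨ t = v
  transverse : ∀ t ∈ Set.Ico (0 : ℝ) 1, ∀ u ∈ Set.Ico (0 : ℝ) 1, t ≠ u → γ t = γ u →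
    LinearIndependent ℝ ![deriv γ t, deriv γ u]

/-- Isotopy of oriented singular knots: up to an orientation preserving change of the parameter, there
is a smooth path of singular knots along which the pairs of parameters that are mapped to
the same point do not change. -/
def SingularIsotopic (γ γ' : ℝ → ℂ × ℂ) : Prop :=
  ∃ (H : ℝ → ℝ → ℂ × ℂ) (ρ : ℝ → ℝ),
    ContDiff ℝ ∞ (fun x : ℝ × ℝ => H x.1 x.2) ∧
    (∀ s ∈ Set.Icc (0 : ℝ) 1, IsSingularKnot (H s) ∧ ∀ t u, H s t = H s u ↔ H 0 t = H 0 u) ∧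
    ContDiff ℝ ∞ ρ ∧ (∀ t, 0 < deriv ρ t) ∧ (∀ t, ρ (t + 1) = ρ t + 1) ∧
    H 0 = γ ∧ ∀ t, H 1 t = γ' (ρ t)

/-- The singular knot `γ` respects `D`: the pairs of points of the oriented circle identified by `γ`
are the chords of `D`. -/
def Respects (γ : ℝ → ℂ × ℂ) (D : ChordDiagram) : Prop :=
  ∃ l : Name, Quotient.mk _ l = D ∧
    ∃ t : Fin l.1.length → ℝ, StrictMono t ∧ (∀ i, t i ∈ Set.Ico (0 : ℝ) 1) ∧
      ∀ u ∈ Set.Ico (0 : ℝ) 1, ∀ v ∈ Set.Ico (0 : ℝ) 1,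
        (u ≠ v ∧ γ u = γ v) ↔ ∃ i j, i ≠ j ∧ l.1.get i = l.1.get j ∧ t i = u ∧ t j = v

/-- The position, above the letter number `r` of the periodically repeated word `w`, of the strand that
starts at the top left. -/
def strandPos {m : ℕ} (w : List (Letter m)) : ℕ → ℕ
  | 0 => 0
  | r + 1 => match w[r % w.length]? with
    | some g => g.act (strandPos w r)
    | none => strandPos w r

/-- The closure of a singular `m`-braid word of length `N` whose permutation is an `m`-cycle. The
closed solid braid is embedded in the 3-sphere by the diffeomorphism
`(e^{iθ}, z) ↦ (e^{iθ}, z) / √(1 + |z|²)` of `S¹ × ℂ` onto the complement of the circle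
`{0} × S¹`, the braid axis. The knot runs `m` times around the axis, through `N` letters each time;
`x` is the number of letters passed at the time `t`. -/
noncomputable def closedBraid {m : ℕ} (w : List (Letter m)) (t : ℝ) : ℂ × ℂ :=
  let x : ℝ := m * w.length * t
  let r : ℕ := (⌊x⌋ % ((m * w.length : ℕ) : ℤ)).toNat
  let z : ℂ := match w[r % w.length]? with
    | some g => g.path (strandPos w r) (Int.fract x)
    | none => strandPos w r
  let c : ℝ := (√(1 + ‖z‖ ^ 2))⁻¹
  (c * Complex.exp (2 * Real.pi * m * t * Complex.I), c * z)

/-- The standard knot of the closure of `W`, for a choice of the smashed crossings. -/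
noncomputable def standardKnot {m : ℕ} (W : ChordWord m) (q : ℕ → Bool) : ℝ → ℂ × ℂ :=
  closedBraid (standardBraid W q)

/-! ### The smooth transition function -/

/-! A closed 3-braid is described by a loop `z` of period 3: the knot is the radial projection of
`(turn (3 * t), z (3 * t))`, and the strands over a point of the circle are `z x`, `z (x + 1)`, `z
(x + 2)`. Any two of them are consecutive in the cyclic order, so only the differences `z (x + 1) -
z x` matter. A straight-line homotopy of such loops is an isotopy if the segments between
corresponding differences avoid 0, or if both differences vanish and the segment between their
derivatives avoids 0 (`SingularIsotopic.of_linear`).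

The isotopy class is read off from a normal form, `triCurve`. The strands stand on an equilateral
triangle that makes a third of a turn at the closing braid, and each chord pinches one edge to a
point and back along a circle. Each difference stays in a half plane that turns with the triangle,
and meets 0 only along the boundary line (`Aligned`). Two aligned loops with the same double points,
whose directions differ by less than π, are isotopic (`SingularIsotopic.of_aligned`). The standard
knot of a word is isotopic to its triangular curve whichever crossings are smashed
(`triCurve_isotopic_standardKnot`). Here collinear blocks are an intermediate stage. A cyclic
permutation changes the triangular curve only by a change of time and of direction within these
limits (`triCurve_cyclic`).

The combinatorial part is `ChordWord.cyclicEquiv_or_exists_fan`. The three kinds of chords are the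
edges of an oriented triangle of strands, so each chord has a tail and a head, which cyclic moves
preserve. If the matching of two names respects tails, a common chord can be moved to the front of
both words, and then the name determines the rest of the word. If some chord is reversed, moving
this chord to the front forces the remaining chords to be `a` and `c` only, in two interleaved
orders, and counting them gives the words `a^l c^p a^n` and `a^l c^n a^p`.

For these two words there is one curve `flypeCurve` in the complex plane, symmetric under a half
period together with `z ↦ -z` and the exchange of `p` and `n`. The clasps `p` and `n` sit near the
points 1 and -1. The isotopy keeps `z` fixed and changes only the coordinate around the axis,
carrying the clasp `p` from the third tenth of a turn to the seventh and the clasp `n` back. Two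
arches may meanwhile cross the braid axis, and they do so far away from the other strands
(`flypeFamily_isotopic`). The final position is the initial one of the other word, rotated by π
(`fanTails_isotopic`).

In the singular braid monoid, the closing braid conjugates the smashed generator with tail `c` to
that with tail `c + 1` (`sbChord_mul_closing`). So cyclic moves are conjugations, and the words of
fans can be rewritten in the two forms of a flype (`braidFlype_of_fanWord`). -/

theorem expNegInvGlue_hasDerivAt (x : ℝ) :
    HasDerivAt expNegInvGlue (x⁻¹ ^ 2 * expNegInvGlue x) x := by
  have := expNegInvGlue.hasDerivAt_polynomial_eval_inv_mul (1 : Polynomial ℝ) x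
  simpa using this

/-- The strict sign is used for transversality at the double points and for the immersion of the
arches of `flypeCurve`. -/
theorem smoothTransition_hasDerivAt_pos {x : ℝ} (h0 : 0 < x) (h1 : x < 1) :
    ∃ c > 0, HasDerivAt Real.smoothTransition c x := by
  have hf := expNegInvGlue_hasDerivAt x
  have hg : HasDerivAt (fun y => expNegInvGlue (1 - y))
      (-((1 - x)⁻¹ ^ 2 * expNegInvGlue (1 - x))) x := by
    have := (expNegInvGlue_hasDerivAt (1 - x)).comp x ((hasDerivAt_id x).const_sub 1)
    exact this.congr_deriv (by ring)
  have hpos := Real.smoothTransition.pos_denom x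
  have hd := hf.div (hf.add hg) hpos.ne'
  refine ⟨_, ?_, hd⟩
  have a := expNegInvGlue.pos_of_pos h0
  have b := expNegInvGlue.pos_of_pos (x := 1 - x) (by linarith)
  have c : 0 < x⁻¹ ^ 2 := by positivity
  have d : 0 < (1 - x)⁻¹ ^ 2 := by have : 0 < 1 - x := by linarith
                                   positivity
  apply div_pos _ (by positivity)
  simp only [Pi.add_apply]
  have : 0 < x⁻¹ ^ 2 * expNegInvGlue x * expNegInvGlue (1 - x)
    + expNegInvGlue x * ((1 - x)⁻¹ ^ 2 * expNegInvGlue (1 - x)) := by positivity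
  nlinarith

theorem smoothTransition_half : Real.smoothTransition (1 / 2) = 1 / 2 := by
  have h : (1 : ℝ) - 1 / 2 = 1 / 2 := by norm_num
  have := expNegInvGlue.pos_of_pos (x := 1 / 2) (by norm_num)
  rw [Real.smoothTransition, h]
  field_simp
  norm_num

theorem smoothTransition_differentiable : Differentiable ℝ Real.smoothTransition :=
  (Real.smoothTransition.contDiff (n := 1)).differentiable (by simp)

theorem smoothTransition_deriv_nonneg (x : ℝ) : 0 ≤ deriv Real.smoothTransition x :=
  Real.smoothTransition.monotone.deriv_nonneg

theorem smoothTransition_strictMonoOn : StrictMonoOn Real.smoothTransition (Set.Icc 0 1) := by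
  apply strictMonoOn_of_deriv_pos (convex_Icc 0 1) Real.smoothTransition.continuous.continuousOn
  intro x hx
  rw [interior_Icc] at hx
  obtain ⟨c, hc, h⟩ := smoothTransition_hasDerivAt_pos hx.1 hx.2
  rwa [h.deriv]

/-! ### Changes of the parameter -/

/-- Orientation preserving changes of the parameter of the circle `ℝ / ℤ`. -/
structure IsReparam (ρ : ℝ → ℝ) : Prop where
  smooth : ContDiff ℝ ∞ ρ
  deriv_pos : ∀ t, 0 < deriv ρ t
  add_one : ∀ t, ρ (t + 1) = ρ t + 1

namespace IsReparam

variable {ρ σ : ℝ → ℝ}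

theorem strictMono (h : IsReparam ρ) : StrictMono ρ := strictMono_of_deriv_pos h.deriv_pos

theorem differentiable (h : IsReparam ρ) : Differentiable ℝ ρ := h.smooth.differentiable (by simp)

theorem add_int (h : IsReparam ρ) (t : ℝ) (k : ℤ) : ρ (t + k) = ρ t + k := by
  induction k using Int.induction_on with
  | zero => simp
  | succ i ih => push_cast at ih ⊢; rw [← add_assoc, h.add_one, ih]; ring
  | pred i ih =>
    have := h.add_one (t + ((-i - 1 : ℤ) : ℝ))
    push_cast at ih this ⊢
    rw [show t + (-(i : ℝ) - 1) + 1 = t + -i by ring, ih] at this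
    linarith

theorem eq_add_int_iff (h : IsReparam ρ) (t u : ℝ) :
    (∃ k : ℤ, ρ t = ρ u + k) ↔ ∃ k : ℤ, t = u + k := by
  refine exists_congr fun k => ?_
  rw [← h.add_int, h.strictMono.injective.eq_iff]

theorem id : IsReparam fun t => t := ⟨contDiff_id, by simp, by simp⟩

theorem comp (h : IsReparam ρ) (h' : IsReparam σ) : IsReparam fun t => ρ (σ t) where
  smooth := h.smooth.comp h'.smooth
  deriv_pos t := by
    have := (h.differentiable (σ t)).hasDerivAt.comp t (h'.differentiable t).hasDerivAt
    have e : deriv (fun t => ρ (σ t)) t = deriv ρ (σ t) * deriv σ t := this.deriv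
    rw [e]
    exact mul_pos (h.deriv_pos _) (h'.deriv_pos _)
  add_one t := by rw [h'.add_one, h.add_one]

theorem surjective (h : IsReparam ρ) : Function.Surjective ρ := by
  apply h.smooth.continuous.surjective
  · apply Filter.tendsto_atTop_atTop.2
    intro b
    refine ⟨⌈b - ρ 0⌉, fun a ha => ?_⟩
    have := h.strictMono.monotone ha
    have h2 := h.add_int 0 ⌈b - ρ 0⌉
    have := Int.le_ceil (b - ρ 0)
    rw [zero_add] at h2
    linarith
  · apply Filter.tendsto_atBot_atBot.2
    intro b
    refine ⟨⌊b - ρ 0⌋, fun a ha => ?_⟩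
    have := h.strictMono.monotone ha
    have h2 := h.add_int 0 ⌊b - ρ 0⌋
    have := Int.floor_le (b - ρ 0)
    rw [zero_add] at h2
    linarith

theorem exists_inverse (h : IsReparam ρ) :
    ∃ σ, IsReparam σ ∧ (∀ t, σ (ρ t) = t) ∧ ∀ t, ρ (σ t) = t := by
  let e : ℝ ≃o ℝ := h.strictMono.orderIsoOfSurjective ρ h.surjective
  have he : ∀ t, e t = ρ t := fun t => rfl
  have h1 : ∀ t, e.symm (ρ t) = t := fun t => e.symm_apply_apply t
  have h2 : ∀ t, ρ (e.symm t) = t := fun t => e.apply_symm_apply t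
  have hder : ∀ t, HasDerivAt e.symm (deriv ρ (e.symm t))⁻¹ t := by
    intro t
    apply HasDerivAt.of_local_left_inverse e.symm.continuous.continuousAt
      (h.differentiable _).hasDerivAt (h.deriv_pos _).ne'
    exact Filter.Eventually.of_forall h2
  refine ⟨e.symm, ⟨?_, ?_, ?_⟩, h1, h2⟩
  · rw [contDiff_iff_contDiffAt]
    intro t
    have := (e.toHomeomorph.toOpenPartialHomeomorph).contDiffAt_symm_deriv (𝕜 := ℝ) (n := ∞)
      (f₀' := deriv ρ (e.symm t)) (a := t) (h.deriv_pos _).ne' (Set.mem_univ _)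
      (h.differentiable _).hasDerivAt h.smooth.contDiffAt
    exact this
  · intro t
    rw [(hder t).deriv]
    exact inv_pos.2 (h.deriv_pos _)
  · intro t
    apply h.strictMono.injective
    rw [h2, h.add_one, h2]

end IsReparam

theorem periodic_fract {γ : ℝ → ℂ × ℂ} (h : Function.Periodic γ 1) (t : ℝ) :
    γ (Int.fract t) = γ t := by
  have := h.sub_int_mul_eq ⌊t⌋ (x := t)
  rwa [mul_one] at this

theorem periodic_deriv_fract {γ : ℝ → ℂ × ℂ} (h : Function.Periodic γ 1) (t : ℝ) :
    deriv γ (Int.fract t) = deriv γ t := by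
  apply periodic_fract (γ := deriv γ)
  intro x
  rw [← deriv_comp_add_const]
  congr 1
  funext y
  exact h y

theorem fract_eq_fract_iff (t u : ℝ) : Int.fract t = Int.fract u ↔ ∃ k : ℤ, t = u + k := by
  rw [Int.fract_eq_fract]
  refine exists_congr fun k => ?_
  constructor <;> intro h <;> linarith

theorem IsSingularKnot.comp_reparam {γ : ℝ → ℂ × ℂ} {ρ : ℝ → ℝ} (h : IsSingularKnot γ)
    (hρ : IsReparam ρ) : IsSingularKnot fun t => γ (ρ t) := by
  have hd : ∀ t, deriv (fun t => γ (ρ t)) t = deriv ρ t • deriv γ (ρ t) := fun t =>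
    ((h.smooth.differentiable (by simp) (ρ t)).hasDerivAt.scomp t
      (hρ.differentiable t).hasDerivAt).deriv
  -- Singularities are only tested on `[0, 1)`. As `ρ` commutes with integer translations, `t ↦
  -- Int.fract (ρ t)` is injective there, and all conditions are carried over by this map.
  have hfe : ∀ t ∈ Set.Ico (0 : ℝ) 1, ∀ u ∈ Set.Ico (0 : ℝ) 1,
      Int.fract (ρ t) = Int.fract (ρ u) → t = u := by
    intro t ht u hu e
    rw [fract_eq_fract_iff, hρ.eq_add_int_iff, ← fract_eq_fract_iff] at e
    rwa [Int.fract_eq_self.2 ht, Int.fract_eq_self.2 hu] at e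
  have hI : ∀ t, Int.fract t ∈ Set.Ico (0 : ℝ) 1 := fun t => ⟨Int.fract_nonneg t, Int.fract_lt_one t⟩
  refine ⟨fun t => h.mem_sphere _, fun t => ?_, h.smooth.comp hρ.smooth, fun t => ?_, ?_, ?_, ?_⟩
  · show γ (ρ (t + 1)) = γ (ρ t)
    rw [hρ.add_one, h.periodic]
  · rw [hd]
    exact smul_ne_zero (hρ.deriv_pos t).ne' (h.immersion _)
  · refine Set.Finite.of_finite_image (f := fun p => (Int.fract (ρ p.1), Int.fract (ρ p.2)))
      (h.finite.subset ?_) ?_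
    · rintro _ ⟨⟨t, u⟩, ⟨ht, hu, hne, e⟩, rfl⟩
      refine ⟨hI _, hI _, fun e' => hne (hfe t ht u hu e'), ?_⟩
      simpa only [periodic_fract h.periodic] using e
    · rintro ⟨t, u⟩ ⟨ht, hu, -⟩ ⟨t', u'⟩ ⟨ht', hu', -⟩ e
      simp only [Prod.mk.injEq] at e ⊢
      exact ⟨hfe _ ht _ ht' e.1, hfe _ hu _ hu' e.2⟩
  · intro t ht u hu v hv e1 e2
    have := h.double _ (hI (ρ t)) _ (hI (ρ u)) _ (hI (ρ v))
      (by simpa only [periodic_fract h.periodic] using e1)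
      (by simpa only [periodic_fract h.periodic] using e2)
    rcases this with e | e | e
    · exact Or.inl (hfe _ ht _ hu e)
    · exact Or.inr (Or.inl (hfe _ hu _ hv e))
    · exact Or.inr (Or.inr (hfe _ ht _ hv e))
  · intro t ht u hu hne e
    have := h.transverse _ (hI (ρ t)) _ (hI (ρ u)) (fun e' => hne (hfe _ ht _ hu e'))
      (by simpa only [periodic_fract h.periodic] using e)
    rw [periodic_deriv_fract h.periodic, periodic_deriv_fract h.periodic] at this
    rw [hd, hd]
    rw [LinearIndependent.pair_iff] at this ⊢
    intro a b hab
    rw [smul_smul, smul_smul] at hab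
    have := this _ _ hab
    simpa [(hρ.deriv_pos t).ne', (hρ.deriv_pos u).ne'] using this

namespace SingularIsotopic

variable {γ γ' γ'' : ℝ → ℂ × ℂ}

theorem left (h : SingularIsotopic γ γ') : IsSingularKnot γ := by
  obtain ⟨H, ρ, -, h, -, -, -, rfl, -⟩ := h
  exact (h 0 (by simp)).1

theorem of_reparam {ρ : ℝ → ℝ} (h : IsSingularKnot γ) (hρ : IsReparam ρ)
    (e : ∀ t, γ t = γ' (ρ t)) : SingularIsotopic γ γ' :=
  ⟨fun _ => γ, ρ, h.smooth.comp contDiff_snd, fun _ _ => ⟨h, fun _ _ => Iff.rfl⟩, hρ.smooth,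
    hρ.deriv_pos, hρ.add_one, rfl, e⟩

theorem refl (h : IsSingularKnot γ) : SingularIsotopic γ γ :=
  of_reparam h .id fun _ => rfl

theorem symm (h : SingularIsotopic γ γ') : SingularIsotopic γ' γ := by
  obtain ⟨H, ρ, hs, hk, h1, h2, h3, h0, he⟩ := h
  have hρ : IsReparam ρ := ⟨h1, h2, h3⟩
  obtain ⟨σ, hσ, e1, e2⟩ := hρ.exists_inverse
  -- An isotopy must start at the given curve exactly, while `H 1` is `γ'` only after the change of
  -- parameter; composing the reversed path with the inverse `σ` corrects this.
  refine ⟨fun s t => H (1 - s) (σ t), σ, ?_, ?_, hσ.smooth, hσ.deriv_pos, hσ.add_one, ?_, ?_⟩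
  · exact hs.comp ((contDiff_const.sub contDiff_fst).prodMk (hσ.smooth.comp contDiff_snd))
  · intro s hs'
    have hs1 : 1 - s ∈ Set.Icc (0 : ℝ) 1 := ⟨by linarith [hs'.2], by linarith [hs'.1]⟩
    refine ⟨(hk _ hs1).1.comp_reparam hσ, fun t u => ?_⟩
    simp only [sub_zero]
    rw [(hk _ hs1).2, (hk 1 (by simp)).2]
  · funext t
    simp only [sub_zero]
    rw [he, e2]
  · intro t
    simp only [sub_self]
    rw [h0]

theorem right (h : SingularIsotopic γ γ') : IsSingularKnot γ' := h.symm.left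

theorem trans (h : SingularIsotopic γ γ') (h' : SingularIsotopic γ' γ'') :
    SingularIsotopic γ γ'' := by
  have hγ' := h'.left
  obtain ⟨H, ρ, hs, hk, h1, h2, h3, h0, he⟩ := h
  have hρ : IsReparam ρ := ⟨h1, h2, h3⟩
  obtain ⟨H', ρ', hs', hk', h1', h2', h3', h0', he'⟩ := h'
  have hρ' : IsReparam ρ' := ⟨h1', h2', h3'⟩
  have hρρ := hρ'.comp hρ
  let S := Real.smoothTransition
  have hS : ContDiff ℝ ∞ S := Real.smoothTransition.contDiff
  have hSI : ∀ x, S x ∈ Set.Icc (0 : ℝ) 1 := fun x =>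
    ⟨Real.smoothTransition.nonneg x, Real.smoothTransition.le_one x⟩
  -- Up to the time `1 / 2` the bracket vanishes, and afterwards the first term cancels against `γ'
  -- (ρ t)`. The sum is therefore both isotopies in succession, and it is smooth without any gluing.
  let G : ℝ → ℝ → ℂ × ℂ := fun s t =>
    H (S (2 * s)) t + (H' (S (2 * s - 1)) (ρ t) - γ' (ρ t))
  have hG1 : ∀ s ≤ 1 / 2, ∀ t, G s t = H (S (2 * s)) t := by
    intro s hs t
    have : S (2 * s - 1) = 0 := Real.smoothTransition.zero_of_nonpos (by linarith)
    simp only [G, this, h0', sub_self, add_zero]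
  have hG2 : ∀ s ≥ 1 / 2, ∀ t, G s t = H' (S (2 * s - 1)) (ρ t) := by
    intro s hs t
    have : S (2 * s) = 1 := Real.smoothTransition.one_of_one_le (by linarith)
    simp only [G, this, he]
    abel
  have hGc : ∀ s ≤ 1 / 2, (∀ t u, G s t = G s u ↔ H 0 t = H 0 u) := by
    intro s hs t u
    rw [hG1 s hs, hG1 s hs, (hk _ (hSI _)).2]
  have hS0 : S 0 = 0 := Real.smoothTransition.zero
  have hG0 : ∀ t, G 0 t = H 0 t := by
    intro t; rw [hG1 0 (by norm_num)]; simp [hS0]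
  refine ⟨G, fun t => ρ' (ρ t), ?_, ?_, hρρ.smooth, hρρ.deriv_pos, hρρ.add_one, ?_, ?_⟩
  · have hr := hρ.smooth.comp (contDiff_snd (E := ℝ) (F := ℝ))
    refine ContDiff.add ?_ (ContDiff.sub ?_ (hγ'.smooth.comp hr))
    · exact hs.comp ((hS.comp (contDiff_const.mul contDiff_fst)).prodMk contDiff_snd)
    · exact hs'.comp ((hS.comp ((contDiff_const.mul contDiff_fst).sub contDiff_const)).prodMk hr)
  · intro s _
    rcases le_total s (1 / 2) with hle | hle
    · refine ⟨?_, fun t u => ?_⟩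
      · have : G s = H (S (2 * s)) := funext (hG1 s hle)
        rw [this]
        exact (hk _ (hSI _)).1
      · rw [hGc s hle, hG0, hG0]
    · refine ⟨?_, fun t u => ?_⟩
      · have : G s = fun t => H' (S (2 * s - 1)) (ρ t) := funext (hG2 s hle)
        rw [this]
        exact (hk' _ (hSI _)).1.comp_reparam hρ
      · rw [hG2 s hle, hG2 s hle, (hk' _ (hSI _)).2, h0', ← he, ← he, (hk 1 (by simp)).2,
          hG0, hG0]
  · funext t
    rw [hG0, h0]
  · intro t
    have : S (2 * 1 - 1) = 1 := Real.smoothTransition.one_of_one_le (by norm_num)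
    rw [hG2 1 (by norm_num), this, he']

end SingularIsotopic

/-! ### Curves in the 3-sphere given by homogeneous coordinates -/

/-- Radial projection of `ℂ² ∖ 0` to the unit sphere. -/
noncomputable def radialProj (v : ℂ × ℂ) : ℂ × ℂ := (√(‖v.1‖ ^ 2 + ‖v.2‖ ^ 2))⁻¹ • v

theorem normSq_pos {v : ℂ × ℂ} (h : v ≠ 0) : 0 < ‖v.1‖ ^ 2 + ‖v.2‖ ^ 2 := by
  by_contra! h'
  have h1 : ‖v.1‖ ^ 2 = 0 := by nlinarith [sq_nonneg ‖v.1‖, sq_nonneg ‖v.2‖]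
  have h2 : ‖v.2‖ ^ 2 = 0 := by nlinarith [sq_nonneg ‖v.1‖, sq_nonneg ‖v.2‖]
  exact h (Prod.ext (by simpa using h1) (by simpa using h2))

theorem scale_pos {v : ℂ × ℂ} (h : v ≠ 0) : 0 < (√(‖v.1‖ ^ 2 + ‖v.2‖ ^ 2))⁻¹ :=
  inv_pos.2 (Real.sqrt_pos.2 (normSq_pos h))

theorem radialProj_mem_sphere {v : ℂ × ℂ} (h : v ≠ 0) :
    ‖(radialProj v).1‖ ^ 2 + ‖(radialProj v).2‖ ^ 2 = 1 := by
  have h1 := normSq_pos h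
  simp only [radialProj, Prod.smul_fst, Prod.smul_snd, norm_smul, mul_pow, norm_inv,
    Real.norm_eq_abs, sq_abs, inv_pow]
  rw [Real.sq_sqrt h1.le]
  field_simp

theorem radialProj_smul {v : ℂ × ℂ} {c : ℝ} (hc : 0 < c) : radialProj (c • v) = radialProj v := by
  simp only [radialProj, Prod.smul_fst, Prod.smul_snd, norm_smul, mul_pow, Real.norm_eq_abs, sq_abs]
  rw [← mul_add, Real.sqrt_mul (sq_nonneg c), Real.sqrt_sq hc.le, smul_smul]
  congr 1
  field_simp

theorem radialProj_eq_iff {v w : ℂ × ℂ} (hv : v ≠ 0) (hw : w ≠ 0) :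
    radialProj v = radialProj w ↔ ∃ c : ℝ, 0 < c ∧ v = c • w := by
  constructor
  · intro h
    have h1 := scale_pos hv
    have h2 := scale_pos hw
    refine ⟨(√(‖v.1‖ ^ 2 + ‖v.2‖ ^ 2))⁻¹⁻¹ * (√(‖w.1‖ ^ 2 + ‖w.2‖ ^ 2))⁻¹, by positivity, ?_⟩
    rw [mul_smul]
    change _ = _ • radialProj w
    rw [← h, radialProj, smul_smul, inv_mul_cancel₀ h1.ne', one_smul]
  · rintro ⟨c, hc, rfl⟩
    exact radialProj_smul hc

theorem contDiffAt_scale {v : ℂ × ℂ} (h : v ≠ 0) :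
    ContDiffAt ℝ ∞ (fun v : ℂ × ℂ => (√(‖v.1‖ ^ 2 + ‖v.2‖ ^ 2))⁻¹) v := by
  have h1 := normSq_pos h
  have hc : ContDiffAt ℝ ∞ (fun v : ℂ × ℂ => ‖v.1‖ ^ 2 + ‖v.2‖ ^ 2) v :=
    ((contDiff_fst.norm_sq ℝ).add (contDiff_snd.norm_sq ℝ)).contDiffAt
  exact (hc.sqrt h1.ne').inv (Real.sqrt_pos.2 h1).ne'

theorem contDiffAt_radialProj {v : ℂ × ℂ} (h : v ≠ 0) : ContDiffAt ℝ ∞ radialProj v :=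
  (contDiffAt_scale h).smul contDiffAt_id

/-- Modulo the radial direction the derivative is only rescaled by a positive factor. Immersion and
transversality on the sphere can thus be tested in `ℂ × ℂ` modulo the ray through the point. -/
theorem exists_hasDerivAt_radialProj {Γ : ℝ → ℂ × ℂ} (hs : ContDiff ℝ ∞ Γ) (hne : ∀ t, Γ t ≠ 0)
    (t : ℝ) : ∃ c c' : ℝ, 0 < c ∧ deriv (fun t => radialProj (Γ t)) t = c • deriv Γ t + c' • Γ t := by
  have h1 : HasDerivAt Γ (deriv Γ t) t := (hs.differentiable (by simp) t).hasDerivAt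
  have h2 : DifferentiableAt ℝ (fun t => (√(‖(Γ t).1‖ ^ 2 + ‖(Γ t).2‖ ^ 2))⁻¹) t :=
    ((contDiffAt_scale (hne t)).comp t hs.contDiffAt).differentiableAt (by simp)
  exact ⟨_, _, scale_pos (hne t), (h2.hasDerivAt.smul h1).deriv⟩

/-- A smooth path of curves in `ℂ² ∖ 0` whose coincidences up to a positive factor do not change and
stay transverse gives an isotopy of singular knots. -/
theorem SingularIsotopic.of_family {Γ : ℝ → ℝ → ℂ × ℂ}
    (hs : ContDiff ℝ ∞ fun x : ℝ × ℝ => Γ x.1 x.2)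
    (hne : ∀ s ∈ Set.Icc (0 : ℝ) 1, ∀ t, Γ s t ≠ 0)
    (hper : ∀ s ∈ Set.Icc (0 : ℝ) 1, ∀ t, Γ s (t + 1) = Γ s t)
    (himm : ∀ s ∈ Set.Icc (0 : ℝ) 1, ∀ t, ∀ c : ℝ, deriv (Γ s) t ≠ c • Γ s t)
    (hco : ∀ s ∈ Set.Icc (0 : ℝ) 1, ∀ t u,
      (∃ c : ℝ, 0 < c ∧ Γ s t = c • Γ s u) ↔ ∃ c : ℝ, 0 < c ∧ Γ 0 t = c • Γ 0 u)
    (htr : ∀ s ∈ Set.Icc (0 : ℝ) 1, ∀ t u, (∃ c : ℝ, 0 < c ∧ Γ s t = c • Γ s u) →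
      (¬∃ k : ℤ, t = u + k) → ∀ a b c : ℝ,
        a • deriv (Γ s) t + b • deriv (Γ s) u = c • Γ s t → a = 0 ∧ b = 0)
    (hfin : {p : ℝ × ℝ | p.1 ∈ Set.Ico (0 : ℝ) 1 ∧ p.2 ∈ Set.Ico (0 : ℝ) 1 ∧
      p.1 ≠ p.2 ∧ radialProj (Γ 0 p.1) = radialProj (Γ 0 p.2)}.Finite)
    (hdbl : ∀ t ∈ Set.Ico (0 : ℝ) 1, ∀ u ∈ Set.Ico (0 : ℝ) 1, ∀ v ∈ Set.Ico (0 : ℝ) 1,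
      radialProj (Γ 0 t) = radialProj (Γ 0 u) → radialProj (Γ 0 u) = radialProj (Γ 0 v) →
      t = u ∨ u = v ∨ t = v) :
    SingularIsotopic (fun t => radialProj (Γ 0 t)) (fun t => radialProj (Γ 1 t)) := by
  have h0 : (0 : ℝ) ∈ Set.Icc (0 : ℝ) 1 := by simp
  have hco' : ∀ s ∈ Set.Icc (0 : ℝ) 1, ∀ t u, radialProj (Γ s t) = radialProj (Γ s u) ↔
      radialProj (Γ 0 t) = radialProj (Γ 0 u) := by
    intro s hs t u
    rw [radialProj_eq_iff (hne s hs t) (hne s hs u), radialProj_eq_iff (hne 0 h0 t) (hne 0 h0 u),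
      hco s hs]
  have hsm : ∀ s, ContDiff ℝ ∞ (Γ s) := fun s => hs.comp (contDiff_const.prodMk contDiff_id)
  have hknot : ∀ s ∈ Set.Icc (0 : ℝ) 1, IsSingularKnot fun t => radialProj (Γ s t) := by
    intro s hs'
    refine ⟨fun t => radialProj_mem_sphere (hne s hs' t), fun t => ?_, ?_, fun t => ?_, ?_, ?_, ?_⟩
    · show radialProj (Γ s (t + 1)) = radialProj (Γ s t)
      rw [hper s hs']
    · rw [contDiff_iff_contDiffAt]
      exact fun t => (contDiffAt_radialProj (hne s hs' t)).comp t (hsm s).contDiffAt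
    · obtain ⟨c, c', hc, h⟩ := exists_hasDerivAt_radialProj (hsm s) (hne s hs') t
      rw [h]
      intro h'
      apply himm s hs' t (-(c⁻¹ * c'))
      have : c⁻¹ • (c • deriv (Γ s) t + c' • Γ s t) = 0 := by rw [h', smul_zero]
      rw [smul_add, smul_smul, smul_smul, inv_mul_cancel₀ hc.ne', one_smul] at this
      rw [neg_smul]
      exact eq_neg_of_add_eq_zero_left this
    · simp only [hco' s hs']
      exact hfin
    · simp only [hco' s hs']
      exact hdbl
    · intro t ht u hu hne' e
      obtain ⟨c, c', hc, h⟩ := exists_hasDerivAt_radialProj (hsm s) (hne s hs') t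
      obtain ⟨d, d', hd, h'⟩ := exists_hasDerivAt_radialProj (hsm s) (hne s hs') u
      have e1 := (radialProj_eq_iff (hne s hs' t) (hne s hs' u)).1 e
      have e2 := e1
      obtain ⟨r, hr, e3⟩ := e2
      rw [LinearIndependent.pair_iff]
      intro a b hab
      rw [h, h'] at hab
      have hk : ¬∃ k : ℤ, t = u + k := by
        rw [← fract_eq_fract_iff, Int.fract_eq_self.2 ht, Int.fract_eq_self.2 hu]
        exact hne'
      have e4 : Γ s u = r⁻¹ • Γ s t := by rw [e3, smul_smul, inv_mul_cancel₀ hr.ne', one_smul]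
      -- The two points lie on one ray, so both radial terms merge into a single multiple of `Γ s
      -- t`.
      have := htr s hs' t u e1 hk (a * c) (b * d) (-(a * c' + b * d' * r⁻¹)) (by
        rw [← sub_eq_zero, ← hab, e4]
        module)
      simpa [hc.ne', hd.ne'] using this
  -- The family is controlled for `s` in the unit interval only; running through it at the time `S
  -- s` never leaves that interval.
  let S := Real.smoothTransition
  have hS : ContDiff ℝ ∞ S := Real.smoothTransition.contDiff
  have hSI : ∀ x, S x ∈ Set.Icc (0 : ℝ) 1 := fun x =>
    ⟨Real.smoothTransition.nonneg x, Real.smoothTransition.le_one x⟩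
  have hS0 : S 0 = 0 := Real.smoothTransition.zero
  have hS1 : S 1 = 1 := Real.smoothTransition.one
  refine ⟨fun s t => radialProj (Γ (S s) t), fun t => t, ?_, ?_, contDiff_id, by simp, by simp,
    by simp only [hS0], by simp only [hS1, implies_true]⟩
  · rw [contDiff_iff_contDiffAt]
    rintro ⟨s, t⟩
    have h1 : ContDiffAt ℝ ∞ (fun x : ℝ × ℝ => Γ (S x.1) x.2) (s, t) :=
      (hs.comp ((hS.comp contDiff_fst).prodMk contDiff_snd)).contDiffAt
    exact ContDiffAt.comp (s, t) (contDiffAt_radialProj (hne _ (hSI s) t)) h1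
  · intro s _
    refine ⟨hknot _ (hSI s), fun t u => ?_⟩
    simp only [hS0]
    exact hco' _ (hSI s) t u

/-! ### Closed 3-braids -/

/-- The point of the unit circle that is reached after `x` turns. -/
noncomputable def turn (x : ℝ) : ℂ := Complex.exp (2 * Real.pi * x * Complex.I)

theorem norm_turn (x : ℝ) : ‖turn x‖ = 1 := by
  have := Complex.norm_exp_ofReal_mul_I (2 * Real.pi * x)
  rw [turn]
  exact_mod_cast this

theorem turn_ne_zero (x : ℝ) : turn x ≠ 0 := Complex.exp_ne_zero _

theorem turn_add (x y : ℝ) : turn (x + y) = turn x * turn y := by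
  rw [turn, turn, turn, ← Complex.exp_add]
  push_cast
  ring_nf

theorem turn_eq_turn_iff (x y : ℝ) : turn x = turn y ↔ ∃ k : ℤ, x = y + k := by
  rw [turn, turn, Complex.exp_eq_exp_iff_exists_int]
  refine exists_congr fun k => ?_
  have h : (2 * Real.pi * Complex.I : ℂ) ≠ 0 := Complex.two_pi_I_ne_zero
  constructor
  · intro e
    have : (2 * Real.pi * Complex.I : ℂ) * x = (2 * Real.pi * Complex.I : ℂ) * ((y + k : ℝ) : ℂ) := by
      push_cast
      linear_combination e
    exact_mod_cast mul_left_cancel₀ h this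
  · intro e
    rw [e]
    push_cast
    ring

theorem turn_int (k : ℤ) : turn k = 1 := by
  have := (turn_eq_turn_iff k 0).2 ⟨k, by simp⟩
  rw [this]
  simp [turn]

theorem turn_add_int (x : ℝ) (k : ℤ) : turn (x + k) = turn x := by rw [turn_add, turn_int, mul_one]

theorem turn_add_one (x : ℝ) : turn (x + 1) = turn x := by exact_mod_cast turn_add_int x 1

theorem turn_hasDerivAt (x : ℝ) : HasDerivAt turn (2 * Real.pi * Complex.I * turn x) x := by
  have h : HasDerivAt (fun x : ℝ => (2 * Real.pi * x * Complex.I : ℂ)) (2 * Real.pi * Complex.I) x := by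
    have := (((Complex.ofRealCLM.hasDerivAt (x := x)).const_mul (2 * Real.pi : ℂ)).mul_const
      Complex.I)
    simpa using this
  exact h.cexp.congr_deriv (by rw [turn]; ring)

theorem contDiff_turn : ContDiff ℝ ∞ turn := by
  have : ContDiff ℝ ∞ fun x : ℝ => (2 * Real.pi * x * Complex.I : ℂ) :=
    (contDiff_const.mul Complex.ofRealCLM.contDiff).mul contDiff_const
  exact this.cexp

/-- Homogeneous coordinates of the closed 3-braid whose strands are the three thirds of `z`. -/
noncomputable def braidCurve (z : ℝ → ℂ) (t : ℝ) : ℂ × ℂ := (turn (3 * t), z (3 * t))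

/-- The closed 3-braid whose strands are the three thirds of `z`. -/
noncomputable def braidKnot (z : ℝ → ℂ) (t : ℝ) : ℂ × ℂ := radialProj (braidCurve z t)

theorem add_three_mul {z : ℝ → ℂ} (h : ∀ x, z (x + 3) = z x) (x : ℝ) (k : ℤ) :
    z (x + 3 * k) = z x := by
  have : Function.Periodic z 3 := h
  have := this.int_mul k x
  rwa [mul_comm] at this

theorem deriv_add_three {z : ℝ → ℂ} (h : ∀ x, z (x + 3) = z x) (x : ℝ) :
    deriv z (x + 3) = deriv z x := by
  rw [← deriv_comp_add_const]
  congr 1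
  funext y
  exact h y

theorem int_mod_three (k : ℤ) : (∃ m : ℤ, (k : ℝ) = 3 * m) ∨ (∃ m : ℤ, (k : ℝ) = 1 + 3 * m) ∨
    ∃ m : ℤ, (k : ℝ) = 2 + 3 * m := by
  have h : k % 3 = 0 ∨ k % 3 = 1 ∨ k % 3 = 2 := by omega
  rcases h with h | h | h
  · exact Or.inl ⟨k / 3, by exact_mod_cast (by omega : k = 3 * (k / 3))⟩
  · exact Or.inr (Or.inl ⟨k / 3, by exact_mod_cast (by omega : k = 1 + 3 * (k / 3))⟩)
  · exact Or.inr (Or.inr ⟨k / 3, by exact_mod_cast (by omega : k = 2 + 3 * (k / 3))⟩)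

theorem braidCurve_ne_zero (z : ℝ → ℂ) (t : ℝ) : braidCurve z t ≠ 0 := fun h =>
  turn_ne_zero _ (congrArg Prod.fst h)

/-- The first coordinates have norm 1, which forces the factor to be 1. What remains is equality
over the same point of the circle. -/
theorem braidCurve_eq_smul_iff (z : ℝ → ℂ) (t u : ℝ) :
    (∃ c : ℝ, 0 < c ∧ braidCurve z t = c • braidCurve z u) ↔
      ∃ k : ℤ, 3 * t = 3 * u + k ∧ z (3 * u + k) = z (3 * u) := by
  constructor
  · rintro ⟨c, hc, h⟩
    have h1 : turn (3 * t) = c • turn (3 * u) := congrArg Prod.fst h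
    have h2 : z (3 * t) = c • z (3 * u) := congrArg Prod.snd h
    have hc1 : c = 1 := by
      have := congrArg norm h1
      rw [norm_smul, norm_turn, norm_turn, Real.norm_eq_abs, abs_of_pos hc] at this
      linarith
    rw [hc1, one_smul] at h1 h2
    obtain ⟨k, hk⟩ := (turn_eq_turn_iff _ _).1 h1
    exact ⟨k, hk, by rw [← hk, h2]⟩
  · rintro ⟨k, hk, h⟩
    refine ⟨1, one_pos, ?_⟩
    rw [one_smul, braidCurve, braidCurve, hk, turn_add_int, h]

theorem braidKnot_eq_iff (z : ℝ → ℂ) (t u : ℝ) : braidKnot z t = braidKnot z u ↔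
      ∃ k : ℤ, 3 * t = 3 * u + k ∧ z (3 * u + k) = z (3 * u) := by
  rw [braidKnot, braidKnot, radialProj_eq_iff (braidCurve_ne_zero _ _) (braidCurve_ne_zero _ _),
    braidCurve_eq_smul_iff]

/-- The strands of a closed singular 3-braid with transverse double points. -/
structure IsBraidLoop (z : ℝ → ℂ) : Prop where
  smooth : ContDiff ℝ ∞ z
  add_three : ∀ x, z (x + 3) = z x
  finite : {x | x ∈ Set.Ico (0 : ℝ) 3 ∧ z (x + 1) = z x}.Finite
  no_triple : ∀ x, z (x + 1) = z x → z (x + 1 + 1) ≠ z (x + 1)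
  transverse : ∀ x, z (x + 1) = z x → deriv z (x + 1) ≠ deriv z x

theorem braidCurve_contDiff {z : ℝ → ℝ → ℂ} (h : ContDiff ℝ ∞ fun x : ℝ × ℝ => z x.1 x.2) :
    ContDiff ℝ ∞ fun x : ℝ × ℝ => braidCurve (z x.1) x.2 := by
  have h3 : ContDiff ℝ ∞ fun x : ℝ × ℝ => 3 * x.2 := contDiff_const.mul contDiff_snd
  exact (contDiff_turn.comp h3).prodMk (h.comp (contDiff_fst.prodMk h3))

theorem braidCurve_hasDerivAt {z : ℝ → ℂ} (h : ContDiff ℝ ∞ z) (t : ℝ) :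
    HasDerivAt (braidCurve z)
      (6 * Real.pi * Complex.I * turn (3 * t), 3 * deriv z (3 * t)) t := by
  have h3 : HasDerivAt (fun t : ℝ => 3 * t) 3 t := by
    simpa using (hasDerivAt_id t).const_mul (3 : ℝ)
  have h1 := (turn_hasDerivAt (3 * t)).scomp t h3
  have h2 := (h.differentiable (by simp) (3 * t)).hasDerivAt.scomp t h3
  refine (h1.prodMk h2).congr_deriv ?_
  simp only [Complex.real_smul, Prod.mk.injEq, Complex.ofReal_ofNat, and_true]
  ring

/-- Conditions on strands at distance 1 suffice: by the period 3, strands at distance 2 are at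
distance 1 in the opposite order. -/
theorem SingularIsotopic.of_braid_family {z : ℝ → ℝ → ℂ} (h0 : IsBraidLoop (z 0))
    (hs : ContDiff ℝ ∞ fun x : ℝ × ℝ => z x.1 x.2)
    (hper : ∀ s ∈ Set.Icc (0 : ℝ) 1, ∀ x, z s (x + 3) = z s x)
    (hco : ∀ s ∈ Set.Icc (0 : ℝ) 1, ∀ x, z s (x + 1) = z s x ↔ z 0 (x + 1) = z 0 x)
    (htr : ∀ s ∈ Set.Icc (0 : ℝ) 1, ∀ x, z s (x + 1) = z s x →
      deriv (z s) (x + 1) ≠ deriv (z s) x) :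
    SingularIsotopic (braidKnot (z 0)) (braidKnot (z 1)) ∧ IsBraidLoop (z 1) := by
  have hsm : ∀ s, ContDiff ℝ ∞ (z s) := fun s => hs.comp (contDiff_const.prodMk contDiff_id)
  have h1 : (1 : ℝ) ∈ Set.Icc (0 : ℝ) 1 := by simp
  refine ⟨?_, hsm 1, hper 1 h1, ?_, ?_, htr 1 h1⟩
  swap
  · simpa only [hco 1 h1] using h0.finite
  swap
  · intro x
    rw [hco 1 h1, ne_eq, hco 1 h1]
    exact h0.no_triple x
  have hpi : (6 * Real.pi * Complex.I : ℂ) ≠ 0 := by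
    simp [Real.pi_ne_zero]
  apply SingularIsotopic.of_family (Γ := fun s => braidCurve (z s)) (braidCurve_contDiff hs)
  · exact fun s _ t => braidCurve_ne_zero _ _
  · intro s hs' t
    have := turn_add_int (3 * t) 3
    rw [braidCurve, braidCurve, mul_add, mul_one, hper s hs']
    push_cast at this
    rw [this]
  · intro s hs' t c h
    rw [(braidCurve_hasDerivAt (hsm s) t).deriv] at h
    have h1 : 6 * Real.pi * Complex.I * turn (3 * t) = c • turn (3 * t) := congrArg Prod.fst h
    rw [Complex.real_smul] at h1
    have h2 := congrArg Complex.im (mul_right_cancel₀ (turn_ne_zero _) h1)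
    simp [Real.pi_ne_zero] at h2
  · intro s hs' t u
    rw [braidCurve_eq_smul_iff, braidCurve_eq_smul_iff]
    refine exists_congr fun k => and_congr_right fun _ => ?_
    obtain ⟨m, hm⟩ | ⟨m, hm⟩ | ⟨m, hm⟩ := int_mod_three k
    · rw [hm, add_three_mul (hper s hs'), add_three_mul h0.add_three]
      simp
    · rw [hm, ← add_assoc, add_three_mul (hper s hs'), add_three_mul h0.add_three, hco s hs']
    · rw [hm, ← add_assoc, add_three_mul (hper s hs'), add_three_mul h0.add_three, eq_comm,
        eq_comm (a := z 0 _), ← hper s hs' (3 * u), ← h0.add_three (3 * u),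
        show 3 * u + 3 = 3 * u + 2 + 1 by ring, hco s hs']
  · intro s hs' t u hc hk a b c h
    rw [braidCurve_eq_smul_iff] at hc
    obtain ⟨k, hk', hz⟩ := hc
    rw [(braidCurve_hasDerivAt (hsm s) t).deriv, (braidCurve_hasDerivAt (hsm s) u).deriv] at h
    have h1 : a • (6 * Real.pi * Complex.I * turn (3 * t)) +
      b • (6 * Real.pi * Complex.I * turn (3 * u)) = c • turn (3 * t) := congrArg Prod.fst h
    have h2 : a • (3 * deriv (z s) (3 * t)) + b • (3 * deriv (z s) (3 * u)) = c • z s (3 * t) :=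
      congrArg Prod.snd h
    rw [show turn (3 * t) = turn (3 * u) by rw [hk', turn_add_int]] at h1
    simp only [Complex.real_smul] at h1 h2
    -- Both strands run around the axis at the same speed, so the first coordinate yields an
    -- imaginary number equal to a real one: `a + b = 0` and `c = 0`. The second coordinate is left
    -- with `a` times the difference of the derivatives.
    have h3 : (a + b) * (6 * Real.pi * Complex.I) = (c : ℂ) :=
      mul_right_cancel₀ (turn_ne_zero (3 * u)) (by linear_combination h1)
    have h4 := congrArg Complex.im h3
    have h5 := congrArg Complex.re h3
    simp [Real.pi_ne_zero] at h4 h5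
    have hb : b = -a := by linarith
    rw [← h5, hb] at h2
    have ha : (a : ℂ) * (deriv (z s) (3 * t) - deriv (z s) (3 * u)) = 0 := by
      push_cast at h2
      linear_combination h2 / 3
    rcases mul_eq_zero.1 ha with h | h
    · have : a = 0 := by exact_mod_cast h
      exact ⟨this, by rw [hb, this, neg_zero]⟩
    exfalso
    rw [hk'] at h
    have hdp := deriv_add_three (hper s hs')
    obtain ⟨m, hm⟩ | ⟨m, hm⟩ | ⟨m, hm⟩ := int_mod_three k
    · apply hk
      exact ⟨m, by linarith⟩
    · rw [hm, ← add_assoc, add_three_mul hdp] at h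
      rw [hm, ← add_assoc, add_three_mul (hper s hs')] at hz
      exact htr s hs' _ hz (sub_eq_zero.1 h)
    · rw [hm, ← add_assoc, add_three_mul hdp] at h
      rw [hm, ← add_assoc, add_three_mul (hper s hs')] at hz
      rw [← hper s hs' (3 * u), show 3 * u + 3 = 3 * u + 2 + 1 by ring] at hz
      rw [← hdp (3 * u), show 3 * u + 3 = 3 * u + 2 + 1 by ring] at h
      exact htr s hs' _ hz.symm (sub_eq_zero.1 h).symm
  · have hf := h0.finite
    -- A coincidence of the strands at `x` and `x + 1` has the parameters `x / 3` and `(x + 1) / 3`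
    -- modulo 1, in either order.
    refine ((hf.image fun x => (Int.fract ((x + 1) / 3), x / 3)).union
      (hf.image fun x => (x / 3, Int.fract ((x + 1) / 3)))).subset ?_
    rintro ⟨t, u⟩ ⟨ht, hu, hne, e⟩
    obtain ⟨k, hk, hz⟩ := (braidKnot_eq_iff (z 0) t u).1 e
    simp only at ht hu hne
    have hI : ∀ y ∈ Set.Ico (0 : ℝ) 1, 3 * y ∈ Set.Ico (0 : ℝ) 3 := fun y hy =>
      ⟨by linarith [hy.1], by linarith [hy.2]⟩
    obtain ⟨m, hm⟩ | ⟨m, hm⟩ | ⟨m, hm⟩ := int_mod_three k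
    · exfalso
      apply hne
      have := (fract_eq_fract_iff t u).2 ⟨m, by linarith⟩
      rwa [Int.fract_eq_self.2 ht, Int.fract_eq_self.2 hu] at this
    · left
      rw [hm, ← add_assoc, add_three_mul h0.add_three] at hz
      refine ⟨3 * u, ⟨hI u hu, hz⟩, ?_⟩
      simp only [Prod.mk.injEq]
      refine ⟨?_, by ring⟩
      rw [← Int.fract_eq_self.2 ht, fract_eq_fract_iff]
      exact ⟨-m, by push_cast; linarith⟩
    · right
      rw [hm, ← add_assoc, add_three_mul h0.add_three] at hz
      refine ⟨3 * t, ⟨hI t ht, ?_⟩, ?_⟩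
      · rw [hk, hm, ← add_assoc, add_three_mul h0.add_three, hz,
          show 3 * u + 2 + 3 * (m : ℝ) + 1 = 3 * u + 3 * ((m + 1 : ℤ) : ℝ) by push_cast; ring,
          add_three_mul h0.add_three]
      · simp only [Prod.mk.injEq]
        refine ⟨by ring, ?_⟩
        rw [← Int.fract_eq_self.2 hu, fract_eq_fract_iff]
        exact ⟨m + 1, by push_cast; linarith⟩
  · intro t ht u hu v hv e1 e2
    obtain ⟨k, hk, hz⟩ := (braidKnot_eq_iff (z 0) t u).1 e1
    obtain ⟨l, hl, hz'⟩ := (braidKnot_eq_iff (z 0) u v).1 e2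
    have hfe : ∀ a ∈ Set.Ico (0 : ℝ) 1, ∀ b ∈ Set.Ico (0 : ℝ) 1,
        (∃ m : ℤ, a = b + m) → a = b := by
      intro a ha b hb h
      rwa [← fract_eq_fract_iff, Int.fract_eq_self.2 ha, Int.fract_eq_self.2 hb] at h
    have hp := fun x k => add_three_mul h0.add_three x k
    -- In most residue classes two of the three parameters agree modulo 1. If both steps are 1 or
    -- both are 2 modulo 3, all three strands would meet, against `no_triple`.
    obtain ⟨m, hm⟩ | ⟨m, hm⟩ | ⟨m, hm⟩ := int_mod_three k <;>
    obtain ⟨n, hn⟩ | ⟨n, hn⟩ | ⟨n, hn⟩ := int_mod_three l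
    · exact Or.inl (hfe _ ht _ hu ⟨m, by linarith⟩)
    · exact Or.inl (hfe _ ht _ hu ⟨m, by linarith⟩)
    · exact Or.inl (hfe _ ht _ hu ⟨m, by linarith⟩)
    · exact Or.inr (Or.inl (hfe _ hu _ hv ⟨n, by linarith⟩))
    · exfalso
      rw [hm, ← add_assoc, hp] at hz
      rw [hn, ← add_assoc, hp] at hz'
      apply h0.no_triple _ hz'
      rw [hl, hn, ← add_assoc, hp, show 3 * v + 1 + 3 * (n : ℝ) + 1 = 3 * v + 1 + 1 + 3 * n by ring,
        hp] at hz
      exact hz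
    · exact Or.inr (Or.inr (hfe _ ht _ hv ⟨m + n + 1, by push_cast; linarith⟩))
    · exact Or.inr (Or.inl (hfe _ hu _ hv ⟨n, by linarith⟩))
    · exact Or.inr (Or.inr (hfe _ ht _ hv ⟨m + n + 1, by push_cast; linarith⟩))
    · exfalso
      rw [hm, ← add_assoc, hp] at hz
      rw [hn, ← add_assoc, hp] at hz'
      rw [hl, hn, show 3 * v + (2 + 3 * (n : ℝ)) + 2 = 3 * v + 1 + 3 * ((n + 1 : ℤ) : ℝ) by
        push_cast; ring, hp, ← add_assoc, hp] at hz
      apply h0.no_triple (3 * v + 1)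
      · rw [hz]; ring_nf
      · rw [show 3 * v + 1 + 1 + 1 = 3 * v + 3 * ((1 : ℤ) : ℝ) by push_cast; ring, hp, ← hz']
        ring_nf

/-! ### Isotopies of closed 3-braids -/

/-- The segment between two complex numbers avoids the origin. -/
def SegmentAvoidsZero (a b : ℂ) : Prop := ∀ s ∈ Set.Icc (0 : ℝ) 1, (1 - s) * a + s * b ≠ 0

theorem SegmentAvoidsZero.symm {a b : ℂ} (h : SegmentAvoidsZero a b) : SegmentAvoidsZero b a := by
  intro s hs
  have := h (1 - s) ⟨by linarith [hs.2], by linarith [hs.1]⟩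
  push_cast at this
  rwa [sub_sub_cancel, add_comm] at this

/-- A half plane that contains both ends, at most one of them on its boundary. -/
theorem segmentAvoidsZero_of_halfPlane {a b : ℂ} (p q : ℝ) (ha : 0 ≤ p * a.re + q * a.im)
    (hb : 0 < p * b.re + q * b.im) (ha0 : a ≠ 0) : SegmentAvoidsZero a b := by
  intro s hs h
  have h1 := congrArg Complex.re h
  have h2 := congrArg Complex.im h
  simp at h1 h2
  have h3 : (1 - s) * (p * a.re + q * a.im) + s * (p * b.re + q * b.im) = 0 := by
    linear_combination p * h1 + q * h2
  have hs0 : s = 0 := by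
    by_contra hne
    have : 0 < s := lt_of_le_of_ne hs.1 (Ne.symm hne)
    nlinarith [mul_nonneg (sub_nonneg.2 hs.2) ha, mul_pos this hb]
  subst hs0
  simp at h1 h2
  exact ha0 (Complex.ext h1 h2)

theorem segmentAvoidsZero_of_re {a b : ℂ} (ha : 0 < a.re) (hb : 0 < b.re) :
    SegmentAvoidsZero a b :=
  segmentAvoidsZero_of_halfPlane 1 0 (by linarith) (by linarith) (fun h => by simp [h] at ha)

theorem segmentAvoidsZero_of_im {a b : ℂ} (ha : 0 < a.im) (hb : 0 < b.im) :
    SegmentAvoidsZero a b :=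
  segmentAvoidsZero_of_halfPlane 0 1 (by linarith) (by linarith) (fun h => by simp [h] at ha)

theorem SegmentAvoidsZero.mul {a b c : ℂ} (hc : c ≠ 0) (h : SegmentAvoidsZero a b) :
    SegmentAvoidsZero (c * a) (c * b) := by
  intro s hs
  rw [show (1 - s) * (c * a) + s * (c * b) = c * ((1 - s) * a + s * b) by ring]
  exact mul_ne_zero hc (h s hs)

theorem SegmentAvoidsZero.of_mul {a b c : ℂ} (hc : c ≠ 0)
    (h : SegmentAvoidsZero (c * a) (c * b)) : SegmentAvoidsZero a b := by
  have := h.mul (inv_ne_zero hc)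
  rwa [inv_mul_cancel_left₀ hc, inv_mul_cancel_left₀ hc] at this

/-- A rotation by `-α / 2` makes the two ends symmetric about the positive real axis, inside the
right half plane. -/
theorem segmentAvoidsZero_exp {α : ℝ} (h : |α| < Real.pi) :
    SegmentAvoidsZero 1 (Complex.exp (α * Complex.I)) := by
  have hc : 0 < Real.cos (α / 2) := by
    apply Real.cos_pos_of_mem_Ioo
    rw [abs_lt] at h
    constructor <;> linarith [h.1, h.2]
  apply SegmentAvoidsZero.of_mul (Complex.exp_ne_zero (((-(α / 2) : ℝ) : ℂ) * Complex.I))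
  rw [mul_one, ← Complex.exp_add, ← add_mul, ← Complex.ofReal_add]
  apply segmentAvoidsZero_of_re
  · rw [Complex.exp_ofReal_mul_I_re, Real.cos_neg]; exact hc
  · rw [Complex.exp_ofReal_mul_I_re, show -(α / 2) + α = α / 2 by ring]; exact hc

/-- The difference of two strands of the interpolated loop runs along the segment between the two
given differences, and likewise for the derivatives. So coincidences neither appear nor disappear,
and they stay transverse. -/
theorem SingularIsotopic.of_linear {z z' : ℝ → ℂ} (hz : IsBraidLoop z) (hs : ContDiff ℝ ∞ z')
    (hper : ∀ x, z' (x + 3) = z' x)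
    (h : ∀ x, SegmentAvoidsZero (z (x + 1) - z x) (z' (x + 1) - z' x) ∨
      (z (x + 1) = z x ∧ z' (x + 1) = z' x ∧
        SegmentAvoidsZero (deriv z (x + 1) - deriv z x) (deriv z' (x + 1) - deriv z' x))) :
    SingularIsotopic (braidKnot z) (braidKnot z') ∧ IsBraidLoop z' := by
  let Z : ℝ → ℝ → ℂ := fun s x => (1 - s) * z x + s * z' x
  have hZ0 : Z 0 = z := by funext x; simp [Z]
  have hZ1 : Z 1 = z' := by funext x; simp [Z]
  have hor : ContDiff ℝ ∞ fun x : ℝ × ℝ => (x.1 : ℂ) := Complex.ofRealCLM.contDiff.comp contDiff_fst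
  have hd : ∀ s x, deriv (Z s) x = (1 - s) * deriv z x + s * deriv z' x := by
    intro s x
    exact (((hz.smooth.differentiable (by simp) x).hasDerivAt.const_mul (1 - s : ℂ)).add
      ((hs.differentiable (by simp) x).hasDerivAt.const_mul (s : ℂ))).deriv
  have hsub : ∀ s x y, Z s y - Z s x = (1 - s) * (z y - z x) + s * (z' y - z' x) := by
    intro s x y; simp only [Z]; ring
  have key : ∀ s ∈ Set.Icc (0 : ℝ) 1, ∀ x, Z s (x + 1) = Z s x ↔ Z 0 (x + 1) = Z 0 x := by
    intro s hs' x
    rw [← sub_eq_zero, hsub, hZ0]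
    rcases h x with h | h
    · have h1 := h s hs'
      have h0 := h 0 (by simp)
      simp only [Complex.ofReal_zero, sub_zero, one_mul, zero_mul, add_zero] at h0
      simp only [h1, false_iff]
      exact fun e => h0 (by rw [e, sub_self])
    · simp [h.1, h.2.1]
  have := SingularIsotopic.of_braid_family (z := Z) (by rwa [hZ0]) ?_ ?_ key ?_
  · rwa [hZ0, hZ1] at this
  · exact ((contDiff_const.sub hor).mul (hz.smooth.comp contDiff_snd)).add
      (hor.mul (hs.comp contDiff_snd))
  · intro s _ x
    simp only [Z, hz.add_three, hper]
  · intro s hs' x e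
    rw [key s hs', hZ0] at e
    rcases h x with h | h
    · have h0 := h 0 (by simp)
      simp [e] at h0
    · rw [← sub_ne_zero, hd, hd]
      convert h.2.2 s hs' using 1
      ring

theorem IsReparam.add_three {φ : ℝ → ℝ} (h : IsReparam φ) (x : ℝ) : φ (x + 3) = φ x + 3 := by
  exact_mod_cast h.add_int x 3

theorem IsReparam.deriv_add_one {φ : ℝ → ℝ} (h : IsReparam φ) (x : ℝ) :
    deriv φ (x + 1) = deriv φ x := by
  rw [← deriv_comp_add_const]
  simp only [h.add_one]
  exact deriv_add_const _

theorem IsReparam.deriv_comp {φ : ℝ → ℝ} (h : IsReparam φ) {z : ℝ → ℂ} (hz : ContDiff ℝ ∞ z)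
    (x : ℝ) : deriv (fun x => z (φ x)) x = deriv φ x • deriv z (φ x) :=
  ((hz.differentiable (by simp) (φ x)).hasDerivAt.scomp x (h.differentiable x).hasDerivAt).deriv

theorem IsBraidLoop.comp_reparam {z : ℝ → ℂ} (h : IsBraidLoop z) {φ : ℝ → ℝ} (hφ : IsReparam φ) :
    IsBraidLoop fun x => z (φ x) := by
  refine ⟨h.smooth.comp hφ.smooth, fun x => ?_, ?_, fun x => ?_, fun x => ?_⟩
  · simp only [hφ.add_three, h.add_three]
  · refine Set.Finite.of_finite_image (f := fun x => 3 * Int.fract (φ x / 3))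
      (h.finite.subset ?_) ?_
    · rintro _ ⟨x, ⟨hx, e⟩, rfl⟩
      have h1 : 3 * Int.fract (φ x / 3) = φ x + 3 * ((-⌊φ x / 3⌋ : ℤ) : ℝ) := by
        rw [Int.fract]; push_cast; ring
      refine ⟨⟨by linarith [Int.fract_nonneg (φ x / 3)], by linarith [Int.fract_lt_one (φ x / 3)]⟩, ?_⟩
      simp only
      rw [h1, add_right_comm, add_three_mul h.add_three, add_three_mul h.add_three]
      simpa only [hφ.add_one] using e
    · rintro x ⟨hx, -⟩ y ⟨hy, -⟩ e
      simp only [mul_eq_mul_left_iff] at e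
      have e1 : Int.fract (φ x / 3) = Int.fract (φ y / 3) := by simpa using e
      obtain ⟨k, hk⟩ := (fract_eq_fract_iff _ _).1 e1
      have h3 : φ x = φ (y + ((3 * k : ℤ) : ℝ)) := by
        rw [hφ.add_int]; push_cast; linarith
      have h4 := hφ.strictMono.injective h3
      push_cast at h4
      have : (fun y : ℝ => y / 3) x = (fun y : ℝ => y / 3) y := by
        have hx' : x / 3 ∈ Set.Ico (0 : ℝ) 1 := ⟨by linarith [hx.1], by linarith [hx.2]⟩
        have hy' : y / 3 ∈ Set.Ico (0 : ℝ) 1 := ⟨by linarith [hy.1], by linarith [hy.2]⟩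
        show x / 3 = y / 3
        rw [← Int.fract_eq_self.2 hx', ← Int.fract_eq_self.2 hy', fract_eq_fract_iff]
        exact ⟨k, by linarith⟩
      simp only at this
      linarith
  · simp only [hφ.add_one]
    exact h.no_triple _
  · rw [hφ.deriv_comp h.smooth, hφ.deriv_comp h.smooth, hφ.deriv_add_one, hφ.add_one]
    intro e e'
    exact h.transverse _ e (smul_right_injective _ (hφ.deriv_pos x).ne' e')

theorem IsBraidLoop.isSingularKnot {z : ℝ → ℂ} (h : IsBraidLoop z) :
    IsSingularKnot (braidKnot z) :=
  (SingularIsotopic.of_braid_family (z := fun _ => z) h (h.smooth.comp contDiff_snd)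
    (fun _ _ => h.add_three) (fun _ _ _ => Iff.rfl) fun _ _ => h.transverse).1.left

theorem IsReparam.div_three {φ : ℝ → ℝ} (h : IsReparam φ) : IsReparam fun t => φ (3 * t) / 3 where
  smooth := (h.smooth.comp (contDiff_const.mul contDiff_id)).div_const _
  deriv_pos t := by
    have h3 : HasDerivAt (fun t : ℝ => 3 * t) 3 t := by
      simpa using (hasDerivAt_id t).const_mul (3 : ℝ)
    have := (((h.differentiable (3 * t)).hasDerivAt).comp t h3).div_const 3
    have e : deriv (fun t => φ (3 * t) / 3) t = deriv φ (3 * t) * 3 / 3 := this.deriv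
    rw [e]
    linarith [h.deriv_pos (3 * t)]
  add_one t := by rw [mul_add, mul_one, h.add_three]; ring

/-- Only `z` is reparametrized here and not the position around the axis, so this is no mere change
of parameter. The position around the axis is moved from `x` to `φ x` by the interpolation `θ`. At
each stage `θ s` is a change of parameter, and composing with its inverse shows a closed braid. -/
theorem SingularIsotopic.of_braid_reparam {z : ℝ → ℂ} (hz : IsBraidLoop z) {φ : ℝ → ℝ}
    (hφ : IsReparam φ) : SingularIsotopic (braidKnot fun x => z (φ x)) (braidKnot z) := by
  let θ : ℝ → ℝ → ℝ := fun s x => (1 - s) * x + s * φ x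
  have hθs : ContDiff ℝ ∞ fun x : ℝ × ℝ => θ x.1 x.2 :=
    ((contDiff_const.sub contDiff_fst).mul contDiff_snd).add
      (contDiff_fst.mul (hφ.smooth.comp contDiff_snd))
  have hθ : ∀ s ∈ Set.Icc (0 : ℝ) 1, IsReparam (θ s) := by
    intro s hs
    refine ⟨hθs.comp (contDiff_const.prodMk contDiff_id), fun x => ?_, fun x => ?_⟩
    · have : HasDerivAt (θ s) ((1 - s) * 1 + s * deriv φ x) x :=
        ((hasDerivAt_id x).const_mul (1 - s)).add ((hφ.differentiable x).hasDerivAt.const_mul s)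
      rw [this.deriv]
      rcases hs.1.eq_or_lt with h | h
      · rw [← h]; norm_num
      · nlinarith [mul_pos h (hφ.deriv_pos x), hs.2]
    · simp only [θ, hφ.add_one]
      ring
  have hZ := hz.comp_reparam hφ
  have h3 : ContDiff ℝ ∞ fun x : ℝ × ℝ => 3 * x.2 := contDiff_const.mul contDiff_snd
  have hco : ∀ s ∈ Set.Icc (0 : ℝ) 1, ∃ σ, IsReparam σ ∧ ∀ t,
      radialProj (turn (θ s (3 * t)), z (φ (3 * t))) =
        braidKnot (fun x => z (φ (σ x))) (θ s (3 * t) / 3) := by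
    intro s hs
    obtain ⟨σ, hσ, e1, e2⟩ := (hθ s hs).exists_inverse
    refine ⟨σ, hσ, fun t => ?_⟩
    rw [braidKnot, braidCurve, mul_div_cancel₀ _ (by norm_num : (3 : ℝ) ≠ 0), e1]
  have hne : ∀ s t, ((turn (θ s (3 * t)), z (φ (3 * t))) : ℂ × ℂ) ≠ 0 :=
    fun s t h => turn_ne_zero _ (congrArg Prod.fst h)
  have hiff : ∀ s ∈ Set.Icc (0 : ℝ) 1, ∀ t u,
      radialProj (turn (θ s (3 * t)), z (φ (3 * t))) =
        radialProj (turn (θ s (3 * u)), z (φ (3 * u))) ↔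
      ∃ k : ℤ, 3 * t = 3 * u + k ∧ z (φ (3 * t)) = z (φ (3 * u)) := by
    intro s hs t u
    obtain ⟨σ, hσ, e⟩ := hco s hs
    rw [radialProj_eq_iff (hne _ _) (hne _ _)]
    constructor
    · rintro ⟨c, hc, h⟩
      have h1 : turn (θ s (3 * t)) = c • turn (θ s (3 * u)) := congrArg Prod.fst h
      have h2 : z (φ (3 * t)) = c • z (φ (3 * u)) := congrArg Prod.snd h
      have hc1 : c = 1 := by
        have := congrArg norm h1
        rw [norm_smul, norm_turn, norm_turn, Real.norm_eq_abs, abs_of_pos hc] at this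
        linarith
      rw [hc1, one_smul] at h1 h2
      rw [turn_eq_turn_iff, (hθ s hs).eq_add_int_iff] at h1
      obtain ⟨k, hk⟩ := h1
      exact ⟨k, hk, h2⟩
    · rintro ⟨k, hk, h⟩
      refine ⟨1, one_pos, ?_⟩
      have : turn (θ s (3 * t)) = turn (θ s (3 * u)) := by
        rw [turn_eq_turn_iff, (hθ s hs).eq_add_int_iff]
        exact ⟨k, hk⟩
      rw [one_smul, this, h]
  refine ⟨fun s t => radialProj (turn (θ s (3 * t)), z (φ (3 * t))), fun t => φ (3 * t) / 3,
    ?_, ?_, hφ.div_three.smooth, hφ.div_three.deriv_pos, hφ.div_three.add_one, ?_, ?_⟩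
  · rw [contDiff_iff_contDiffAt]
    rintro ⟨s, t⟩
    have h1 : ContDiff ℝ ∞ (fun x : ℝ × ℝ =>
        ((turn (θ x.1 (3 * x.2)), z (φ (3 * x.2))) : ℂ × ℂ)) :=
      (contDiff_turn.comp (hθs.comp (contDiff_fst.prodMk h3))).prodMk (hZ.smooth.comp h3)
    exact ContDiffAt.comp (s, t) (contDiffAt_radialProj (hne s t)) h1.contDiffAt
  · intro s hs
    refine ⟨?_, fun t u => by rw [hiff s hs, hiff 0 (by simp)]⟩
    obtain ⟨σ, hσ, e⟩ := hco s hs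
    simp only [e]
    exact ((hz.comp_reparam (hφ.comp hσ)).isSingularKnot).comp_reparam (hθ s hs).div_three
  · funext t
    simp only [θ, sub_zero, one_mul, zero_mul, add_zero]
    rfl
  · intro t
    simp only [θ, sub_self, one_mul, zero_mul, zero_add]
    rw [braidKnot, braidCurve, mul_div_cancel₀ _ (by norm_num : (3 : ℝ) ≠ 0)]

/-- The difference of consecutive strands stays in a moving half plane, which it leaves for the
origin only along its boundary line. -/
structure Aligned (θ : ℝ → ℝ) (z : ℝ → ℂ) : Prop where
  re_pos : ∀ x, z (x + 1) ≠ z x → 0 < (Complex.exp ((-θ x : ℝ) * Complex.I) * (z (x + 1) - z x)).re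
  im_pos : ∀ x, z (x + 1) = z x →
    0 < (Complex.exp ((-θ x : ℝ) * Complex.I) * (deriv z (x + 1) - deriv z x)).im

theorem Aligned.comp_reparam {θ : ℝ → ℝ} {z : ℝ → ℂ} (h : Aligned θ z) (hz : ContDiff ℝ ∞ z)
    {φ : ℝ → ℝ} (hφ : IsReparam φ) : Aligned (fun x => θ (φ x)) fun x => z (φ x) := by
  refine ⟨fun x => ?_, fun x => ?_⟩
  · simp only [hφ.add_one]
    exact h.re_pos _
  · rw [hφ.deriv_comp hz, hφ.deriv_comp hz, hφ.deriv_add_one, hφ.add_one, ← smul_sub]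
    intro e
    have := mul_pos (hφ.deriv_pos x) (h.im_pos _ e)
    rw [mul_smul_comm, Complex.smul_im]
    exact this

/-- As `α` has period 1, the strands over a point of the circle are rotated together, and each
difference is multiplied by `exp (α x * I)`. An angle below π keeps the segment from a vector to its
image away from 0. -/
theorem SingularIsotopic.of_rotation {z : ℝ → ℂ} (hz : IsBraidLoop z) {α : ℝ → ℝ}
    (hα : ContDiff ℝ ∞ α) (hper : ∀ x, α (x + 1) = α x) (hpi : ∀ x, |α x| < Real.pi) :
    SingularIsotopic (braidKnot z) (braidKnot fun x => Complex.exp (α x * Complex.I) * z x) ∧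
      IsBraidLoop (fun x => Complex.exp (α x * Complex.I) * z x) ∧
      ∀ θ, Aligned θ z →
        Aligned (fun x => θ x + α x) fun x => Complex.exp (α x * Complex.I) * z x := by
  have hper3 : ∀ x, α (x + 3) = α x := by
    intro x
    rw [show x + 3 = x + 1 + 1 + 1 by ring, hper, hper, hper]
  have hE : ContDiff ℝ ∞ fun x => Complex.exp (α x * Complex.I) :=
    ((Complex.ofRealCLM.contDiff.comp hα).mul contDiff_const).cexp
  have hEp : ∀ x, deriv (fun x => Complex.exp (α x * Complex.I)) (x + 1) =
      deriv (fun x => Complex.exp (α x * Complex.I)) x := by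
    intro x
    rw [← deriv_comp_add_const]
    simp only [hper]
  have hd : ∀ x, z (x + 1) = z x →
      deriv (fun x => Complex.exp (α x * Complex.I) * z x) (x + 1) -
        deriv (fun x => Complex.exp (α x * Complex.I) * z x) x =
      Complex.exp (α x * Complex.I) * (deriv z (x + 1) - deriv z x) := by
    intro x e
    have h : ∀ x, deriv (fun x => Complex.exp (α x * Complex.I) * z x) x = _ := fun x =>
      ((hE.differentiable (by simp) x).hasDerivAt.mul
        (hz.smooth.differentiable (by simp) x).hasDerivAt).deriv
    rw [h, h, hEp, e, hper]
    ring
  have hm : ∀ (t x : ℝ) (w : ℂ), Complex.exp ((-(t + α x) : ℝ) * Complex.I) *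
      (Complex.exp (α x * Complex.I) * w) = Complex.exp ((-t : ℝ) * Complex.I) * w := by
    intro t x w
    rw [← mul_assoc, ← Complex.exp_add]
    congr 2
    push_cast
    ring
  have hsub : ∀ x, Complex.exp (α (x + 1) * Complex.I) * z (x + 1) -
      Complex.exp (α x * Complex.I) * z x = Complex.exp (α x * Complex.I) * (z (x + 1) - z x) := by
    intro x
    rw [hper]; ring
  refine and_assoc.1 ⟨SingularIsotopic.of_linear hz (hE.mul hz.smooth) ?_ ?_, ?_⟩
  · intro x
    simp only [hper3, hz.add_three]
  · intro x
    simp only [hsub]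
    by_cases e : z (x + 1) = z x
    · refine Or.inr ⟨e, by rw [e, hper], ?_⟩
      rw [hd x e]
      have := (segmentAvoidsZero_exp (hpi x)).mul (sub_ne_zero.2 (hz.transverse x e))
      rwa [mul_one, mul_comm] at this
    · left
      have := (segmentAvoidsZero_exp (hpi x)).mul (sub_ne_zero.2 e)
      rwa [mul_one, mul_comm] at this
  · intro θ h
    refine ⟨fun x hx => ?_, fun x hx => ?_⟩
    · have hx' : z (x + 1) ≠ z x := by
        rintro e
        apply hx
        rw [e, hper]
      rw [hsub, hm]
      exact h.re_pos x hx'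
    · have hx' : z (x + 1) = z x := by
        rw [hper] at hx
        exact mul_left_cancel₀ (Complex.exp_ne_zero _) hx
      rw [hd x hx', hm]
      exact h.im_pos x hx'

/-- After the change of time `φ` and a rotation by the difference of the directions, both loops are
aligned with the same `θ'`. Corresponding differences then lie in a common open half plane, or both
vanish with derivatives in a common open half plane, and linear interpolation applies. -/
theorem SingularIsotopic.of_aligned {θ θ' : ℝ → ℝ} {z z' : ℝ → ℂ} (hz : IsBraidLoop z)
    (h : Aligned θ z) (hs' : ContDiff ℝ ∞ z') (hper' : ∀ x, z' (x + 3) = z' x)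
    (h' : Aligned θ' z') (hθ : ContDiff ℝ ∞ θ) (hθ' : ContDiff ℝ ∞ θ') {φ : ℝ → ℝ}
    (hφ : IsReparam φ) (hzero : ∀ x, z' (x + 1) = z' x ↔ z (φ x + 1) = z (φ x))
    (hper : ∀ x, θ' (x + 1) - θ (φ x + 1) = θ' x - θ (φ x))
    (hpi : ∀ x, |θ' x - θ (φ x)| < Real.pi) :
    SingularIsotopic (braidKnot z) (braidKnot z') ∧ IsBraidLoop z' := by
  obtain ⟨i2, b2, a2⟩ := SingularIsotopic.of_rotation (hz.comp_reparam hφ)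
    (α := fun x => θ' x - θ (φ x)) (hθ'.sub (hθ.comp hφ.smooth))
    (fun x => by rw [hφ.add_one, hper]) hpi
  have a2 := a2 _ (h.comp_reparam hz.smooth hφ)
  simp only [add_sub_cancel] at a2
  suffices hseg : _ by
    obtain ⟨i3, b3⟩ := SingularIsotopic.of_linear b2 hs' hper' hseg
    exact ⟨(SingularIsotopic.of_braid_reparam hz hφ).symm.trans (i2.trans i3), b3⟩
  · intro x
    have e0 := Complex.exp_ne_zero ((-θ' x : ℝ) * Complex.I)
    have hiff : Complex.exp ((θ' (x + 1) - θ (φ (x + 1)) : ℝ) * Complex.I) * z (φ (x + 1)) =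
        Complex.exp ((θ' x - θ (φ x) : ℝ) * Complex.I) * z (φ x) ↔ z' (x + 1) = z' x := by
      rw [hφ.add_one, hper, hzero]
      exact (mul_right_injective₀ (Complex.exp_ne_zero _)).eq_iff
    by_cases e : z' (x + 1) = z' x
    · right
      refine ⟨hiff.2 e, e, ?_⟩
      exact (segmentAvoidsZero_of_im (a2.im_pos x (hiff.2 e)) (h'.im_pos x e)).of_mul e0
    · left
      exact (segmentAvoidsZero_of_re (a2.re_pos x fun e' => e (hiff.1 e')) (h'.re_pos x e)).of_mul e0

/-! ### Gluing functions on unit intervals -/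

section Glue

variable {E : Type*}

/-- The function that is equal to `B j (x - j)` on the interval `[j, j + 1)`. -/
noncomputable def glue (B : ℤ → ℝ → E) (x : ℝ) : E := B ⌊x⌋ (Int.fract x)

theorem glue_int_add (B : ℤ → ℝ → E) (j : ℤ) {u : ℝ} (h0 : 0 ≤ u) (h1 : u < 1) :
    glue B (j + u) = B j u := by
  have h : Int.fract u = u := Int.fract_eq_self.2 ⟨h0, h1⟩
  have h' : ⌊u⌋ = 0 := Int.floor_eq_zero_iff.2 ⟨h0, h1⟩
  rw [glue, Int.floor_intCast_add, Int.fract_intCast_add, h, h', add_zero]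

theorem glue_int (B : ℤ → ℝ → E) (j : ℤ) : glue B j = B j 0 := by
  have := glue_int_add B j (u := 0) le_rfl one_pos
  rwa [add_zero] at this

theorem glue_int_add' {B A : ℤ → ℝ → E} (h0 : ∀ j u, u ≤ 0 → B j u = A j u)
    (h1 : ∀ j u, 1 ≤ u → B j u = A (j + 1) (u - 1)) (j : ℤ) {u : ℝ} (hu0 : 0 ≤ u) (hu1 : u ≤ 1) :
    glue B (j + u) = B j u := by
  rcases hu1.eq_or_lt with rfl | h
  · have := glue_int B (j + 1)
    push_cast at this
    rw [this, h0 _ _ le_rfl, h1 j 1 le_rfl, sub_self]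
  · exact glue_int_add B j hu0 h

theorem glue_eventuallyEq (B : ℤ → ℝ → E) (j : ℤ) {u : ℝ} (h0 : 0 < u) (h1 : u < 1) :
    glue B =ᶠ[nhds (j + u)] fun x => B j (x - j) := by
  have hU : Set.Ioo (j : ℝ) (j + 1) ∈ nhds ((j : ℝ) + u) :=
    isOpen_Ioo.mem_nhds ⟨by linarith, by linarith⟩
  filter_upwards [hU] with x hx
  have hf : ⌊x⌋ = j := by
    rw [Int.floor_eq_iff]
    exact ⟨hx.1.le, hx.2⟩
  simp only [glue, Int.fract, hf]

theorem glue_add_int {B C : ℤ → ℝ → E} {k : ℤ} (h : ∀ j u, B (j + k) u = C j u) (x : ℝ) :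
    glue B (x + k) = glue C x := by
  rw [glue, Int.floor_add_intCast, Int.fract_add_intCast, h, glue]

theorem exists_int_add (x : ℝ) : ∃ (j : ℤ) (u : ℝ), 0 ≤ u ∧ u < 1 ∧ x = j + u :=
  ⟨⌊x⌋, Int.fract x, Int.fract_nonneg x, Int.fract_lt_one x, (Int.floor_add_fract x).symm⟩

variable [NormedAddCommGroup E] [NormedSpace ℝ E]

/-- Near the integer `j` the glued function equals `B (j - 1) + B j - A j`, suitably shifted,
because on each side of `j` one of the two blocks coincides with `A j`. This sum is smooth. -/
theorem contDiff_glue_param {B A : ℤ → ℝ → ℝ → E}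
    (hB : ∀ j, ContDiff ℝ ∞ fun p : ℝ × ℝ => B j p.1 p.2)
    (hA : ∀ j, ContDiff ℝ ∞ fun p : ℝ × ℝ => A j p.1 p.2)
    (h0 : ∀ j s u, u ≤ 0 → B j s u = A j s u)
    (h1 : ∀ j s u, 1 ≤ u → B j s u = A (j + 1) s (u - 1)) :
    ContDiff ℝ ∞ fun p : ℝ × ℝ => glue (fun j => B j p.1) p.2 := by
  rw [contDiff_iff_contDiffAt]
  rintro ⟨s, x⟩
  set j := ⌊x⌋ with hj
  have hx0 : (j : ℝ) ≤ x := Int.floor_le x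
  have hx1 : x < j + 1 := Int.lt_floor_add_one x
  have hsh : ∀ c : ℝ, ContDiff ℝ ∞ fun p : ℝ × ℝ => (p.1, p.2 - c) := fun c =>
    contDiff_fst.prodMk (contDiff_snd.sub contDiff_const)
  have hG : ContDiff ℝ ∞ fun p : ℝ × ℝ =>
      B (j - 1) p.1 (p.2 - (j - 1)) + B j p.1 (p.2 - j) - A j p.1 (p.2 - j) :=
    (((hB (j - 1)).comp (hsh (j - 1))).add ((hB j).comp (hsh j))).sub ((hA j).comp (hsh j))
  refine hG.contDiffAt.congr_of_eventuallyEq ?_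
  have hU : {p : ℝ × ℝ | (j : ℝ) - 1 < p.2 ∧ p.2 < j + 1} ∈ nhds (s, x) := by
    apply IsOpen.mem_nhds
    · exact (isOpen_lt continuous_const continuous_snd).inter
        (isOpen_lt continuous_snd continuous_const)
    · exact ⟨by show (j : ℝ) - 1 < x; linarith, hx1⟩
  filter_upwards [hU] with p hp
  obtain ⟨r, y⟩ := p
  replace hp : (j : ℝ) - 1 < y ∧ y < j + 1 := hp
  rcases lt_or_ge y j with hy | hy
  · have hf : ⌊y⌋ = j - 1 := by
      rw [Int.floor_eq_iff]
      push_cast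
      exact ⟨hp.1.le, by linarith⟩
    simp only [glue, Int.fract, hf]
    rw [h0 j r (y - j) (by linarith)]
    push_cast
    abel
  · have hf : ⌊y⌋ = j := by
      rw [Int.floor_eq_iff]
      exact ⟨hy, hp.2⟩
    simp only [glue, Int.fract, hf]
    rw [h1 (j - 1) r (y - (j - 1)) (by linarith), sub_add_cancel,
      show y - (j - 1) - 1 = y - (j : ℝ) by ring]
    abel

theorem contDiff_glue {B A : ℤ → ℝ → E} (hB : ∀ j, ContDiff ℝ ∞ (B j))
    (hA : ∀ j, ContDiff ℝ ∞ (A j)) (h0 : ∀ j u, u ≤ 0 → B j u = A j u)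
    (h1 : ∀ j u, 1 ≤ u → B j u = A (j + 1) (u - 1)) : ContDiff ℝ ∞ (glue B) := by
  have := contDiff_glue_param (B := fun j _ => B j) (A := fun j _ => A j)
    (fun j => (hB j).comp contDiff_snd) (fun j => (hA j).comp contDiff_snd)
    (fun j _ => h0 j) fun j _ => h1 j
  exact this.comp ((contDiff_const (c := (0 : ℝ))).prodMk contDiff_id)

theorem glue_deriv (B : ℤ → ℝ → E) (j : ℤ) {u : ℝ} (h0 : 0 < u) (h1 : u < 1) :
    deriv (glue B) (j + u) = deriv (B j) u := by
  rw [(glue_eventuallyEq B j h0 h1).deriv_eq, deriv_comp_sub_const, add_sub_cancel_left]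

end Glue

/-! ### Smooth monotone interpolation -/

/-- One piece of a smooth increasing function that has slope `ε` at the ends. -/
noncomputable def interpPiece (y : ℤ → ℝ) (ε : ℝ) (j : ℤ) (u : ℝ) : ℝ :=
  y j + ε * u + (y (j + 1) - y j - ε) * Real.smoothTransition u

/-- A smooth increasing function with the value `y j` at each integer `j`. -/
noncomputable def interp (y : ℤ → ℝ) (ε : ℝ) : ℝ → ℝ := glue (interpPiece y ε)

section Interp

variable {y : ℤ → ℝ} {ε : ℝ}

theorem interpPiece_of_nonpos (j : ℤ) {u : ℝ} (h : u ≤ 0) : interpPiece y ε j u = y j + ε * u := by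
  rw [interpPiece, Real.smoothTransition.zero_of_nonpos h]; ring

theorem interpPiece_of_one_le (j : ℤ) {u : ℝ} (h : 1 ≤ u) :
    interpPiece y ε j u = y (j + 1) + ε * (u - 1) := by
  rw [interpPiece, Real.smoothTransition.one_of_one_le h]; ring

theorem interpPiece_of_eq {j : ℤ} (h : y (j + 1) - y j = ε) (u : ℝ) :
    interpPiece y ε j u = y j + ε * u := by
  rw [interpPiece, h]; ring

theorem contDiff_interpPiece (j : ℤ) : ContDiff ℝ ∞ (interpPiece y ε j) :=
  (contDiff_const.add (contDiff_const.mul contDiff_id)).add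
    (contDiff_const.mul Real.smoothTransition.contDiff)

theorem interpPiece_deriv (j : ℤ) (u : ℝ) : deriv (interpPiece y ε j) u =
    ε + (y (j + 1) - y j - ε) * deriv Real.smoothTransition u := by
  have h1 : HasDerivAt (fun u : ℝ => y j + ε * u) ε u := by
    simpa using ((hasDerivAt_id u).const_mul ε).const_add (y j)
  exact (h1.add ((smoothTransition_differentiable u).hasDerivAt.const_mul _)).deriv

theorem contDiff_interp : ContDiff ℝ ∞ (interp y ε) :=
  contDiff_glue (A := fun j u => y j + ε * u) contDiff_interpPiece
    (fun _ => contDiff_const.add (contDiff_const.mul contDiff_id))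
    (fun j _ h => interpPiece_of_nonpos j h) fun j _ h => interpPiece_of_one_le j h

theorem interp_int_add (j : ℤ) {u : ℝ} (h0 : 0 ≤ u) (h1 : u ≤ 1) :
    interp y ε (j + u) = interpPiece y ε j u :=
  glue_int_add' (A := fun j u => y j + ε * u) (fun j _ h => interpPiece_of_nonpos j h)
    (fun j _ h => interpPiece_of_one_le j h) j h0 h1

theorem interp_int (j : ℤ) : interp y ε j = y j := by
  rw [interp, glue_int, interpPiece_of_nonpos _ le_rfl, mul_zero, add_zero]

theorem interp_deriv_pos (hε : 0 < ε) (hy : ∀ j, ε ≤ y (j + 1) - y j) (x : ℝ) :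
    0 < deriv (interp y ε) x := by
  have hpos : ∀ j u, 0 < deriv (interpPiece y ε j) u := by
    intro j u
    rw [interpPiece_deriv]
    have := mul_nonneg (sub_nonneg.2 (hy j)) (smoothTransition_deriv_nonneg u)
    linarith
  obtain ⟨j, u, h0, h1, rfl⟩ := exists_int_add x
  rcases h0.eq_or_lt with rfl | h0
  · have hd : HasDerivAt (interp y ε) (deriv (interp y ε) j) j :=
      (contDiff_interp.differentiable (by simp) _).hasDerivAt
    -- At an integer the derivative exists by smoothness, and its value is read off from the piece
    -- on the right.
    have h2 : HasDerivWithinAt (interp y ε) (deriv (interp y ε) j) (Set.Ici (j : ℝ)) j :=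
      hd.hasDerivWithinAt
    have h3 : HasDerivAt (fun x : ℝ => interpPiece y ε j (x - j)) (deriv (interpPiece y ε j) 0) j := by
      have := ((contDiff_interpPiece (y := y) (ε := ε) j).differentiable (by simp)
        ((j : ℝ) - j)).hasDerivAt.comp_sub_const (j : ℝ) (j : ℝ)
      rwa [sub_self] at this
    have h4 : HasDerivWithinAt (interp y ε) (deriv (interpPiece y ε j) 0) (Set.Ici (j : ℝ)) j := by
      refine h3.hasDerivWithinAt.congr_of_eventuallyEq ?_ ?_
      · have : Set.Iio (j + 1 : ℝ) ∈ nhds (j : ℝ) := isOpen_Iio.mem_nhds (by simp)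
        filter_upwards [inter_mem_nhdsWithin (Set.Ici (j : ℝ)) this] with x hx
        have := interp_int_add (y := y) (ε := ε) j (u := x - j) (by linarith [Set.mem_Ici.1 hx.1])
          (by linarith [Set.mem_Iio.1 hx.2])
        rwa [add_sub_cancel] at this
      · simp [interp_int, interpPiece_of_nonpos]
    rw [add_zero]
    rw [(uniqueDiffWithinAt_Ici (j : ℝ)).eq_deriv _ h2 h4]
    exact hpos j 0
  · rw [interp, glue_deriv _ _ h0 h1]
    exact hpos j u

theorem interp_add_int {M : ℤ} {p : ℝ} (h : ∀ j, y (j + M) = y j + p) (x : ℝ) :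
    interp y ε (x + M) = interp y ε x + p := by
  rw [interp, glue_add_int (C := fun j u => interpPiece y ε j u + p)]
  · rfl
  · intro j u
    rw [interpPiece, interpPiece, h, add_right_comm j M 1, h]
    ring

theorem interp_strictMono (hε : 0 < ε) (hy : ∀ j, ε ≤ y (j + 1) - y j) :
    StrictMono (interp y ε) := strictMono_of_deriv_pos (interp_deriv_pos hε hy)

theorem interp_isReparam {M : ℤ} {p : ℝ} (hM : 0 < M) (hp : 0 < p) (hε : 0 < ε)
    (hy : ∀ j, ε ≤ y (j + 1) - y j) (h : ∀ j, y (j + M) = y j + p) :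
    IsReparam fun x => interp y ε (M * x) / p where
  smooth := (contDiff_interp.comp (contDiff_const.mul contDiff_id)).div_const _
  deriv_pos x := by
    have hM' : (0 : ℝ) < M := by exact_mod_cast hM
    have h3 : HasDerivAt (fun t : ℝ => (M : ℝ) * t) M x := by
      simpa using (hasDerivAt_id x).const_mul (M : ℝ)
    have := (((contDiff_interp (y := y) (ε := ε)).differentiable (by simp) (M * x)).hasDerivAt.comp
      x h3).div_const p
    have e : deriv (fun x => interp y ε (M * x) / p) x = deriv (interp y ε) (M * x) * M / p :=
      this.deriv
    rw [e]
    exact div_pos (mul_pos (interp_deriv_pos hε hy _) hM') hp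
  add_one x := by
    rw [mul_add, mul_one, interp_add_int h, add_div, div_self hp.ne']

end Interp

/-! ### Strand curves built from blocks

A word in `C_3` is encoded by the list of the tails of its chords, where the chord that joins the
strands `k` and `k + 1` modulo `3` has the tail `k`. The letter `none` stands for the closing braid. -/

/-- The block at the place `j` of the periodically repeated word. -/
def blockSym (w : List (ZMod 3)) (j : ℤ) : Option (ZMod 3) := w[(j % (w.length + 1 : ℕ)).toNat]?

/-- The strand that passes through the block at the place `j`. -/
def blockStrand (w : List (ZMod 3)) (j : ℤ) : ZMod 3 := ((j / (w.length + 1 : ℕ) : ℤ) : ZMod 3)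

section Block

variable (w : List (ZMod 3)) (j : ℤ)

theorem blockSym_add : blockSym w (j + (w.length + 1 : ℕ)) = blockSym w j := by
  rw [blockSym, Int.add_emod_right, blockSym]

theorem blockStrand_add : blockStrand w (j + (w.length + 1 : ℕ)) = blockStrand w j + 1 := by
  have h : ((w.length + 1 : ℕ) : ℤ) ≠ 0 := by positivity
  rw [blockStrand, Int.add_ediv_of_dvd_right dvd_rfl, Int.ediv_self h, blockStrand]
  push_cast
  ring

/-- The letter `none` occurs exactly at the last residue `w.length`, which is where the quotient,
the index of the strand, increases. -/
theorem div_add_one_of_blockSym_eq_none (h : blockSym w j = none) :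
    (j + 1) / ((w.length + 1 : ℕ) : ℤ) = j / ((w.length + 1 : ℕ) : ℤ) + 1 := by
  have hpos : (0 : ℤ) < ((w.length + 1 : ℕ) : ℤ) := by positivity
  have h1 := Int.emod_lt_of_pos j hpos
  have h2 := Int.emod_nonneg j hpos.ne'
  have h3 := Int.emod_add_mul_ediv j ((w.length + 1 : ℕ) : ℤ)
  rw [blockSym, List.getElem?_eq_none_iff] at h
  have h4 : j % ((w.length + 1 : ℕ) : ℤ) + 1 = ((w.length + 1 : ℕ) : ℤ) := by
    have : ((w.length + 1 : ℕ) : ℤ) = w.length + 1 := by push_cast; ring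
    omega
  have h5 : j + 1 = ((w.length + 1 : ℕ) : ℤ) * (j / ((w.length + 1 : ℕ) : ℤ) + 1) := by linarith
  rw [h5, Int.mul_ediv_cancel_left _ hpos.ne']

theorem div_add_one_of_blockSym_eq_some {c : ZMod 3} (h : blockSym w j = some c) :
    (j + 1) / ((w.length + 1 : ℕ) : ℤ) = j / ((w.length + 1 : ℕ) : ℤ) := by
  have hpos : (0 : ℤ) < ((w.length + 1 : ℕ) : ℤ) := by positivity
  have h1 := Int.emod_lt_of_pos j hpos
  have h2 := Int.emod_nonneg j hpos.ne'
  have h3 := Int.emod_add_mul_ediv j ((w.length + 1 : ℕ) : ℤ)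
  have h6 : (j % ((w.length + 1 : ℕ) : ℤ)).toNat < w.length := by
    rw [blockSym] at h
    exact (List.getElem?_eq_some_iff.1 h).1
  have h4 : j % ((w.length + 1 : ℕ) : ℤ) + 1 < ((w.length + 1 : ℕ) : ℤ) := by
    have : ((w.length + 1 : ℕ) : ℤ) = w.length + 1 := by push_cast; ring
    omega
  rw [Int.ediv_eq_iff_of_pos hpos]
  constructor <;> nlinarith

theorem blockStrand_add_one_of_none (h : blockSym w j = none) :
    blockStrand w (j + 1) = blockStrand w j + 1 := by
  rw [blockStrand, div_add_one_of_blockSym_eq_none w j h, blockStrand]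
  push_cast
  ring

theorem blockStrand_add_one_of_some {c : ZMod 3} (h : blockSym w j = some c) :
    blockStrand w (j + 1) = blockStrand w j := by
  rw [blockStrand, div_add_one_of_blockSym_eq_some w j h, blockStrand]

end Block

/-- A choice of paths of the three strands through each kind of block, which starts and ends at the
standing positions of the strands. -/
structure IsBlockSystem (blk : Option (ZMod 3) → ZMod 3 → ℝ → ℂ) (pos : ZMod 3 → ℂ) : Prop where
  smooth : ∀ b k, ContDiff ℝ ∞ (blk b k)
  start : ∀ b k u, u ≤ 0 → blk b k u = pos k
  stop_some : ∀ c k u, 1 ≤ u → blk (some c) k u = pos k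
  stop_none : ∀ k u, 1 ≤ u → blk none k u = pos (k + 1)

/-- The strands of the closed braid composed from the blocks of a word. -/
noncomputable def strandCurve (blk : Option (ZMod 3) → ZMod 3 → ℝ → ℂ) (w : List (ZMod 3)) (x : ℝ) :
    ℂ := glue (fun j => blk (blockSym w j) (blockStrand w j)) ((w.length + 1 : ℕ) * x)

section StrandCurve

variable {blk blk' : Option (ZMod 3) → ZMod 3 → ℝ → ℂ} {pos pos' : ZMod 3 → ℂ} (w : List (ZMod 3))

theorem IsBlockSystem.contDiff (h : IsBlockSystem blk pos) : ContDiff ℝ ∞ (strandCurve blk w) := by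
  have : ContDiff ℝ ∞ (glue fun j => blk (blockSym w j) (blockStrand w j)) := by
    refine contDiff_glue (A := fun j _ => pos (blockStrand w j)) (fun j => h.smooth _ _)
      (fun _ => contDiff_const) (fun j u hu => h.start _ _ _ hu) fun j u hu => ?_
    rcases hb : blockSym w j with _ | c
    · rw [h.stop_none _ _ hu, blockStrand_add_one_of_none w j hb]
    · rw [h.stop_some _ _ _ hu, blockStrand_add_one_of_some w j hb]
  exact this.comp (contDiff_const.mul contDiff_id)

theorem block_mul_div (j : ℤ) (u : ℝ) :
    ((w.length + 1 : ℕ) : ℝ) * ((j + u) / (w.length + 1 : ℕ)) = j + u := by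
  have : ((w.length + 1 : ℕ) : ℝ) ≠ 0 := by positivity
  field_simp

theorem block_div_add_one (j : ℤ) (u : ℝ) : (j + u) / ((w.length + 1 : ℕ) : ℝ) + 1 =
    (((j + (w.length + 1 : ℕ) : ℤ) : ℝ) + u) / ((w.length + 1 : ℕ) : ℝ) := by
  have : ((w.length + 1 : ℕ) : ℝ) ≠ 0 := by positivity
  push_cast at this ⊢
  field_simp
  ring

theorem exists_block (x : ℝ) : ∃ (j : ℤ) (u : ℝ), 0 ≤ u ∧ u < 1 ∧
    x = (j + u) / ((w.length + 1 : ℕ) : ℝ) := by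
  obtain ⟨j, u, h0, h1, e⟩ := exists_int_add (((w.length + 1 : ℕ) : ℝ) * x)
  have : ((w.length + 1 : ℕ) : ℝ) ≠ 0 := by positivity
  exact ⟨j, u, h0, h1, by rw [← e]; field_simp⟩

theorem strandCurve_apply (j : ℤ) {u : ℝ} (h0 : 0 ≤ u) (h1 : u < 1) :
    strandCurve blk w ((j + u) / (w.length + 1 : ℕ)) = blk (blockSym w j) (blockStrand w j) u := by
  rw [strandCurve, block_mul_div, glue_int_add _ _ h0 h1]

theorem strandCurve_apply_add_one (j : ℤ) {u : ℝ} (h0 : 0 ≤ u) (h1 : u < 1) :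
    strandCurve blk w ((j + u) / (w.length + 1 : ℕ) + 1) =
      blk (blockSym w j) (blockStrand w j + 1) u := by
  rw [block_div_add_one, strandCurve_apply w _ h0 h1, blockSym_add, blockStrand_add]

theorem strandCurve_deriv (j : ℤ) {u : ℝ} (h0 : 0 < u) (h1 : u < 1) :
    deriv (strandCurve blk w) ((j + u) / (w.length + 1 : ℕ)) =
      (w.length + 1 : ℕ) * deriv (blk (blockSym w j) (blockStrand w j)) u := by
  have : strandCurve blk w = fun x =>
    glue (fun j => blk (blockSym w j) (blockStrand w j)) ((w.length + 1 : ℕ) * x) := rfl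
  rw [this, deriv_comp_mul_left, block_mul_div, glue_deriv _ _ h0 h1, Complex.real_smul]
  norm_cast

theorem strandCurve_deriv_add_one (j : ℤ) {u : ℝ} (h0 : 0 < u) (h1 : u < 1) :
    deriv (strandCurve blk w) ((j + u) / (w.length + 1 : ℕ) + 1) =
      (w.length + 1 : ℕ) * deriv (blk (blockSym w j) (blockStrand w j + 1)) u := by
  rw [block_div_add_one, strandCurve_deriv w _ h0 h1, blockSym_add, blockStrand_add]

theorem strandCurve_add_three (x : ℝ) : strandCurve blk w (x + 3) = strandCurve blk w x := by
  obtain ⟨j, u, h0, h1, rfl⟩ := exists_block w x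
  rw [show ∀ y : ℝ, y + 3 = y + 1 + 1 + 1 by intro y; ring, block_div_add_one, block_div_add_one,
    strandCurve_apply_add_one w _ h0 h1, strandCurve_apply w _ h0 h1, blockSym_add, blockSym_add,
    blockStrand_add, blockStrand_add, add_assoc, add_assoc, show (1 : ZMod 3) + (1 + 1) = 0 by decide,
    add_zero]

theorem SingularIsotopic.of_blocks (hz : IsBraidLoop (strandCurve blk w))
    (h' : IsBlockSystem blk' pos')
    (h : ∀ b k u, 0 ≤ u → u < 1 →
      SegmentAvoidsZero (blk b (k + 1) u - blk b k u) (blk' b (k + 1) u - blk' b k u) ∨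
      (0 < u ∧ blk b (k + 1) u = blk b k u ∧ blk' b (k + 1) u = blk' b k u ∧
        SegmentAvoidsZero (deriv (blk b (k + 1)) u - deriv (blk b k) u)
          (deriv (blk' b (k + 1)) u - deriv (blk' b k) u))) :
    SingularIsotopic (braidKnot (strandCurve blk w)) (braidKnot (strandCurve blk' w)) ∧
      IsBraidLoop (strandCurve blk' w) := by
  refine SingularIsotopic.of_linear hz (h'.contDiff w) (strandCurve_add_three w) fun x => ?_
  obtain ⟨j, u, h0, h1, rfl⟩ := exists_block w x
  rw [strandCurve_apply_add_one w j h0 h1, strandCurve_apply w j h0 h1,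
    strandCurve_apply_add_one w j h0 h1, strandCurve_apply w j h0 h1]
  refine (h (blockSym w j) (blockStrand w j) u h0 h1).imp_right ?_
  rintro ⟨hu, e, e', hd⟩
  refine ⟨e, e', ?_⟩
  rw [strandCurve_deriv_add_one w j hu h1, strandCurve_deriv w j hu h1,
    strandCurve_deriv_add_one w j hu h1, strandCurve_deriv w j hu h1, ← mul_sub, ← mul_sub]
  exact hd.mul (by exact_mod_cast (by positivity : ((w.length + 1 : ℕ) : ℝ) ≠ 0))

end StrandCurve

/-! ### Pinching two strands to a double point -/

/-- The displacement that brings two strands at distance `1` to a double point at the time `1 / 2`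
and back, along a circle. -/
noncomputable def pinch (u : ℝ) : ℂ := (1 - turn (-Real.smoothTransition u)) / 4

theorem contDiff_pinch : ContDiff ℝ ∞ pinch :=
  (contDiff_const.sub (contDiff_turn.comp Real.smoothTransition.contDiff.neg)).div_const _

theorem pinch_re (u : ℝ) :
    (pinch u).re = (1 - Real.cos (2 * Real.pi * Real.smoothTransition u)) / 4 := by
  have : (turn (-Real.smoothTransition u)).re =
      Real.cos (2 * Real.pi * Real.smoothTransition u) := by
    rw [turn, ← Complex.ofReal_ofNat, ← Complex.ofReal_mul, ← Complex.ofReal_mul,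
      Complex.exp_ofReal_mul_I_re, mul_neg, Real.cos_neg]
  rw [pinch, ← this]
  simp

theorem pinch_im (u : ℝ) :
    (pinch u).im = Real.sin (2 * Real.pi * Real.smoothTransition u) / 4 := by
  have : (turn (-Real.smoothTransition u)).im =
      -Real.sin (2 * Real.pi * Real.smoothTransition u) := by
    rw [turn, ← Complex.ofReal_ofNat, ← Complex.ofReal_mul, ← Complex.ofReal_mul,
      Complex.exp_ofReal_mul_I_im, mul_neg, Real.sin_neg]
  rw [pinch, ← neg_neg (Real.sin _), ← this]
  simp

theorem pinch_of_nonpos {u : ℝ} (h : u ≤ 0) : pinch u = 0 := by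
  rw [pinch, Real.smoothTransition.zero_of_nonpos h]; simp [turn]

theorem pinch_of_one_le {u : ℝ} (h : 1 ≤ u) : pinch u = 0 := by
  have := turn_int (-1)
  push_cast at this
  rw [pinch, Real.smoothTransition.one_of_one_le h, this]; simp

theorem pinch_circle (u : ℝ) : (pinch u).re ^ 2 + (pinch u).im ^ 2 = (pinch u).re / 2 := by
  rw [pinch_re, pinch_im]
  nlinarith [Real.sin_sq_add_cos_sq (2 * Real.pi * Real.smoothTransition u)]

theorem pinch_re_nonneg (u : ℝ) : 0 ≤ (pinch u).re := by
  rw [pinch_re]; linarith [Real.cos_le_one (2 * Real.pi * Real.smoothTransition u)]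

theorem pinch_re_le (u : ℝ) : (pinch u).re ≤ 1 / 2 := by
  rw [pinch_re]; linarith [Real.neg_one_le_cos (2 * Real.pi * Real.smoothTransition u)]

theorem pinch_im_le (u : ℝ) : (pinch u).im ≤ 1 / 4 := by
  rw [pinch_im]; linarith [Real.sin_le_one (2 * Real.pi * Real.smoothTransition u)]

theorem le_pinch_im (u : ℝ) : -(1 / 4) ≤ (pinch u).im := by
  rw [pinch_im]; linarith [Real.neg_one_le_sin (2 * Real.pi * Real.smoothTransition u)]

theorem pinch_im_pos {u : ℝ} (h0 : 0 < u) (h1 : u < 1 / 2) : 0 < (pinch u).im := by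
  have hs0 := Real.smoothTransition.pos_of_pos h0
  have hs1 := smoothTransition_strictMonoOn ⟨h0.le, by linarith⟩ ⟨by norm_num, by norm_num⟩ h1
  rw [smoothTransition_half] at hs1
  rw [pinch_im]
  have := Real.sin_pos_of_pos_of_lt_pi (x := 2 * Real.pi * Real.smoothTransition u)
    (by positivity) (by nlinarith [Real.pi_pos])
  linarith

theorem pinch_im_neg {u : ℝ} (h0 : 1 / 2 < u) (h1 : u < 1) : (pinch u).im < 0 := by
  have hs0 := smoothTransition_strictMonoOn ⟨by norm_num, by norm_num⟩ ⟨by linarith, h1.le⟩ h0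
  rw [smoothTransition_half] at hs0
  have hs1 := Real.smoothTransition.lt_one_of_lt_one h1
  rw [pinch_im]
  have := Real.sin_pos_of_pos_of_lt_pi
    (x := 2 * Real.pi * Real.smoothTransition u - Real.pi)
    (by nlinarith [Real.pi_pos]) (by nlinarith [Real.pi_pos])
  rw [Real.sin_sub_pi] at this
  linarith

theorem pinch_half : pinch (1 / 2) = 1 / 2 := by
  apply Complex.ext
  · rw [pinch_re, smoothTransition_half, show 2 * Real.pi * (1 / 2) = Real.pi by ring, Real.cos_pi]
    norm_num
  · rw [pinch_im, smoothTransition_half, show 2 * Real.pi * (1 / 2) = Real.pi by ring, Real.sin_pi]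
    norm_num

/-- On the circle of `pinch_circle` the value `1 / 2` of the real part forces a vanishing imaginary
part, which inside the unit interval happens only at the time `1 / 2`. Hence `1 - 2 * pinch u` lies
in the open right half plane except for its single zero. -/
theorem pinch_re_lt {u : ℝ} (h : u ≠ 1 / 2) : (pinch u).re < 1 / 2 := by
  rcases le_or_gt u 0 with h0 | h0
  · rw [pinch_of_nonpos h0]; norm_num
  rcases le_or_gt 1 u with h1 | h1
  · rw [pinch_of_one_le h1]; norm_num
  refine lt_of_le_of_ne (pinch_re_le u) fun e => ?_
  have hc := pinch_circle u
  rw [e] at hc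
  have : (pinch u).im = 0 := by
    have : (pinch u).im ^ 2 = 0 := by linarith
    exact pow_eq_zero_iff (two_ne_zero) |>.1 this
  rcases lt_or_gt_of_ne h with h | h
  · exact (pinch_im_pos h0 h).ne' this
  · exact (pinch_im_neg h h1).ne this

/-- The vertical tangent means that `1 - 2 * pinch` passes through 0 along the boundary of the right
half plane, as `Aligned` demands. -/
theorem pinch_hasDerivAt_half :
    ∃ c : ℝ, 0 < c ∧ HasDerivAt pinch (-(c * Complex.I)) (1 / 2) := by
  obtain ⟨c, hc, h⟩ := smoothTransition_hasDerivAt_pos (x := 1 / 2) (by norm_num) (by norm_num)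
  refine ⟨Real.pi / 2 * c, by positivity, ?_⟩
  have h1 := (turn_hasDerivAt (-Real.smoothTransition (1 / 2))).scomp (1 / 2 : ℝ) h.neg
  refine ((h1.const_sub 1).div_const 4).congr_deriv ?_
  have : turn (-(1 / 2)) = -1 := by
    rw [turn, show (2 * Real.pi * ((-(1 / 2) : ℝ) : ℂ) * Complex.I) = -(Real.pi * Complex.I) by
      push_cast; ring, Complex.exp_neg, Complex.exp_pi_mul_I]
    norm_num
  rw [smoothTransition_half, this, Complex.real_smul]
  push_cast
  ring

/-! ### Triangular closed braids -/

/-- The primitive third root of unity in the upper half plane. -/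
noncomputable def cubeRoot : ℂ := ⟨-1 / 2, √3 / 2⟩

theorem cubeRoot_re : cubeRoot.re = -1 / 2 := rfl

theorem cubeRoot_im : cubeRoot.im = √3 / 2 := rfl

theorem sqrt_three_sq : √3 ^ 2 = (3 : ℝ) := Real.sq_sqrt (by norm_num)

theorem cubeRoot_sq : cubeRoot ^ 2 = -1 - cubeRoot := by
  have := sqrt_three_sq
  apply Complex.ext
  · simp only [sq, Complex.mul_re, cubeRoot_re, cubeRoot_im, Complex.sub_re, Complex.neg_re,
      Complex.one_re]
    linarith
  · simp only [sq, Complex.mul_im, cubeRoot_re, cubeRoot_im, Complex.sub_im, Complex.neg_im,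
      Complex.one_im]
    ring

theorem cubeRoot_pow_three : cubeRoot ^ 3 = 1 := by
  linear_combination (cubeRoot - 1) * cubeRoot_sq

theorem exp_two_pi_div_three : Complex.exp ((2 * Real.pi / 3 : ℝ) * Complex.I) = cubeRoot := by
  have h : 2 * Real.pi / 3 = Real.pi - Real.pi / 3 := by ring
  apply Complex.ext
  · rw [Complex.exp_ofReal_mul_I_re, h, Real.cos_pi_sub, Real.cos_pi_div_three, cubeRoot_re]; ring
  · rw [Complex.exp_ofReal_mul_I_im, h, Real.sin_pi_sub, Real.sin_pi_div_three, cubeRoot_im]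

/-- The powers of the third root of unity. -/
noncomputable def cubePow (k : ZMod 3) : ℂ :=
  if k = 0 then 1 else if k = 1 then cubeRoot else cubeRoot ^ 2

theorem zmod_three_cases (k : ZMod 3) : k = 0 ∨ k = 1 ∨ k = 2 := by revert k; decide

theorem zmod_three_cases' (c k : ZMod 3) : c = k ∨ c = k + 1 ∨ c = k + 2 := by revert c k; decide

theorem zmod_add_one_ne (k : ZMod 3) : k + 1 ≠ k := by revert k; decide

theorem cubePow_zero : cubePow 0 = 1 := if_pos rfl

theorem cubePow_add_one (k : ZMod 3) : cubePow (k + 1) = cubeRoot * cubePow k := by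
  rcases zmod_three_cases k with rfl | rfl | rfl
  · simp [cubePow]
  · rw [cubePow, cubePow, if_neg (by decide), if_neg (by decide), if_neg (by decide), if_pos rfl, sq]
  · rw [cubePow, cubePow, if_pos (by decide), if_neg (by decide), if_neg (by decide), ← pow_succ',
      cubeRoot_pow_three]

theorem cubePow_one : cubePow 1 = cubeRoot := by
  have := cubePow_add_one 0
  rwa [cubePow_zero, mul_one, zero_add] at this

theorem cubePow_two : cubePow 2 = cubeRoot ^ 2 := by
  have := cubePow_add_one 1
  rw [cubePow_one, ← sq] at this
  exact this

theorem exp_mul_int (m : ℤ) :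
    Complex.exp ((2 * Real.pi / 3 * m : ℝ) * Complex.I) = cubePow (m : ZMod 3) := by
  have hne : cubeRoot ≠ 0 := by
    intro h
    have := cubeRoot_pow_three
    rw [h] at this
    norm_num at this
  have hs : ∀ m : ℤ, Complex.exp ((2 * Real.pi / 3 * (m + 1 : ℤ) : ℝ) * Complex.I) =
      cubeRoot * Complex.exp ((2 * Real.pi / 3 * m : ℝ) * Complex.I) := by
    intro m
    rw [← exp_two_pi_div_three, ← Complex.exp_add]
    congr 1
    push_cast
    ring
  induction m using Int.induction_on with
  | zero => simp [cubePow_zero]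
  | succ i ih => rw [hs, ih]; push_cast; rw [cubePow_add_one]
  | pred i ih =>
    apply mul_left_cancel₀ hne
    rw [← hs, ← cubePow_add_one, sub_add_cancel, ih]
    push_cast
    rw [sub_add_cancel]

/-- Three strands on a triangle, which turns by a third at the closing braid, and two of which are
pinched at each chord. -/
noncomputable def triBlock (b : Option (ZMod 3)) (k : ZMod 3) (u : ℝ) : ℂ :=
  (cubeRoot - 1) / 3 * cubePow k * match b with
    | none => Complex.exp ((2 * Real.pi / 3 * Real.smoothTransition u : ℝ) * Complex.I)
    | some c => 1 + ((if c = k then cubeRoot - 1 else if c = k + 2 then cubeRoot ^ 2 - 1 else 0) : ℂ)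
        * pinch u

/-- The direction of the edge of the triangle from the strand `k` to the next one. -/
noncomputable def edgeDir (k : ZMod 3) : ℂ := -cubeRoot * cubePow k

/-- The factor by which a pinch deforms the edges of the triangle. -/
noncomputable def edgeFactor (c k : ZMod 3) (u : ℝ) : ℂ :=
  if c = k then 1 - 2 * pinch u else if c = k + 1 then 1 + cubeRoot * pinch u
    else 1 + cubeRoot ^ 2 * pinch u

/-- The factor `(cubeRoot - 1) / 3` in `triBlock` normalizes the triangle: `(cubeRoot - 1) ^ 2 / 3 =
-cubeRoot`, so the edges become the unit vectors `edgeDir`. -/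
theorem triBlock_sub_none (k : ZMod 3) (u : ℝ) : triBlock none (k + 1) u - triBlock none k u =
    edgeDir k * Complex.exp ((2 * Real.pi / 3 * Real.smoothTransition u : ℝ) * Complex.I) := by
  rw [triBlock, triBlock, edgeDir, cubePow_add_one]
  linear_combination (cubePow k * Complex.exp ((2 * Real.pi / 3 * Real.smoothTransition u : ℝ)
    * Complex.I)) / 3 * cubeRoot_sq

theorem triBlock_sub_some (c k : ZMod 3) (u : ℝ) :
    triBlock (some c) (k + 1) u - triBlock (some c) k u = edgeDir k * edgeFactor c k u := by
  have h1 := zmod_add_one_ne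
  have h2 : ∀ k : ZMod 3, k ≠ k + 1 := by decide
  have h3 : ∀ k : ZMod 3, k ≠ k + 2 := by decide
  have h4 : ∀ k : ZMod 3, k + 2 ≠ k := by decide
  have h5 : ∀ k : ZMod 3, k + 1 + 2 = k := by decide
  have h6 : ∀ k : ZMod 3, k + 1 ≠ k + 2 := by decide
  have h7 : ∀ k : ZMod 3, k + 2 ≠ k + 1 := by decide
  have hs := cubeRoot_sq
  have hc := cubeRoot_pow_three
  rcases zmod_three_cases' c k with rfl | rfl | rfl
  · simp only [triBlock, edgeDir, edgeFactor, cubePow_add_one, h2, h5, if_true, if_false]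
    linear_combination cubePow c / 3 * (1 - 2 * pinch u + pinch u * (cubeRoot ^ 2 - cubeRoot)) * hs - cubePow c / 3 * pinch u * hc
  · simp only [triBlock, edgeDir, edgeFactor, cubePow_add_one, h1, h6, if_true, if_false]
    linear_combination cubePow k / 3 * (1 + pinch u * cubeRoot) * hs
  · simp only [triBlock, edgeDir, edgeFactor, cubePow_add_one, h4, h7, h5, if_true, if_false]
    linear_combination cubePow k / 3 * (1 + pinch u * cubeRoot ^ 2) * hs + (1 / 3 - cubeRoot / 3) * cubePow k * pinch u * hc

theorem triBlock_isBlockSystem :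
    IsBlockSystem triBlock fun k => (cubeRoot - 1) / 3 * cubePow k := by
  refine ⟨fun b k => ?_, fun b k u hu => ?_, fun c k u hu => ?_, fun k u hu => ?_⟩
  · rcases b with _ | c
    · refine contDiff_const.mul (ContDiff.cexp (ContDiff.mul ?_ contDiff_const))
      exact Complex.ofRealCLM.contDiff.comp (contDiff_const.mul Real.smoothTransition.contDiff)
    · exact contDiff_const.mul (contDiff_const.add (contDiff_const.mul contDiff_pinch))
  · rcases b with _ | c
    · simp [triBlock, Real.smoothTransition.zero_of_nonpos hu]
    · simp [triBlock, pinch_of_nonpos hu]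
  · simp [triBlock, pinch_of_one_le hu]
  · simp only [triBlock, Real.smoothTransition.one_of_one_le hu, mul_one, exp_two_pi_div_three,
      cubePow_add_one]
    ring

/-- The angle by which the triangle is turned. -/
noncomputable def triAngle (w : List (ZMod 3)) (x : ℝ) : ℝ :=
  glue (fun j u => -(Real.pi / 3) + 2 * Real.pi / 3 * ((j / (w.length + 1 : ℕ) : ℤ) +
    if blockSym w j = none then Real.smoothTransition u else 0)) ((w.length + 1 : ℕ) * x)

section TriAngle

variable (w : List (ZMod 3))

theorem triAngle_apply (j : ℤ) {u : ℝ} (h0 : 0 ≤ u) (h1 : u < 1) :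
    triAngle w ((j + u) / (w.length + 1 : ℕ)) = -(Real.pi / 3) + 2 * Real.pi / 3 *
      ((j / (w.length + 1 : ℕ) : ℤ) + if blockSym w j = none then Real.smoothTransition u else 0) := by
  rw [triAngle, block_mul_div, glue_int_add _ _ h0 h1]

theorem triAngle_add_one (x : ℝ) : triAngle w (x + 1) = triAngle w x + 2 * Real.pi / 3 := by
  obtain ⟨j, u, h0, h1, rfl⟩ := exists_block w x
  have h : ((w.length + 1 : ℕ) : ℤ) ≠ 0 := by positivity
  rw [block_div_add_one, triAngle_apply w _ h0 h1, triAngle_apply w _ h0 h1, blockSym_add,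
    Int.add_ediv_of_dvd_right dvd_rfl, Int.ediv_self h]
  push_cast
  ring

theorem contDiff_triAngle : ContDiff ℝ ∞ (triAngle w) := by
  suffices h : ContDiff ℝ ∞ (glue fun (j : ℤ) (u : ℝ) => -(Real.pi / 3) + 2 * Real.pi / 3 *
      (((j / (w.length + 1 : ℕ) : ℤ) : ℝ) +
        if blockSym w j = none then Real.smoothTransition u else 0)) from
    h.comp (contDiff_const.mul contDiff_id)
  refine contDiff_glue (A := fun j _ => -(Real.pi / 3) + 2 * Real.pi / 3 *
    ((j / (w.length + 1 : ℕ) : ℤ) : ℝ)) (fun j => ?_) (fun _ => contDiff_const)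
    (fun j u hu => ?_) fun j u hu => ?_
  · split_ifs
    · exact contDiff_const.add (contDiff_const.mul (contDiff_const.add
        Real.smoothTransition.contDiff))
    · exact contDiff_const
  · rw [Real.smoothTransition.zero_of_nonpos hu]
    simp
  · rcases hb : blockSym w j with _ | c
    · rw [div_add_one_of_blockSym_eq_none w j hb, if_pos rfl,
        Real.smoothTransition.one_of_one_le hu]
      push_cast
      ring
    · rw [div_add_one_of_blockSym_eq_some w j hb, if_neg (by simp), add_zero]

theorem triAngle_monotone : Monotone (triAngle w) := by
  have h : ∀ x y, x ≤ y → triAngle w x ≤ triAngle w y := by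
    intro x y hxy
    obtain ⟨j, u, h0, h1, rfl⟩ := exists_block w x
    obtain ⟨j', u', h0', h1', rfl⟩ := exists_block w y
    have hN : (0 : ℝ) < ((w.length + 1 : ℕ) : ℝ) := by positivity
    have hNz : (0 : ℤ) < ((w.length + 1 : ℕ) : ℤ) := by positivity
    rw [div_le_div_iff_of_pos_right hN] at hxy
    rw [triAngle_apply w _ h0 h1, triAngle_apply w _ h0' h1']
    have hpi := Real.pi_pos
    have hle : ((j / (w.length + 1 : ℕ) : ℤ) : ℝ) +
        (if blockSym w j = none then Real.smoothTransition u else 0) ≤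
        ((j' / (w.length + 1 : ℕ) : ℤ) : ℝ) +
        (if blockSym w j' = none then Real.smoothTransition u' else 0) := by
      have hs := Real.smoothTransition.nonneg
      have hs1 := Real.smoothTransition.le_one
      rcases lt_trichotomy j j' with hj | rfl | hj
      · have h2 : (j + 1) / ((w.length + 1 : ℕ) : ℤ) ≤ j' / ((w.length + 1 : ℕ) : ℤ) :=
          Int.ediv_le_ediv hNz hj
        have h4 : (0 : ℝ) ≤ if blockSym w j' = none then Real.smoothTransition u' else 0 := by
          split_ifs
          · exact hs _
          · exact le_rfl
        rcases hb : blockSym w j with _ | c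
        · rw [div_add_one_of_blockSym_eq_none w j hb] at h2
          have h3 : ((j / ((w.length + 1 : ℕ) : ℤ) : ℤ) : ℝ) + 1 ≤
            ((j' / ((w.length + 1 : ℕ) : ℤ) : ℤ) : ℝ) := by exact_mod_cast h2
          rw [if_pos rfl]
          linarith [hs1 u]
        · rw [div_add_one_of_blockSym_eq_some w j hb] at h2
          have h3 : ((j / ((w.length + 1 : ℕ) : ℤ) : ℤ) : ℝ) ≤
            ((j' / ((w.length + 1 : ℕ) : ℤ) : ℤ) : ℝ) := by exact_mod_cast h2
          rw [if_neg (by simp)]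
          linarith
      · have := Real.smoothTransition.monotone (show u ≤ u' by linarith)
        split_ifs <;> linarith
      · exfalso
        have : (j' : ℝ) + 1 ≤ j := by exact_mod_cast hj
        linarith
    nlinarith
  exact h

end TriAngle

/-- The pinched edge touches the boundary of the half plane only at the double point. The other two
edges are disturbed by at most `1 / 2` in the real and `1 / 4` in the imaginary part of `pinch`, too
little to turn them out of the half plane. -/
theorem re_edgeFactor_pos {c k : ZMod 3} {u : ℝ} (h : c ≠ k ∨ u ≠ 1 / 2) :
    0 < (edgeFactor c k u).re := by
  have h3 : √3 ≤ 2 := by rw [Real.sqrt_le_left (by norm_num)]; norm_num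
  have h0 := Real.sqrt_nonneg 3
  have a := pinch_re_nonneg u
  have b := pinch_re_le u
  have c1 := pinch_im_le u
  have c2 := le_pinch_im u
  rw [edgeFactor]
  split_ifs with h1 h2
  · have := pinch_re_lt (h.resolve_left (not_not.2 h1))
    simp
    linarith
  · simp [cubeRoot_re, cubeRoot_im]
    nlinarith
  · rw [cubeRoot_sq]
    simp [cubeRoot_re, cubeRoot_im]
    nlinarith

theorem edgeFactor_half (c : ZMod 3) : edgeFactor c c (1 / 2) = 0 := by
  rw [edgeFactor, if_pos rfl, pinch_half]; norm_num

theorem edgeFactor_hasDerivAt_half (c : ZMod 3) :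
    ∃ r : ℝ, 0 < r ∧ HasDerivAt (edgeFactor c c) (r * Complex.I) (1 / 2) := by
  obtain ⟨r, hr, h⟩ := pinch_hasDerivAt_half
  refine ⟨2 * r, by positivity, ?_⟩
  have : edgeFactor c c = fun u => 1 - 2 * pinch u := by
    funext u; rw [edgeFactor, if_pos rfl]
  rw [this]
  refine ((h.const_mul 2).const_sub 1).congr_deriv ?_
  push_cast
  ring

theorem edgeDir_eq_exp (m : ℤ) : edgeDir (m : ZMod 3) =
    Complex.exp ((-(Real.pi / 3) + 2 * Real.pi / 3 * m : ℝ) * Complex.I) := by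
  have : Complex.exp ((-(Real.pi / 3) : ℝ) * Complex.I) = -cubeRoot := by
    apply Complex.ext
    · rw [Complex.exp_ofReal_mul_I_re, Real.cos_neg, Real.cos_pi_div_three, Complex.neg_re,
        cubeRoot_re]; norm_num
    · rw [Complex.exp_ofReal_mul_I_im, Real.sin_neg, Real.sin_pi_div_three, Complex.neg_im,
        cubeRoot_im]
  rw [edgeDir, ← exp_mul_int, ← this, ← Complex.exp_add]
  congr 1
  push_cast
  ring

theorem edgeDir_ne_zero (k : ZMod 3) : edgeDir k ≠ 0 := by
  obtain ⟨m, rfl⟩ := ZMod.intCast_surjective k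
  rw [edgeDir_eq_exp]
  exact Complex.exp_ne_zero _

/-- The triangular closed braid of a word. -/
noncomputable def triCurve (w : List (ZMod 3)) : ℝ → ℂ := strandCurve triBlock w

section TriCurve

variable (w : List (ZMod 3))

theorem triCurve_eq_iff (j : ℤ) {u : ℝ} (h0 : 0 ≤ u) (h1 : u < 1) :
    triCurve w ((j + u) / (w.length + 1 : ℕ) + 1) = triCurve w ((j + u) / (w.length + 1 : ℕ)) ↔
      blockSym w j = some (blockStrand w j) ∧ u = 1 / 2 := by
  rw [triCurve, strandCurve_apply_add_one w j h0 h1, strandCurve_apply w j h0 h1, ← sub_eq_zero]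
  rcases hb : blockSym w j with _ | c
  · rw [triBlock_sub_none]
    simp [edgeDir_ne_zero, Complex.exp_ne_zero]
  · rw [triBlock_sub_some]
    simp only [mul_eq_zero, edgeDir_ne_zero, false_or, Option.some.injEq]
    constructor
    · intro h
      by_contra h'
      have := re_edgeFactor_pos (c := c) (k := blockStrand w j) (u := u) (by tauto)
      rw [h] at this
      simp at this
    · rintro ⟨rfl, rfl⟩
      exact edgeFactor_half _

/-- Rotated back by `triAngle`, a difference becomes 1 during the closing braid and `edgeFactor`
during a chord; at a double point the derivative of `edgeFactor` is a positive multiple of `I`. -/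
theorem triCurve_aligned : Aligned (triAngle w) (triCurve w) := by
  have hexp : ∀ (j : ℤ), Complex.exp ((-(-(Real.pi / 3) + 2 * Real.pi / 3 *
      ((j / (w.length + 1 : ℕ) : ℤ) : ℝ)) : ℝ) * Complex.I) * edgeDir (blockStrand w j) = 1 := by
    intro j
    rw [blockStrand, edgeDir_eq_exp, ← Complex.exp_add, ← add_mul, ← Complex.ofReal_add,
      neg_add_cancel]
    simp
  refine ⟨fun x hx => ?_, fun x hx => ?_⟩
  · obtain ⟨j, u, h0, h1, rfl⟩ := exists_block w x
    rw [ne_eq, triCurve_eq_iff w j h0 h1] at hx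
    rw [triAngle_apply w j h0 h1, triCurve, strandCurve_apply_add_one w j h0 h1,
      strandCurve_apply w j h0 h1]
    rcases hb : blockSym w j with _ | c
    · rw [triBlock_sub_none, blockStrand, edgeDir_eq_exp, ← Complex.exp_add, ← Complex.exp_add,
        if_pos rfl]
      have : ∀ a b c d : ℝ, ((-(a + b * (c + d)) : ℝ) : ℂ) * Complex.I +
          (((a + b * c : ℝ) : ℂ) * Complex.I + ((b * d : ℝ) : ℂ) * Complex.I) = 0 := by
        intro a b c d; push_cast; ring
      rw [this]
      simp
    · rw [triBlock_sub_some, if_neg (by simp), add_zero, ← mul_assoc, hexp, one_mul]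
      apply re_edgeFactor_pos
      rw [hb] at hx
      simp only [Option.some.injEq] at hx
      tauto
  · obtain ⟨j, u, h0, h1, rfl⟩ := exists_block w x
    rw [triCurve_eq_iff w j h0 h1] at hx
    obtain ⟨hb, rfl⟩ := hx
    have hN : (0 : ℝ) < ((w.length + 1 : ℕ) : ℝ) := by positivity
    rw [triAngle_apply w j h0 h1, triCurve, strandCurve_deriv_add_one w j (by norm_num) h1,
      strandCurve_deriv w j (by norm_num) h1, hb, if_neg (by simp), add_zero, ← mul_sub]
    have hs := triBlock_isBlockSystem.smooth
    rw [← deriv_fun_sub ((hs _ _).differentiable (by simp) _) ((hs _ _).differentiable (by simp) _)]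
    obtain ⟨r, hr, hd⟩ := edgeFactor_hasDerivAt_half (blockStrand w j)
    have : (fun u => triBlock (some (blockStrand w j)) (blockStrand w j + 1) u -
        triBlock (some (blockStrand w j)) (blockStrand w j) u) =
        fun u => edgeDir (blockStrand w j) * edgeFactor (blockStrand w j) (blockStrand w j) u := by
      funext u; rw [triBlock_sub_some]
    rw [this, (hd.const_mul _).deriv, mul_left_comm, ← mul_assoc _ (edgeDir _), hexp, one_mul]
    have : (((w.length + 1 : ℕ) : ℂ) * (r * Complex.I)).im = ((w.length + 1 : ℕ) : ℝ) * r := by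
      simp [Complex.mul_im]
    rw [this]
    positivity

theorem triCurve_isBraidLoop : IsBraidLoop (triCurve w) where
  smooth := triBlock_isBlockSystem.contDiff w
  add_three := strandCurve_add_three w
  finite := by
    refine ((Set.finite_Icc (0 : ℤ) (3 * (w.length + 1 : ℕ))).image
      fun j : ℤ => ((j : ℝ) + 1 / 2) / (w.length + 1 : ℕ)).subset ?_
    rintro x ⟨hx, e⟩
    obtain ⟨j, u, h0, h1, rfl⟩ := exists_block w x
    rw [triCurve_eq_iff w j h0 h1] at e
    obtain ⟨hb, rfl⟩ := e
    refine ⟨j, ?_, rfl⟩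
    have hN : (0 : ℝ) < ((w.length + 1 : ℕ) : ℝ) := by positivity
    have h2 := hx.1
    have h3 := hx.2
    rw [le_div_iff₀ hN] at h2
    rw [div_lt_iff₀ hN] at h3
    constructor
    · have : (-1 : ℝ) < j := by linarith
      have : -1 < j := by exact_mod_cast this
      omega
    · have : (j : ℝ) < 3 * (w.length + 1 : ℕ) := by linarith
      have : j < 3 * (w.length + 1 : ℕ) := by exact_mod_cast this
      omega
  no_triple x e := by
    obtain ⟨j, u, h0, h1, rfl⟩ := exists_block w x
    rw [triCurve_eq_iff w j h0 h1] at e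
    rw [block_div_add_one, ne_eq, triCurve_eq_iff w _ h0 h1, blockSym_add, blockStrand_add, e.1]
    rintro ⟨h, -⟩
    exact zmod_add_one_ne _ (Option.some.inj h).symm
  transverse x e h := by
    have := (triCurve_aligned w).im_pos x e
    rw [h] at this
    simp at this

end TriCurve

/-! ### Collinear blocks -/

theorem IsBlockSystem.deriv_sub {blk : Option (ZMod 3) → ZMod 3 → ℝ → ℂ} {pos : ZMod 3 → ℂ}
    (h : IsBlockSystem blk pos) {b : Option (ZMod 3)} {k l : ZMod 3} {u : ℝ} {f : ℝ → ℂ} {d : ℂ}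
    (hf : ∀ u, blk b l u - blk b k u = f u) (hd : HasDerivAt f d u) :
    deriv (blk b l) u - deriv (blk b k) u = d := by
  rw [← deriv_fun_sub ((h.smooth _ _).differentiable (by simp) _)
    ((h.smooth _ _).differentiable (by simp) _), funext hf, hd.deriv]

/-- The arc from `0` to `1` at the side of negative imaginary part. -/
noncomputable def arc (g : ℝ) : ℂ := ⟨g, -(g * (1 - g))⟩

/-- The mirror image of `arc`. -/
noncomputable def arcConj (g : ℝ) : ℂ := ⟨g, g * (1 - g)⟩

theorem arc_zero : arc 0 = 0 := by apply Complex.ext <;> simp [arc]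
theorem arc_one : arc 1 = 1 := by apply Complex.ext <;> simp [arc]
theorem arcConj_zero : arcConj 0 = 0 := by apply Complex.ext <;> simp [arcConj]
theorem arcConj_one : arcConj 1 = 1 := by apply Complex.ext <;> simp [arcConj]

theorem arc_eq (g : ℝ) : arc g = g - g * (1 - g) * Complex.I := by
  apply Complex.ext <;> simp [arc]

theorem arcConj_eq (g : ℝ) : arcConj g = g + g * (1 - g) * Complex.I := by
  apply Complex.ext <;> simp [arcConj]

theorem contDiff_arc : ContDiff ℝ ∞ arc := by
  rw [funext arc_eq]
  have h : ContDiff ℝ ∞ fun g : ℝ => (g : ℂ) := Complex.ofRealCLM.contDiff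
  exact h.sub ((h.mul (contDiff_const.sub h)).mul contDiff_const)

theorem contDiff_arcConj : ContDiff ℝ ∞ arcConj := by
  rw [funext arcConj_eq]
  have h : ContDiff ℝ ∞ fun g : ℝ => (g : ℂ) := Complex.ofRealCLM.contDiff
  exact h.add ((h.mul (contDiff_const.sub h)).mul contDiff_const)

/-- The strands of the collinear blocks; at both ends they are at the points `0, 1, 2`. -/
noncomputable def linBlock (b : Option (ZMod 3)) (k : ZMod 3) (u : ℝ) : ℂ :=
  match b with
  | none =>
    if k = 0 then arc (Real.smoothTransition (2 * u - 1))
    else if k = 1 then 1 + arc (Real.smoothTransition (2 * u))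
    else 2 - arc (Real.smoothTransition (2 * u)) - arc (Real.smoothTransition (2 * u - 1))
  | some c =>
    if c = 0 then if k = 0 then pinch u else if k = 1 then 1 - pinch u else 2
    else if c = 1 then if k = 0 then 0 else if k = 1 then 1 + pinch u else 2 - pinch u
    else if k = 0 then pinch (2 * u - 1 / 2)
      else if k = 1 then 1 + arc (Real.smoothTransition (4 * u))
        - arcConj (Real.smoothTransition (4 * u - 3))
      else 2 - arc (Real.smoothTransition (4 * u)) - pinch (2 * u - 1 / 2)
        + arcConj (Real.smoothTransition (4 * u - 3))

/-- The points of the real line at which the strands of the collinear blocks start. -/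
noncomputable def linPos (k : ZMod 3) : ℂ := if k = 0 then 0 else if k = 1 then 1 else 2

/-- These blocks mediate between triangles and letters: the strands stand at `0, 1, 2` and cross as
the letters do, while the double point is still formed by a circular pinch. -/
theorem linBlock_isBlockSystem : IsBlockSystem linBlock linPos := by
  have hS : ∀ a b : ℝ, ContDiff ℝ ∞ fun u => Real.smoothTransition (a * u - b) := fun a b =>
    Real.smoothTransition.contDiff.comp ((contDiff_const.mul contDiff_id).sub contDiff_const)
  have hS' : ∀ a : ℝ, ContDiff ℝ ∞ fun u => Real.smoothTransition (a * u) := fun a =>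
    Real.smoothTransition.contDiff.comp (contDiff_const.mul contDiff_id)
  have hp := contDiff_pinch
  have hp' : ContDiff ℝ ∞ fun u => pinch (2 * u - 1 / 2) :=
    contDiff_pinch.comp ((contDiff_const.mul contDiff_id).sub contDiff_const)
  refine ⟨fun b k => ?_, fun b k u hu => ?_, fun c k u hu => ?_, fun k u hu => ?_⟩
  · have a1 := contDiff_arc.comp (hS 2 1)
    have a2 := contDiff_arc.comp (hS' 2)
    have a3 := contDiff_arc.comp (hS' 4)
    have a4 := contDiff_arcConj.comp (hS 4 3)
    simp only [Function.comp_def] at a1 a2 a3 a4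
    unfold linBlock
    rcases b with _ | c
    · dsimp only
      split_ifs
      · exact a1
      · exact contDiff_const.add a2
      · exact (contDiff_const.sub a2).sub a1
    · dsimp only
      split_ifs
      · exact hp
      · exact contDiff_const.sub hp
      · exact contDiff_const
      · exact contDiff_const
      · exact contDiff_const.add hp
      · exact contDiff_const.sub hp
      · exact hp'
      · exact (contDiff_const.add a3).sub a4
      · exact ((contDiff_const.sub a3).sub hp').add a4
  · have e1 : Real.smoothTransition (2 * u - 1) = 0 :=
      Real.smoothTransition.zero_of_nonpos (by linarith)
    have e2 : Real.smoothTransition (2 * u) = 0 :=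
      Real.smoothTransition.zero_of_nonpos (by linarith)
    have e3 : Real.smoothTransition (4 * u) = 0 :=
      Real.smoothTransition.zero_of_nonpos (by linarith)
    have e4 : Real.smoothTransition (4 * u - 3) = 0 :=
      Real.smoothTransition.zero_of_nonpos (by linarith)
    have e5 : pinch u = 0 := pinch_of_nonpos hu
    have e6 : pinch (2 * u - 1 / 2) = 0 := pinch_of_nonpos (by linarith)
    rcases b with _ | c
    · simp only [linBlock, linPos, e1, e2, arc_zero, add_zero, sub_zero]
    · simp only [linBlock, linPos, e3, e4, e5, e6, arc_zero, arcConj_zero, add_zero, sub_zero,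
        ite_self]
  · have e3 : Real.smoothTransition (4 * u) = 1 :=
      Real.smoothTransition.one_of_one_le (by linarith)
    have e4 : Real.smoothTransition (4 * u - 3) = 1 :=
      Real.smoothTransition.one_of_one_le (by linarith)
    have e5 : pinch u = 0 := pinch_of_one_le hu
    have e6 : pinch (2 * u - 1 / 2) = 0 := pinch_of_one_le (by linarith)
    simp only [linBlock, linPos, e3, e4, e5, e6, arc_one, arcConj_one, add_zero, sub_zero,
        ite_self, add_sub_cancel_right, sub_add_cancel]
  · have e1 : Real.smoothTransition (2 * u - 1) = 1 :=
      Real.smoothTransition.one_of_one_le (by linarith)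
    have e2 : Real.smoothTransition (2 * u) = 1 :=
      Real.smoothTransition.one_of_one_le (by linarith)
    simp only [linBlock, linPos, e1, e2, arc_one]
    rcases zmod_three_cases k with rfl | rfl | rfl
    · simp
    · have : (1 : ZMod 3) + 1 ≠ 0 ∧ (1 : ZMod 3) + 1 ≠ 1 := by decide
      simp [this]; norm_num
    · have : (2 : ZMod 3) + 1 = 0 ∧ (2 : ZMod 3) ≠ 0 ∧ (2 : ZMod 3) ≠ 1 := by decide
      simp [this]; norm_num

/-- A segment between two points of a common open half plane, after a rotation. -/
theorem segmentAvoidsZero_mul_left {a b d : ℂ} (ha : 0 < a.re) (hb : 0 < b.re) (hd : d ≠ 0) :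
    SegmentAvoidsZero (a * d) (b * d) := by
  rw [mul_comm a, mul_comm b]
  exact (segmentAvoidsZero_of_re ha hb).mul hd

theorem one_sub_two_pinch_ne_zero {u : ℝ} (h : u ≠ 1 / 2) : 1 - 2 * pinch u ≠ 0 := by
  intro h0
  have := congrArg Complex.re h0
  have := pinch_re_lt h
  simp at *
  linarith

theorem one_sub_two_pinch_hasDerivAt : ∃ r : ℝ, 0 < r ∧
    HasDerivAt (fun u => 1 - 2 * pinch u) (r * Complex.I) (1 / 2) := by
  obtain ⟨r, hr, h⟩ := edgeFactor_hasDerivAt_half 0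
  have : edgeFactor 0 0 = fun u => 1 - 2 * pinch u := by
    funext u; rw [edgeFactor, if_pos rfl]
  exact ⟨r, hr, this ▸ h⟩

theorem sqrt_three_lt_two : √3 < 2 := by
  rw [Real.sqrt_lt' (by norm_num)]; norm_num

theorem sqrt_three_gt : 17 / 10 < √3 := by
  rw [Real.lt_sqrt (by norm_num)]; norm_num

theorem neg_cubeRoot_re_pos : 0 < (-cubeRoot).re := by rw [Complex.neg_re, cubeRoot_re]; norm_num

theorem neg_cubeRoot_sq_re_pos : 0 < (-cubeRoot ^ 2).re := by
  rw [cubeRoot_sq]; simp [cubeRoot_re]; norm_num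

theorem edgeDir_zero : edgeDir 0 = -cubeRoot := by rw [edgeDir, cubePow_zero, mul_one]
theorem edgeDir_one : edgeDir 1 = -cubeRoot ^ 2 := by rw [edgeDir, cubePow_one]; ring
theorem edgeDir_two : edgeDir 2 = -1 := by
  rw [edgeDir, cubePow_two]; linear_combination -cubeRoot_pow_three

/-! ### Comparison of triangular and collinear blocks -/

/-- The edges of the triangular and of the collinear blocks can be deformed into each other. -/
def BlockCondition (blk blk' : Option (ZMod 3) → ZMod 3 → ℝ → ℂ) (b : Option (ZMod 3)) (k : ZMod 3)
    (u : ℝ) : Prop :=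
  SegmentAvoidsZero (blk b (k + 1) u - blk b k u) (blk' b (k + 1) u - blk' b k u) ∨
      (0 < u ∧ blk b (k + 1) u = blk b k u ∧ blk' b (k + 1) u = blk' b k u ∧
        SegmentAvoidsZero (deriv (blk b (k + 1)) u - deriv (blk b k) u)
          (deriv (blk' b (k + 1)) u - deriv (blk' b k) u))

/-- The pinched edge carries the same factor `1 - 2 * pinch u` in both systems, once times
`-cubeRoot` and once times 1, two numbers with positive real part. For each other edge the two
versions lie in one half plane, the right one for the edge of index 1 and the left one for the edge
of index 2. -/
theorem triBlock_linBlock_zero (k : ZMod 3) (u : ℝ) :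
    BlockCondition triBlock linBlock (some 0) k u := by
  have s1 := sqrt_three_lt_two
  have s2 := sqrt_three_gt
  have a := pinch_re_nonneg u
  have b := pinch_re_le u
  have c1 := pinch_im_le u
  have c2 := le_pinch_im u
  have n1 : (2 : ZMod 3) ≠ 0 := by decide
  have n2 : (2 : ZMod 3) ≠ 1 := by decide
  have n3 : (0 : ZMod 3) = 2 + 1 := by decide
  have n4 : (0 : ZMod 3) ≠ 1 + 1 := by decide
  have n5 : (2 : ZMod 3) = 1 + 1 := by decide
  rcases zmod_three_cases k with rfl | rfl | rfl
  · have h1 : ∀ u, triBlock (some 0) (0 + 1) u - triBlock (some 0) 0 u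
        = -cubeRoot * (1 - 2 * pinch u) := by
      intro u
      rw [triBlock_sub_some, edgeDir_zero, edgeFactor, if_pos rfl]
    have h2 : ∀ u, linBlock (some 0) (0 + 1) u - linBlock (some 0) 0 u = 1 * (1 - 2 * pinch u) := by
      intro u
      simp [linBlock]; ring
    by_cases hu : u = 1 / 2
    · obtain ⟨r, hr, hd⟩ := one_sub_two_pinch_hasDerivAt
      subst hu
      refine Or.inr ⟨by norm_num, sub_eq_zero.1 ?_, sub_eq_zero.1 ?_, ?_⟩
      · rw [h1, pinch_half]; norm_num
      · rw [h2, pinch_half]; norm_num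
      · rw [triBlock_isBlockSystem.deriv_sub h1 (hd.const_mul _),
          linBlock_isBlockSystem.deriv_sub h2 (hd.const_mul _)]
        exact segmentAvoidsZero_mul_left neg_cubeRoot_re_pos (by simp)
          (by simp [hr.ne'])
    · left
      rw [h1, h2]
      exact segmentAvoidsZero_mul_left neg_cubeRoot_re_pos (by simp) (one_sub_two_pinch_ne_zero hu)
  · left
    rw [triBlock_sub_some, edgeDir_one, edgeFactor, if_neg (by decide), if_neg (by decide)]
    have h2 : linBlock (some 0) (1 + 1) u - linBlock (some 0) 1 u = 1 + pinch u := by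
      rw [← n5]
      simp [linBlock, n1, n2]; ring
    rw [h2, show -cubeRoot ^ 2 * (1 + cubeRoot ^ 2 * pinch u) = 1 + cubeRoot - cubeRoot * pinch u by
      linear_combination -cubeRoot_sq - cubeRoot * pinch u * cubeRoot_pow_three]
    apply segmentAvoidsZero_of_re
    · simp [cubeRoot_re, cubeRoot_im]; nlinarith
    · simp; linarith
  · left
    rw [triBlock_sub_some, edgeDir_two, edgeFactor, if_neg (by decide), if_pos n3]
    have h2 : linBlock (some 0) (2 + 1) u - linBlock (some 0) 2 u = pinch u - 2 := by
      rw [← n3]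
      simp [linBlock, n1, n2]
    rw [h2]
    apply segmentAvoidsZero_of_halfPlane (-1) 0
    · simp [cubeRoot_re, cubeRoot_im]; nlinarith
    · simp; linarith
    · intro h
      have := congrArg Complex.re h
      simp [cubeRoot_re, cubeRoot_im] at this; nlinarith

theorem triBlock_linBlock_one (k : ZMod 3) (u : ℝ) :
    BlockCondition triBlock linBlock (some 1) k u := by
  have s1 := sqrt_three_lt_two
  have s2 := sqrt_three_gt
  have a := pinch_re_nonneg u
  have b := pinch_re_le u
  have c1 := pinch_im_le u
  have c2 := le_pinch_im u
  have n1 : (2 : ZMod 3) ≠ 0 := by decide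
  have n2 : (2 : ZMod 3) ≠ 1 := by decide
  have n3 : (2 : ZMod 3) + 1 = 0 := by decide
  have n5 : (2 : ZMod 3) = 1 + 1 := by decide
  rcases zmod_three_cases k with rfl | rfl | rfl
  · left
    rw [triBlock_sub_some, edgeDir_zero, edgeFactor, if_neg (by decide), if_pos (by decide)]
    have h2 : linBlock (some 1) (0 + 1) u - linBlock (some 1) 0 u = 1 + pinch u := by
      simp [linBlock]
    rw [h2]
    rw [show -cubeRoot * (1 + cubeRoot * pinch u) = -cubeRoot + (1 + cubeRoot) * pinch u by
      linear_combination - pinch u * cubeRoot_sq]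
    apply segmentAvoidsZero_of_re
    · simp [cubeRoot_re, cubeRoot_im]; nlinarith
    · simp; linarith
  · have h1 : ∀ u, triBlock (some 1) (1 + 1) u - triBlock (some 1) 1 u
        = -cubeRoot ^ 2 * (1 - 2 * pinch u) := by
      intro u
      rw [triBlock_sub_some, edgeDir_one, edgeFactor, if_pos rfl]
    have h2 : ∀ u, linBlock (some 1) (1 + 1) u - linBlock (some 1) 1 u = 1 * (1 - 2 * pinch u) := by
      intro u
      rw [← n5]
      simp [linBlock, n1, n2]; ring
    by_cases hu : u = 1 / 2
    · obtain ⟨r, hr, hd⟩ := one_sub_two_pinch_hasDerivAt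
      subst hu
      refine Or.inr ⟨by norm_num, sub_eq_zero.1 ?_, sub_eq_zero.1 ?_, ?_⟩
      · rw [h1, pinch_half]; norm_num
      · rw [h2, pinch_half]; norm_num
      · rw [triBlock_isBlockSystem.deriv_sub h1 (hd.const_mul _),
          linBlock_isBlockSystem.deriv_sub h2 (hd.const_mul _)]
        exact segmentAvoidsZero_mul_left neg_cubeRoot_sq_re_pos (by simp)
          (by simp [hr.ne'])
    · left
      rw [h1, h2]
      exact segmentAvoidsZero_mul_left neg_cubeRoot_sq_re_pos (by simp)
        (one_sub_two_pinch_ne_zero hu)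
  · left
    rw [triBlock_sub_some, edgeDir_two, edgeFactor, if_neg (by decide), if_neg (by decide)]
    have h2 : linBlock (some 1) (2 + 1) u - linBlock (some 1) 2 u = pinch u - 2 := by
      rw [n3]
      simp [linBlock, n1, n2]
    rw [h2, show -1 * (1 + cubeRoot ^ 2 * pinch u) = -1 + (1 + cubeRoot) * pinch u by
      linear_combination - pinch u * cubeRoot_sq]
    apply segmentAvoidsZero_of_halfPlane (-1) 0
    · simp [cubeRoot_re, cubeRoot_im]; nlinarith
    · simp; linarith
    · intro h
      have := congrArg Complex.re h
      simp [cubeRoot_re, cubeRoot_im] at this; nlinarith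

theorem smoothTransition_mem (u : ℝ) :
    0 ≤ Real.smoothTransition u ∧ Real.smoothTransition u ≤ 1 :=
  ⟨Real.smoothTransition.nonneg u, Real.smoothTransition.le_one u⟩

theorem linBlock_two_sub (u : ℝ) : linBlock (some 2) (2 + 1) u - linBlock (some 2) 2 u =
    -2 + arc (Real.smoothTransition (4 * u)) - arcConj (Real.smoothTransition (4 * u - 3))
      + 2 * pinch (2 * u - 1 / 2) := by
  have n1 : (2 : ZMod 3) ≠ 0 := by decide
  have n2 : (2 : ZMod 3) ≠ 1 := by decide
  rw [show (2 : ZMod 3) + 1 = 0 by decide]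
  simp [linBlock, n1, n2]; ring

theorem linBlock_two_eventuallyEq :
    (fun u => linBlock (some 2) (2 + 1) u - linBlock (some 2) 2 u) =ᶠ[nhds (1 / 2)]
      fun u : ℝ => -1 * (1 - 2 * pinch (2 * u - 1 / 2)) := by
  filter_upwards [Ioo_mem_nhds (show (1 / 4 : ℝ) < 1 / 2 by norm_num)
    (show (1 / 2 : ℝ) < 3 / 4 by norm_num)] with u hu
  rw [linBlock_two_sub, Real.smoothTransition.one_of_one_le (by linarith [hu.1]),
    Real.smoothTransition.zero_of_nonpos (by linarith [hu.2]), arc_one, arcConj_zero]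
  ring

theorem linBlock_hasDerivAt_two : ∃ r : ℝ, 0 < r ∧
    HasDerivAt (fun u => linBlock (some 2) (2 + 1) u - linBlock (some 2) 2 u) (-(r * Complex.I))
      (1 / 2) := by
  obtain ⟨r, hr, hd⟩ := one_sub_two_pinch_hasDerivAt
  refine ⟨2 * r, by positivity, HasDerivAt.congr_of_eventuallyEq ?_ linBlock_two_eventuallyEq⟩
  have h0 : HasDerivAt (fun u : ℝ => 2 * u - 1 / 2) 2 (1 / 2) := by
    simpa using ((hasDerivAt_id (1 / 2 : ℝ)).const_mul 2).sub_const (1 / 2)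
  have hd1 : HasDerivAt (fun u => 1 - 2 * pinch u) (r * Complex.I) (2 * (1 / 2) - 1 / 2) := by
    norm_num; convert hd using 1
  refine ((HasDerivAt.scomp (h := fun u : ℝ => 2 * u - 1 / 2) (1 / 2 : ℝ) hd1 h0).const_mul
    (-1)).congr_deriv ?_
  simp only [Complex.real_smul]
  push_cast
  ring

/-- The collinear block of the chord of tail 2 has three stages: in the first quarter the strands 1
and 2 cross, in the middle half the pinch takes place, in the last quarter they cross back. The
double points are simultaneous because `2 * u - 1 / 2` fixes `1 / 2`. The half planes are chosen
stage by stage where no single one serves. -/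
theorem triBlock_linBlock_two (k : ZMod 3) (u : ℝ) :
    BlockCondition triBlock linBlock (some 2) k u := by
  have s1 := sqrt_three_lt_two
  have s2 := sqrt_three_gt
  have a := pinch_re_nonneg u
  have b := pinch_re_le u
  have c1 := pinch_im_le u
  have c2 := le_pinch_im u
  have a' := pinch_re_nonneg (2 * u - 1 / 2)
  have b' := pinch_re_le (2 * u - 1 / 2)
  have c1' := pinch_im_le (2 * u - 1 / 2)
  have c2' := le_pinch_im (2 * u - 1 / 2)
  have n1 : (2 : ZMod 3) ≠ 0 := by decide
  have n2 : (2 : ZMod 3) ≠ 1 := by decide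
  have n3 : (2 : ZMod 3) + 1 = 0 := by decide
  have n5 : (2 : ZMod 3) = 1 + 1 := by decide
  obtain ⟨g0, g1⟩ := smoothTransition_mem (4 * u)
  obtain ⟨g0', g1'⟩ := smoothTransition_mem (4 * u - 3)
  have hm := Real.smoothTransition.zero_of_nonpos (x := 4 * u - 3)
  have hm' := Real.smoothTransition.one_of_one_le (x := 4 * u)
  have hq := pinch_of_nonpos (u := 2 * u - 1 / 2)
  have hq' := pinch_of_one_le (u := 2 * u - 1 / 2)
  rcases zmod_three_cases k with rfl | rfl | rfl
  · left
    rw [triBlock_sub_some, edgeDir_zero, edgeFactor, if_neg (by decide), if_neg (by decide)]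
    have h2 : linBlock (some 2) (0 + 1) u - linBlock (some 2) 0 u =
        1 + arc (Real.smoothTransition (4 * u)) - arcConj (Real.smoothTransition (4 * u - 3))
          - pinch (2 * u - 1 / 2) := by
      simp [linBlock, n1, n2]
    rw [h2, show -cubeRoot * (1 + cubeRoot ^ 2 * pinch u) = -cubeRoot - pinch u by
      linear_combination - pinch u * cubeRoot_pow_three]
    apply segmentAvoidsZero_of_halfPlane 1 0
    · simp [cubeRoot_re]; linarith
    · simp [arc, arcConj]
      by_cases h : 4 * u - 3 ≤ 0
      · rw [hm h]; linarith
      · rw [hm' (by linarith)]; linarith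
    · intro h
      have := congrArg Complex.im h
      simp [cubeRoot_im] at this
      linarith
  · left
    rw [triBlock_sub_some, edgeDir_one, edgeFactor, if_neg (by decide), if_pos (by decide)]
    have h2 : linBlock (some 2) (1 + 1) u - linBlock (some 2) 1 u =
        1 - 2 * arc (Real.smoothTransition (4 * u))
          + 2 * arcConj (Real.smoothTransition (4 * u - 3)) - pinch (2 * u - 1 / 2) := by
      rw [← n5]
      simp [linBlock, n1, n2]; ring
    rw [h2, show -cubeRoot ^ 2 * (1 + cubeRoot * pinch u) = 1 + cubeRoot - pinch u by
      linear_combination - pinch u * cubeRoot_pow_three - cubeRoot_sq]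
    by_cases hu : 2 * u - 1 / 2 ≤ 0
    · rw [hq hu, hm (by linarith), arcConj_zero]
      apply SegmentAvoidsZero.symm
      apply segmentAvoidsZero_of_halfPlane 0 1
      · simp [arc]; nlinarith
      · simp [cubeRoot_im]; linarith
      · intro h
        generalize Real.smoothTransition (4 * u) = g at h
        have h1 := congrArg Complex.re h
        have h2 := congrArg Complex.im h
        simp [arc] at h1 h2
        rcases h2 with h2 | h2 <;> linarith
    by_cases hu' : 1 ≤ 2 * u - 1 / 2
    · rw [hq' hu', hm' (by linarith), arc_one]
      apply SegmentAvoidsZero.symm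
      apply segmentAvoidsZero_of_halfPlane 0 1
      · simp [arcConj]; nlinarith
      · simp [cubeRoot_im]; linarith
      · intro h
        generalize Real.smoothTransition (4 * u - 3) = g at h
        have h1 := congrArg Complex.re h
        have h2 := congrArg Complex.im h
        simp [arcConj] at h1 h2
        rcases h2 with h2 | h2 <;> linarith
    · rw [hm (by linarith), hm' (by linarith), arc_one, arcConj_zero]
      -- Here the edge of the triangle points upwards, perhaps to the right, and the collinear one
      -- to the left; a diagonal half plane contains both.
      apply segmentAvoidsZero_of_halfPlane (-1) 1
      · simp [cubeRoot_re, cubeRoot_im]; linarith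
      · simp; linarith
      · intro h
        have h1 := congrArg Complex.im h
        simp [cubeRoot_im] at h1
        linarith
  · have h1 : ∀ u, triBlock (some 2) (2 + 1) u - triBlock (some 2) 2 u
        = -1 * (1 - 2 * pinch u) := by
      intro u
      rw [triBlock_sub_some, edgeDir_two, edgeFactor, if_pos rfl]
    have h2 := linBlock_two_sub
    by_cases hu : u = 1 / 2
    · obtain ⟨r, hr, hd⟩ := one_sub_two_pinch_hasDerivAt
      subst hu
      obtain ⟨r', hr', hd'⟩ := linBlock_hasDerivAt_two
      refine Or.inr ⟨by norm_num, sub_eq_zero.1 ?_, sub_eq_zero.1 ?_, ?_⟩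
      · rw [h1, pinch_half]; norm_num
      · refine linBlock_two_eventuallyEq.eq_of_nhds.trans ?_
        norm_num [show (2⁻¹ : ℝ) = 1 / 2 by norm_num, pinch_half]
      · rw [triBlock_isBlockSystem.deriv_sub h1 (hd.const_mul _),
          linBlock_isBlockSystem.deriv_sub (fun _ => rfl) hd']
        apply segmentAvoidsZero_of_halfPlane 0 (-1) <;> simp [hr', hr.le, hr.ne']
    · left
      rw [h1, h2]
      apply SegmentAvoidsZero.symm
      have e := pinch_re_lt hu
      have e' := pinch_re_lt (u := 2 * u - 1 / 2) (by intro h; apply hu; linarith)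
      apply segmentAvoidsZero_of_halfPlane (-1) 0
      · simp [arc, arcConj, -one_div]
        by_cases h : 2 * u - 1 / 2 ≤ 0
        · rw [hq h]; simp; linarith
        by_cases h' : 4 * u - 3 ≤ 0
        · rw [hm h']; linarith
        · rw [hq' (by linarith)]; simp; linarith
      · simp; linarith
      · intro h
        have h1 := congrArg Complex.re h
        simp [arc, arcConj, -one_div] at h1
        by_cases h : 2 * u - 1 / 2 ≤ 0
        · rw [hq h, hm (by linarith)] at h1; simp at h1; linarith
        by_cases h' : 4 * u - 3 ≤ 0
        · rw [hm h'] at h1; linarith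
        · rw [hq' (by linarith), hm' (by linarith)] at h1; simp at h1
          linarith [Real.smoothTransition.nonneg (4 * u - 3)]

/-- While the triangle turns, the edges sweep the angles from `-π/3` to `π/3`, from `π/3` to `π`,
and from `π` to `5π/3`. Up to the middle of the block they lie in the right, upper and left half
planes, afterwards in the right, left and lower ones. The two successive crossings of the collinear
strands follow the same pattern, the middle of the turn being at `u = 1 / 2` on both sides. -/
theorem triBlock_linBlock_none (k : ZMod 3) {u : ℝ} (hu0 : 0 ≤ u) (hu1 : u < 1) :
    BlockCondition triBlock linBlock none k u := by
  have n1 : (2 : ZMod 3) ≠ 0 := by decide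
  have n2 : (2 : ZMod 3) ≠ 1 := by decide
  have n3 : (2 : ZMod 3) + 1 = 0 := by decide
  have n5 : (2 : ZMod 3) = 1 + 1 := by decide
  have hpi := Real.pi_pos
  obtain ⟨σ0, σ1⟩ := smoothTransition_mem u
  obtain ⟨g0, g1⟩ := smoothTransition_mem (2 * u)
  obtain ⟨g0', g1'⟩ := smoothTransition_mem (2 * u - 1)
  have hm := Real.smoothTransition.zero_of_nonpos (x := 2 * u - 1)
  have hm' := Real.smoothTransition.one_of_one_le (x := 2 * u)
  have hlt : u < 1 / 2 → Real.smoothTransition u < 1 / 2 := fun h => by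
    rw [← smoothTransition_half]
    exact smoothTransition_strictMonoOn ⟨hu0, hu1.le⟩ ⟨by norm_num, by norm_num⟩ h
  have hle : 1 / 2 ≤ u → 1 / 2 ≤ Real.smoothTransition u := fun h => by
    rw [← smoothTransition_half]
    exact smoothTransition_strictMonoOn.monotoneOn ⟨by norm_num, by norm_num⟩ ⟨hu0, hu1.le⟩ h
  have hT : ∀ m : ℕ, triBlock none ((m : ℕ) + 1) u - triBlock none (m : ℕ) u =
      Complex.exp ((-(Real.pi / 3) + 2 * Real.pi / 3 * m
        + 2 * Real.pi / 3 * Real.smoothTransition u : ℝ) * Complex.I) := by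
    intro m
    have := edgeDir_eq_exp m
    push_cast at this
    rw [triBlock_sub_none, this, ← Complex.exp_add]
    congr 1
    push_cast
    ring
  generalize Real.smoothTransition u = σ at *
  left
  rcases zmod_three_cases k with rfl | rfl | rfl
  · have h1 := hT 0
    have h2 : linBlock none (0 + 1) u - linBlock none 0 u =
        1 + arc (Real.smoothTransition (2 * u)) - arc (Real.smoothTransition (2 * u - 1)) := by
      simp [linBlock]
    simp only [Nat.cast_zero] at h1
    rw [h1, h2]
    apply segmentAvoidsZero_of_re
    · rw [Complex.exp_ofReal_mul_I_re]
      apply Real.cos_pos_of_mem_Ioo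
      constructor <;> nlinarith
    · simp [arc]
      by_cases h : 2 * u - 1 ≤ 0
      · rw [hm h]; linarith
      · rw [hm' (by linarith)]; linarith
  · have h1 := hT 1
    have h2 : linBlock none (1 + 1) u - linBlock none 1 u =
        1 - 2 * arc (Real.smoothTransition (2 * u)) - arc (Real.smoothTransition (2 * u - 1)) := by
      rw [← n5]
      simp [linBlock, n1, n2]; ring
    simp only [Nat.cast_one] at h1
    rw [h1, h2]
    apply SegmentAvoidsZero.symm
    rcases lt_or_ge u (1 / 2) with h | h
    · rw [hm (by linarith), arc_zero]
      generalize Real.smoothTransition (2 * u) = g at *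
      apply segmentAvoidsZero_of_halfPlane 0 1
      · simp [arc]; nlinarith
      · rw [Complex.exp_ofReal_mul_I_im, Complex.exp_ofReal_mul_I_re]
        have := hlt h
        have := Real.sin_pos_of_pos_of_lt_pi
          (x := -(Real.pi / 3) + 2 * Real.pi / 3 * 1 + 2 * Real.pi / 3 * σ)
          (by nlinarith) (by nlinarith)
        simpa using this
      · intro h0
        have e1 := congrArg Complex.re h0
        have e2 := congrArg Complex.im h0
        simp [arc] at e1 e2
        rcases e2 with e2 | e2 <;> linarith
    · rw [hm' (by linarith), arc_one]
      generalize Real.smoothTransition (2 * u - 1) = g at *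
      apply segmentAvoidsZero_of_halfPlane (-1) 0
      · simp [arc]; linarith
      · rw [Complex.exp_ofReal_mul_I_im, Complex.exp_ofReal_mul_I_re]
        have := hle h
        have := Real.cos_neg_of_pi_div_two_lt_of_lt
          (x := -(Real.pi / 3) + 2 * Real.pi / 3 * 1 + 2 * Real.pi / 3 * σ)
          (by nlinarith) (by nlinarith)
        simpa using this
      · intro h0
        have e1 := congrArg Complex.re h0
        simp [arc] at e1
        linarith
  · have h1 := hT 2
    have h2 : linBlock none (2 + 1) u - linBlock none 2 u =
        -2 + arc (Real.smoothTransition (2 * u)) + 2 * arc (Real.smoothTransition (2 * u - 1)) := by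
      rw [n3]
      simp [linBlock, n1, n2]; ring
    simp only [Nat.cast_ofNat] at h1
    rw [h1, h2, show (-(Real.pi / 3) + 2 * Real.pi / 3 * 2 + 2 * Real.pi / 3 * σ) =
      2 * Real.pi / 3 * σ + Real.pi by ring]
    apply SegmentAvoidsZero.symm
    rcases lt_or_ge u (1 / 2) with h | h
    · rw [hm (by linarith), arc_zero]
      generalize Real.smoothTransition (2 * u) = g at *
      apply segmentAvoidsZero_of_halfPlane (-1) 0
      · simp [arc]; linarith
      · rw [Complex.exp_ofReal_mul_I_im, Complex.exp_ofReal_mul_I_re, Real.cos_add_pi]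
        have := hlt h
        have := Real.cos_pos_of_mem_Ioo (x := 2 * Real.pi / 3 * σ)
          ⟨by nlinarith, by nlinarith⟩
        simpa using this
      · intro h0
        have e1 := congrArg Complex.re h0
        simp [arc] at e1
        linarith
    · rw [hm' (by linarith), arc_one]
      generalize Real.smoothTransition (2 * u - 1) = g at *
      apply segmentAvoidsZero_of_halfPlane 0 (-1)
      · simp [arc]; nlinarith
      · rw [Complex.exp_ofReal_mul_I_im, Complex.exp_ofReal_mul_I_re, Real.sin_add_pi]
        have := hle h
        have := Real.sin_pos_of_pos_of_lt_pi (x := 2 * Real.pi / 3 * σ)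
          (by nlinarith) (by nlinarith)
        simpa using this
      · intro h0
        have e1 := congrArg Complex.re h0
        have e2 := congrArg Complex.im h0
        simp [arc] at e1 e2
        rcases e2 with e2 | e2 <;> linarith

theorem triBlock_linBlock (b : Option (ZMod 3)) (k : ZMod 3) {u : ℝ} (h0 : 0 ≤ u) (h1 : u < 1) :
    BlockCondition triBlock linBlock b k u := by
  rcases b with _ | c
  · exact triBlock_linBlock_none k h0 h1
  · rcases zmod_three_cases c with rfl | rfl | rfl
    · exact triBlock_linBlock_zero k u
    · exact triBlock_linBlock_one k u
    · exact triBlock_linBlock_two k u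

theorem BlockCondition.eq_iff {blk blk' : Option (ZMod 3) → ZMod 3 → ℝ → ℂ} {b : Option (ZMod 3)}
    {k : ZMod 3} {u : ℝ} (h : BlockCondition blk blk' b k u) :
    blk b (k + 1) u = blk b k u ↔ blk' b (k + 1) u = blk' b k u := by
  rcases h with h | ⟨-, h, h', -⟩
  · have h0 := h 0 (by simp)
    have h1 := h 1 (by simp)
    simp only [sub_zero, one_mul, zero_mul, add_zero, Complex.ofReal_zero, Complex.ofReal_one,
      sub_self, zero_add, ne_eq, sub_eq_zero] at h0 h1
    exact ⟨fun e => absurd e h0, fun e => absurd e h1⟩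
  · exact ⟨fun _ => h', fun _ => h⟩

section LinCurve

variable (w : List (ZMod 3))

theorem triCurve_isotopic_linBlock :
    SingularIsotopic (braidKnot (triCurve w)) (braidKnot (strandCurve linBlock w)) ∧
      IsBraidLoop (strandCurve linBlock w) :=
  SingularIsotopic.of_blocks w (triCurve_isBraidLoop w) linBlock_isBlockSystem
    fun b k _ h0 h1 => triBlock_linBlock b k h0 h1

theorem linBlock_eq_iff (b : Option (ZMod 3)) (k : ZMod 3) {u : ℝ} (h0 : 0 ≤ u) (h1 : u < 1) :
    linBlock b (k + 1) u = linBlock b k u ↔ b = some k ∧ u = 1 / 2 := by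
  rw [← (triBlock_linBlock b k h0 h1).eq_iff, ← sub_eq_zero]
  rcases b with _ | c
  · rw [triBlock_sub_none]
    simp [edgeDir_ne_zero, Complex.exp_ne_zero]
  · rw [triBlock_sub_some, mul_eq_zero, or_iff_right (edgeDir_ne_zero k), Option.some.injEq]
    refine ⟨fun h => ?_, ?_⟩
    · by_contra hne
      have := re_edgeFactor_pos (c := c) (k := k) (u := u) (by tauto)
      rw [h] at this
      simp at this
    · rintro ⟨rfl, rfl⟩
      exact edgeFactor_half _

end LinCurve

/-! ### The letters of a standard braid -/

/-- The strand at which the first endpoint of a chord between the three strands sits, when the chord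
is read in the cyclic order `0, 1, 2`. -/
def Chord.tail (g : Chord 3) : ZMod 3 := if g.i = 0 ∧ g.j = 2 then 2 else ((g.i : ℕ) : ZMod 3)

/-- The letters of a smashed chord, or of the closing braid. -/
def chunkWord (b : Option (ZMod 3)) (q : Bool) : List (Letter 3) :=
  match b with
  | none => [Letter.neg 1, Letter.neg 0]
  | some c =>
    if c = 0 then if q then [Letter.pos 0, Letter.sing 0] else [Letter.sing 0, Letter.pos 0]
    else if c = 1 then if q then [Letter.pos 1, Letter.sing 1] else [Letter.sing 1, Letter.pos 1]
    else if q then [Letter.neg 1, Letter.pos 0, Letter.sing 0, Letter.pos 1]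
      else [Letter.neg 1, Letter.sing 0, Letter.pos 0, Letter.pos 1]

theorem Chord.cases_three (g : Chord 3) :
    g = ⟨0, 1, by decide⟩ ∨ g = ⟨1, 2, by decide⟩ ∨ g = ⟨0, 2, by decide⟩ := by
  obtain ⟨i, j, h⟩ := g
  fin_cases i <;> fin_cases j <;> first | exact absurd h (by decide) | simp

theorem Chord.smashed_eq (g : Chord 3) (b : Bool) : g.smashed b = chunkWord (some g.tail) b := by
  rcases g.cases_three with rfl | rfl | rfl <;> cases b <;> rfl

theorem closingBraid_three (b : Bool) : closingBraid 3 = chunkWord none b := rfl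

/-- The action of a word on the positions of the strands. -/
def actWord (B : List (Letter 3)) (p : ℕ) : ℕ := B.foldl (fun p g => g.act p) p

theorem actWord_append (A B : List (Letter 3)) (p : ℕ) :
    actWord (A ++ B) p = actWord B (actWord A p) := List.foldl_append

theorem actWord_chunkWord_some (c : ZMod 3) (q : Bool) (k : ZMod 3) :
    actWord (chunkWord (some c) q) k.val = k.val := by
  revert c q k; decide

theorem actWord_chunkWord_none (q : Bool) (k : ZMod 3) :
    actWord (chunkWord none q) k.val = (k + 1).val := by
  revert q k; decide

theorem strandPos_mul_add (w : List (Letter 3)) (p : ℕ) {s : ℕ} (hs : s ≤ w.length) :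
    strandPos w (p * w.length + s) = actWord (w.take s) (strandPos w (p * w.length)) := by
  induction s with
  | zero => simp [actWord]
  | succ s ih =>
    have hlt : s < w.length := hs
    rw [List.take_add_one, actWord_append, ← ih hlt.le, ← Nat.add_assoc, strandPos,
      Nat.mul_comm p, Nat.mul_add_mod, Nat.mod_eq_of_lt hlt]
    rw [List.getElem?_eq_getElem hlt]
    rfl

/-- The list of the smashed chords and the closing braid that compose a standard braid. -/
def chunks (W : ChordWord 3) (q : ℕ → Bool) : List (List (Letter 3)) :=
  (W.zipIdx.map fun g => chunkWord (some g.1.tail) (q g.2)) ++ [chunkWord none true]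

/-- The tails of the chords of a word. -/
def ChordWord.tails (W : ChordWord 3) : List (ZMod 3) := W.map Chord.tail

section Chunks

variable (W : ChordWord 3) (q : ℕ → Bool)

theorem ChordWord.length_tails : W.tails.length = W.length := List.length_map _

theorem standardBraid_eq : standardBraid W q = (chunks W q).flatten := by
  rw [chunks, List.flatten_append, standardBraid, List.flatMap_def, List.flatten_singleton,
    closingBraid_three true]
  simp only [Chord.smashed_eq]

theorem length_chunks : (chunks W q).length = W.length + 1 := by simp [chunks]

theorem chunks_getElem (i : ℕ) (hi : i < W.length + 1) :
    (chunks W q)[i]? = some (chunkWord W.tails[i]? (q i)) := by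
  rcases Nat.lt_succ_iff_lt_or_eq.1 hi with h | rfl
  · rw [chunks, List.getElem?_append_left (by simpa using h)]
    simp [ChordWord.tails, List.getElem?_eq_getElem h]
  · rw [chunks, List.getElem?_append_right (by simp)]
    simp [ChordWord.tails, chunkWord]

theorem actWord_take_chunks (i : ℕ) (hi : i ≤ W.length) (k : ZMod 3) :
    actWord ((chunks W q).take i).flatten k.val = k.val := by
  induction i with
  | zero => simp [actWord]
  | succ i ih =>
    rw [List.take_add_one, chunks_getElem W q i (by omega), List.flatten_append, actWord_append,
      ih (by omega)]
    have : i < W.tails.length := by rw [W.length_tails]; omega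
    simp only [Option.toList_some, List.flatten_singleton, List.getElem?_eq_getElem this]
    exact actWord_chunkWord_some _ _ k

/-- The smashed generators are pure, so the positions change at the closing braid only, by one step.
-/
theorem actWord_standardBraid (k : ZMod 3) : actWord (standardBraid W q) k.val = (k + 1).val := by
  have h : chunks W q = (chunks W q).take (W.length + 1) :=
    (List.take_of_length_le (length_chunks W q).le).symm
  rw [standardBraid_eq, h, List.take_add_one, chunks_getElem W q _ (by omega),
    List.flatten_append, actWord_append, actWord_take_chunks W q _ le_rfl]
  have : W.tails[W.length]? = none := by simp [ChordWord.tails]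
  simp only [Option.toList_some, List.flatten_singleton, this]
  exact actWord_chunkWord_none _ k

theorem strandPos_mul (p : ℕ) :
    strandPos (standardBraid W q) (p * (standardBraid W q).length) = (p : ZMod 3).val := by
  induction p with
  | zero => simp [strandPos]
  | succ p ih =>
    rw [Nat.add_mul, Nat.one_mul, strandPos_mul_add _ _ le_rfl, List.take_length, ih,
      actWord_standardBraid]
    push_cast
    rfl

/-- The number of letters before a chunk. -/
def chunkStart (i : ℕ) : ℕ := ((chunks W q).take i).flatten.length

theorem chunkStart_zero : chunkStart W q 0 = 0 := rfl

theorem chunkStart_succ (i : ℕ) (hi : i < W.length + 1) :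
    chunkStart W q (i + 1) = chunkStart W q i + (chunkWord W.tails[i]? (q i)).length := by
  rw [chunkStart, List.take_add_one, chunks_getElem W q i hi]
  simp [chunkStart]

theorem chunkStart_last : chunkStart W q (W.length + 1) = (standardBraid W q).length := by
  rw [chunkStart, standardBraid_eq, List.take_of_length_le (length_chunks W q).le]

theorem standardBraid_split (i : ℕ) (hi : i < W.length + 1) : ∃ C,
    standardBraid W q = ((chunks W q).take i).flatten ++ (chunkWord W.tails[i]? (q i) ++ C) := by
  refine ⟨((chunks W q).drop (i + 1)).flatten, ?_⟩
  have h := chunks_getElem W q i hi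
  rw [List.getElem?_eq_some_iff] at h
  obtain ⟨h1, h2⟩ := h
  rw [standardBraid_eq, ← List.flatten_cons, ← h2, ← List.flatten_append,
    ← List.drop_eq_getElem_cons h1, List.take_append_drop]

theorem standardBraid_getElem (i s : ℕ) (hi : i < W.length + 1)
    (hs : s < (chunkWord W.tails[i]? (q i)).length) :
    (standardBraid W q)[chunkStart W q i + s]? = (chunkWord W.tails[i]? (q i))[s]? := by
  obtain ⟨C, h⟩ := standardBraid_split W q i hi
  rw [h, List.getElem?_append_right (by simp [chunkStart]), chunkStart, Nat.add_sub_cancel_left,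
    List.getElem?_append_left hs]

theorem chunkStart_add_lt (i s : ℕ) (hi : i < W.length + 1)
    (hs : s < (chunkWord W.tails[i]? (q i)).length) :
    chunkStart W q i + s < (standardBraid W q).length := by
  obtain ⟨C, h⟩ := standardBraid_split W q i hi
  rw [h, chunkStart]
  simp only [List.length_append]
  omega

theorem strandPos_chunk (p i s : ℕ) (hi : i < W.length + 1)
    (hs : s < (chunkWord W.tails[i]? (q i)).length) :
    strandPos (standardBraid W q) (p * (standardBraid W q).length + (chunkStart W q i + s)) =
      actWord ((chunkWord W.tails[i]? (q i)).take s) (p : ZMod 3).val := by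
  rw [strandPos_mul_add _ _ (chunkStart_add_lt W q i s hi hs).le, strandPos_mul]
  obtain ⟨C, h⟩ := standardBraid_split W q i hi
  rw [h, List.take_append, chunkStart, List.take_of_length_le (by omega), Nat.add_sub_cancel_left,
    List.take_append, Nat.sub_eq_zero_of_le hs.le, List.take_zero, List.append_nil, actWord_append,
    actWord_take_chunks W q i (by omega)]

end Chunks

/-! ### The strands of a standard knot -/

/-- The position of the first of two strands that are exchanged by a crossing and by a double point, in
the order given by `q`. -/
noncomputable def exchange (q : Bool) (x : ℝ) : ℂ :=
  if q then arcConj (Real.smoothTransition x) - Real.smoothTransition (x - 1)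
  else Real.smoothTransition x - arcConj (Real.smoothTransition (x - 1))

/-- The strands of a smashed chord, or of the closing braid; `x` is the number of letters passed. -/
noncomputable def letterBlock (b : Option (ZMod 3)) (q : Bool) (k : ZMod 3) (x : ℝ) : ℂ :=
  match b with
  | none =>
    if k = 0 then arc (Real.smoothTransition (x - 1))
    else if k = 1 then 1 + arc (Real.smoothTransition x)
    else 2 - arc (Real.smoothTransition x) - arc (Real.smoothTransition (x - 1))
  | some c =>
    if c = 0 then if k = 0 then exchange q x else if k = 1 then 1 - exchange q x else 2
    else if c = 1 then if k = 0 then 0 else if k = 1 then 1 + exchange q x else 2 - exchange q x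
    else if k = 0 then exchange q (x - 1)
      else if k = 1 then 1 + arc (Real.smoothTransition x)
        - arcConj (Real.smoothTransition (x - 3))
      else 2 - arc (Real.smoothTransition x) - exchange q (x - 1)
        + arcConj (Real.smoothTransition (x - 3))

/-- A finite check. During the letter number `s`, every transition in `letterBlock` that belongs to
an earlier letter is already 1, and every one that belongs to a later letter is still 0. -/
theorem letterBlock_eq_path (b : Option (ZMod 3)) (q : Bool) (k : ZMod 3) (s : ℕ) (g : Letter 3)
    (hs : (chunkWord b q)[s]? = some g) {v : ℝ} (h0 : 0 ≤ v) (h1 : v < 1) :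
    g.path (actWord ((chunkWord b q).take s) k.val) v = letterBlock b q k (s + v) := by
  have n1 : (1 : ZMod 3).val = 1 := rfl
  have n2 : (2 : ZMod 3).val = 2 := rfl
  have n3 : (2 : ZMod 3) ≠ 0 := by decide
  have n4 : (2 : ZMod 3) ≠ 1 := by decide
  have f1 : Real.smoothTransition (v - 1) = 0 :=
    Real.smoothTransition.zero_of_nonpos (by linarith)
  have f2 : Real.smoothTransition (v - 1 - 1) = 0 :=
    Real.smoothTransition.zero_of_nonpos (by linarith)
  have f3 : Real.smoothTransition (v - 3) = 0 :=
    Real.smoothTransition.zero_of_nonpos (by linarith)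
  have f4 : Real.smoothTransition (1 + v) = 1 :=
    Real.smoothTransition.one_of_one_le (by linarith)
  have f5 : Real.smoothTransition (1 + v - 3) = 0 :=
    Real.smoothTransition.zero_of_nonpos (by linarith)
  have f6 : Real.smoothTransition (2 + v) = 1 :=
    Real.smoothTransition.one_of_one_le (by linarith)
  have f7 : Real.smoothTransition (2 + v - 1) = 1 :=
    Real.smoothTransition.one_of_one_le (by linarith)
  have f8 : Real.smoothTransition (2 + v - 1 - 1) = Real.smoothTransition v := by congr 1; ring
  have f9 : Real.smoothTransition (2 + v - 3) = 0 :=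
    Real.smoothTransition.zero_of_nonpos (by linarith)
  have f10 : Real.smoothTransition (3 + v) = 1 :=
    Real.smoothTransition.one_of_one_le (by linarith)
  have f11 : Real.smoothTransition (3 + v - 1) = 1 :=
    Real.smoothTransition.one_of_one_le (by linarith)
  have f12 : Real.smoothTransition (3 + v - 1 - 1) = 1 :=
    Real.smoothTransition.one_of_one_le (by linarith)
  have A : ∀ (g : Letter 3) (p : ℕ), g.act p = if p = g.idx then g.idx + 1 else
      if p = g.idx + 1 then g.idx else p := fun g p => Equiv.swap_apply_def _ _ _
  have key : ∀ q k, ∀ s < (chunkWord b q).length, (chunkWord b q)[s]? = some g →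
      g.path (actWord ((chunkWord b q).take s) k.val) v = letterBlock b q k (s + v) := by
    rcases b with _ | c
    · intro q k s hs hg
      rcases zmod_three_cases k with rfl | rfl | rfl <;>
      simp only [chunkWord, List.length_cons, List.length_nil] at hs <;>
      interval_cases s <;>
      simp [chunkWord] at hg <;> subst hg <;>
      apply Complex.ext <;>
      simp [Letter.path, actWord, A, Letter.idx, Letter.sign, chunkWord,
        letterBlock, n1, n2, n3, n4, f1, f4, arc] <;> ring
    · intro q k s hs hg
      rcases zmod_three_cases c with rfl | rfl | rfl <;>
      rcases zmod_three_cases k with rfl | rfl | rfl <;>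
      cases q <;>
      simp [chunkWord, n3, n4] at hs <;>
      interval_cases s <;>
      simp [chunkWord, n3, n4] at hg <;> subst hg <;>
      apply Complex.ext <;>
      simp [Letter.path, actWord, A, Letter.idx, Letter.sign, chunkWord, exchange,
        letterBlock, n1, n2, n3, n4, f1, f2, f3, f4, f5, f6, f7, f8, f9, f10, f11, f12, arc, arcConj] <;> ring
  exact key q k s (List.getElem?_eq_some_iff.1 hs).1 hs

theorem smoothTransition_lt_half {x : ℝ} (h : x < 1 / 2) : Real.smoothTransition x < 1 / 2 := by
  rcases le_or_gt x 0 with h0 | h0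
  · rw [Real.smoothTransition.zero_of_nonpos h0]; norm_num
  · rw [← smoothTransition_half]
    exact smoothTransition_strictMonoOn ⟨h0.le, by linarith⟩ ⟨by norm_num, by norm_num⟩ h

theorem half_lt_smoothTransition {x : ℝ} (h : 1 / 2 < x) : 1 / 2 < Real.smoothTransition x := by
  rcases le_or_gt 1 x with h0 | h0
  · rw [Real.smoothTransition.one_of_one_le h0]; norm_num
  · rw [← smoothTransition_half]
    exact smoothTransition_strictMonoOn ⟨by norm_num, by norm_num⟩ ⟨by linarith, h0.le⟩ h

theorem smoothTransition_pos {x : ℝ} (h : 0 < x) : 0 < Real.smoothTransition x :=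
  Real.smoothTransition.pos_of_pos h

theorem smoothTransition_lt_one {x : ℝ} (h : x < 1) : Real.smoothTransition x < 1 :=
  Real.smoothTransition.lt_one_of_lt_one h

/-- The time of the double point in `exchange`. -/
noncomputable def exchangeTime (q : Bool) : ℝ := if q then 3 / 2 else 1 / 2

theorem exchange_of_le (q : Bool) {x : ℝ} (h : x ≤ 1) : exchange q x =
    if q then arcConj (Real.smoothTransition x) else Real.smoothTransition x := by
  rw [exchange, Real.smoothTransition.zero_of_nonpos (x := x - 1) (by linarith), arcConj_zero]
  simp

theorem exchange_of_ge (q : Bool) {x : ℝ} (h : 1 ≤ x) : exchange q x =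
    if q then 1 - (Real.smoothTransition (x - 1) : ℂ)
      else 1 - arcConj (Real.smoothTransition (x - 1)) := by
  rw [exchange, Real.smoothTransition.one_of_one_le (x := x) h, arcConj_one, Complex.ofReal_one]

theorem exchange_re_mem (q : Bool) (x : ℝ) : 0 ≤ (exchange q x).re ∧ (exchange q x).re ≤ 1 := by
  obtain ⟨h0, h1⟩ := smoothTransition_mem x
  obtain ⟨h0', h1'⟩ := smoothTransition_mem (x - 1)
  rcases le_total x 1 with h | h
  · rw [exchange_of_le q h]
    cases q <;> simp [arcConj, h0, h1]
  · rw [exchange_of_ge q h]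
    cases q <;> simp [arcConj, h0', h1']

theorem contDiff_exchange (q : Bool) : ContDiff ℝ ∞ (exchange q) := by
  have h1 : ContDiff ℝ ∞ fun x : ℝ => arcConj (Real.smoothTransition x) :=
    contDiff_arcConj.comp Real.smoothTransition.contDiff
  have h2 : ContDiff ℝ ∞ fun x : ℝ => (Real.smoothTransition x : ℂ) :=
    Complex.ofRealCLM.contDiff.comp Real.smoothTransition.contDiff
  have h3 : ContDiff ℝ ∞ fun x : ℝ => x - 1 := contDiff_id.sub contDiff_const
  cases q
  · exact h2.sub (h1.comp h3)
  · exact h1.sub (h2.comp h3)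

theorem exchange_double (q : Bool) : exchange q (exchangeTime q) = 1 / 2 := by
  have h : (2 : ℝ)⁻¹ = 1 / 2 := by norm_num
  cases q
  · rw [exchange_of_le _ (by norm_num [exchangeTime])]
    norm_num [exchangeTime, h, smoothTransition_half]
  · rw [exchange_of_ge _ (by norm_num [exchangeTime])]
    norm_num [exchangeTime, h, smoothTransition_half]

theorem exchange_hasDerivAt (q : Bool) :
    ∃ c : ℝ, c ≠ 0 ∧ HasDerivAt (exchange q) c (exchangeTime q) := by
  obtain ⟨c, hc, h⟩ := smoothTransition_hasDerivAt_pos (x := 1 / 2) (by norm_num) (by norm_num)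
  cases q
  · refine ⟨c, hc.ne', ?_⟩
    have : exchange false =ᶠ[nhds (exchangeTime false)] fun x => (Real.smoothTransition x : ℂ) := by
      filter_upwards [Iio_mem_nhds (show exchangeTime false < 1 by norm_num [exchangeTime])] with x hx
      rw [exchange_of_le _ (le_of_lt hx)]; simp
    exact (HasDerivAt.ofReal_comp (by simpa [exchangeTime] using h)).congr_of_eventuallyEq this
  · refine ⟨-c, neg_ne_zero.2 hc.ne', ?_⟩
    have : exchange true =ᶠ[nhds (exchangeTime true)]
        fun x => 1 - (Real.smoothTransition (x - 1) : ℂ) := by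
      filter_upwards [Ioi_mem_nhds (show 1 < exchangeTime true by norm_num [exchangeTime])] with x hx
      rw [exchange_of_ge _ (le_of_lt hx)]; simp
    refine HasDerivAt.congr_of_eventuallyEq ?_ this
    rw [Complex.ofReal_neg]
    refine HasDerivAt.const_sub _ (HasDerivAt.ofReal_comp ?_)
    refine HasDerivAt.comp_sub_const _ _ ?_
    rwa [show exchangeTime true - 1 = 1 / 2 by norm_num [exchangeTime]]

/-- This is where the choice of the smashed crossing loses its influence. The circle `1 - 2 * pinch`
runs through the lower half plane before its zero and through the upper one after it. For `q = true`
the genuine crossing comes first and passes through the lower half plane; for `q = false` it comes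
last and passes through the upper one. The double point itself moves along the real axis. -/
theorem segmentAvoidsZero_exchange (q : Bool) {u x : ℝ} (hu0 : 0 ≤ u) (hu1 : u < 1)
    (h0 : u = 0 → x = 0) (hlt : u < 1 / 2 → x < exchangeTime q)
    (hgt : 1 / 2 < u → exchangeTime q < x) (hne : u ≠ 1 / 2) :
    SegmentAvoidsZero (1 - 2 * pinch u) (1 - 2 * exchange q x) := by
  have hre := pinch_re_lt hne
  obtain ⟨s0, s1⟩ := smoothTransition_mem x
  obtain ⟨s0', s1'⟩ := smoothTransition_mem (x - 1)
  apply SegmentAvoidsZero.symm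
  rcases lt_or_gt_of_ne hne with h | h
  · have hx := hlt h
    cases q
    · simp only [exchangeTime, Bool.false_eq_true, if_false] at hx
      have := smoothTransition_lt_half hx
      rw [exchange_of_le _ (by linarith)]
      apply segmentAvoidsZero_of_re <;> simp <;> linarith
    · simp only [exchangeTime, if_true] at hx
      -- At `u = 0` the circle starts on the real axis, and the lower half plane is of no use; this
      -- is why `x = 0` is needed there.
      rcases hu0.eq_or_lt with h00 | h00
      · rw [h0 h00.symm, ← h00, pinch_of_nonpos le_rfl, exchange_of_le _ zero_le_one,
          Real.smoothTransition.zero, if_pos rfl, arcConj_zero]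
        apply segmentAvoidsZero_of_re <;> simp
      have him := pinch_im_pos h00 h
      apply segmentAvoidsZero_of_halfPlane 0 (-1)
      · rcases le_total x 1 with h1 | h1
        · rw [exchange_of_le _ h1]; simp [arcConj]; nlinarith
        · rw [exchange_of_ge _ h1]; simp
      · simp; linarith
      · intro h
        have e1 := congrArg Complex.re h
        have e2 := congrArg Complex.im h
        rcases le_total x 1 with h1 | h1
        · rw [exchange_of_le _ h1] at e1 e2
          generalize Real.smoothTransition x = g at *
          simp [arcConj] at e1 e2
          rcases e2 with e2 | e2 <;> linarith
        · rw [exchange_of_ge _ h1] at e1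
          have := smoothTransition_lt_half (x := x - 1) (by linarith)
          simp at e1
          linarith
  · have hx := hgt h
    cases q
    · simp only [exchangeTime, Bool.false_eq_true, if_false] at hx
      have him := pinch_im_neg h hu1
      apply segmentAvoidsZero_of_halfPlane 0 1
      · rcases le_total x 1 with h1 | h1
        · rw [exchange_of_le _ h1]; simp
        · rw [exchange_of_ge _ h1]; simp [arcConj]; nlinarith
      · simp; linarith
      · intro h
        have e1 := congrArg Complex.re h
        have e2 := congrArg Complex.im h
        rcases le_total x 1 with h1 | h1
        · rw [exchange_of_le _ h1] at e1
          have := half_lt_smoothTransition hx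
          simp at e1
          linarith
        · rw [exchange_of_ge _ h1] at e1 e2
          generalize Real.smoothTransition (x - 1) = g at *
          simp [arcConj] at e1 e2
          rcases e2 with e2 | e2 <;> linarith
    · simp only [exchangeTime, if_true] at hx
      have := half_lt_smoothTransition (x := x - 1) (by linarith)
      rw [exchange_of_ge _ (by linarith)]
      apply segmentAvoidsZero_of_re <;> simp <;> linarith

/-! ### Comparison of collinear blocks and letters -/

/-- The number of letters of a chunk. -/
def chunkLength (b : Option (ZMod 3)) : ℕ := if b = some 2 then 4 else 2

theorem length_chunkWord (b : Option (ZMod 3)) (q : Bool) :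
    (chunkWord b q).length = chunkLength b := by
  revert b q; decide

/-- The number of letters of a chunk that are passed in a quarter, a half and three quarters of the
time of a block. -/
noncomputable def chunkNode (b : Option (ZMod 3)) (q : Bool) (s : ℕ) : ℝ :=
  let mid : ℝ := if b = none then 1 else exchangeTime q
  if b = some 2 then match s with
    | 0 => 0
    | 1 => 1
    | 2 => 1 + mid
    | 3 => 3
    | _ => 4
  else match s with
    | 0 => 0
    | 1 => mid / 2
    | 2 => mid
    | 3 => (mid + 2) / 2
    | _ => 2

theorem letterBlock_contDiff (b : Option (ZMod 3)) (q : Bool) (k : ZMod 3) :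
    ContDiff ℝ ∞ (letterBlock b q k) := by
  have hS : ∀ b : ℝ, ContDiff ℝ ∞ fun x => Real.smoothTransition (x - b) := fun b =>
    Real.smoothTransition.contDiff.comp (contDiff_id.sub contDiff_const)
  have a1 := contDiff_arc.comp (hS 1)
  have a2 := contDiff_arc.comp Real.smoothTransition.contDiff
  have a4 := contDiff_arcConj.comp (hS 3)
  simp only [Function.comp_def] at a1 a2 a4
  have e1 := contDiff_exchange q
  have e2 : ContDiff ℝ ∞ fun x => exchange q (x - 1) :=
    e1.comp (contDiff_id.sub contDiff_const)
  unfold letterBlock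
  rcases b with _ | c
  · dsimp only
    split_ifs
    · exact a1
    · exact contDiff_const.add a2
    · exact (contDiff_const.sub a2).sub a1
  · dsimp only
    split_ifs
    · exact e1
    · exact contDiff_const.sub e1
    · exact contDiff_const
    · exact contDiff_const
    · exact contDiff_const.add e1
    · exact contDiff_const.sub e1
    · exact e2
    · exact (contDiff_const.add a2).sub a4
    · exact ((contDiff_const.sub a2).sub e2).add a4

theorem letterBlock_deriv_sub {b : Option (ZMod 3)} {q : Bool} {k l : ZMod 3} {x : ℝ} {f : ℝ → ℂ}
    {d : ℂ} (hf : ∀ x, letterBlock b q l x - letterBlock b q k x = f x) (hd : HasDerivAt f d x) :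
    deriv (letterBlock b q l) x - deriv (letterBlock b q k) x = d := by
  rw [← deriv_fun_sub ((letterBlock_contDiff _ _ _).differentiable (by simp) _)
    ((letterBlock_contDiff _ _ _).differentiable (by simp) _), funext hf, hd.deriv]

/-- The edges of the collinear blocks and of the letters can be deformed into each other. -/
def LetterCondition (b : Option (ZMod 3)) (q : Bool) (k : ZMod 3) (u x : ℝ) : Prop :=
  SegmentAvoidsZero (linBlock b (k + 1) u - linBlock b k u)
    (letterBlock b q (k + 1) x - letterBlock b q k x) ∨
  (0 < u ∧ linBlock b (k + 1) u = linBlock b k u ∧ letterBlock b q (k + 1) x = letterBlock b q k x ∧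
    ∀ a : ℝ, 0 < a → SegmentAvoidsZero (deriv (linBlock b (k + 1)) u - deriv (linBlock b k) u)
      (a * (deriv (letterBlock b q (k + 1)) x - deriv (letterBlock b q k) x)))

/-- The pinch passes through 0 vertically and the letters horizontally, so the sign of `c`, which
depends on the smashed crossing, is irrelevant. -/
theorem segmentAvoidsZero_double {r c a : ℝ} (hr : 0 < r) (hc : c ≠ 0) (ha : 0 < a) :
    SegmentAvoidsZero (r * Complex.I) (a * (-2 * c)) := by
  apply SegmentAvoidsZero.symm
  apply segmentAvoidsZero_of_halfPlane 0 1 <;> simp [hr, hc, ha.ne']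

theorem letterCondition_some_zero (q : Bool) (k : ZMod 3) {u x : ℝ} (hu0 : 0 ≤ u) (hu1 : u < 1)
    (h0 : u = 0 → x = 0) (hlt : u < 1 / 2 → x < exchangeTime q)
    (hgt : 1 / 2 < u → exchangeTime q < x) (heq : u = 1 / 2 → x = exchangeTime q) :
    LetterCondition (some 0) q k u x := by
  have a := pinch_re_nonneg u
  have b := pinch_re_le u
  obtain ⟨e0, e1⟩ := exchange_re_mem q x
  have n1 : (2 : ZMod 3) ≠ 0 := by decide
  have n2 : (2 : ZMod 3) ≠ 1 := by decide
  have n3 : (2 : ZMod 3) + 1 = 0 := by decide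
  have n5 : (2 : ZMod 3) = 1 + 1 := by decide
  rcases zmod_three_cases k with rfl | rfl | rfl
  · have h1 : ∀ u, linBlock (some 0) (0 + 1) u - linBlock (some 0) 0 u = 1 - 2 * pinch u := by
      intro u; simp [linBlock]; ring
    have h2 : ∀ x, letterBlock (some 0) q (0 + 1) x - letterBlock (some 0) q 0 x
        = 1 - 2 * exchange q x := by
      intro u; simp [letterBlock]; ring
    by_cases hu : u = 1 / 2
    · obtain ⟨r, hr, hd⟩ := one_sub_two_pinch_hasDerivAt
      obtain ⟨c, hc, hd'⟩ := exchange_hasDerivAt q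
      obtain rfl := heq hu
      subst hu
      refine Or.inr ⟨by norm_num, sub_eq_zero.1 ?_, sub_eq_zero.1 ?_, fun t ht => ?_⟩
      · rw [h1, pinch_half]; norm_num
      · rw [h2, exchange_double]; norm_num
      · rw [linBlock_isBlockSystem.deriv_sub h1 hd,
          letterBlock_deriv_sub h2 ((hd'.const_mul 2).const_sub 1), ← neg_mul]
        exact segmentAvoidsZero_double hr hc ht
    · left
      rw [h1, h2]
      exact segmentAvoidsZero_exchange q hu0 hu1 h0 hlt hgt hu
  · left
    have h1 : linBlock (some 0) (1 + 1) u - linBlock (some 0) 1 u = 1 + pinch u := by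
      rw [← n5]; simp [linBlock, n1, n2]; ring
    have h2 : letterBlock (some 0) q (1 + 1) x - letterBlock (some 0) q 1 x = 1 + exchange q x := by
      rw [← n5]; simp [letterBlock, n1, n2]; ring
    rw [h1, h2]
    apply segmentAvoidsZero_of_re <;> simp <;> linarith
  · left
    have h1 : linBlock (some 0) (2 + 1) u - linBlock (some 0) 2 u = pinch u - 2 := by
      rw [n3]; simp [linBlock, n1, n2]
    have h2 : letterBlock (some 0) q (2 + 1) x - letterBlock (some 0) q 2 x = exchange q x - 2 := by
      rw [n3]; simp [letterBlock, n1, n2]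
    rw [h1, h2]
    apply segmentAvoidsZero_of_halfPlane (-1) 0
    · simp; linarith
    · simp; linarith
    · intro h
      have := congrArg Complex.re h
      simp at this; linarith

theorem letterCondition_some_one (q : Bool) (k : ZMod 3) {u x : ℝ} (hu0 : 0 ≤ u) (hu1 : u < 1)
    (h0 : u = 0 → x = 0) (hlt : u < 1 / 2 → x < exchangeTime q)
    (hgt : 1 / 2 < u → exchangeTime q < x) (heq : u = 1 / 2 → x = exchangeTime q) :
    LetterCondition (some 1) q k u x := by
  have a := pinch_re_nonneg u
  have b := pinch_re_le u
  obtain ⟨e0, e1⟩ := exchange_re_mem q x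
  have n1 : (2 : ZMod 3) ≠ 0 := by decide
  have n2 : (2 : ZMod 3) ≠ 1 := by decide
  have n3 : (2 : ZMod 3) + 1 = 0 := by decide
  have n5 : (2 : ZMod 3) = 1 + 1 := by decide
  rcases zmod_three_cases k with rfl | rfl | rfl
  · left
    have h1 : linBlock (some 1) (0 + 1) u - linBlock (some 1) 0 u = 1 + pinch u := by
      simp [linBlock]
    have h2 : letterBlock (some 1) q (0 + 1) x - letterBlock (some 1) q 0 x = 1 + exchange q x := by
      simp [letterBlock]
    rw [h1, h2]
    apply segmentAvoidsZero_of_re <;> simp <;> linarith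
  · have h1 : ∀ u, linBlock (some 1) (1 + 1) u - linBlock (some 1) 1 u = 1 - 2 * pinch u := by
      intro u; rw [← n5]; simp [linBlock, n1, n2]; ring
    have h2 : ∀ x, letterBlock (some 1) q (1 + 1) x - letterBlock (some 1) q 1 x
        = 1 - 2 * exchange q x := by
      intro u; rw [← n5]; simp [letterBlock, n1, n2]; ring
    by_cases hu : u = 1 / 2
    · obtain ⟨r, hr, hd⟩ := one_sub_two_pinch_hasDerivAt
      obtain ⟨c, hc, hd'⟩ := exchange_hasDerivAt q
      obtain rfl := heq hu
      subst hu
      refine Or.inr ⟨by norm_num, sub_eq_zero.1 ?_, sub_eq_zero.1 ?_, fun t ht => ?_⟩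
      · rw [h1, pinch_half]; norm_num
      · rw [h2, exchange_double]; norm_num
      · rw [linBlock_isBlockSystem.deriv_sub h1 hd,
          letterBlock_deriv_sub h2 ((hd'.const_mul 2).const_sub 1), ← neg_mul]
        exact segmentAvoidsZero_double hr hc ht
    · left
      rw [h1, h2]
      exact segmentAvoidsZero_exchange q hu0 hu1 h0 hlt hgt hu
  · left
    have h1 : linBlock (some 1) (2 + 1) u - linBlock (some 1) 2 u = pinch u - 2 := by
      rw [n3]; simp [linBlock, n1, n2]
    have h2 : letterBlock (some 1) q (2 + 1) x - letterBlock (some 1) q 2 x = exchange q x - 2 := by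
      rw [n3]; simp [letterBlock, n1, n2]
    rw [h1, h2]
    apply segmentAvoidsZero_of_halfPlane (-1) 0
    · simp; linarith
    · simp; linarith
    · intro h
      have := congrArg Complex.re h
      simp at this; linarith

theorem arc_im_neg {g : ℝ} (h0 : 0 < g) (h1 : g < 1) : (arc g).im < 0 := by
  simp [arc]; nlinarith

theorem arc_im_nonpos (x : ℝ) : (arc (Real.smoothTransition x)).im ≤ 0 := by
  obtain ⟨s0, s1⟩ := smoothTransition_mem x
  simp [arc]; nlinarith

theorem one_sub_two_arc_ne_zero (g : ℝ) : 1 - 2 * arc g ≠ 0 := by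
  intro h
  have e1 := congrArg Complex.re h
  have e2 := congrArg Complex.im h
  simp [arc] at e1 e2
  rcases e2 with e2 | e2 <;> linarith

theorem one_sub_two_arcConj_ne_zero (g : ℝ) : 1 - 2 * arcConj g ≠ 0 := by
  intro h
  have e1 := congrArg Complex.re h
  have e2 := congrArg Complex.im h
  simp [arcConj] at e1 e2
  rcases e2 with e2 | e2 <;> linarith

theorem letterCondition_none (q : Bool) (k : ZMod 3) {u x : ℝ} (hu0 : 0 ≤ u) (hu1 : u < 1)
    (h0 : u = 0 → x = 0) (hlt : u ≤ 1 / 2 → x ≤ 1) (hgt : 1 / 2 ≤ u → 1 ≤ x) :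
    LetterCondition none q k u x := by
  have n1 : (2 : ZMod 3) ≠ 0 := by decide
  have n2 : (2 : ZMod 3) ≠ 1 := by decide
  have n3 : (2 : ZMod 3) + 1 = 0 := by decide
  have n5 : (2 : ZMod 3) = 1 + 1 := by decide
  obtain ⟨g0, g1⟩ := smoothTransition_mem (2 * u)
  obtain ⟨g0', g1'⟩ := smoothTransition_mem (2 * u - 1)
  obtain ⟨s0, s1⟩ := smoothTransition_mem x
  obtain ⟨s0', s1'⟩ := smoothTransition_mem (x - 1)
  left
  rcases zmod_three_cases k with rfl | rfl | rfl
  · have h1 : linBlock none (0 + 1) u - linBlock none 0 u =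
        1 + arc (Real.smoothTransition (2 * u)) - arc (Real.smoothTransition (2 * u - 1)) := by
      simp [linBlock]
    have h2 : letterBlock none q (0 + 1) x - letterBlock none q 0 x =
        1 + arc (Real.smoothTransition x) - arc (Real.smoothTransition (x - 1)) := by
      simp [letterBlock]
    rw [h1, h2]
    rcases le_total u (1 / 2) with h | h
    · rw [Real.smoothTransition.zero_of_nonpos (x := 2 * u - 1) (by linarith),
        Real.smoothTransition.zero_of_nonpos (x := x - 1) (by linarith [hlt h])]
      apply segmentAvoidsZero_of_re <;> simp [arc] <;> linarith
    · rw [Real.smoothTransition.one_of_one_le (x := 2 * u) (by linarith),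
        Real.smoothTransition.one_of_one_le (x := x) (by linarith [hgt h])]
      apply segmentAvoidsZero_of_re <;> simp [arc] <;> linarith
  · have h1 : linBlock none (1 + 1) u - linBlock none 1 u =
        1 - 2 * arc (Real.smoothTransition (2 * u)) - arc (Real.smoothTransition (2 * u - 1)) := by
      rw [← n5]; simp [linBlock, n1, n2]; ring
    have h2 : letterBlock none q (1 + 1) x - letterBlock none q 1 x =
        1 - 2 * arc (Real.smoothTransition x) - arc (Real.smoothTransition (x - 1)) := by
      rw [← n5]; simp [letterBlock, n1, n2]; ring
    rw [h1, h2]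
    rcases lt_or_ge u (1 / 2) with h | h
    · rw [Real.smoothTransition.zero_of_nonpos (x := 2 * u - 1) (by linarith),
        Real.smoothTransition.zero_of_nonpos (x := x - 1) (by linarith [hlt h.le]), arc_zero,
        sub_zero, sub_zero]
      rcases hu0.eq_or_lt with h00 | h00
      · rw [h0 h00.symm, ← h00]
        apply segmentAvoidsZero_of_re <;> simp [arc]
      · apply SegmentAvoidsZero.symm
        apply segmentAvoidsZero_of_halfPlane 0 1 _ _ (one_sub_two_arc_ne_zero _)
        · have := arc_im_nonpos x
          simp; linarith
        · have := arc_im_neg (smoothTransition_pos (x := 2 * u) (by linarith))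
            (smoothTransition_lt_one (by linarith))
          simp; linarith
    · rw [Real.smoothTransition.one_of_one_le (x := 2 * u) (by linarith),
        Real.smoothTransition.one_of_one_le (x := x) (by linarith [hgt h])]
      apply segmentAvoidsZero_of_halfPlane (-1) 0
      · simp [arc]; linarith
      · simp [arc]; linarith
      · intro h
        have := congrArg Complex.re h
        simp [arc] at this; linarith
  · have h1 : linBlock none (2 + 1) u - linBlock none 2 u =
        -2 + arc (Real.smoothTransition (2 * u)) + 2 * arc (Real.smoothTransition (2 * u - 1)) := by
      rw [n3]; simp [linBlock, n1, n2]; ring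
    have h2 : letterBlock none q (2 + 1) x - letterBlock none q 2 x =
        -2 + arc (Real.smoothTransition x) + 2 * arc (Real.smoothTransition (x - 1)) := by
      rw [n3]; simp [letterBlock, n1, n2]; ring
    rw [h1, h2]
    rcases le_or_gt u (1 / 2) with h | h
    · rw [Real.smoothTransition.zero_of_nonpos (x := 2 * u - 1) (by linarith),
        Real.smoothTransition.zero_of_nonpos (x := x - 1) (by linarith [hlt h])]
      apply segmentAvoidsZero_of_halfPlane (-1) 0
      · simp [arc]; linarith
      · simp [arc]; linarith
      · intro h
        have := congrArg Complex.re h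
        simp [arc] at this; linarith
    · rw [Real.smoothTransition.one_of_one_le (x := 2 * u) (by linarith),
        Real.smoothTransition.one_of_one_le (x := x) (by linarith [hgt h.le]), arc_one,
        show ∀ a : ℂ, -2 + 1 + 2 * a = -(1 - 2 * a) by intro a; ring,
        show ∀ a : ℂ, -2 + 1 + 2 * a = -(1 - 2 * a) by intro a; ring]
      apply SegmentAvoidsZero.symm
      apply segmentAvoidsZero_of_halfPlane 0 (-1) _ _ (neg_ne_zero.2 (one_sub_two_arc_ne_zero _))
      · have := arc_im_nonpos (x - 1)
        simp; linarith
      · have := arc_im_neg (smoothTransition_pos (x := 2 * u - 1) (by linarith))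
          (smoothTransition_lt_one (by linarith))
        simp; linarith

/-- The conditions at the times `1 / 4` and `3 / 4` synchronize the outer crossings `σ₂⁻¹` and `σ₂`
with the first and the last letter. The exchange then happens strictly between them on both sides,
and only one of the three motions has to be compared at a time. -/
theorem letterCondition_some_two (q : Bool) (k : ZMod 3) {u x : ℝ} (hu0 : 0 ≤ u)
    (hx0 : u = 0 → x = 0) (h1l : u ≤ 1 / 4 → x ≤ 1) (h1g : 1 / 4 ≤ u → 1 ≤ x)
    (h3l : u ≤ 3 / 4 → x ≤ 3) (h3g : 3 / 4 ≤ u → 3 ≤ x)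
    (hlt : u < 1 / 2 → x < 1 + exchangeTime q)
    (hgt : 1 / 2 < u → 1 + exchangeTime q < x) (heq : u = 1 / 2 → x = 1 + exchangeTime q)
    (hu1 : u < 1) :
    LetterCondition (some 2) q k u x := by
  have a' := pinch_re_nonneg (2 * u - 1 / 2)
  have b' := pinch_re_le (2 * u - 1 / 2)
  have c1' := pinch_im_le (2 * u - 1 / 2)
  have c2' := le_pinch_im (2 * u - 1 / 2)
  obtain ⟨e0, e1⟩ := exchange_re_mem q (x - 1)
  have n1 : (2 : ZMod 3) ≠ 0 := by decide
  have n2 : (2 : ZMod 3) ≠ 1 := by decide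
  have n3 : (2 : ZMod 3) + 1 = 0 := by decide
  have n5 : (2 : ZMod 3) = 1 + 1 := by decide
  obtain ⟨g0, g1⟩ := smoothTransition_mem (4 * u)
  obtain ⟨g0', g1'⟩ := smoothTransition_mem (4 * u - 3)
  obtain ⟨s0, s1⟩ := smoothTransition_mem x
  obtain ⟨s0', s1'⟩ := smoothTransition_mem (x - 3)
  have S0 : ∀ y : ℝ, y ≤ 0 → Real.smoothTransition y = 0 := fun _ =>
    Real.smoothTransition.zero_of_nonpos
  have S1 : ∀ y : ℝ, 1 ≤ y → Real.smoothTransition y = 1 := fun _ =>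
    Real.smoothTransition.one_of_one_le
  have E0 : ∀ y : ℝ, y ≤ 0 → exchange q y = 0 := fun y hy => by
    rw [exchange_of_le q (by linarith), S0 y hy]; simp [arcConj_zero]
  have E1 : ∀ y : ℝ, 2 ≤ y → exchange q y = 0 := fun y hy => by
    rw [exchange_of_ge q (by linarith), S1 (y - 1) (by linarith)]; simp [arcConj_one]
  have hq := pinch_of_nonpos (u := 2 * u - 1 / 2)
  have hq' := pinch_of_one_le (u := 2 * u - 1 / 2)
  have hcases : u < 1 / 4 ∨ (1 / 4 ≤ u ∧ u ≤ 3 / 4) ∨ 3 / 4 < u := by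
    rcases lt_or_ge u (1 / 4) with h | h
    · exact Or.inl h
    · rcases le_or_gt u (3 / 4) with h' | h'
      · exact Or.inr (Or.inl ⟨h, h'⟩)
      · exact Or.inr (Or.inr h')
  have hcases' : u < 1 / 4 ∨ (1 / 4 ≤ u ∧ u < 3 / 4) ∨ 3 / 4 ≤ u := by
    rcases lt_or_ge u (1 / 4) with h | h
    · exact Or.inl h
    · rcases lt_or_ge u (3 / 4) with h' | h'
      · exact Or.inr (Or.inl ⟨h, h'⟩)
      · exact Or.inr (Or.inr h')
  have zero_pinch : ∀ h : u < 1 / 4, pinch (2 * u - 1 / 2) = 0 ∧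
      Real.smoothTransition (4 * u - 3) = 0 ∧ exchange q (x - 1) = 0 ∧
      Real.smoothTransition (x - 3) = 0 := fun h =>
    have := h1l h.le
    ⟨hq (by linarith), S0 _ (by linarith), E0 _ (by linarith), S0 _ (by linarith)⟩
  have mid_pinch : ∀ h : 1 / 4 ≤ u ∧ u ≤ 3 / 4, Real.smoothTransition (4 * u - 3) = 0 ∧
      Real.smoothTransition (4 * u) = 1 ∧ Real.smoothTransition (x - 3) = 0 ∧
      Real.smoothTransition x = 1 := fun h =>
    have := h3l h.2
    ⟨S0 _ (by linarith), S1 _ (by linarith), S0 _ (by linarith), S1 _ (h1g h.1)⟩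
  have last_pinch : ∀ h : 3 / 4 ≤ u, pinch (2 * u - 1 / 2) = 0 ∧
      Real.smoothTransition (4 * u) = 1 ∧ exchange q (x - 1) = 0 ∧
      Real.smoothTransition x = 1 := fun h =>
    have := h3g h
    ⟨hq' (by linarith), S1 _ (by linarith), E1 _ (by linarith), S1 _ (by linarith)⟩
  rcases zmod_three_cases k with rfl | rfl | rfl
  · left
    have h1 : linBlock (some 2) (0 + 1) u - linBlock (some 2) 0 u =
        1 + arc (Real.smoothTransition (4 * u)) - arcConj (Real.smoothTransition (4 * u - 3))
          - pinch (2 * u - 1 / 2) := by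
      simp [linBlock, n1, n2]
    have h2 : letterBlock (some 2) q (0 + 1) x - letterBlock (some 2) q 0 x =
        1 + arc (Real.smoothTransition x) - arcConj (Real.smoothTransition (x - 3))
          - exchange q (x - 1) := by
      simp [letterBlock, n1, n2]
    rw [h1, h2]
    rcases hcases with h | h | h
    · obtain ⟨r1, r2, r3, r4⟩ := zero_pinch h
      rw [r1, r2, r3, r4]
      apply segmentAvoidsZero_of_re <;> simp [arc, arcConj] <;> linarith
    · obtain ⟨r1, r2, r3, r4⟩ := mid_pinch h
      rw [r1, r2, r3, r4]
      apply segmentAvoidsZero_of_re <;> simp [arc, arcConj, -one_div] <;> linarith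
    · obtain ⟨r1, r2, r3, r4⟩ := last_pinch h.le
      rw [r1, r2, r3, r4]
      apply segmentAvoidsZero_of_re <;> simp [arc, arcConj] <;> linarith
  · left
    have h1 : linBlock (some 2) (1 + 1) u - linBlock (some 2) 1 u =
        1 - 2 * arc (Real.smoothTransition (4 * u))
          + 2 * arcConj (Real.smoothTransition (4 * u - 3)) - pinch (2 * u - 1 / 2) := by
      rw [← n5]; simp [linBlock, n1, n2]; ring
    have h2 : letterBlock (some 2) q (1 + 1) x - letterBlock (some 2) q 1 x =
        1 - 2 * arc (Real.smoothTransition x)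
          + 2 * arcConj (Real.smoothTransition (x - 3)) - exchange q (x - 1) := by
      rw [← n5]; simp [letterBlock, n1, n2]; ring
    rw [h1, h2]
    rcases hcases with h | h | h
    · obtain ⟨r1, r2, r3, r4⟩ := zero_pinch h
      rw [r1, r2, r3, r4, arcConj_zero, mul_zero, add_zero, add_zero, sub_zero, sub_zero]
      rcases hu0.eq_or_lt with h00 | h00
      · rw [hx0 h00.symm, ← h00]
        apply segmentAvoidsZero_of_re <;> simp [arc]
      · apply SegmentAvoidsZero.symm
        apply segmentAvoidsZero_of_halfPlane 0 1 _ _ (one_sub_two_arc_ne_zero _)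
        · have := arc_im_nonpos x
          simp; linarith
        · have := arc_im_neg (smoothTransition_pos (x := 4 * u) (by linarith))
            (smoothTransition_lt_one (by linarith))
          simp; linarith
    · obtain ⟨r1, r2, r3, r4⟩ := mid_pinch h
      rw [r1, r2, r3, r4]
      apply segmentAvoidsZero_of_halfPlane (-1) 0
      · simp [arc, arcConj, -one_div]; linarith
      · simp [arc, arcConj]; linarith
      · intro h
        have := congrArg Complex.re h
        simp [arc, arcConj, -one_div] at this; linarith
    · obtain ⟨r1, r2, r3, r4⟩ := last_pinch h.le
      rw [r1, r2, r3, r4, arc_one, show ∀ a : ℂ, 1 - 2 * 1 + 2 * a - 0 = -(1 - 2 * a) by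
        intro a; ring, show ∀ a : ℂ, 1 - 2 * 1 + 2 * a - 0 = -(1 - 2 * a) by intro a; ring]
      apply SegmentAvoidsZero.symm
      apply segmentAvoidsZero_of_halfPlane 0 1 _ _ (neg_ne_zero.2 (one_sub_two_arcConj_ne_zero _))
      · simp [arcConj]; nlinarith
      · have h1 := smoothTransition_pos (x := 4 * u - 3) (by linarith)
        have h2 := smoothTransition_lt_one (x := 4 * u - 3) (by linarith)
        simp [arcConj]; nlinarith
  · have h1 : ∀ u, linBlock (some 2) (2 + 1) u - linBlock (some 2) 2 u =
        -2 + arc (Real.smoothTransition (4 * u)) - arcConj (Real.smoothTransition (4 * u - 3))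
          + 2 * pinch (2 * u - 1 / 2) := by
      intro u; rw [n3]; simp [linBlock, n1, n2]; ring
    have h2 : ∀ x, letterBlock (some 2) q (2 + 1) x - letterBlock (some 2) q 2 x =
        -2 + arc (Real.smoothTransition x) - arcConj (Real.smoothTransition (x - 3))
          + 2 * exchange q (x - 1) := by
      intro u; rw [n3]; simp [letterBlock, n1, n2]; ring
    by_cases hu : u = 1 / 2
    · obtain ⟨r, hr, hd⟩ := one_sub_two_pinch_hasDerivAt
      obtain ⟨c, hc, hd'⟩ := exchange_hasDerivAt q
      obtain rfl := heq hu
      subst hu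
      have hE : HasDerivAt (fun x => exchange q (x - 1)) c (1 + exchangeTime q) := by
        refine HasDerivAt.comp_sub_const _ _ ?_
        rwa [add_sub_cancel_left]
      have h1' : (1 : ℝ) < 1 + exchangeTime q ∧ 1 + exchangeTime q < 3 := by
        cases q <;> norm_num [exchangeTime]
      have h3 : (fun x => letterBlock (some 2) q (2 + 1) x - letterBlock (some 2) q 2 x)
          =ᶠ[nhds (1 + exchangeTime q)] fun x => 2 * exchange q (x - 1) - 1 := by
        filter_upwards [Ioo_mem_nhds h1'.1 h1'.2] with x hx
        rw [h2, S1 _ hx.1.le, S0 (x - 3) (by linarith [hx.2]), arc_one, arcConj_zero]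
        ring
      refine Or.inr ⟨by norm_num, (linBlock_eq_iff _ _ (by norm_num) (by norm_num)).2 ⟨rfl, rfl⟩,
        sub_eq_zero.1 ?_, fun t ht => ?_⟩
      · refine h3.eq_of_nhds.trans ?_
        rw [add_sub_cancel_left, exchange_double]
        norm_num
      · obtain ⟨r, hr, hd⟩ := linBlock_hasDerivAt_two
        rw [linBlock_isBlockSystem.deriv_sub (fun _ => rfl) hd, letterBlock_deriv_sub (fun _ => rfl)
          (((hE.const_mul 2).sub_const 1).congr_of_eventuallyEq h3)]
        apply SegmentAvoidsZero.symm
        apply segmentAvoidsZero_of_halfPlane 0 (-1) <;> simp [hr, hc, ht.ne']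
    · left
      rw [linBlock_two_sub, h2]
      rcases hcases' with h | h | h
      · obtain ⟨r1, r2, r3, r4⟩ := zero_pinch h
        rw [r1, r2, r3, r4]
        apply segmentAvoidsZero_of_halfPlane (-1) 0
        · simp [arc, arcConj]; linarith
        · simp [arc, arcConj]; linarith
        · intro h
          have := congrArg Complex.re h
          simp [arc, arcConj] at this; linarith
      · obtain ⟨r1, r2, r3, r4⟩ := mid_pinch ⟨h.1, h.2.le⟩
        rw [r1, r2, r3, r4, arc_one, arcConj_zero,
          show ∀ a : ℂ, -2 + 1 - 0 + 2 * a = -1 * (1 - 2 * a) by intro a; ring,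
          show ∀ a : ℂ, -2 + 1 - 0 + 2 * a = -1 * (1 - 2 * a) by intro a; ring]
        refine (segmentAvoidsZero_exchange q (by linarith) (by linarith) (fun h' => ?_)
          (fun h' => ?_) (fun h' => ?_) fun h' => hu ?_).mul (by norm_num)
        · have : u = 1 / 4 := by linarith
          linarith [h1l this.le, h1g this.ge]
        · linarith [hlt (by linarith)]
        · linarith [hgt (by linarith)]
        · linarith
      · obtain ⟨r1, r2, r3, r4⟩ := last_pinch h
        rw [r1, r2, r3, r4]
        apply segmentAvoidsZero_of_halfPlane (-1) 0
        · simp [arc, arcConj]; linarith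
        · simp [arc, arcConj]; linarith
        · intro h
          have := congrArg Complex.re h
          simp [arc, arcConj] at this; linarith

/-- Only the order of events matters: any strictly increasing change of time with the right values
at the quarters of the block will do. -/
theorem letterCondition (b : Option (ZMod 3)) (q : Bool) (k : ZMod 3) {T : ℝ → ℝ}
    (hT : StrictMono T) (hn : ∀ s : ℕ, s ≤ 4 → T (s / 4) = chunkNode b q s) {u : ℝ} (hu0 : 0 ≤ u)
    (hu1 : u < 1) : LetterCondition b q k u (T u) := by
  have n1 : (2 : ZMod 3) ≠ 0 := by decide
  have n2 : (2 : ZMod 3) ≠ 1 := by decide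
  have h0 := hn 0 (by norm_num)
  have h1 := hn 1 (by norm_num)
  have h2 := hn 2 (by norm_num)
  have h3 := hn 3 (by norm_num)
  rw [Nat.cast_zero, zero_div] at h0
  rw [Nat.cast_one] at h1
  rw [Nat.cast_ofNat, show (2 / 4 : ℝ) = 1 / 2 by norm_num] at h2
  rw [Nat.cast_ofNat] at h3
  have z : chunkNode b q 0 = 0 := by simp [chunkNode]
  have lt : ∀ {v c : ℝ}, T v = c → u < v → T u < c := fun e h => e ▸ hT h
  have gt : ∀ {v c : ℝ}, T v = c → v < u → c < T u := fun e h => e ▸ hT h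
  have le : ∀ {v c : ℝ}, T v = c → u ≤ v → T u ≤ c := fun e h => e ▸ hT.monotone h
  have ge : ∀ {v c : ℝ}, T v = c → v ≤ u → c ≤ T u := fun e h => e ▸ hT.monotone h
  have eq : ∀ {v c : ℝ}, T v = c → u = v → T u = c := fun e h => h ▸ e
  have e0 : u = 0 → T u = 0 := fun h => by rw [h, h0, z]
  rcases b with _ | c
  · simp only [chunkNode, if_true, reduceCtorEq, if_false] at h2
    exact letterCondition_none q k hu0 hu1 e0 (le h2) (ge h2)
  rcases zmod_three_cases c with rfl | rfl | rfl
  · simp only [chunkNode, Option.some.injEq, n1.symm, reduceCtorEq, if_false] at h2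
    exact letterCondition_some_zero q k hu0 hu1 e0 (lt h2) (gt h2) (eq h2)
  · simp only [chunkNode, Option.some.injEq, n2.symm, reduceCtorEq, if_false] at h2
    exact letterCondition_some_one q k hu0 hu1 e0 (lt h2) (gt h2) (eq h2)
  · simp only [chunkNode, if_true, reduceCtorEq, if_false] at h1 h2 h3
    exact letterCondition_some_two q k hu0 e0 (le h1) (ge h1) (le h3) (ge h3) (lt h2) (gt h2)
      (eq h2) hu1

theorem chunkNode_zero (b : Option (ZMod 3)) (q : Bool) : chunkNode b q 0 = 0 := by
  simp [chunkNode]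

theorem chunkNode_four (b : Option (ZMod 3)) (q : Bool) : chunkNode b q 4 = chunkLength b := by
  unfold chunkNode chunkLength
  split_ifs <;> simp

/-- The bound is attained next to a double point: the time `1 / 2` is halved, or the time `3 / 2`
leaves `1 / 2` to be halved. It serves as the slope at the nodes in `letterTime`. -/
theorem chunkNode_gap (b : Option (ZMod 3)) (q : Bool) {s : ℕ} (hs : s < 4) :
    1 / 4 ≤ chunkNode b q (s + 1) - chunkNode b q s := by
  unfold chunkNode exchangeTime
  interval_cases s <;> split_ifs <;> norm_num

/-! ### The curve read from the letters, and its change of time -/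

section LetterCurve

variable (W : ChordWord 3) (q : ℕ → Bool)

/-- The position of the strand before a letter. -/
def letterPos (j : ℤ) : ℕ :=
  strandPos (standardBraid W q) (j % ((3 * (standardBraid W q).length : ℕ) : ℤ)).toNat

/-- The letters along the knot. -/
def letterAt (j : ℤ) : Option (Letter 3) :=
  (standardBraid W q)[(j % ((3 * (standardBraid W q).length : ℕ) : ℤ)).toNat %
    (standardBraid W q).length]?

/-- The strand along a letter. -/
noncomputable def letterPath (j : ℤ) (u : ℝ) : ℂ :=
  match letterAt W q j with
  | some g => g.path (letterPos W q j) u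
  | none => letterPos W q j

/-- The curve in the complex plane that describes a standard knot. -/
noncomputable def letterCurve (y : ℝ) : ℂ :=
  glue (letterPath W q) ((standardBraid W q).length * y)

/-- The factor in `closedBraid` is the one of the radial projection, since the first homogeneous
coordinate has norm 1. -/
theorem standardKnot_eq : standardKnot W q = braidKnot (letterCurve W q) := by
  funext t
  unfold standardKnot closedBraid braidKnot radialProj braidCurve letterCurve glue letterPath
    letterAt letterPos
  have h : ((3 : ℕ) : ℝ) * ((standardBraid W q).length : ℝ) * t =
      (standardBraid W q).length * (3 * t) := by push_cast; ring
  dsimp only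
  rw [h, norm_turn, one_pow]
  have key : ∀ z : ℂ, ((((√(1 + ‖z‖ ^ 2))⁻¹ : ℝ) : ℂ) *
      Complex.exp (2 * Real.pi * ((3 : ℕ) : ℂ) * t * Complex.I), (((√(1 + ‖z‖ ^ 2))⁻¹ : ℝ) : ℂ) * z) =
      (√(1 + ‖z‖ ^ 2))⁻¹ • (turn (3 * t), z) := fun z => by
    refine Prod.ext ?_ ?_
    · simp only [Prod.smul_fst, Complex.real_smul, turn]
      congr 2
      push_cast
      ring
    · simp only [Prod.smul_snd, Complex.real_smul]
  generalize (standardBraid W q)[(⌊((standardBraid W q).length : ℝ) * (3 * t)⌋ %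
    ((3 * (standardBraid W q).length : ℕ) : ℤ)).toNat % (standardBraid W q).length]? = o
  cases o <;> exact key _

theorem length_standardBraid_pos : 0 < (standardBraid W q).length := by
  rw [← chunkStart_last, chunkStart_succ W q _ (by omega), length_chunkWord, chunkLength]
  split_ifs <;> omega

theorem letterPos_add (j : ℤ) :
    letterPos W q (j + (3 * (standardBraid W q).length : ℕ)) = letterPos W q j := by
  rw [letterPos, Int.add_emod_right, letterPos]

theorem letterAt_add (j : ℤ) :
    letterAt W q (j + (3 * (standardBraid W q).length : ℕ)) = letterAt W q j := by
  rw [letterAt, Int.add_emod_right, letterAt]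

theorem letterPos_add_one (j : ℤ) {g : Letter 3} (h : letterAt W q j = some g) :
    letterPos W q (j + 1) = g.act (letterPos W q j) := by
  have hL := length_standardBraid_pos W q
  -- After three rounds the strand is at position 0 again. This covers the case where `j + 1` wraps
  -- around to the residue 0.
  have hm := strandPos_mul W q 3
  have hz : ((3 : ℕ) : ZMod 3).val = 0 := rfl
  rw [hz] at hm
  unfold letterAt at h
  unfold letterPos
  generalize hM : 3 * (standardBraid W q).length = M at *
  have hM0 : 0 < M := by omega
  obtain ⟨r, hr⟩ : ∃ r : ℕ, j % (M : ℤ) = r :=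
    ⟨_, (Int.toNat_of_nonneg (Int.emod_nonneg _ (by omega))).symm⟩
  have hlt : r < M := by
    have := Int.emod_lt_of_pos j (show (0 : ℤ) < M by omega)
    omega
  have hs : strandPos (standardBraid W q) (r + 1) = g.act (strandPos (standardBraid W q) r) := by
    rw [strandPos]
    rw [hr] at h
    simp only [Int.toNat_natCast] at h
    rw [h]
  rw [← Int.emod_add_emod, hr]
  simp only [Int.toNat_natCast]
  rw [← hs]
  rcases Nat.lt_or_ge (r + 1) M with h1 | h1
  · rw [Int.emod_eq_of_lt (by omega) (by omega)]
    rfl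
  · obtain rfl : r + 1 = M := by omega
    have : ((r : ℤ) + 1) % ((r + 1 : ℕ) : ℤ) = 0 := by push_cast; simp
    rw [this, hm]
    rfl

theorem Letter.contDiff_path (g : Letter 3) (p : ℕ) : ContDiff ℝ ∞ (g.path p) := by
  have h : ContDiff ℝ ∞ fun u : ℝ => (Real.smoothTransition u : ℂ) :=
    Complex.ofRealCLM.contDiff.comp Real.smoothTransition.contDiff
  unfold Letter.path
  dsimp only
  split_ifs
  · have : ∀ u : ℝ, (⟨g.idx + Real.smoothTransition u, g.sign * (Real.smoothTransition u *
        (1 - Real.smoothTransition u))⟩ : ℂ) = g.idx + (Real.smoothTransition u : ℂ) +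
        g.sign * ((Real.smoothTransition u : ℂ) * (1 - Real.smoothTransition u)) * Complex.I := by
      intro u; apply Complex.ext <;> simp
    simp only [this]
    exact (contDiff_const.add h).add ((contDiff_const.mul (h.mul (contDiff_const.sub h))).mul
      contDiff_const)
  · have : ∀ u : ℝ, (⟨g.idx + 1 - Real.smoothTransition u, -(g.sign * (Real.smoothTransition u *
        (1 - Real.smoothTransition u)))⟩ : ℂ) = g.idx + 1 - (Real.smoothTransition u : ℂ) -
        g.sign * ((Real.smoothTransition u : ℂ) * (1 - Real.smoothTransition u)) * Complex.I := by
      intro u; apply Complex.ext <;> simp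
    simp only [this]
    exact (contDiff_const.sub h).sub ((contDiff_const.mul (h.mul (contDiff_const.sub h))).mul
      contDiff_const)
  · exact contDiff_const

theorem Letter.path_of_nonpos (g : Letter 3) (p : ℕ) {u : ℝ} (h : u ≤ 0) : g.path p u = p := by
  rw [Letter.path, Real.smoothTransition.zero_of_nonpos h]
  split_ifs with h1 h2 <;> apply Complex.ext <;> simp [*]

theorem Letter.path_of_one_le (g : Letter 3) (p : ℕ) {u : ℝ} (h : 1 ≤ u) :
    g.path p u = g.act p := by
  rw [Letter.path, Real.smoothTransition.one_of_one_le h, Letter.act, Equiv.swap_apply_def]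
  split_ifs with h1 h2 <;> apply Complex.ext <;> simp [*]

theorem letterCurve_contDiff : ContDiff ℝ ∞ (letterCurve W q) := by
  refine (contDiff_glue (A := fun j _ => (letterPos W q j : ℂ)) (fun j => ?_)
    (fun j => contDiff_const) (fun j u hu => ?_) fun j u hu => ?_).comp
    (contDiff_const.mul contDiff_id)
  · unfold letterPath
    rcases letterAt W q j with _ | g
    · exact contDiff_const
    · exact g.contDiff_path _
  · unfold letterPath
    rcases letterAt W q j with _ | g
    · rfl
    · exact g.path_of_nonpos _ hu
  · unfold letterPath
    rcases h : letterAt W q j with _ | g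
    · exfalso
      rw [letterAt, List.getElem?_eq_none_iff] at h
      have := Nat.mod_lt (j % ((3 * (standardBraid W q).length : ℕ) : ℤ)).toNat
        (length_standardBraid_pos W q)
      omega
    · rw [letterPos_add_one W q j h]
      exact g.path_of_one_le _ hu

theorem letterCurve_add_three (y : ℝ) : letterCurve W q (y + 3) = letterCurve W q y := by
  have := glue_add_int (B := letterPath W q) (C := letterPath W q)
    (k := (3 * (standardBraid W q).length : ℕ)) (fun j u => by
      rw [letterPath, letterAt_add, letterPos_add]; rfl) ((standardBraid W q).length * y)
  rw [letterCurve, letterCurve, ← this]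
  congr 1
  push_cast
  ring

/-- The number of letters before a block. -/
def blockStart (j : ℤ) : ℤ := j / (W.tails.length + 1 : ℕ) * (standardBraid W q).length +
  chunkStart W q (j % (W.tails.length + 1 : ℕ)).toNat

/-- The choice of the smashed crossing in a block. -/
def blockChoice (j : ℤ) : Bool := q (j % (W.tails.length + 1 : ℕ)).toNat

theorem blockChoice_add (j : ℤ) :
    blockChoice W q (j + (W.tails.length + 1 : ℕ)) = blockChoice W q j := by
  rw [blockChoice, Int.add_emod_right, blockChoice]

theorem blockStart_add (j : ℤ) : blockStart W q (j + (W.tails.length + 1 : ℕ)) =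
    blockStart W q j + (standardBraid W q).length := by
  have h : ((W.tails.length + 1 : ℕ) : ℤ) ≠ 0 := by positivity
  rw [blockStart, blockStart, Int.add_emod_right, Int.add_ediv_of_dvd_right dvd_rfl, Int.ediv_self h]
  ring

theorem block_mod (w : List (ZMod 3)) (j : ℤ) : ∃ i : ℕ, i < w.length + 1 ∧
    j % (w.length + 1 : ℕ) = i := by
  have h1 := Int.emod_nonneg j (show ((w.length + 1 : ℕ) : ℤ) ≠ 0 by positivity)
  have h2 := Int.emod_lt_of_pos j (show (0 : ℤ) < (w.length + 1 : ℕ) by positivity)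
  exact ⟨_, by omega, (Int.toNat_of_nonneg h1).symm⟩

theorem blockStart_add_one (j : ℤ) :
    blockStart W q (j + 1) = blockStart W q j + chunkLength (blockSym W.tails j) := by
  obtain ⟨i, hi, hr⟩ := block_mod W.tails j
  have hi' : i < W.length + 1 := by rwa [W.length_tails] at hi
  have hlen : (chunkWord W.tails[i]? (q i)).length = chunkLength (blockSym W.tails j) := by
    rw [length_chunkWord, blockSym, hr, Int.toNat_natCast]
  have hs := chunkStart_succ W q i hi'
  rw [hlen] at hs
  rw [blockStart, blockStart, hr, Int.toNat_natCast]
  rcases h : blockSym W.tails j with _ | c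
  · have hd := div_add_one_of_blockSym_eq_none _ _ h
    rw [h] at hs
    rw [blockSym, hr, Int.toNat_natCast, List.getElem?_eq_none_iff] at h
    obtain rfl : i = W.tails.length := by omega
    have hm : (j + 1) % ((W.tails.length + 1 : ℕ) : ℤ) = 0 := by
      have h1 := Int.emod_add_mul_ediv (j + 1) ((W.tails.length + 1 : ℕ) : ℤ)
      have h2 := Int.emod_add_mul_ediv j ((W.tails.length + 1 : ℕ) : ℤ)
      rw [hd, mul_add, mul_one] at h1
      rw [hr] at h2
      push_cast at *
      linarith
    rw [W.length_tails, chunkStart_last, ← W.length_tails] at hs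
    rw [hd, hm, hs]
    push_cast [chunkStart_zero, Int.toNat_zero]
    ring
  · have hd := div_add_one_of_blockSym_eq_some _ _ h
    have hm : (j + 1) % ((W.tails.length + 1 : ℕ) : ℤ) = (i + 1 : ℕ) := by
      have h1 := Int.emod_add_mul_ediv (j + 1) ((W.tails.length + 1 : ℕ) : ℤ)
      have h2 := Int.emod_add_mul_ediv j ((W.tails.length + 1 : ℕ) : ℤ)
      rw [hd] at h1
      rw [hr] at h2
      push_cast at *
      linarith
    rw [hd, hm, Int.toNat_natCast, hs, h]
    push_cast
    ring

theorem exists_letter_mod (j : ℤ) {s : ℕ} (hs : s < chunkLength (blockSym W.tails j)) :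
    ∃ p i : ℕ, i < W.length + 1 ∧ blockSym W.tails j = W.tails[i]? ∧ blockChoice W q j = q i ∧
      blockStrand W.tails j = (p : ZMod 3) ∧
      ((blockStart W q j + s) % ((3 * (standardBraid W q).length : ℕ) : ℤ)).toNat =
        p * (standardBraid W q).length + (chunkStart W q i + s) := by
  obtain ⟨i, hi, hr⟩ := block_mod W.tails j
  have hi' : i < W.length + 1 := by rwa [W.length_tails] at hi
  have hsym : blockSym W.tails j = W.tails[i]? := by rw [blockSym, hr, Int.toNat_natCast]
  have hlt := chunkStart_add_lt W q i s hi' (by rwa [length_chunkWord, ← hsym])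
  obtain ⟨p, hp, hpm⟩ : ∃ p : ℕ, p < 3 ∧ j / ((W.tails.length + 1 : ℕ) : ℤ) % 3 = p := by
    have h1 := Int.emod_nonneg (j / ((W.tails.length + 1 : ℕ) : ℤ)) (show (3 : ℤ) ≠ 0 by norm_num)
    have h2 := Int.emod_lt_of_pos (j / ((W.tails.length + 1 : ℕ) : ℤ)) (show (0 : ℤ) < 3 by norm_num)
    exact ⟨_, by omega, (Int.toNat_of_nonneg h1).symm⟩
  refine ⟨p, i, hi', hsym, by rw [blockChoice, hr, Int.toNat_natCast], ?_, ?_⟩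
  · rw [blockStrand, ← Int.cast_natCast (R := ZMod 3) p, ZMod.intCast_eq_intCast_iff, ← hpm]
    exact (Int.mod_modEq _ _).symm
  · have hb : blockStart W q j + s = ((p * (standardBraid W q).length + (chunkStart W q i + s) : ℕ) : ℤ)
        + ((3 * (standardBraid W q).length : ℕ) : ℤ) *
          (j / ((W.tails.length + 1 : ℕ) : ℤ) / 3) := by
      have := Int.emod_add_mul_ediv (j / ((W.tails.length + 1 : ℕ) : ℤ)) 3
      rw [hpm] at this
      rw [blockStart, hr, Int.toNat_natCast]
      push_cast at *
      linear_combination (-(standardBraid W q).length : ℤ) * this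
    rw [hb, Int.add_mul_emod_self_left, Int.emod_eq_of_lt (by positivity), Int.toNat_natCast]
    have : p * (standardBraid W q).length ≤ 2 * (standardBraid W q).length :=
      Nat.mul_le_mul_right _ (by omega)
    norm_cast
    omega

theorem letterCurve_block (j : ℤ) {x : ℝ} (h0 : 0 ≤ x)
    (h1 : x < chunkLength (blockSym W.tails j)) :
    letterCurve W q ((blockStart W q j + x) / (standardBraid W q).length) =
      letterBlock (blockSym W.tails j) (blockChoice W q j) (blockStrand W.tails j) x := by
  have hL : ((standardBraid W q).length : ℝ) ≠ 0 := by
    have := length_standardBraid_pos W q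
    positivity
  obtain ⟨s, hs⟩ : ∃ s : ℕ, ⌊x⌋ = s := ⟨_, (Int.toNat_of_nonneg (Int.floor_nonneg.2 h0)).symm⟩
  have hsx : (s : ℝ) ≤ x := by
    have := Int.floor_le x
    rwa [hs, Int.cast_natCast] at this
  have hxs : x < s + 1 := by
    have := Int.lt_floor_add_one x
    rwa [hs, Int.cast_natCast] at this
  have hlt : s < chunkLength (blockSym W.tails j) := by
    have : (s : ℝ) < chunkLength (blockSym W.tails j) := hsx.trans_lt h1
    exact_mod_cast this
  obtain ⟨p, i, hi, hsym, hq, hstr, hmod⟩ := exists_letter_mod W q j hlt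
  have hlt' : s < (chunkWord W.tails[i]? (q i)).length := by rwa [length_chunkWord, ← hsym]
  rw [letterCurve, mul_div_cancel₀ _ hL, show (blockStart W q j : ℝ) + x =
    ((blockStart W q j + s : ℤ) : ℝ) + (x - s) by push_cast; ring,
    glue_int_add _ _ (by linarith) (by linarith), letterPath]
  have hat : letterAt W q (blockStart W q j + s) = (chunkWord W.tails[i]? (q i))[s]? := by
    rw [letterAt, hmod, Nat.mul_comm, Nat.mul_add_mod, Nat.mod_eq_of_lt
      (chunkStart_add_lt W q i s hi hlt'), standardBraid_getElem W q i s hi hlt']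
  have hpos : letterPos W q (blockStart W q j + s) =
      actWord ((chunkWord W.tails[i]? (q i)).take s) (p : ZMod 3).val := by
    rw [letterPos, hmod, strandPos_chunk W q p i s hi hlt']
  rw [hat, hpos, List.getElem?_eq_getElem hlt']
  dsimp only
  rw [letterBlock_eq_path _ _ (p : ZMod 3) s _ (List.getElem?_eq_getElem hlt')
    (by linarith : 0 ≤ x - s) (by linarith), hsym, hq, hstr]
  congr 1
  ring

/-- The nodes of the change of the time from blocks to letters. -/
noncomputable def blockNode (m : ℤ) : ℝ := blockStart W q (m / 4) +
  chunkNode (blockSym W.tails (m / 4)) (blockChoice W q (m / 4)) (m % 4).toNat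

theorem blockNode_mul_add (j : ℤ) {s : ℕ} (hs : s ≤ 4) : blockNode W q (4 * j + s) =
    blockStart W q j + chunkNode (blockSym W.tails j) (blockChoice W q j) s := by
  rcases hs.lt_or_eq with h | rfl
  · have h1 : (4 * j + s) / 4 = j := by omega
    have h2 : (4 * j + s) % 4 = s := by omega
    rw [blockNode, h1, h2, Int.toNat_natCast]
  · have h1 : (4 * j + (4 : ℕ)) / 4 = j + 1 := by omega
    have h2 : (4 * j + (4 : ℕ)) % 4 = 0 := by omega
    rw [blockNode, h1, h2, Int.toNat_zero, chunkNode_zero, chunkNode_four, blockStart_add_one]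
    push_cast
    ring

theorem blockNode_gap (m : ℤ) : 1 / 4 ≤ blockNode W q (m + 1) - blockNode W q m := by
  obtain ⟨j, s, hs, rfl⟩ : ∃ (j : ℤ) (s : ℕ), s < 4 ∧ m = 4 * j + s :=
    ⟨m / 4, (m % 4).toNat, by omega, by omega⟩
  have := blockNode_mul_add W q j (s := s + 1) (by omega)
  push_cast at this
  rw [add_assoc, this, blockNode_mul_add W q j hs.le]
  have := chunkNode_gap (blockSym W.tails j) (blockChoice W q j) hs
  linarith

theorem blockNode_add (m : ℤ) : blockNode W q (m + 4 * (W.tails.length + 1 : ℕ)) =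
    blockNode W q m + (standardBraid W q).length := by
  have h1 : (m + 4 * (W.tails.length + 1 : ℕ)) / 4 = m / 4 + (W.tails.length + 1 : ℕ) := by omega
  have h2 : (m + 4 * (W.tails.length + 1 : ℕ)) % 4 = m % 4 := by omega
  rw [blockNode, h1, h2, blockStart_add, blockSym_add, blockChoice_add, blockNode]
  push_cast
  ring

/-- The change of the time from blocks to letters. -/
noncomputable def letterTime (x : ℝ) : ℝ :=
  interp (blockNode W q) (1 / 4) ((4 * (W.tails.length + 1 : ℕ) : ℤ) * x) / (standardBraid W q).length

theorem letterTime_isReparam : IsReparam (letterTime W q) :=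
  interp_isReparam (by positivity) (by exact_mod_cast length_standardBraid_pos W q) (by norm_num)
    (blockNode_gap W q) (blockNode_add W q)

/-- The number of letters passed in a block. -/
noncomputable def blockTime (j : ℤ) (u : ℝ) : ℝ :=
  interp (blockNode W q) (1 / 4) (4 * (j + u)) - blockStart W q j

theorem blockTime_strictMono (j : ℤ) : StrictMono (blockTime W q j) := fun u v h => by
  have := interp_strictMono (by norm_num) (blockNode_gap W q)
    (show 4 * ((j : ℝ) + u) < 4 * (j + v) by linarith)
  unfold blockTime
  linarith

theorem blockTime_node (j : ℤ) (s : ℕ) (hs : s ≤ 4) : blockTime W q j (s / 4) =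
    chunkNode (blockSym W.tails j) (blockChoice W q j) s := by
  have : 4 * ((j : ℝ) + s / 4) = ((4 * j + s : ℤ) : ℝ) := by push_cast; ring
  rw [blockTime, this, interp_int, blockNode_mul_add W q j hs]
  ring

theorem blockTime_add (j : ℤ) (u : ℝ) :
    blockTime W q (j + (W.tails.length + 1 : ℕ)) u = blockTime W q j u := by
  have h := interp_add_int (ε := 1 / 4) (blockNode_add W q) (4 * (j + u))
  rw [blockTime, blockTime, blockStart_add]
  push_cast at *
  rw [show 4 * ((j : ℝ) + (W.tails.length + 1) + u) = 4 * (j + u) + 4 * (W.tails.length + 1) by ring, h]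
  ring

theorem blockTime_mem (j : ℤ) {u : ℝ} (h0 : 0 ≤ u) (h1 : u < 1) :
    0 ≤ blockTime W q j u ∧ blockTime W q j u < chunkLength (blockSym W.tails j) := by
  have e0 := blockTime_node W q j 0 (by norm_num)
  have e1 := blockTime_node W q j 4 (by norm_num)
  rw [chunkNode_zero] at e0
  rw [chunkNode_four] at e1
  norm_num at e0 e1
  exact ⟨e0 ▸ (blockTime_strictMono W q j).monotone h0, e1 ▸ blockTime_strictMono W q j h1⟩

theorem letterTime_apply (j : ℤ) (u : ℝ) :
    letterTime W q ((j + u) / (W.tails.length + 1 : ℕ)) =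
      (blockStart W q j + blockTime W q j u) / (standardBraid W q).length := by
  rw [letterTime, blockTime, add_sub_cancel]
  congr 2
  push_cast
  field_simp

theorem letterCurve_letterTime (j : ℤ) {u : ℝ} (h0 : 0 ≤ u) (h1 : u < 1) :
    letterCurve W q (letterTime W q ((j + u) / (W.tails.length + 1 : ℕ))) =
      letterBlock (blockSym W.tails j) (blockChoice W q j) (blockStrand W.tails j)
        (blockTime W q j u) := by
  obtain ⟨e0, e1⟩ := blockTime_mem W q j h0 h1
  rw [letterTime_apply, letterCurve_block W q j e0 e1]

theorem letterCurve_letterTime_add_one (j : ℤ) {u : ℝ} (h0 : 0 ≤ u) (h1 : u < 1) :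
    letterCurve W q (letterTime W q ((j + u) / (W.tails.length + 1 : ℕ) + 1)) =
      letterBlock (blockSym W.tails j) (blockChoice W q j) (blockStrand W.tails j + 1)
        (blockTime W q j u) := by
  rw [block_div_add_one, letterCurve_letterTime W q _ h0 h1, blockSym_add, blockChoice_add,
    blockStrand_add, blockTime_add]

theorem blockTime_hasDerivAt (j : ℤ) (u : ℝ) : ∃ a : ℝ, 0 < a ∧ HasDerivAt (blockTime W q j) a u := by
  have hd := ((contDiff_interp (y := blockNode W q) (ε := 1 / 4)).differentiable (by simp)
    (4 * (j + u))).hasDerivAt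
  have h0 : HasDerivAt (fun u : ℝ => 4 * ((j : ℝ) + u)) 4 u := by
    simpa using ((hasDerivAt_id u).const_add (j : ℝ)).const_mul 4
  exact ⟨_, mul_pos (interp_deriv_pos (by norm_num) (blockNode_gap W q) _) (by norm_num),
    (hd.comp u h0).sub_const _⟩

theorem letterCurve_letterTime_hasDerivAt (j : ℤ) {u a : ℝ} (h0 : 0 < u) (h1 : u < 1)
    (ha : HasDerivAt (blockTime W q j) a u) :
    deriv (fun x => letterCurve W q (letterTime W q x)) ((j + u) / (W.tails.length + 1 : ℕ)) =
      ((W.tails.length + 1 : ℕ) * a : ℝ) * deriv (letterBlock (blockSym W.tails j)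
        (blockChoice W q j) (blockStrand W.tails j)) (blockTime W q j u) := by
  have hN : (0 : ℝ) < (W.tails.length + 1 : ℕ) := by positivity
  set x := ((j : ℝ) + u) / (W.tails.length + 1 : ℕ) with hx
  have hux : (W.tails.length + 1 : ℕ) * x - j = u := by rw [hx]; field_simp; ring
  have he : (fun x => letterCurve W q (letterTime W q x)) =ᶠ[nhds x] fun x =>
      letterBlock (blockSym W.tails j) (blockChoice W q j) (blockStrand W.tails j)
        (blockTime W q j ((W.tails.length + 1 : ℕ) * x - j)) := by
    have hc : Continuous fun x : ℝ => (W.tails.length + 1 : ℕ) * x - (j : ℝ) := by fun_prop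
    have := hc.continuousAt.preimage_mem_nhds (Ioo_mem_nhds (hux.symm ▸ h0) (hux.symm ▸ h1))
    filter_upwards [this] with y hy
    rw [← letterCurve_letterTime W q j (le_of_lt hy.1) hy.2]
    congr 2
    field_simp
    ring
  have hd := ((letterBlock_contDiff (blockSym W.tails j) (blockChoice W q j)
    (blockStrand W.tails j)).differentiable (by simp) (blockTime W q j u)).hasDerivAt
  have hl : HasDerivAt (fun x : ℝ => (W.tails.length + 1 : ℕ) * x - (j : ℝ))
      (W.tails.length + 1 : ℕ) x := by
    simpa using ((hasDerivAt_id x).const_mul ((W.tails.length + 1 : ℕ) : ℝ)).sub_const (j : ℝ)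
  have ha' : HasDerivAt (blockTime W q j) a ((W.tails.length + 1 : ℕ) * x - j) := hux.symm ▸ ha
  have hd' : HasDerivAt (letterBlock (blockSym W.tails j) (blockChoice W q j)
      (blockStrand W.tails j)) _ (blockTime W q j ((W.tails.length + 1 : ℕ) * x - j)) :=
    hux.symm ▸ hd
  have hb : HasDerivAt (fun x : ℝ => blockTime W q j ((W.tails.length + 1 : ℕ) * x - j))
      (a * (W.tails.length + 1 : ℕ)) x :=
    HasDerivAt.comp (h := fun x : ℝ => (W.tails.length + 1 : ℕ) * x - (j : ℝ)) x ha' hl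
  have hc := HasDerivAt.scomp (h := fun x => blockTime W q j ((W.tails.length + 1 : ℕ) * x - j)) x hd' hb
  refine he.deriv_eq.trans (hc.deriv.trans ?_)
  rw [Complex.real_smul, mul_comm a, hux]

theorem linBlock_isotopic_letterCurve :
    SingularIsotopic (braidKnot (strandCurve linBlock W.tails))
        (braidKnot fun x => letterCurve W q (letterTime W q x)) ∧
      IsBraidLoop fun x => letterCurve W q (letterTime W q x) := by
  refine SingularIsotopic.of_linear (triCurve_isotopic_linBlock W.tails).2
    ((letterCurve_contDiff W q).comp (letterTime_isReparam W q).smooth) (fun x => ?_) fun x => ?_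
  · rw [(letterTime_isReparam W q).add_three, letterCurve_add_three]
  obtain ⟨j, u, h0, h1, rfl⟩ := exists_block W.tails x
  rw [letterCurve_letterTime W q j h0 h1, letterCurve_letterTime_add_one W q j h0 h1,
    strandCurve_apply _ _ h0 h1, strandCurve_apply_add_one _ _ h0 h1]
  rcases letterCondition (blockSym W.tails j) (blockChoice W q j) (blockStrand W.tails j)
    (blockTime_strictMono W q j) (blockTime_node W q j) h0 h1 with h | ⟨hu, h2, h3, h4⟩
  · exact Or.inl h
  · refine Or.inr ⟨h2, h3, ?_⟩
    -- The speed of the change of time multiplies both derivatives at the double point;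
    -- `LetterCondition` allows for an arbitrary positive factor for this reason.
    obtain ⟨a, ha, hd⟩ := blockTime_hasDerivAt W q j u
    have hd' : HasDerivAt (blockTime W q (j + (W.tails.length + 1 : ℕ))) a u := by
      rwa [funext (blockTime_add W q j)]
    rw [strandCurve_deriv _ _ hu h1, strandCurve_deriv_add_one _ _ hu h1,
      letterCurve_letterTime_hasDerivAt W q j hu h1 hd, block_div_add_one,
      letterCurve_letterTime_hasDerivAt W q _ hu h1 hd', blockSym_add, blockChoice_add,
      blockStrand_add, blockTime_add, ← mul_sub, ← mul_sub]
    have := (h4 a ha).mul (c := ((W.tails.length + 1 : ℕ) : ℂ)) (Nat.cast_ne_zero.2 (by omega))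
    convert this using 1
    push_cast
    ring

theorem triCurve_isotopic_standardKnot :
    SingularIsotopic (braidKnot (triCurve W.tails)) (standardKnot W q) := by
  rw [standardKnot_eq]
  have hloop := (linBlock_isotopic_letterCurve W q).2
  obtain ⟨σ, hσ, h1, h2⟩ := (letterTime_isReparam W q).exists_inverse
  have hK : IsBraidLoop (letterCurve W q) := by
    have := hloop.comp_reparam hσ
    simpa only [h2] using this
  exact ((triCurve_isotopic_linBlock W.tails).1.trans (linBlock_isotopic_letterCurve W q).1).trans
    (SingularIsotopic.of_braid_reparam hK (letterTime_isReparam W q))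

theorem standardKnot_isSingularKnot : IsSingularKnot (standardKnot W q) :=
  (triCurve_isotopic_standardKnot W q).right

theorem LetterCondition.eq_iff {b : Option (ZMod 3)} {q : Bool} {k : ZMod 3} {u x : ℝ}
    (h : LetterCondition b q k u x) :
    letterBlock b q (k + 1) x = letterBlock b q k x ↔ linBlock b (k + 1) u = linBlock b k u := by
  rcases h with h | ⟨-, h, h', -⟩
  · have h0 := h 0 (by simp)
    have h1 := h 1 (by simp)
    simp only [sub_zero, one_mul, zero_mul, add_zero, Complex.ofReal_zero, Complex.ofReal_one,
      sub_self, zero_add, ne_eq, sub_eq_zero] at h0 h1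
    exact ⟨fun e => absurd e h1, fun e => absurd e h0⟩
  · exact ⟨fun _ => h, fun _ => h'⟩

theorem letterCurve_eq_iff (j : ℤ) {u : ℝ} (h0 : 0 ≤ u) (h1 : u < 1) :
    letterCurve W q (letterTime W q ((j + u) / (W.tails.length + 1 : ℕ)) + 1) =
      letterCurve W q (letterTime W q ((j + u) / (W.tails.length + 1 : ℕ))) ↔
        blockSym W.tails j = some (blockStrand W.tails j) ∧ u = 1 / 2 := by
  rw [← (letterTime_isReparam W q).add_one, letterCurve_letterTime W q j h0 h1,
    letterCurve_letterTime_add_one W q j h0 h1, (letterCondition (blockSym W.tails j)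
    (blockChoice W q j) (blockStrand W.tails j) (blockTime_strictMono W q j)
    (blockTime_node W q j) h0 h1).eq_iff, linBlock_eq_iff _ _ h0 h1]

end LetterCurve

/-! ### Cyclic permutation -/

theorem Chord.tail_slide (g : Chord 3) : g.slide.tail = g.tail + 1 := by
  rcases g.cases_three with rfl | rfl | rfl <;> rfl

theorem triAngle_congr {w w' : List (ZMod 3)} (h : w.length = w'.length) (x : ℝ) :
    triAngle w x = triAngle w' x := by
  have hn : ∀ j, blockSym w j = none ↔ blockSym w' j = none := fun j => by
    rw [blockSym, blockSym, List.getElem?_eq_none_iff, List.getElem?_eq_none_iff, h]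
  unfold triAngle
  simp only [hn, h]

section Cyclic

variable (w : List (ZMod 3)) (c : ZMod 3)

/-- The times of the middles of the blocks after a cyclic permutation. -/
noncomputable def cyclicNode (m : ℤ) : ℝ :=
  (m / (w.length + 2 : ℕ) * (w.length + 2 : ℕ) : ℤ) +
    (if m % (w.length + 2 : ℕ) = 0 then -(3 / 2)
    else if m % (w.length + 2 : ℕ) = (w.length + 1 : ℕ) then (w.length : ℝ)
    else (m % (w.length + 2 : ℕ) : ℤ) - 1 / 2)

/-- The middle of each new block is sent to a time on the old curve. The new first chord on the
strand `p` was the last chord on the strand `p - 1`, with the middle `(p - 1) * (w.length + 2) +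
w.length + 1 / 2`, whence `-(3 / 2)`. The other chords were one block earlier. The middle of the
closing braid has no prescribed image; the time `w.length` lies between the neighbouring values. -/
theorem cyclicNode_mul_add (p : ℤ) {r : ℕ} (h : r < w.length + 2) :
    cyclicNode w (p * (w.length + 2 : ℕ) + r) = p * (w.length + 2 : ℕ) +
      (if r = 0 then -(3 / 2) else if r = w.length + 1 then (w.length : ℝ) else r - 1 / 2) := by
  have h0 : ((w.length + 2 : ℕ) : ℤ) ≠ 0 := by positivity
  have h1 : (p * (w.length + 2 : ℕ) + r) / ((w.length + 2 : ℕ) : ℤ) = p := by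
    rw [Int.add_comm, Int.add_mul_ediv_right _ _ h0, Int.ediv_eq_zero_of_lt (by omega) (by omega),
      zero_add]
  have h2 : (p * (w.length + 2 : ℕ) + r) % ((w.length + 2 : ℕ) : ℤ) = r := by
    rw [Int.add_comm, Int.add_mul_emod_self_right, Int.emod_eq_of_lt (by omega) (by omega)]
  rw [cyclicNode, h1, h2]
  norm_cast

theorem exists_cyclic_rem (m : ℤ) : ∃ (p : ℤ) (r : ℕ), r < w.length + 2 ∧
    m = p * (w.length + 2 : ℕ) + r := by
  have h1 := Int.emod_nonneg m (show ((w.length + 2 : ℕ) : ℤ) ≠ 0 by positivity)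
  have h2 := Int.emod_lt_of_pos m (show (0 : ℤ) < (w.length + 2 : ℕ) by positivity)
  refine ⟨m / (w.length + 2 : ℕ), (m % (w.length + 2 : ℕ)).toNat, by omega, ?_⟩
  rw [Int.toNat_of_nonneg h1, mul_comm, Int.mul_ediv_add_emod]

theorem cyclicNode_add (m : ℤ) :
    cyclicNode w (m + (w.length + 2 : ℕ)) = cyclicNode w m + (w.length + 2 : ℕ) := by
  obtain ⟨p, r, hr, rfl⟩ := exists_cyclic_rem w m
  rw [cyclicNode_mul_add w p hr, show p * ((w.length + 2 : ℕ) : ℤ) + r + (w.length + 2 : ℕ) =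
    (p + 1) * (w.length + 2 : ℕ) + r by ring, cyclicNode_mul_add w _ hr]
  push_cast
  ring

theorem cyclicNode_gap (m : ℤ) : 1 / 2 ≤ cyclicNode w (m + 1) - cyclicNode w m := by
  obtain ⟨p, r, hr, rfl⟩ := exists_cyclic_rem w m
  rw [cyclicNode_mul_add w p hr]
  rcases Nat.lt_or_ge (r + 1) (w.length + 2) with h | h
  · rw [show p * ((w.length + 2 : ℕ) : ℤ) + r + 1 = p * (w.length + 2 : ℕ) + (r + 1 : ℕ) by
      push_cast; ring, cyclicNode_mul_add w _ h, if_neg (Nat.succ_ne_zero r)]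
    rcases Nat.eq_zero_or_pos r with rfl | h0
    · have : (0 : ℝ) ≤ w.length := by positivity
      rw [if_pos rfl]
      split_ifs
      · linarith
      · push_cast; linarith
    · rw [if_neg (by omega : ¬r = 0), if_neg (by omega : ¬r = w.length + 1)]
      split_ifs with h1
      · have : (r : ℝ) = w.length := by exact_mod_cast (by omega : r = w.length)
        rw [this]; linarith
      · push_cast; linarith
  · have h1 : r = w.length + 1 := by omega
    rw [show p * ((w.length + 2 : ℕ) : ℤ) + r + 1 = (p + 1) * (w.length + 2 : ℕ) + (0 : ℕ) by
      rw [h1]; push_cast; ring, cyclicNode_mul_add w _ (by omega), if_pos rfl, if_neg (by omega),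
      if_pos h1]
    push_cast
    linarith

/-- The change of the time that accompanies a cyclic permutation. -/
noncomputable def cyclicTime (x : ℝ) : ℝ :=
  interp (cyclicNode w) (1 / 2) ((w.length + 2 : ℕ) * x - 1 / 2) / (w.length + 2 : ℕ)

theorem cyclicTime_isReparam : IsReparam (cyclicTime w) := by
  have hN : (0 : ℝ) < (w.length + 2 : ℕ) := by positivity
  have hs : ContDiff ℝ ∞ fun x : ℝ => ((w.length + 2 : ℕ) : ℝ) * x - 1 / 2 :=
    (contDiff_const.mul contDiff_id).sub contDiff_const
  refine ⟨(contDiff_interp.comp hs).div_const _, fun x => ?_, fun x => ?_⟩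
  · have hd := ((contDiff_interp (y := cyclicNode w) (ε := 1 / 2)).differentiable (by simp)
      ((w.length + 2 : ℕ) * x - 1 / 2)).hasDerivAt
    have h0 : HasDerivAt (fun x : ℝ => ((w.length + 2 : ℕ) : ℝ) * x - 1 / 2) (w.length + 2 : ℕ) x := by
      simpa using ((hasDerivAt_id x).const_mul ((w.length + 2 : ℕ) : ℝ)).sub_const (1 / 2)
    have : HasDerivAt (cyclicTime w) _ x :=
      (HasDerivAt.comp (h := fun x : ℝ => ((w.length + 2 : ℕ) : ℝ) * x - 1 / 2) x hd h0).div_const _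
    rw [this.deriv]
    exact div_pos (mul_pos (interp_deriv_pos (by norm_num) (cyclicNode_gap w) _) hN) hN
  · have h := interp_add_int (ε := 1 / 2) (cyclicNode_add w) ((w.length + 2 : ℕ) * x - 1 / 2)
    rw [Int.cast_natCast] at h
    rw [cyclicTime, cyclicTime, show ((w.length + 2 : ℕ) : ℝ) * (x + 1) - 1 / 2 =
      (w.length + 2 : ℕ) * x - 1 / 2 + (w.length + 2 : ℕ) by ring, h, add_div, div_self hN.ne']

theorem cyclicTime_half (m : ℤ) : cyclicTime w ((m + 1 / 2) / (w.length + 2 : ℕ)) =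
    cyclicNode w m / (w.length + 2 : ℕ) := by
  rw [cyclicTime, mul_div_cancel₀ _ (by positivity), add_sub_cancel_right, interp_int]

theorem blockSym_mul_add (v : List (ZMod 3)) (p : ℤ) {r : ℕ} (h : r < v.length + 1) :
    blockSym v (p * (v.length + 1 : ℕ) + r) = v[r]? := by
  rw [blockSym, Int.add_comm, Int.add_mul_emod_self_right, Int.emod_eq_of_lt (by omega) (by omega),
    Int.toNat_natCast]

theorem blockStrand_mul_add (v : List (ZMod 3)) (p : ℤ) {r : ℕ} (h : r < v.length + 1) :
    blockStrand v (p * (v.length + 1 : ℕ) + r) = p := by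
  rw [blockStrand, Int.add_comm, Int.add_mul_ediv_right _ _ (by positivity),
    Int.ediv_eq_zero_of_lt (by omega) (by omega), zero_add]

/-- The double points of a triangular curve. -/
theorem triCurve_eq_iff' (v : List (ZMod 3)) (x : ℝ) :
    triCurve v (x + 1) = triCurve v x ↔ ∃ (p : ℤ) (r : ℕ), v[r]? = some (p : ZMod 3) ∧
      x = (p * (v.length + 1 : ℕ) + r + 1 / 2) / (v.length + 1 : ℕ) := by
  constructor
  · intro h
    obtain ⟨j, u, h0, h1, rfl⟩ := exists_block v x
    obtain ⟨h2, rfl⟩ := (triCurve_eq_iff v j h0 h1).1 h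
    obtain ⟨r, hr, hj⟩ := block_mod v j
    have hj' : j = j / (v.length + 1 : ℕ) * (v.length + 1 : ℕ) + r := by
      rw [← hj, mul_comm, Int.mul_ediv_add_emod]
    generalize j / ((v.length + 1 : ℕ) : ℤ) = p at hj'
    subst hj'
    rw [blockSym_mul_add v p hr, blockStrand_mul_add v p hr] at h2
    refine ⟨p, r, h2, by push_cast; ring⟩
  · rintro ⟨p, r, h, rfl⟩
    have hr : r < v.length + 1 := by
      have := (List.getElem?_eq_some_iff.1 h).1
      omega
    have := (triCurve_eq_iff v (p * (v.length + 1 : ℕ) + r) (u := 1 / 2) (by norm_num)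
      (by norm_num)).2 ⟨by rw [blockSym_mul_add v p hr, blockStrand_mul_add v p hr, h], rfl⟩
    push_cast at this ⊢
    exact this

theorem cyclicTime_zero (x : ℝ) : triCurve ((c + 1) :: w) (x + 1) = triCurve ((c + 1) :: w) x ↔
    triCurve (w ++ [c]) (cyclicTime w x + 1) = triCurve (w ++ [c]) (cyclicTime w x) := by
  have e1 : ((c + 1) :: w).length + 1 = w.length + 2 := by simp
  have e2 : (w ++ [c]).length + 1 = w.length + 2 := by simp
  have hN : (0 : ℝ) < (w.length + 2 : ℕ) := by positivity
  rw [triCurve_eq_iff', triCurve_eq_iff', e1, e2]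
  constructor
  · rintro ⟨p, r, hr, rfl⟩
    rcases r with _ | r
    -- The tail has increased by one while the chord has gone around to the next strand, so the
    -- strands `p` and `p - 1` correspond.
    · have hc : c = ((p - 1 : ℤ) : ZMod 3) := by
        simp only [List.getElem?_cons_zero, Option.some.injEq] at hr
        rw [Int.cast_sub, ← hr, Int.cast_one, add_sub_cancel_right]
      refine ⟨p - 1, w.length, by simp [hc], ?_⟩
      have := cyclicTime_half w (p * (w.length + 2 : ℕ) + (0 : ℕ))
      rw [cyclicNode_mul_add w p (by omega), if_pos rfl] at this
      push_cast at this ⊢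
      rw [this]
      congr 1
      ring
    · simp only [List.getElem?_cons_succ] at hr
      have hlt := (List.getElem?_eq_some_iff.1 hr).1
      refine ⟨p, r, by rwa [List.getElem?_append_left hlt], ?_⟩
      have := cyclicTime_half w (p * (w.length + 2 : ℕ) + (r + 1 : ℕ))
      rw [cyclicNode_mul_add w p (by omega), if_neg (by omega), if_neg (by omega)] at this
      push_cast at this ⊢
      rw [this]
      congr 1
      ring
  · rintro ⟨p, r, hr, hx⟩
    have hlt := (List.getElem?_eq_some_iff.1 hr).1
    rw [List.length_append, List.length_singleton] at hlt
    rcases Nat.lt_succ_iff_lt_or_eq.1 hlt with h | rfl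
    · rw [List.getElem?_append_left h] at hr
      refine ⟨p, r + 1, by simpa using hr, (cyclicTime_isReparam w).strictMono.injective ?_⟩
      have := cyclicTime_half w (p * (w.length + 2 : ℕ) + (r + 1 : ℕ))
      rw [cyclicNode_mul_add w p (by omega), if_neg (by omega), if_neg (by omega)] at this
      push_cast at this hx ⊢
      rw [this, hx]
      congr 1
      ring
    · simp only [List.getElem?_append_right le_rfl, Nat.sub_self, List.getElem?_cons_zero,
        Option.some.injEq] at hr
      refine ⟨p + 1, 0, by simp [hr], (cyclicTime_isReparam w).strictMono.injective ?_⟩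
      have := cyclicTime_half w ((p + 1) * (w.length + 2 : ℕ) + (0 : ℕ))
      rw [cyclicNode_mul_add w _ (by omega), if_pos rfl] at this
      push_cast at this hx ⊢
      rw [this, hx]
      congr 1
      ring

theorem triAngle_mul_add (v : List (ZMod 3)) (hv : v ≠ []) (p : ℤ) {u : ℝ} (h0 : 0 ≤ u)
    (h1 : u < 1) : triAngle v ((p * (v.length + 1 : ℕ) + u) / (v.length + 1 : ℕ)) =
      -(Real.pi / 3) + 2 * Real.pi / 3 * p := by
  have hl : 0 < v.length := List.length_pos_iff.2 hv
  have := triAngle_apply v (p * (v.length + 1 : ℕ) + (0 : ℕ)) h0 h1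
  rw [blockSym_mul_add v p (by omega), List.getElem?_eq_getElem hl, if_neg (by simp),
    Int.add_comm, Int.add_mul_ediv_right _ _ (by positivity),
    Int.ediv_eq_zero_of_lt (by omega) (by omega), zero_add, add_zero] at this
  rw [← this]
  push_cast
  congr 2
  ring

/-- If the word has one chord only, the block after it is already the closing braid, and the
triangle starts to turn. Strictly before the middle of that block it has made less than half of its
turn. -/
theorem triAngle_lt (v : List (ZMod 3)) (hv : v ≠ []) (p : ℤ) {t : ℝ} (h0 : 1 / 2 ≤ t)
    (h1 : t < 3 / 2) : triAngle v ((p * (v.length + 1 : ℕ) + t) / (v.length + 1 : ℕ)) <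
      -(Real.pi / 3) + 2 * Real.pi / 3 * (p + 1 / 2) := by
  have hpi := Real.pi_pos
  have hl : 0 < v.length := List.length_pos_iff.2 hv
  rcases lt_or_ge t 1 with h | h
  · rw [triAngle_mul_add v hv p (by linarith) h]
    nlinarith
  · have := triAngle_apply v (p * (v.length + 1 : ℕ) + (1 : ℕ)) (u := t - 1) (by linarith)
      (by linarith)
    rw [Int.add_comm, Int.add_mul_ediv_right _ _ (by positivity),
      Int.ediv_eq_zero_of_lt (by omega) (by push_cast; omega), zero_add] at this
    rw [show (p : ℝ) * (v.length + 1 : ℕ) + t =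
      ((((1 : ℕ) : ℤ) + p * (v.length + 1 : ℕ) : ℤ) : ℝ) + (t - 1) by push_cast; ring, this]
    have hs := smoothTransition_lt_half (x := t - 1) (by linarith)
    split_ifs <;> nlinarith

/-- The change of time goes backwards, so the difference is nonnegative, and it passes at most one
and a half closing braids. One and a half times `2π/3` is exactly π, which the strict bound of
`triAngle_lt` excludes. -/
theorem cyclicTime_angle (x : ℝ) :
    |triAngle ((c + 1) :: w) x - triAngle (w ++ [c]) (cyclicTime w x)| < Real.pi := by
  have hpi := Real.pi_pos
  have hne : (c + 1) :: w ≠ [] := List.cons_ne_nil _ _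
  rw [triAngle_congr (w := w ++ [c]) (w' := (c + 1) :: w) (by simp)]
  have hmono := triAngle_monotone ((c + 1) :: w)
  have hval := triAngle_mul_add ((c + 1) :: w) hne
  have hlt := triAngle_lt ((c + 1) :: w) hne
  have e1 : ((c + 1) :: w).length + 1 = w.length + 2 := by simp
  rw [e1] at hval hlt
  generalize triAngle ((c + 1) :: w) = ψ at *
  have hN : (0 : ℝ) < (w.length + 2 : ℕ) := by positivity
  have hN2 : (2 : ℝ) ≤ (w.length + 2 : ℕ) := by push_cast; linarith [Nat.cast_nonneg (α := ℝ) w.length]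
  obtain ⟨m, v, h0, h1, hx⟩ := exists_int_add ((w.length + 2 : ℕ) * x - 1 / 2)
  have hx' : x = (m + (v + 1 / 2)) / (w.length + 2 : ℕ) := by
    rw [eq_div_iff hN.ne']; linarith
  have hφ : cyclicTime w x = interp (cyclicNode w) (1 / 2) (m + v) / (w.length + 2 : ℕ) := by
    rw [cyclicTime, hx]
  have him := (interp_strictMono (by norm_num) (cyclicNode_gap w)).monotone
  have hlo : cyclicNode w m / (w.length + 2 : ℕ) ≤ cyclicTime w x := by
    rw [hφ, ← interp_int (y := cyclicNode w) (ε := 1 / 2) m]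
    gcongr
    exact him (by linarith)
  have hhi : cyclicTime w x ≤ cyclicNode w (m + 1) / (w.length + 2 : ℕ) := by
    rw [hφ, ← interp_int (y := cyclicNode w) (ε := 1 / 2) (m + 1)]
    gcongr
    exact him (by push_cast; linarith)
  have hle : cyclicNode w (m + 1) ≤ m + 1 / 2 := by
    obtain ⟨p, r, hr, hm⟩ := exists_cyclic_rem w (m + 1)
    have hm' : (m : ℝ) = p * (w.length + 2 : ℕ) + r - 1 := by
      have : (m : ℝ) + 1 = p * (w.length + 2 : ℕ) + r := by exact_mod_cast hm
      linarith
    rw [hm, cyclicNode_mul_add w p hr, hm']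
    split_ifs with h2 h3
    · rw [h2]; push_cast; linarith
    · rw [h3]; push_cast; linarith
    · linarith
  have hge : ψ (cyclicTime w x) ≤ ψ x := by
    apply hmono
    refine hhi.trans ?_
    rw [hx']
    gcongr
    linarith
  rw [abs_of_nonneg (by linarith)]
  obtain ⟨p, r, hr, rfl⟩ := exists_cyclic_rem w m
  rw [cyclicNode_mul_add w p hr] at hlo
  have hψ := hmono hlo
  rcases Nat.eq_zero_or_pos r with rfl | hr0
  -- The critical case, between the middles of the first two new blocks: the old time may lie before
  -- the preceding closing braid.
  · have h2 := hlt p (t := v + 1 / 2) (by linarith) (by linarith)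
    have h3 : ψ x < -(Real.pi / 3) + 2 * Real.pi / 3 * (p + 1 / 2) := by
      rw [hx']; push_cast at h2 ⊢; simpa using h2
    have h4 := hval (p - 1) le_rfl one_pos
    have h5 : ψ (((p - 1 : ℤ) * (w.length + 2 : ℕ) + 0) / (w.length + 2 : ℕ)) ≤
        ψ ((p * (w.length + 2 : ℕ) + (if (0 : ℕ) = 0 then -(3 / 2) else
          if 0 = w.length + 1 then (w.length : ℝ) else (0 : ℕ) - 1 / 2)) / (w.length + 2 : ℕ)) := by
      apply hmono
      rw [div_le_div_iff_of_pos_right hN, if_pos rfl]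
      push_cast at hN2 ⊢
      nlinarith
    rw [h4] at h5
    push_cast at h5 hψ
    nlinarith
  · have h4 := hval p le_rfl one_pos
    have h6 := hval (p + 1) (u := 1 / 2) (by norm_num) (by norm_num)
    have h7 : ψ x ≤ ψ (((p + 1 : ℤ) * (w.length + 2 : ℕ) + 1 / 2) / (w.length + 2 : ℕ)) := by
      apply hmono
      rw [hx', div_le_div_iff_of_pos_right hN]
      have : (r : ℝ) ≤ w.length + 1 := by exact_mod_cast (by omega : r ≤ w.length + 1)
      push_cast
      linarith
    have h5 : ψ ((p * (w.length + 2 : ℕ) + 0) / (w.length + 2 : ℕ)) ≤ ψ (cyclicTime w x) := by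
      apply hmono
      refine le_trans ?_ hlo
      rw [div_le_div_iff_of_pos_right hN]
      have : (1 : ℝ) ≤ r := by exact_mod_cast hr0
      rw [if_neg (by omega)]
      split_ifs
      · linarith [Nat.cast_nonneg (α := ℝ) w.length]
      · linarith
    rw [h6] at h7
    rw [h4] at h5
    push_cast at h7
    nlinarith

theorem triCurve_cyclic : SingularIsotopic (braidKnot (triCurve (w ++ [c])))
    (braidKnot (triCurve ((c + 1) :: w))) :=
  (SingularIsotopic.of_aligned (triCurve_isBraidLoop _) (triCurve_aligned _)
    (triBlock_isBlockSystem.contDiff _) (strandCurve_add_three _) (triCurve_aligned _)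
    (contDiff_triAngle _) (contDiff_triAngle _) (cyclicTime_isReparam w) (cyclicTime_zero w c)
    (fun x => by rw [triAngle_add_one, triAngle_add_one]; ring) (cyclicTime_angle w c)).1

end Cyclic

theorem CyclicMove.isotopic {V W : ChordWord 3} (h : CyclicMove V W) :
    SingularIsotopic (braidKnot (triCurve V.tails)) (braidKnot (triCurve W.tails)) := by
  obtain ⟨W', g, rfl, rfl⟩ := h
  have := triCurve_cyclic (ChordWord.tails W') g.tail
  simpa [ChordWord.tails, Chord.tail_slide] using this

theorem CyclicEquiv.isotopic {V W : ChordWord 3} (h : CyclicEquiv V W) :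
    SingularIsotopic (braidKnot (triCurve V.tails)) (braidKnot (triCurve W.tails)) := by
  induction h with
  | rel _ _ h => exact h.isotopic
  | refl x => exact .refl (triCurve_isBraidLoop _).isSingularKnot
  | symm _ _ _ ih => exact ih.symm
  | trans _ _ _ _ _ ih ih' => exact ih.trans ih'

/-! ### The curve for the flype -/

/-- A sequence of `m` pinches. -/
noncomputable def clasp (m : ℕ) (u : ℝ) : ℂ := 1 - 2 * ∑ k ∈ Finset.range m, pinch (m * u - k)

theorem contDiff_clasp (m : ℕ) : ContDiff ℝ ∞ (clasp m) :=
  contDiff_const.sub (contDiff_const.mul (ContDiff.sum fun _ _ =>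
    contDiff_pinch.comp ((contDiff_const.mul contDiff_id).sub contDiff_const)))

theorem clasp_eq_of_lt {m k : ℕ} (hk : k < m) {u : ℝ} (h0 : k ≤ m * u) (h1 : m * u ≤ k + 1) :
    clasp m u = 1 - 2 * pinch (m * u - k) := by
  rw [clasp, Finset.sum_eq_single_of_mem k (Finset.mem_range.2 hk)]
  intro i _ hi
  rcases lt_or_gt_of_ne hi with h | h
  · have : (i : ℝ) + 1 ≤ k := by exact_mod_cast h
    exact pinch_of_one_le (by linarith)
  · have : (k : ℝ) + 1 ≤ i := by exact_mod_cast h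
    exact pinch_of_nonpos (by linarith)

theorem clasp_of_nonpos {m : ℕ} {u : ℝ} (h : u ≤ 0) : clasp m u = 1 := by
  rw [clasp, Finset.sum_eq_zero, mul_zero, sub_zero]
  intro k _
  have : m * u ≤ 0 := mul_nonpos_of_nonneg_of_nonpos (by positivity) h
  exact pinch_of_nonpos (by linarith [Nat.cast_nonneg (α := ℝ) k])

theorem clasp_of_one_le {m : ℕ} {u : ℝ} (h : 1 ≤ u) : clasp m u = 1 := by
  rw [clasp, Finset.sum_eq_zero, mul_zero, sub_zero]
  intro k hk
  have h1 : (k : ℝ) + 1 ≤ m := by exact_mod_cast Finset.mem_range.1 hk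
  have : (m : ℝ) ≤ m * u := le_mul_of_one_le_right (by positivity) h
  exact pinch_of_one_le (by linarith)

theorem exists_clasp (m : ℕ) (u : ℝ) : clasp m u = 1 ∨
    ∃ k < m, k ≤ m * u ∧ m * u ≤ k + 1 ∧ clasp m u = 1 - 2 * pinch (m * u - k) := by
  rcases le_or_gt u 0 with h0 | h0
  · exact Or.inl (clasp_of_nonpos h0)
  rcases le_or_gt 1 u with h1 | h1
  · exact Or.inl (clasp_of_one_le h1)
  rcases Nat.eq_zero_or_pos m with rfl | hm
  · exact Or.inl (by simp [clasp])
  have hm' : (0 : ℝ) < m := by exact_mod_cast hm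
  have hmu : 0 ≤ m * u := by positivity
  have hlt : ⌊m * u⌋₊ < m := (Nat.floor_lt hmu).2 (by nlinarith)
  exact Or.inr ⟨⌊m * u⌋₊, hlt, Nat.floor_le hmu, (Nat.lt_floor_add_one _).le,
    clasp_eq_of_lt hlt (Nat.floor_le hmu) (Nat.lt_floor_add_one _).le⟩

theorem exists_clasp_eq_pinch (m : ℕ) (u : ℝ) : ∃ v, clasp m u = 1 - 2 * pinch v := by
  rcases exists_clasp m u with h | ⟨k, -, -, -, h⟩
  · exact ⟨0, by rw [h, pinch_of_nonpos le_rfl]; ring⟩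
  · exact ⟨_, h⟩

theorem clasp_eq_zero_iff (m : ℕ) (u : ℝ) : clasp m u = 0 ↔ ∃ k < m, m * u = k + 1 / 2 := by
  constructor
  · intro h
    rcases exists_clasp m u with h1 | ⟨k, hk, -, -, h1⟩
    · rw [h1] at h
      simp at h
    · refine ⟨k, hk, ?_⟩
      by_contra hne
      exact one_sub_two_pinch_ne_zero (u := m * u - k) (by intro h2; apply hne; linarith) (h1 ▸ h)
  · rintro ⟨k, hk, h⟩
    rw [clasp_eq_of_lt hk (by linarith) (by linarith), h, add_sub_cancel_left, pinch_half]
    norm_num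

theorem clasp_zero_mem {m : ℕ} {u : ℝ} (h : clasp m u = 0) : 0 < u ∧ u < 1 := by
  constructor
  · by_contra hu
    rw [clasp_of_nonpos (not_lt.1 hu)] at h
    simp at h
  · by_contra hu
    rw [clasp_of_one_le (not_lt.1 hu)] at h
    simp at h

theorem clasp_hasDerivAt {m : ℕ} {u : ℝ} (h : clasp m u = 0) :
    ∃ r : ℝ, 0 < r ∧ HasDerivAt (clasp m) (r * Complex.I) u := by
  obtain ⟨k, hk, hu⟩ := (clasp_eq_zero_iff m u).1 h
  obtain ⟨r, hr, hd⟩ := one_sub_two_pinch_hasDerivAt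
  have hm : (0 : ℝ) < m := by exact_mod_cast (by omega : 0 < m)
  refine ⟨m * r, by positivity, ?_⟩
  have h0 : HasDerivAt (fun u : ℝ => m * u - k) m u := by
    simpa using ((hasDerivAt_id u).const_mul (m : ℝ)).sub_const (k : ℝ)
  have hd1 : HasDerivAt (fun u => 1 - 2 * pinch u) (r * Complex.I) (m * u - k) := by
    rwa [hu, add_sub_cancel_left]
  have hd2 := HasDerivAt.scomp (h := fun u : ℝ => m * u - k) u hd1 h0
  have he : clasp m =ᶠ[nhds u] fun u => 1 - 2 * pinch (m * u - k) := by
    have hc : Continuous fun u : ℝ => (m : ℝ) * u := by fun_prop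
    have := hc.continuousAt.preimage_mem_nhds (Ioo_mem_nhds (show (k : ℝ) < m * u by linarith)
      (show m * u < (k : ℝ) + 1 by linarith))
    filter_upwards [this] with v hv
    exact clasp_eq_of_lt hk (le_of_lt hv.1) (le_of_lt hv.2)
  refine (HasDerivAt.congr_of_eventuallyEq (f := fun u : ℝ => 1 - 2 * pinch (m * u - k)) hd2 he).congr_deriv ?_
  simp only [Complex.real_smul]
  push_cast
  ring

theorem clasp_re_nonneg (m : ℕ) (u : ℝ) : 0 ≤ (clasp m u).re := by
  obtain ⟨v, h⟩ := exists_clasp_eq_pinch m u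
  have := pinch_re_le v
  rw [h]; simp; linarith

theorem clasp_re_le (m : ℕ) (u : ℝ) : (clasp m u).re ≤ 1 := by
  obtain ⟨v, h⟩ := exists_clasp_eq_pinch m u
  have := pinch_re_nonneg v
  rw [h]; simp; linarith

theorem clasp_im_le (m : ℕ) (u : ℝ) : (clasp m u).im ≤ 1 / 2 := by
  obtain ⟨v, h⟩ := exists_clasp_eq_pinch m u
  have := le_pinch_im v
  rw [h]; simp; linarith

theorem le_clasp_im (m : ℕ) (u : ℝ) : -(1 / 2) ≤ (clasp m u).im := by
  obtain ⟨v, h⟩ := exists_clasp_eq_pinch m u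
  have := pinch_im_le v
  rw [h]; simp; linarith

theorem clasp_re_pos {m : ℕ} {u : ℝ} (h0 : clasp m u ≠ 0) : 0 < (clasp m u).re := by
  obtain ⟨v, h⟩ := exists_clasp_eq_pinch m u
  have : v ≠ 1 / 2 := by
    rintro rfl
    rw [pinch_half] at h
    norm_num at h
    exact h0 h
  have := pinch_re_lt this
  rw [h]; simp; linarith

/-- Half of the curve for the flype, in ten blocks. -/
noncomputable def halfBlock (l p n : ℕ) (r : ℤ) (u : ℝ) : ℂ :=
  let S : ℝ := Real.smoothTransition u
  if r = 0 then Complex.I / 2 * clasp l u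
  else if r = 1 then S + Complex.I / 2
  else if r = 2 then 1 + Complex.I / 2
  else if r = 3 then 1 + Complex.I / 2 * clasp p u
  else if r = 4 then 1 + Complex.I / 2
  else if r = 5 then ⟨Real.cos (Real.pi * S), 1 / 2 + Real.sin (Real.pi * S)⟩
  else if r = 6 then -1 + Complex.I / 2
  else if r = 7 then -1 + Complex.I / 2 * clasp n u
  else if r = 8 then -1 + Complex.I / 2
  else -1 + S + Complex.I * (1 / 2 - S)

/-- The points where the blocks of `halfBlock` meet. -/
noncomputable def halfPos (r : ℤ) : ℂ :=
  if r ≤ 1 then Complex.I / 2 else if r ≤ 5 then 1 + Complex.I / 2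
  else if r ≤ 9 then -1 + Complex.I / 2 else -(Complex.I / 2)

section HalfBlock

variable (l p n : ℕ)

/-- The half curve starts at `I / 2`, is pinched `l` times towards 0, goes to `1 + I / 2`, is
pinched `p` times towards 1, passes over a semicircular arch to `-1 + I / 2`, is pinched `n` times
towards -1, and descends to `-(I / 2)`. -/
theorem contDiff_halfBlock (r : ℤ) : ContDiff ℝ ∞ (halfBlock l p n r) := by
  have hS : ContDiff ℝ ∞ fun u : ℝ => (Real.smoothTransition u : ℂ) :=
    Complex.ofRealCLM.contDiff.comp Real.smoothTransition.contDiff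
  have hpi : ContDiff ℝ ∞ fun u : ℝ => Real.pi * Real.smoothTransition u :=
    contDiff_const.mul Real.smoothTransition.contDiff
  unfold halfBlock
  dsimp only
  split_ifs
  · exact contDiff_const.mul (contDiff_clasp l)
  · exact hS.add contDiff_const
  · exact contDiff_const
  · exact contDiff_const.add (contDiff_const.mul (contDiff_clasp p))
  · exact contDiff_const
  · have : ∀ u : ℝ, (⟨Real.cos (Real.pi * Real.smoothTransition u),
        1 / 2 + Real.sin (Real.pi * Real.smoothTransition u)⟩ : ℂ) =
        (Real.cos (Real.pi * Real.smoothTransition u) : ℂ) +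
        (1 / 2 + (Real.sin (Real.pi * Real.smoothTransition u) : ℂ)) * Complex.I := by
      intro u; apply Complex.ext <;> simp [-Complex.ofReal_cos, -Complex.ofReal_sin]
    simp only [this]
    have h1 : ContDiff ℝ ∞ fun u : ℝ => (Real.cos (Real.pi * Real.smoothTransition u) : ℂ) :=
      Complex.ofRealCLM.contDiff.comp (Real.contDiff_cos.comp hpi)
    have h2 : ContDiff ℝ ∞ fun u : ℝ => (Real.sin (Real.pi * Real.smoothTransition u) : ℂ) :=
      Complex.ofRealCLM.contDiff.comp (Real.contDiff_sin.comp hpi)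
    exact h1.add ((contDiff_const.add h2).mul contDiff_const)
  · exact contDiff_const
  · exact contDiff_const.add (contDiff_const.mul (contDiff_clasp n))
  · exact contDiff_const
  · exact (contDiff_const.add hS).add (contDiff_const.mul (contDiff_const.sub hS))

theorem halfBlock_of_nonpos {r : ℤ} (h0 : 0 ≤ r) (h9 : r ≤ 9) {u : ℝ} (hu : u ≤ 0) :
    halfBlock l p n r u = halfPos r := by
  have hS := Real.smoothTransition.zero_of_nonpos hu
  interval_cases r <;> simp [halfBlock, halfPos, hS, clasp_of_nonpos hu] <;>
    apply Complex.ext <;> simp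

theorem halfBlock_of_one_le {r : ℤ} (h0 : 0 ≤ r) (h9 : r ≤ 9) {u : ℝ} (hu : 1 ≤ u) :
    halfBlock l p n r u = halfPos (r + 1) := by
  have hS := Real.smoothTransition.one_of_one_le hu
  interval_cases r <;> simp [halfBlock, halfPos, hS, clasp_of_one_le hu] <;>
    apply Complex.ext <;> simp <;> norm_num

/-- The blocks of the curve for the flype; the second half is symmetric to the first one. -/
noncomputable def flypeBlock (j : ℤ) (u : ℝ) : ℂ :=
  if j % 20 < 10 then halfBlock l p n (j % 20) u else -halfBlock l n p (j % 20 - 10) u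

/-- The points where the blocks of `flypeBlock` meet. -/
noncomputable def flypePos (j : ℤ) : ℂ :=
  if j % 20 < 10 then halfPos (j % 20) else -halfPos (j % 20 - 10)

theorem contDiff_flypeBlock (j : ℤ) : ContDiff ℝ ∞ (flypeBlock l p n j) := by
  unfold flypeBlock
  split_ifs
  · exact contDiff_halfBlock _ _ _ _
  · exact (contDiff_halfBlock _ _ _ _).neg

theorem flypeBlock_of_nonpos (j : ℤ) {u : ℝ} (hu : u ≤ 0) : flypeBlock l p n j u = flypePos j := by
  unfold flypeBlock flypePos
  split_ifs with h
  · rw [halfBlock_of_nonpos l p n (by omega) (by omega) hu]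
  · rw [halfBlock_of_nonpos l n p (by omega) (by omega) hu]

theorem halfPos_zero : halfPos 0 = Complex.I / 2 := by simp [halfPos]

theorem halfPos_ten : halfPos 10 = -(Complex.I / 2) := by simp [halfPos]

theorem flypeBlock_of_one_le (j : ℤ) {u : ℝ} (hu : 1 ≤ u) :
    flypeBlock l p n j u = flypePos (j + 1) := by
  unfold flypeBlock flypePos
  split_ifs with h h' h'
  · rw [halfBlock_of_one_le l p n (by omega) (by omega) hu]
    congr 1; omega
  · have h9 : j % 20 = 9 := by omega
    have h10 : (j + 1) % 20 = 10 := by omega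
    rw [halfBlock_of_one_le l p n (by omega) (by omega) hu, h9, h10, show (9 : ℤ) + 1 = 10 by rfl,
      halfPos_ten, sub_self, halfPos_zero]
  · have h9 : j % 20 = 19 := by omega
    have h10 : (j + 1) % 20 = 0 := by omega
    rw [halfBlock_of_one_le l n p (by omega) (by omega) hu, h9, h10,
      show (19 : ℤ) - 10 + 1 = 10 by rfl, halfPos_ten, halfPos_zero, neg_neg]
  · rw [halfBlock_of_one_le l n p (by omega) (by omega) hu]
    congr 2; omega

/-- The symmetry on which the flype rests: half a period acts as `z ↦ -z` and exchanges `p` and `n`.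
It also places the two branches of each clasp opposite to each other: the blocks 0 and 10 meet at 0,
the blocks 3 and 17 at 1, the blocks 7 and 13 at -1. -/
theorem flypeBlock_add_ten (j : ℤ) (u : ℝ) : flypeBlock l p n (j + 10) u = -flypeBlock l n p j u := by
  unfold flypeBlock
  split_ifs with h h' h'
  · omega
  · have : (j + 10) % 20 = j % 20 - 10 := by omega
    rw [this, neg_neg]
  · have : (j + 10) % 20 - 10 = j % 20 := by omega
    rw [this]
  · omega

/-- The curve for the flype. -/
noncomputable def flypeCurve : ℝ → ℂ := glue (flypeBlock l p n)

theorem contDiff_flypeCurve : ContDiff ℝ ∞ (flypeCurve l p n) :=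
  contDiff_glue (A := fun j _ => flypePos j) (contDiff_flypeBlock l p n)
    (fun _ => contDiff_const) (fun j _ hu => flypeBlock_of_nonpos l p n j hu)
    fun j _ hu => flypeBlock_of_one_le l p n j hu

theorem flypeCurve_add_ten (t : ℝ) : flypeCurve l p n (t + 10) = -flypeCurve l n p t := by
  have h := glue_add_int (B := flypeBlock l p n) (C := fun j u => -flypeBlock l n p j u) (k := 10)
    (flypeBlock_add_ten l p n) t
  simp only [Int.cast_ofNat] at h
  exact h

theorem flypeCurve_add_twenty (t : ℝ) : flypeCurve l p n (t + 20) = flypeCurve l p n t := by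
  rw [show t + 20 = t + 10 + 10 by ring, flypeCurve_add_ten, flypeCurve_add_ten, neg_neg]

theorem flypeCurve_apply (j : ℤ) {u : ℝ} (h0 : 0 ≤ u) (h1 : u ≤ 1) :
    flypeCurve l p n (j + u) = flypeBlock l p n j u :=
  glue_int_add' (A := fun j _ => flypePos j) (fun j _ hu => flypeBlock_of_nonpos l p n j hu)
    (fun j _ hu => flypeBlock_of_one_le l p n j hu) j h0 h1

end HalfBlock

/-- The number of tenths of a turn passed before a block. -/
noncomputable def flypeNode (j : ℤ) : ℝ :=
  ((30 * (j / 20) + if j % 20 ≤ 12 then j % 20 else if j % 20 ≤ 16 then j % 20 + 4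
    else if j % 20 ≤ 18 then j % 20 + 6 else j % 20 + 10 : ℤ) : ℝ)

/-- In `flypeNode` the resting blocks 12, 16 and 18 are stretched to 5, 3 and 5 tenths of a turn.
Thereby the blocks 10, 13 and 17 begin at 10, 17 and 23 tenths, over the same places of the circle
as their partners 0, 7 and 3. -/
theorem flypeNode_add (j : ℤ) : flypeNode (j + 20) = flypeNode j + 30 := by
  have h1 : (j + 20) / 20 = j / 20 + 1 := by omega
  have h2 : (j + 20) % 20 = j % 20 := by omega
  rw [flypeNode, flypeNode, h1, h2]
  push_cast
  ring

theorem flypeNode_gap (j : ℤ) : 1 ≤ flypeNode (j + 1) - flypeNode j := by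
  have h1 := Int.emod_nonneg j (show (20 : ℤ) ≠ 0 by norm_num)
  have h2 := Int.emod_lt_of_pos j (show (0 : ℤ) < 20 by norm_num)
  unfold flypeNode
  norm_cast
  split_ifs <;> omega

/-- The number of tenths of a turn passed at a time. -/
noncomputable def flypeTime : ℝ → ℝ := interp flypeNode 1

theorem contDiff_flypeTime : ContDiff ℝ ∞ flypeTime := contDiff_interp

theorem flypeTime_add (t : ℝ) : flypeTime (t + 20) = flypeTime t + 30 := by
  have := interp_add_int (ε := 1) (M := 20) flypeNode_add t
  simpa [flypeTime] using this

theorem flypeTime_deriv_pos (t : ℝ) : 0 < deriv flypeTime t :=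
  interp_deriv_pos one_pos flypeNode_gap t

theorem flypeTime_strictMono : StrictMono flypeTime := interp_strictMono one_pos flypeNode_gap

theorem flypeTime_int (j : ℤ) : flypeTime j = flypeNode j := interp_int j

theorem flypeTime_isReparam : IsReparam fun t => flypeTime (20 * t) / 30 := by
  have := interp_isReparam (y := flypeNode) (ε := 1) (M := 20) (p := 30) (by norm_num) (by norm_num)
    one_pos flypeNode_gap flypeNode_add
  simpa [flypeTime] using this

theorem flypeTime_of_gap {j : ℤ} (h : flypeNode (j + 1) - flypeNode j = 1) {u : ℝ} (h0 : 0 ≤ u)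
    (h1 : u ≤ 1) : flypeTime (j + u) = flypeNode j + u := by
  rw [flypeTime, interp_int_add j h0 h1, interpPiece_of_eq h, one_mul]

/-! ### The curve for the flype as a closed 3-braid -/

/-- The component of a vector in the direction `y`. -/
noncomputable def dirComp (y : ℝ) (d : ℂ) : ℝ := d.re * Real.cos y + d.im * Real.sin y

theorem exp_mul_re (y : ℝ) (d : ℂ) : (Complex.exp ((-y : ℝ) * Complex.I) * d).re = dirComp y d := by
  rw [Complex.mul_re, Complex.exp_ofReal_mul_I_re, Complex.exp_ofReal_mul_I_im, Real.cos_neg,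
    Real.sin_neg, dirComp]
  ring

theorem exp_mul_im (y : ℝ) (d : ℂ) :
    (Complex.exp ((-y : ℝ) * Complex.I) * d).im = dirComp y (-Complex.I * d) := by
  rw [Complex.mul_im, Complex.exp_ofReal_mul_I_re, Complex.exp_ofReal_mul_I_im, Real.cos_neg,
    Real.sin_neg, dirComp]
  simp
  ring

theorem cos_two_pi_div_three : Real.cos (2 * Real.pi / 3) = -(1 / 2) := by
  rw [show 2 * Real.pi / 3 = Real.pi - Real.pi / 3 by ring, Real.cos_pi_sub, Real.cos_pi_div_three]

theorem sin_two_pi_div_three : Real.sin (2 * Real.pi / 3) = √3 / 2 := by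
  rw [show 2 * Real.pi / 3 = Real.pi - Real.pi / 3 by ring, Real.sin_pi_sub, Real.sin_pi_div_three]

theorem dirComp_sub_third (y : ℝ) (d : ℂ) : dirComp (y - 2 * Real.pi / 3) d =
    d.re * (-(1 / 2) * Real.cos y + √3 / 2 * Real.sin y) -
      d.im * (1 / 2 * Real.sin y + √3 / 2 * Real.cos y) := by
  rw [dirComp, Real.cos_sub, Real.sin_sub, cos_two_pi_div_three, sin_two_pi_div_three]
  ring

theorem dirComp_add_third (y : ℝ) (d : ℂ) : dirComp (y + 2 * Real.pi / 3) d =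
    -d.re * (1 / 2 * Real.cos y + √3 / 2 * Real.sin y) +
      d.im * (-(1 / 2) * Real.sin y + √3 / 2 * Real.cos y) := by
  rw [dirComp, Real.cos_add, Real.sin_add, cos_two_pi_div_three, sin_two_pi_div_three]
  ring

/-- The triangle `a b c` has its edge from `b` to `c` roughly in the direction `y`, and the others in
the directions a third of a turn away, except for the first one if `P` and the last one if `Q`. -/
structure TriangleAligned (P Q : Prop) (y : ℝ) (a b c : ℂ) : Prop where
  first : ¬P → 0 < dirComp (y - 2 * Real.pi / 3) (b - a)
  second : 0 < dirComp y (c - b)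
  third : ¬Q → 0 < dirComp (y + 2 * Real.pi / 3) (a - c)

section TriangleAligned

variable {y : ℝ}

theorem sin_cos_of_small (h0 : -(Real.pi / 6) ≤ y) (h1 : y ≤ Real.pi / 6) :
    √3 / 2 ≤ Real.cos y ∧ -(1 / 2) ≤ Real.sin y ∧ Real.sin y ≤ 1 / 2 := by
  have hpi := Real.pi_pos
  refine ⟨?_, ?_, ?_⟩
  · rw [← Real.cos_pi_div_six, ← Real.cos_abs y]
    exact Real.cos_le_cos_of_nonneg_of_le_pi (abs_nonneg _) (by linarith) (abs_le.2 ⟨h0, h1⟩)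
  · rw [← Real.sin_pi_div_six, ← Real.sin_neg]
    exact Real.sin_le_sin_of_le_of_le_pi_div_two (by linarith) (by linarith) h0
  · rw [← Real.sin_pi_div_six]
    exact Real.sin_le_sin_of_le_of_le_pi_div_two (by linarith) (by linarith) h1

theorem dirComp_sub_third_pos (h0 : -(Real.pi / 6) ≤ y) (h1 : y ≤ Real.pi / 6) {d : ℂ}
    (hr : d.re ≤ 0) (hi : d.im < 0) : 0 < dirComp (y - 2 * Real.pi / 3) d := by
  obtain ⟨hc, hs, hs'⟩ := sin_cos_of_small h0 h1
  have h3 : √3 * √3 = 3 := Real.mul_self_sqrt (by norm_num)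
  have h3' := Real.sqrt_nonneg 3
  rw [dirComp_sub_third]
  have e1 : -(1 / 2) * Real.cos y + √3 / 2 * Real.sin y ≤ 0 := by nlinarith
  have e2 : 1 / 2 ≤ 1 / 2 * Real.sin y + √3 / 2 * Real.cos y := by nlinarith
  nlinarith [mul_nonneg_of_nonpos_of_nonpos hr e1]

theorem dirComp_add_third_pos (h0 : -(Real.pi / 6) ≤ y) (h1 : y ≤ Real.pi / 6) {d : ℂ}
    (hr : d.re ≤ 0) (hi : 0 < d.im) : 0 < dirComp (y + 2 * Real.pi / 3) d := by
  obtain ⟨hc, hs, hs'⟩ := sin_cos_of_small h0 h1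
  have h3 : √3 * √3 = 3 := Real.mul_self_sqrt (by norm_num)
  have h3' := Real.sqrt_nonneg 3
  rw [dirComp_add_third]
  have e1 : 0 ≤ 1 / 2 * Real.cos y + √3 / 2 * Real.sin y := by nlinarith
  have e2 : 1 / 2 ≤ -(1 / 2) * Real.sin y + √3 / 2 * Real.cos y := by nlinarith
  nlinarith [mul_nonneg (neg_nonneg.2 hr) e1]

theorem dirComp_pos (h0 : -(Real.pi / 6) ≤ y) (h1 : y ≤ Real.pi / 6) {d : ℂ}
    (hr : 3 / 4 ≤ d.re) (hi : |d.im| ≤ 1 / 2) : 0 < dirComp y d := by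
  obtain ⟨hc, hs, hs'⟩ := sin_cos_of_small h0 h1
  have h3 := sqrt_three_gt
  rw [dirComp]
  obtain ⟨hi1, hi2⟩ := abs_le.1 hi
  have e1 : -(1 / 4) ≤ d.im * Real.sin y := by
    have : |d.im * Real.sin y| ≤ 1 / 2 * (1 / 2) := by
      rw [abs_mul]
      exact mul_le_mul hi (abs_le.2 ⟨hs, hs'⟩) (abs_nonneg _) (by norm_num)
    linarith [(abs_le.1 this).1]
  nlinarith

/-- At the direction `π / 6` the first edge is expected to point exactly along `-I`, as a clasp
between the first two strands does. The zero of the clasp is then left along the boundary of the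
half plane. For the same reason the direction is `-(π / 6)` at a clasp of the third edge. -/
theorem dirComp_first_clasp (d : ℂ) :
    dirComp (Real.pi / 6 - 2 * Real.pi / 3) (-Complex.I * d) = d.re := by
  rw [dirComp, show Real.pi / 6 - 2 * Real.pi / 3 = -(Real.pi / 2) by ring, Real.cos_neg,
    Real.sin_neg, Real.cos_pi_div_two, Real.sin_pi_div_two]
  simp

theorem dirComp_third_clasp (d : ℂ) :
    dirComp (-(Real.pi / 6) + 2 * Real.pi / 3) (Complex.I * d) = d.re := by
  rw [dirComp, show -(Real.pi / 6) + 2 * Real.pi / 3 = Real.pi / 2 by ring, Real.cos_pi_div_two,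
    Real.sin_pi_div_two]
  simp

end TriangleAligned

/-- The blocks of `flypeCurve` passed in a tenth of a turn. -/
def flypeSlot (i : ℤ) : ℤ :=
  let r := i % 30
  if r ≤ 11 then r else if r ≤ 16 then 12 else if r ≤ 19 then r - 4 else if r ≤ 22 then 16
  else if r ≤ 23 then 17 else if r ≤ 28 then 18 else 19

theorem flypeSlot_add (i : ℤ) : flypeSlot (i + 30) = flypeSlot i := by
  simp [flypeSlot]

theorem flypeSlot_mod (i : ℤ) : flypeSlot (i % 30) = flypeSlot i := by
  simp [flypeSlot]

section FlypeLoop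

variable (l p n : ℕ)

/-- The curve for the flype, as a closed 3-braid. -/
noncomputable def flypeLoop (x : ℝ) : ℂ := glue (fun i => flypeBlock l p n (flypeSlot i)) (10 * x)

theorem flypePos_slot (i : ℤ) : flypePos (flypeSlot i + 1) = flypePos (flypeSlot (i + 1)) := by
  rw [← flypeSlot_mod i, ← flypeSlot_mod (i + 1), Int.add_emod i 1 30]
  have h1 := Int.emod_nonneg i (show (30 : ℤ) ≠ 0 by norm_num)
  have h2 := Int.emod_lt_of_pos i (show (0 : ℤ) < 30 by norm_num)
  generalize i % 30 = r at *
  interval_cases r <;> simp [flypePos, halfPos, flypeSlot]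

theorem contDiff_flypeLoop : ContDiff ℝ ∞ (flypeLoop l p n) := by
  have : ContDiff ℝ ∞ (glue fun i => flypeBlock l p n (flypeSlot i)) :=
    contDiff_glue (A := fun i _ => flypePos (flypeSlot i)) (fun i => contDiff_flypeBlock l p n _)
      (fun _ => contDiff_const) (fun j _ hu => flypeBlock_of_nonpos l p n _ hu)
      fun j _ hu => by rw [flypeBlock_of_one_le l p n _ hu, flypePos_slot]
  exact this.comp (contDiff_const.mul contDiff_id)

theorem flypeLoop_add_three (x : ℝ) : flypeLoop l p n (x + 3) = flypeLoop l p n x := by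
  have h := glue_add_int (B := fun i => flypeBlock l p n (flypeSlot i))
    (C := fun i => flypeBlock l p n (flypeSlot i)) (k := 30)
    (fun j u => by rw [flypeSlot_add]) (10 * x)
  rw [flypeLoop, flypeLoop, ← h]
  congr 1
  push_cast
  ring

theorem flypeLoop_apply (i : ℤ) {u : ℝ} (h0 : 0 ≤ u) (h1 : u < 1) :
    flypeLoop l p n ((i + u) / 10) = flypeBlock l p n (flypeSlot i) u := by
  rw [flypeLoop, mul_div_cancel₀ _ (by norm_num), glue_int_add _ _ h0 h1]

theorem flypeLoop_apply_add_one (i : ℤ) {u : ℝ} (h0 : 0 ≤ u) (h1 : u < 1) :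
    flypeLoop l p n ((i + u) / 10 + 1) = flypeBlock l p n (flypeSlot (i + 10)) u := by
  rw [← flypeLoop_apply l p n (i + 10) h0 h1]
  congr 1
  push_cast
  ring

theorem flypeLoop_time (t : ℝ) : flypeLoop l p n (flypeTime t / 10) = flypeCurve l p n t := by
  obtain ⟨j, u, h0, h1, rfl⟩ := exists_int_add t
  have key : ∀ i : ℤ, flypeNode j ≤ i → (i : ℝ) < flypeNode (j + 1) →
      flypeBlock l p n (flypeSlot i) = flypeBlock l p n j := by
    intro i hi hi'
    have e : flypeSlot i = j % 20 := by
      unfold flypeNode at hi hi'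
      rw [Int.cast_le] at hi
      rw [Int.cast_lt] at hi'
      unfold flypeSlot
      dsimp only
      split_ifs at hi hi' ⊢ <;> omega
    rw [e]
    funext v
    simp [flypeBlock]
  rw [flypeCurve_apply l p n j h0 h1.le]
  by_cases hg : flypeNode (j + 1) - flypeNode j = 1
  · rw [flypeTime_of_gap hg h0 h1.le]
    obtain ⟨i, hi⟩ : ∃ i : ℤ, flypeNode j = i := ⟨_, rfl⟩
    rw [hi, flypeLoop_apply l p n i h0 h1, key i hi.le (by linarith)]
  · have hmono := flypeTime_strictMono
    have hlo : flypeNode j ≤ flypeTime (j + u) := by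
      rw [← flypeTime_int]; exact hmono.monotone (by linarith)
    have hhi : flypeTime (j + u) < flypeNode (j + 1) := by
      rw [← flypeTime_int]; exact hmono (by push_cast; linarith)
    obtain ⟨i, v, hv0, hv1, hx⟩ := exists_int_add (flypeTime (j + u))
    rw [hx, flypeLoop_apply l p n i hv0 hv1]
    rw [hx] at hlo hhi
    obtain ⟨a, ha⟩ : ∃ a : ℤ, flypeNode j = a := ⟨_, rfl⟩
    have hai : a ≤ i := by
      have : (a : ℝ) < i + 1 := by linarith
      have : a < i + 1 := by exact_mod_cast this
      omega
    rw [key i (by rw [ha]; exact_mod_cast hai) (by linarith)]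
    -- Only these blocks last longer than a tenth, and they are constant, so the time within them is
    -- irrelevant.
    have hj : j % 20 = 12 ∨ j % 20 = 16 ∨ j % 20 = 18 := by
      unfold flypeNode at hg
      norm_cast at hg
      split_ifs at hg <;> omega
    rcases hj with h | h | h <;> simp [flypeBlock, halfBlock, h]

/-- The direction of the second edge at the beginning of a tenth of a turn. -/
noncomputable def flypeNodeAngle (i : ℤ) : ℝ :=
  (if i % 10 ≤ 1 then Real.pi / 6 else if i % 10 ≤ 5 then -(Real.pi / 6) else Real.pi / 6) +
    2 * Real.pi / 3 * ((i / 10 : ℤ) - 1)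

/-- The directions that show that the curve for the flype is aligned. -/
noncomputable def flypeAngle (x : ℝ) : ℝ := interp flypeNodeAngle 0 (10 * x)

theorem contDiff_flypeAngle : ContDiff ℝ ∞ flypeAngle :=
  contDiff_interp.comp (contDiff_const.mul contDiff_id)

theorem flypeNodeAngle_add (i : ℤ) : flypeNodeAngle (i + 10) = flypeNodeAngle i + 2 * Real.pi / 3 := by
  have h : (i + 10) / 10 = i / 10 + 1 := by omega
  rw [flypeNodeAngle, flypeNodeAngle, Int.add_emod_right, h]
  push_cast
  ring

theorem flypeAngle_add_one (x : ℝ) : flypeAngle (x + 1) = flypeAngle x + 2 * Real.pi / 3 := by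
  have := interp_add_int (y := flypeNodeAngle) (ε := 0) (M := 10) flypeNodeAngle_add (10 * x)
  rw [flypeAngle, flypeAngle, ← this]
  congr 1
  push_cast
  ring

theorem flypeAngle_apply (i : ℤ) {u : ℝ} (h0 : 0 ≤ u) (h1 : u ≤ 1) : flypeAngle ((i + u) / 10) =
    flypeNodeAngle i + (flypeNodeAngle (i + 1) - flypeNodeAngle i) * Real.smoothTransition u := by
  rw [flypeAngle, mul_div_cancel₀ _ (by norm_num), interp_int_add i h0 h1, interpPiece]
  ring

/-- The direction of the edge from the second to the third strand during a tenth of a turn. -/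
noncomputable def flypeSlotAngle (j : ℤ) (u : ℝ) : ℝ :=
  if j = 0 then Real.pi / 6 else if j = 1 then Real.pi / 6 - Real.pi / 3 * Real.smoothTransition u
  else if j ≤ 4 then -(Real.pi / 6)
  else if j = 5 then -(Real.pi / 6) + Real.pi / 3 * Real.smoothTransition u
  else if j ≤ 8 then Real.pi / 6
  else Real.pi / 6 + 2 * Real.pi / 3 * Real.smoothTransition u

theorem flypeAngle_slot (q : ℤ) {j : ℤ} (hj : 0 ≤ j) (hj' : j ≤ 9) {u : ℝ} (h0 : 0 ≤ u)
    (h1 : u ≤ 1) : flypeAngle (((10 * q + j : ℤ) + u) / 10) =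
      flypeSlotAngle j u + 2 * Real.pi / 3 * (q - 1) := by
  rw [flypeAngle_apply _ h0 h1]
  have e1 : (10 * q + j) / 10 = q := by omega
  have e2 : (10 * q + j) % 10 = j := by omega
  have e3 : (10 * q + j + 1) / 10 = if j = 9 then q + 1 else q := by split_ifs <;> omega
  have e4 : (10 * q + j + 1) % 10 = if j = 9 then 0 else j + 1 := by split_ifs <;> omega
  rw [flypeNodeAngle, flypeNodeAngle, e1, e2, e3, e4]
  interval_cases j <;> simp [flypeSlotAngle] <;> ring

theorem flypeSlotAngle_small {j : ℤ} (hj : 0 ≤ j) (hj' : j ≤ 8) (u : ℝ) :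
    -(Real.pi / 6) ≤ flypeSlotAngle j u ∧ flypeSlotAngle j u ≤ Real.pi / 6 := by
  have hpi := Real.pi_pos
  have hS0 := Real.smoothTransition.nonneg u
  have hS1 := Real.smoothTransition.le_one u
  constructor <;> interval_cases j <;> simp [flypeSlotAngle] <;> nlinarith

/-- Up to the last tenth, the second strand stays at the lower left and the third at the lower right
of the first. The edge between them is nearly horizontal, the first edge points down and not to the
right, the third up and not to the right, which agrees with all directions within `π / 6`. At the
clasps the exact direction is used instead. -/
theorem triangleAligned_small {j : ℤ} (hj : 0 ≤ j) (hj' : j ≤ 8) {u : ℝ} :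
    TriangleAligned (j = 0 ∧ clasp l u = 0 ∨ j = 7 ∧ clasp n u = 0) (j = 3 ∧ clasp p u = 0)
      (flypeSlotAngle j u) (flypeBlock l p n (flypeSlot j) u)
      (flypeBlock l p n (flypeSlot (10 + j)) u) (flypeBlock l p n (flypeSlot (20 + j)) u) := by
  obtain ⟨y0, y1⟩ := flypeSlotAngle_small hj hj' u
  have hS0 := Real.smoothTransition.nonneg u
  have hS1 := Real.smoothTransition.le_one u
  have hpi := Real.pi_pos
  have hcr := fun m => clasp_re_nonneg m u
  have hcr' := fun m => clasp_re_le m u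
  have hci := fun m => le_clasp_im m u
  have hci' := fun m => clasp_im_le m u
  have harch : 0 ≤ Real.sin (Real.pi * Real.smoothTransition u) :=
    Real.sin_nonneg_of_nonneg_of_le_pi (by positivity) (by nlinarith)
  have hcos := Real.neg_one_le_cos (Real.pi * Real.smoothTransition u)
  have hcos' := Real.cos_le_one (Real.pi * Real.smoothTransition u)
  refine ⟨fun hne => ?_, ?_, fun hne => ?_⟩
  · by_cases h : j = 0 ∨ j = 7
    · obtain ⟨m, hm, hy⟩ : ∃ m, flypeBlock l p n (flypeSlot (10 + j)) u -
          flypeBlock l p n (flypeSlot j) u = -Complex.I * clasp m u ∧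
          flypeSlotAngle j u = Real.pi / 6 ∧ clasp m u ≠ 0 := by
        rcases h with rfl | rfl
        · exact ⟨l, by simp [flypeSlot, flypeBlock, halfBlock]; ring, by simp [flypeSlotAngle],
            by simpa using hne⟩
        · exact ⟨n, by simp [flypeSlot, flypeBlock, halfBlock]; ring, by simp [flypeSlotAngle],
            by simpa using hne⟩
      rw [hm, hy.1, dirComp_first_clasp]
      exact clasp_re_pos hy.2
    · push Not at h
      clear hne
      apply dirComp_sub_third_pos y0 y1 <;> interval_cases j <;>
        simp [flypeSlot, flypeBlock, halfBlock] at h ⊢ <;>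
        linarith [hcr p, hcr' p, hci p, hci' p]
  · apply dirComp_pos y0 y1
    · interval_cases j <;> simp [flypeSlot, flypeBlock, halfBlock] <;>
        linarith [hci p, hci' p, hci l, hci' l, hci n, hci' n]
    · rw [abs_le]
      constructor <;> interval_cases j <;> simp [flypeSlot, flypeBlock, halfBlock] <;>
        linarith [hcr p, hcr' p, hcr l, hcr' l, hcr n, hcr' n]
  · by_cases h : j = 3
    · subst h
      have hm : flypeBlock l p n (flypeSlot 3) u - flypeBlock l p n (flypeSlot (20 + 3)) u =
          Complex.I * clasp p u := by
        simp [flypeSlot, flypeBlock, halfBlock]; ring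
      rw [hm, show flypeSlotAngle 3 u = -(Real.pi / 6) by simp [flypeSlotAngle],
        dirComp_third_clasp]
      exact clasp_re_pos (by simpa using hne)
    · clear hne
      apply dirComp_add_third_pos y0 y1 <;> interval_cases j <;>
        simp [flypeSlot, flypeBlock, halfBlock] at h ⊢ <;>
        linarith [hcr l, hcr' l, hci l, hci' l, hcr n, hcr' n, hci n, hci' n]

end FlypeLoop

/-- In the last tenth each strand moves to the initial place of the next one, and the triangle makes
a third of a turn. Addition theorems turn the component into a sum of two terms that are nonnegative
for `S` in the unit interval and never vanish together. -/
theorem dirComp_arch_first {S : ℝ} (h0 : 0 ≤ S) (h1 : S ≤ 1) :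
    0 < dirComp (Real.pi / 6 + 2 * Real.pi / 3 * S - 2 * Real.pi / 3)
      ⟨1 - S - Real.cos (Real.pi * S), -1 + S - Real.sin (Real.pi * S)⟩ := by
  have hpi := Real.pi_pos
  have e : dirComp (Real.pi / 6 + 2 * Real.pi / 3 * S - 2 * Real.pi / 3)
      ⟨1 - S - Real.cos (Real.pi * S), -1 + S - Real.sin (Real.pi * S)⟩ =
      Real.sin (Real.pi / 3 * S) + (1 - S) * (√2 * Real.sin (2 * Real.pi / 3 * S + Real.pi / 4)) := by
    rw [dirComp, show Real.pi / 6 + 2 * Real.pi / 3 * S - 2 * Real.pi / 3 =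
      2 * Real.pi / 3 * S - Real.pi / 2 by ring, Real.cos_sub_pi_div_two, Real.sin_sub_pi_div_two,
      show Real.pi / 3 * S = Real.pi * S - 2 * Real.pi / 3 * S by ring, Real.sin_sub, Real.sin_add,
      Real.cos_pi_div_four, Real.sin_pi_div_four]
    have h2 : √2 * √2 = 2 := Real.mul_self_sqrt (by norm_num)
    linear_combination (-(1 - S) * (Real.sin (2 * Real.pi / 3 * S) +
      Real.cos (2 * Real.pi / 3 * S)) / 2) * h2
  rw [e]
  have hs2 : 0 < Real.sin (2 * Real.pi / 3 * S + Real.pi / 4) :=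
    Real.sin_pos_of_pos_of_lt_pi (by positivity) (by nlinarith)
  have h2 : (0 : ℝ) < √2 := by positivity
  rcases h0.eq_or_lt with rfl | h0
  · simp at hs2 ⊢
  · have hs1 : 0 < Real.sin (Real.pi / 3 * S) :=
      Real.sin_pos_of_pos_of_lt_pi (by positivity) (by nlinarith)
    have := mul_nonneg (sub_nonneg.2 h1) (mul_pos h2 hs2).le
    linarith

/-- The arch contributes `cos (π S / 3 - π / 6)`, at least `√3 / 2`; the linear motion of the other
strand is too weak to outweigh it. -/
theorem dirComp_arch_second {S : ℝ} (h0 : 0 ≤ S) (h1 : S ≤ 1) :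
    0 < dirComp (Real.pi / 6 + 2 * Real.pi / 3 * S)
      ⟨1 - S + Real.cos (Real.pi * S), S + Real.sin (Real.pi * S)⟩ := by
  have hpi := Real.pi_pos
  have h3 := sqrt_three_gt
  have h3' := sqrt_three_lt_two
  have e : dirComp (Real.pi / 6 + 2 * Real.pi / 3 * S)
      ⟨1 - S + Real.cos (Real.pi * S), S + Real.sin (Real.pi * S)⟩ =
      Real.cos (Real.pi / 3 * S - Real.pi / 6) + ((1 - S) * Real.cos (Real.pi / 6 + 2 * Real.pi / 3 * S)
        + S * Real.sin (Real.pi / 6 + 2 * Real.pi / 3 * S)) := by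
    rw [dirComp, show Real.pi / 3 * S - Real.pi / 6 =
      Real.pi * S - (Real.pi / 6 + 2 * Real.pi / 3 * S) by ring, Real.cos_sub (Real.pi * S)]
    ring
  rw [e]
  have hc := (sin_cos_of_small (y := Real.pi / 3 * S - Real.pi / 6) (by nlinarith) (by nlinarith)).1
  have hs : 1 / 2 ≤ Real.sin (Real.pi / 6 + 2 * Real.pi / 3 * S) := by
    have := (sin_cos_of_small (y := Real.pi / 6 + 2 * Real.pi / 3 * S - Real.pi / 2))
    rw [← Real.cos_sub_pi_div_two, ← Real.cos_pi_div_three, ← Real.cos_abs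
      (Real.pi / 6 + 2 * Real.pi / 3 * S - Real.pi / 2)]
    exact Real.cos_le_cos_of_nonneg_of_le_pi (abs_nonneg _) (by linarith)
      (abs_le.2 ⟨by nlinarith, by nlinarith⟩)
  rcases le_or_gt S (1 / 2) with h | h
  · have : 0 ≤ Real.cos (Real.pi / 6 + 2 * Real.pi / 3 * S) :=
      Real.cos_nonneg_of_neg_pi_div_two_le_of_le (by nlinarith) (by nlinarith)
    have := mul_nonneg (sub_nonneg.2 h1) this
    nlinarith
  · have : -(√3 / 2) ≤ Real.cos (Real.pi / 6 + 2 * Real.pi / 3 * S) := by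
      rw [← Real.cos_pi_div_six, ← Real.cos_pi_sub]
      exact Real.cos_le_cos_of_nonneg_of_le_pi (by positivity) (by linarith) (by nlinarith)
    nlinarith

theorem dirComp_arch_third {S : ℝ} (h0 : 0 ≤ S) (h1 : S ≤ 1) :
    0 < dirComp (Real.pi / 6 + 2 * Real.pi / 3 * S + 2 * Real.pi / 3) ⟨-2 * (1 - S), 1 - 2 * S⟩ := by
  have hpi := Real.pi_pos
  have h3 := sqrt_three_gt
  rw [dirComp, show Real.pi / 6 + 2 * Real.pi / 3 * S + 2 * Real.pi / 3 =
    2 * Real.pi / 3 * S - Real.pi / 6 + Real.pi by ring, Real.cos_add_pi, Real.sin_add_pi]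
  have e : ∀ a b c d : ℝ, a * -b + c * -d = -a * b - c * d := by intros; ring
  simp only [e]
  rcases le_or_gt S (1 / 2) with h | h
  · obtain ⟨hc, hs, hs'⟩ := sin_cos_of_small (y := 2 * Real.pi / 3 * S - Real.pi / 6) (by nlinarith)
      (by nlinarith)
    nlinarith
  · have hs : 0 < Real.sin (2 * Real.pi / 3 * S - Real.pi / 6) :=
      Real.sin_pos_of_pos_of_lt_pi (by nlinarith) (by nlinarith)
    have hc : 0 ≤ Real.cos (2 * Real.pi / 3 * S - Real.pi / 6) :=
      Real.cos_nonneg_of_neg_pi_div_two_le_of_le (by nlinarith) (by nlinarith)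
    have := mul_nonneg (sub_nonneg.2 h1) hc
    have := mul_pos (show 0 < 2 * S - 1 by linarith) hs
    nlinarith

section FlypeLoop

variable (l p n : ℕ)

theorem triangleAligned_arch {u : ℝ} : TriangleAligned False False (flypeSlotAngle 9 u)
    (flypeBlock l p n (flypeSlot 9) u) (flypeBlock l p n (flypeSlot 19) u)
    (flypeBlock l p n (flypeSlot 29) u) := by
  have hS0 := Real.smoothTransition.nonneg u
  have hS1 := Real.smoothTransition.le_one u
  have h1 := dirComp_arch_first hS0 hS1
  have h2 := dirComp_arch_second hS0 hS1
  have h3 := dirComp_arch_third hS0 hS1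
  have hy : flypeSlotAngle 9 u = Real.pi / 6 + 2 * Real.pi / 3 * Real.smoothTransition u := by
    simp [flypeSlotAngle]
  rw [hy]
  refine ⟨fun _ => ?_, ?_, fun _ => ?_⟩
  · convert h1 using 2
    apply Complex.ext <;> simp [flypeSlot, flypeBlock, halfBlock] <;> ring
  · convert h2 using 2
    apply Complex.ext <;> simp [flypeSlot, flypeBlock, halfBlock] <;> ring
  · convert h3 using 2
    apply Complex.ext <;> simp [flypeSlot, flypeBlock, halfBlock] <;> ring

theorem triangleAligned_slot {j : ℤ} (hj : 0 ≤ j) (hj' : j ≤ 9) (u : ℝ) :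
    TriangleAligned (j = 0 ∧ clasp l u = 0 ∨ j = 7 ∧ clasp n u = 0) (j = 3 ∧ clasp p u = 0)
      (flypeSlotAngle j u) (flypeBlock l p n (flypeSlot j) u)
      (flypeBlock l p n (flypeSlot (10 + j)) u) (flypeBlock l p n (flypeSlot (20 + j)) u) := by
  by_cases h : j ≤ 8
  · exact triangleAligned_small l p n hj h
  · obtain rfl : j = 9 := by omega
    obtain ⟨h1, h2, h3⟩ := triangleAligned_arch l p n (u := u)
    exact ⟨fun _ => h1 (by simp), h2, fun _ => h3 (by simp)⟩

/-- The double points of the curve for the flype, as a closed 3-braid, at a third and a tenth of a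
turn. -/
def FlypeDouble (q j : ℤ) (u : ℝ) : Prop :=
  q % 3 = 0 ∧ j = 0 ∧ clasp l u = 0 ∨ q % 3 = 0 ∧ j = 7 ∧ clasp n u = 0 ∨
    q % 3 = 2 ∧ j = 3 ∧ clasp p u = 0

theorem flypeSlot_eq (q j : ℤ) : flypeSlot (10 * q + j) = flypeSlot (10 * (q % 3) + j) := by
  have : (10 * q + j) % 30 = (10 * (q % 3) + j) % 30 := by omega
  rw [← flypeSlot_mod, this, flypeSlot_mod]

theorem dirComp_add_turns (y : ℝ) (m : ℤ) (d : ℂ) : dirComp (y + m * (2 * Real.pi)) d = dirComp y d := by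
  rw [dirComp, Real.cos_add_int_mul_two_pi, Real.sin_add_int_mul_two_pi, dirComp]

theorem flype_dirComp_pos (q : ℤ) {j : ℤ} (hj : 0 ≤ j) (hj' : j ≤ 9) (u : ℝ)
    (h : ¬FlypeDouble l p n q j u) : 0 < dirComp (flypeSlotAngle j u + 2 * Real.pi / 3 * (q - 1))
      (flypeBlock l p n (flypeSlot (10 * q + j + 10)) u -
        flypeBlock l p n (flypeSlot (10 * q + j)) u) := by
  obtain ⟨h1, h2, h3⟩ := triangleAligned_slot l p n hj hj' u
  rw [show 10 * q + j + 10 = 10 * (q + 1) + j by ring, flypeSlot_eq q, flypeSlot_eq (q + 1)]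
  unfold FlypeDouble at h
  have hq : (q : ℝ) = (q % 3 : ℤ) + 3 * (q / 3 : ℤ) := by exact_mod_cast (Int.emod_add_mul_ediv q 3).symm
  rw [show flypeSlotAngle j u + 2 * Real.pi / 3 * ((q : ℝ) - 1) =
    flypeSlotAngle j u + 2 * Real.pi / 3 * ((q % 3 : ℤ) - 1) + (q / 3 : ℤ) * (2 * Real.pi) by
    rw [hq]; ring, dirComp_add_turns]
  have hk : q % 3 = 0 ∨ q % 3 = 1 ∨ q % 3 = 2 := by omega
  rcases hk with hk | hk | hk
  · have hk' : (q + 1) % 3 = 1 := by omega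
    rw [hk, hk']
    convert h1 (by tauto) using 2 <;> simp
    ring
  · have hk' : (q + 1) % 3 = 2 := by omega
    rw [hk, hk']
    convert h2 using 2 <;> norm_num
  · have hk' : (q + 1) % 3 = 0 := by omega
    rw [hk, hk']
    have hQ : ¬(j = 3 ∧ clasp p u = 0) := fun h' => h (Or.inr (Or.inr ⟨hk, h'⟩))
    have e : flypeSlotAngle j u + 2 * Real.pi / 3 * (((2 : ℤ) : ℝ) - 1) =
        flypeSlotAngle j u + 2 * Real.pi / 3 := by
      push_cast; ring
    rw [e, mul_zero, zero_add]
    exact h3 hQ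

theorem flype_dirComp_deriv {q j : ℤ} {u : ℝ} (h : FlypeDouble l p n q j u) :
    (0 < u ∧ u < 1) ∧ flypeBlock l p n (flypeSlot (10 * q + j + 10)) u =
      flypeBlock l p n (flypeSlot (10 * q + j)) u ∧
    0 < dirComp (flypeSlotAngle j u + 2 * Real.pi / 3 * (q - 1))
      (-Complex.I * (deriv (flypeBlock l p n (flypeSlot (10 * q + j + 10))) u -
        deriv (flypeBlock l p n (flypeSlot (10 * q + j))) u)) := by
  have hq : (q : ℝ) = (q % 3 : ℤ) + 3 * (q / 3 : ℤ) := by exact_mod_cast (Int.emod_add_mul_ediv q 3).symm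
  rw [← deriv_fun_sub ((contDiff_flypeBlock l p n _).differentiable (by simp) _)
    ((contDiff_flypeBlock l p n _).differentiable (by simp) _)]
  rw [show 10 * q + j + 10 = 10 * (q + 1) + j by ring, flypeSlot_eq q, flypeSlot_eq (q + 1)]
  rw [show flypeSlotAngle j u + 2 * Real.pi / 3 * ((q : ℝ) - 1) =
    flypeSlotAngle j u + 2 * Real.pi / 3 * ((q % 3 : ℤ) - 1) + (q / 3 : ℤ) * (2 * Real.pi) by
    rw [hq]; ring, dirComp_add_turns]
  have key : ∀ (m : ℕ) (y : ℝ) (c : ℂ) (f g : ℝ → ℂ), (∀ v, f v - g v = c * clasp m v) →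
      clasp m u = 0 → 0 < dirComp y c → (0 < u ∧ u < 1) ∧ f u = g u ∧
      0 < dirComp y (-Complex.I * deriv (fun v => f v - g v) u) := by
    intro m y c f g hfg hm hy
    obtain ⟨r, hr, hd⟩ := clasp_hasDerivAt hm
    refine ⟨clasp_zero_mem hm, sub_eq_zero.1 (by rw [hfg, hm, mul_zero]), ?_⟩
    simp only [hfg]
    rw [(hd.const_mul c).deriv]
    have : -Complex.I * (c * (r * Complex.I)) = r * c := by
      -- The clasp leaves 0 with the derivative `c * r * I`, perpendicular to the direction `c` in
      -- which the edge points otherwise; rotated by a quarter turn it is aligned with the edge.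
      linear_combination (-(r * c)) * Complex.I_mul_I
    rw [this, dirComp]
    rw [dirComp] at hy
    simp only [Complex.mul_re, Complex.mul_im, Complex.ofReal_re, Complex.ofReal_im]
    nlinarith
  have hI1 : 0 < dirComp (Real.pi / 6 - 2 * Real.pi / 3) (-Complex.I) := by
    have := dirComp_first_clasp 1
    rw [mul_one, Complex.one_re] at this
    rw [this]; exact one_pos
  have hI2 : 0 < dirComp (-(Real.pi / 6) + 2 * Real.pi / 3) Complex.I := by
    have := dirComp_third_clasp 1
    rw [mul_one, Complex.one_re] at this
    rw [this]; exact one_pos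
  rcases h with ⟨hk, rfl, hc⟩ | ⟨hk, rfl, hc⟩ | ⟨hk, rfl, hc⟩
  · have hk' : (q + 1) % 3 = 1 := by omega
    rw [hk, hk']
    refine key l _ (-Complex.I) _ _ (fun v => ?_) hc ?_
    · simp [flypeSlot, flypeBlock, halfBlock]; ring
    · convert hI1 using 2
      simp [flypeSlotAngle]; ring
  · have hk' : (q + 1) % 3 = 1 := by omega
    rw [hk, hk']
    refine key n _ (-Complex.I) _ _ (fun v => ?_) hc ?_
    · simp [flypeSlot, flypeBlock, halfBlock]; ring
    · convert hI1 using 2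
      simp [flypeSlotAngle]; ring
  · have hk' : (q + 1) % 3 = 0 := by omega
    rw [hk, hk']
    refine key p _ Complex.I _ _ (fun v => ?_) hc ?_
    · simp [flypeSlot, flypeBlock, halfBlock]; ring
    · convert hI2 using 2
      simp [flypeSlotAngle]; ring

theorem flypeLoop_eq_iff (q : ℤ) {j : ℤ} (hj : 0 ≤ j) (hj' : j ≤ 9) {u : ℝ} (h0 : 0 ≤ u) (h1 : u < 1) :
    flypeLoop l p n (((10 * q + j : ℤ) + u) / 10 + 1) = flypeLoop l p n (((10 * q + j : ℤ) + u) / 10) ↔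
      FlypeDouble l p n q j u := by
  rw [flypeLoop_apply_add_one l p n _ h0 h1, flypeLoop_apply l p n _ h0 h1]
  refine ⟨fun h => ?_, fun h => (flype_dirComp_deriv l p n h).2.1⟩
  by_contra hd
  have := flype_dirComp_pos l p n q hj hj' u hd
  rw [h, sub_self] at this
  simp [dirComp] at this

theorem exists_tenth (x : ℝ) : ∃ (q j : ℤ) (u : ℝ), 0 ≤ j ∧ j ≤ 9 ∧ 0 ≤ u ∧ u < 1 ∧
    x = ((10 * q + j : ℤ) + u) / 10 := by
  obtain ⟨i, u, h0, h1, hx⟩ := exists_int_add (10 * x)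
  refine ⟨i / 10, i % 10, u, by omega, by omega, h0, h1, ?_⟩
  rw [Int.mul_ediv_add_emod i 10, ← hx]
  ring

theorem flypeLoop_aligned : Aligned flypeAngle (flypeLoop l p n) := by
  refine ⟨fun x hx => ?_, fun x hx => ?_⟩
  · obtain ⟨q, j, u, hj, hj', h0, h1, rfl⟩ := exists_tenth x
    rw [ne_eq, flypeLoop_eq_iff l p n q hj hj' h0 h1] at hx
    rw [exp_mul_re, flypeLoop_apply_add_one l p n _ h0 h1, flypeLoop_apply l p n _ h0 h1,
      flypeAngle_slot q hj hj' h0 h1.le]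
    exact flype_dirComp_pos l p n q hj hj' u hx
  · obtain ⟨q, j, u, hj, hj', h0, h1, rfl⟩ := exists_tenth x
    rw [flypeLoop_eq_iff l p n q hj hj' h0 h1] at hx
    obtain ⟨⟨h2, h3⟩, -, h⟩ := flype_dirComp_deriv l p n hx
    have hd : ∀ (i : ℤ), deriv (flypeLoop l p n) ((i + u) / 10) =
        10 * deriv (flypeBlock l p n (flypeSlot i)) u := by
      intro i
      have := deriv_comp_mul_left (10 : ℝ) (glue fun i => flypeBlock l p n (flypeSlot i))
        ((i + u) / 10)
      rw [mul_div_cancel₀ _ (by norm_num), glue_deriv _ i h2 h3, Complex.real_smul] at this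
      rw [show flypeLoop l p n = fun x => glue (fun i => flypeBlock l p n (flypeSlot i)) (10 * x)
        from rfl, this]
      simp
    have e : (((10 * q + j : ℤ) : ℝ) + u) / 10 + 1 = ((10 * q + j + 10 : ℤ) + u) / 10 := by
      push_cast; ring
    rw [exp_mul_im, e, hd, hd, flypeAngle_slot q hj hj' h0 h1.le, ← mul_sub, mul_left_comm]
    rw [dirComp] at h ⊢
    rw [show (10 : ℂ) = ((10 : ℝ) : ℂ) by simp]
    simp only [Complex.re_ofReal_mul, Complex.im_ofReal_mul]
    linarith

end FlypeLoop

/-! ### The curve for the flype and the triangular curve -/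

section Fan

variable (l p n : ℕ)

/-- The tails of the chords of `a^l c^p a^n`. -/
def fanTails : List (ZMod 3) := List.replicate l 0 ++ List.replicate p 2 ++ List.replicate n 0

theorem length_fanTails : (fanTails l p n).length = l + p + n := by
  simp [fanTails, Nat.add_assoc]

/-- The times, in tenths of a turn, of the chords and of the middle of the last tenth. -/
noncomputable def fanOffset (r : ℕ) : ℝ :=
  if r < l then (r + 1 / 2) / l else if r < l + p then 3 + (r - l + 1 / 2) / p
  else if r < l + p + n then 7 + (r - l - p + 1 / 2) / n else 19 / 2

/-- The times, in tenths of a turn, of the chords and of the middles of the last tenths. -/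
noncomputable def fanNode (m : ℤ) : ℝ :=
  10 * (m / (l + p + n + 1 : ℕ) : ℤ) + fanOffset l p n (m % (l + p + n + 1 : ℕ)).toNat

theorem fanNode_mul_add (q : ℤ) {r : ℕ} (h : r < l + p + n + 1) :
    fanNode l p n (q * (l + p + n + 1 : ℕ) + r) = 10 * q + fanOffset l p n r := by
  have h0 : ((l + p + n + 1 : ℕ) : ℤ) ≠ 0 := by positivity
  have h1 : (q * (l + p + n + 1 : ℕ) + r) / ((l + p + n + 1 : ℕ) : ℤ) = q := by
    rw [Int.add_comm, Int.add_mul_ediv_right _ _ h0, Int.ediv_eq_zero_of_lt (by omega) (by omega),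
      zero_add]
  have h2 : (q * (l + p + n + 1 : ℕ) + r) % ((l + p + n + 1 : ℕ) : ℤ) = r := by
    rw [Int.add_comm, Int.add_mul_emod_self_right, Int.emod_eq_of_lt (by omega) (by omega)]
  rw [fanNode, h1, h2, Int.toNat_natCast]

theorem exists_fan_rem (m : ℤ) : ∃ (q : ℤ) (r : ℕ), r < l + p + n + 1 ∧
    m = q * (l + p + n + 1 : ℕ) + r := by
  have h1 := Int.emod_nonneg m (show ((l + p + n + 1 : ℕ) : ℤ) ≠ 0 by positivity)
  have h2 := Int.emod_lt_of_pos m (show (0 : ℤ) < (l + p + n + 1 : ℕ) by positivity)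
  refine ⟨m / (l + p + n + 1 : ℕ), (m % (l + p + n + 1 : ℕ)).toNat, by omega, ?_⟩
  rw [Int.toNat_of_nonneg h1, mul_comm, Int.mul_ediv_add_emod]

theorem fanNode_add (m : ℤ) : fanNode l p n (m + (l + p + n + 1 : ℕ)) = fanNode l p n m + 10 := by
  obtain ⟨q, r, hr, rfl⟩ := exists_fan_rem l p n m
  rw [fanNode_mul_add l p n q hr, show q * ((l + p + n + 1 : ℕ) : ℤ) + r + (l + p + n + 1 : ℕ) =
    (q + 1) * (l + p + n + 1 : ℕ) + r by ring, fanNode_mul_add l p n _ hr]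
  push_cast
  ring

theorem div_mem_unit {a m : ℕ} (h : a < m) : 0 ≤ ((a : ℝ) + 1 / 2) / m ∧ ((a : ℝ) + 1 / 2) / m ≤ 1 := by
  have h1 : (a : ℝ) + 1 ≤ m := by exact_mod_cast h
  refine ⟨by positivity, div_le_one_of_le₀ (by linarith) (by positivity)⟩

theorem fanOffset_first {r : ℕ} (h : r < l) : fanOffset l p n r = (r + 1 / 2) / l := if_pos h

theorem fanOffset_second {r : ℕ} (h : r < p) : fanOffset l p n (l + r) = 3 + (r + 1 / 2) / p := by
  rw [fanOffset, if_neg (by omega), if_pos (by omega)]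
  push_cast
  rw [add_sub_cancel_left]

theorem fanOffset_third {r : ℕ} (h : r < n) :
    fanOffset l p n (l + p + r) = 7 + (r + 1 / 2) / n := by
  rw [fanOffset, if_neg (by omega), if_neg (by omega), if_pos (by omega)]
  push_cast
  congr 3
  ring

theorem fanOffset_last : fanOffset l p n (l + p + n) = 19 / 2 := by
  rw [fanOffset, if_neg (by omega), if_neg (by omega), if_neg (by omega)]

theorem fan_cases {r : ℕ} (h : r < l + p + n + 1) : r < l ∨ (∃ k < p, r = l + k) ∨
    (∃ k < n, r = l + p + k) ∨ r = l + p + n := by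
  by_cases h1 : r < l
  · exact Or.inl h1
  by_cases h2 : r < l + p
  · exact Or.inr (Or.inl ⟨r - l, by omega, by omega⟩)
  by_cases h3 : r < l + p + n
  · exact Or.inr (Or.inr (Or.inl ⟨r - l - p, by omega, by omega⟩))
  · exact Or.inr (Or.inr (Or.inr (by omega)))

theorem fanOffset_nonneg {r : ℕ} (h : r < l + p + n + 1) : 0 ≤ fanOffset l p n r := by
  obtain h | ⟨k, hk, rfl⟩ | ⟨k, hk, rfl⟩ | rfl := fan_cases l p n h
  · rw [fanOffset_first l p n h]; exact (div_mem_unit h).1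
  · rw [fanOffset_second l p n hk]; linarith [(div_mem_unit hk).1]
  · rw [fanOffset_third l p n hk]; linarith [(div_mem_unit hk).1]
  · rw [fanOffset_last]; norm_num

/-- A lower bound for the distances of the times of the chords. -/
noncomputable def fanGap : ℝ := 1 / (l + p + n + 2 : ℕ)

theorem fanGap_pos : 0 < fanGap l p n := by unfold fanGap; positivity

/-- The summand 2 in `fanGap` provides for the middle `19 / 2` of the last tenth, which is only
guaranteed the distance `1 / 2` from the next turn. -/
theorem fanGap_le_half : fanGap l p n ≤ 1 / 2 := by
  unfold fanGap
  apply one_div_le_one_div_of_le (by norm_num)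
  push_cast
  have : (0 : ℝ) ≤ l + p + n := by positivity
  linarith

theorem fanGap_le {m : ℕ} (h0 : 0 < m) (h : m ≤ l + p + n + 2) (a : ℝ) :
    fanGap l p n ≤ (a + 1 + 1 / 2) / m - (a + 1 / 2) / m := by
  have h0' : (0 : ℝ) < m := by exact_mod_cast h0
  rw [← sub_div, show a + 1 + 1 / 2 - (a + 1 / 2) = 1 by ring]
  exact one_div_le_one_div_of_le h0' (by exact_mod_cast h)

theorem fanNode_gap (m : ℤ) : fanGap l p n ≤ fanNode l p n (m + 1) - fanNode l p n m := by
  obtain ⟨q, r, hr, rfl⟩ := exists_fan_rem l p n m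
  have hg := fanGap_le_half l p n
  rw [fanNode_mul_add l p n q hr]
  rcases Nat.lt_or_ge (r + 1) (l + p + n + 1) with h | h
  · rw [show q * ((l + p + n + 1 : ℕ) : ℤ) + r + 1 = q * (l + p + n + 1 : ℕ) + (r + 1 : ℕ) by
      push_cast; ring, fanNode_mul_add l p n _ h, add_sub_add_left_eq_sub]
    obtain h1 | ⟨k, h1, rfl⟩ | ⟨k, h1, rfl⟩ | rfl := fan_cases l p n hr
    · rw [fanOffset_first l p n h1]
      have b1 := div_mem_unit h1
      obtain h2 | ⟨i, h2, h3⟩ | ⟨i, h2, h3⟩ | h3 := fan_cases l p n h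
      · rw [fanOffset_first l p n h2]
        push_cast
        exact fanGap_le l p n (by omega) (by omega) _
      · rw [h3, fanOffset_second l p n h2]; linarith [(div_mem_unit h2).1]
      · rw [h3, fanOffset_third l p n h2]; linarith [(div_mem_unit h2).1]
      · rw [h3, fanOffset_last]; linarith
    · rw [fanOffset_second l p n h1]
      have b1 := div_mem_unit h1
      obtain h2 | ⟨i, h2, h3⟩ | ⟨i, h2, h3⟩ | h3 := fan_cases l p n h
      · omega
      · rw [h3, fanOffset_second l p n h2, show i = k + 1 by omega]
        push_cast
        rw [add_sub_add_left_eq_sub]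
        exact fanGap_le l p n (by omega) (by omega) _
      · rw [h3, fanOffset_third l p n h2]; linarith [(div_mem_unit h2).1]
      · rw [h3, fanOffset_last]; linarith
    · rw [fanOffset_third l p n h1]
      have b1 := div_mem_unit h1
      obtain h2 | ⟨i, h2, h3⟩ | ⟨i, h2, h3⟩ | h3 := fan_cases l p n h
      · omega
      · omega
      · rw [h3, fanOffset_third l p n h2, show i = k + 1 by omega]
        push_cast
        rw [add_sub_add_left_eq_sub]
        exact fanGap_le l p n (by omega) (by omega) _
      · rw [h3, fanOffset_last]; linarith
    · omega
  · obtain rfl : r = l + p + n := by omega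
    rw [show q * ((l + p + n + 1 : ℕ) : ℤ) + (l + p + n : ℕ) + 1 =
      (q + 1) * (l + p + n + 1 : ℕ) + (0 : ℕ) by push_cast; ring,
      fanNode_mul_add l p n _ (by omega), fanOffset_last]
    have := fanOffset_nonneg l p n (r := 0) (by omega)
    push_cast
    linarith

/-- The change of the time from the triangular curve to the curve for the flype. -/
noncomputable def fanTime (x : ℝ) : ℝ :=
  interp (fanNode l p n) (fanGap l p n) ((l + p + n + 1 : ℕ) * x - 1 / 2) / 10

theorem fanTime_isReparam : IsReparam (fanTime l p n) := by
  have hN : (0 : ℝ) < (l + p + n + 1 : ℕ) := by positivity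
  have hs : ContDiff ℝ ∞ fun x : ℝ => ((l + p + n + 1 : ℕ) : ℝ) * x - 1 / 2 :=
    (contDiff_const.mul contDiff_id).sub contDiff_const
  refine ⟨(contDiff_interp.comp hs).div_const _, fun x => ?_, fun x => ?_⟩
  · have hd := ((contDiff_interp (y := fanNode l p n) (ε := fanGap l p n)).differentiable (by simp)
      ((l + p + n + 1 : ℕ) * x - 1 / 2)).hasDerivAt
    have h0 : HasDerivAt (fun x : ℝ => ((l + p + n + 1 : ℕ) : ℝ) * x - 1 / 2) (l + p + n + 1 : ℕ) x := by
      simpa using ((hasDerivAt_id x).const_mul ((l + p + n + 1 : ℕ) : ℝ)).sub_const (1 / 2)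
    have : HasDerivAt (fanTime l p n) _ x :=
      (HasDerivAt.comp (h := fun x : ℝ => ((l + p + n + 1 : ℕ) : ℝ) * x - 1 / 2) x hd h0).div_const _
    rw [this.deriv]
    exact div_pos (mul_pos (interp_deriv_pos (fanGap_pos l p n) (fanNode_gap l p n) _) hN)
      (by norm_num)
  · have h := interp_add_int (ε := fanGap l p n) (fanNode_add l p n)
      ((l + p + n + 1 : ℕ) * x - 1 / 2)
    rw [Int.cast_natCast] at h
    rw [fanTime, fanTime, show ((l + p + n + 1 : ℕ) : ℝ) * (x + 1) - 1 / 2 =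
      (l + p + n + 1 : ℕ) * x - 1 / 2 + (l + p + n + 1 : ℕ) by ring, h, add_div,
      div_self (by norm_num)]

theorem fanTime_half (q : ℤ) {r : ℕ} (h : r < l + p + n + 1) :
    fanTime l p n ((q * (l + p + n + 1 : ℕ) + r + 1 / 2) / (l + p + n + 1 : ℕ)) =
      (10 * q + fanOffset l p n r) / 10 := by
  rw [fanTime, mul_div_cancel₀ _ (by positivity), add_sub_cancel_right, ← fanNode_mul_add l p n q h]
  have := interp_int (y := fanNode l p n) (ε := fanGap l p n) (q * (l + p + n + 1 : ℕ) + r)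
  rw [← this]
  push_cast
  rfl

theorem zmod_three_eq_zero_iff (q : ℤ) : (q : ZMod 3) = 0 ↔ q % 3 = 0 := by
  rw [ZMod.intCast_zmod_eq_zero_iff_dvd, Int.dvd_iff_emod_eq_zero]
  rfl

theorem zmod_three_eq_two_iff (q : ℤ) : (q : ZMod 3) = 2 ↔ q % 3 = 2 := by
  have h := ZMod.intCast_eq_intCast_iff' q 2 3
  simpa using h

theorem fanTails_first {r : ℕ} (h : r < l) : (fanTails l p n)[r]? = some 0 := by
  rw [fanTails, List.getElem?_append_left (by simp; omega), List.getElem?_append_left (by simpa),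
    List.getElem?_replicate, if_pos h]

theorem fanTails_second {r : ℕ} (h : r < p) : (fanTails l p n)[l + r]? = some 2 := by
  rw [fanTails, List.getElem?_append_left (by simpa), List.getElem?_append_right (by simp),
    List.getElem?_replicate, if_pos (by simpa)]

theorem fanTails_third {r : ℕ} (h : r < n) : (fanTails l p n)[l + p + r]? = some 0 := by
  rw [fanTails, List.getElem?_append_right (by simp), List.getElem?_replicate, if_pos (by simpa)]

/-- The double points of the curve for the flype, as a closed 3-braid. -/
theorem flypeLoop_eq_iff' (x : ℝ) : flypeLoop l p n (x + 1) = flypeLoop l p n x ↔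
    ∃ (q : ℤ) (r : ℕ), (fanTails l p n)[r]? = some (q : ZMod 3) ∧
      x = (10 * q + fanOffset l p n r) / 10 := by
  have hu : ∀ {m k : ℕ} {u : ℝ}, k < m → m * u = k + 1 / 2 → u = (k + 1 / 2) / m := by
    intro m k u hk h
    have : (0 : ℝ) < m := by exact_mod_cast (by omega : 0 < m)
    rw [eq_div_iff this.ne', ← h, mul_comm]
  have hu' : ∀ {m k : ℕ}, k < m → clasp m ((k + 1 / 2) / m) = 0 := by
    intro m k hk
    have : (0 : ℝ) < m := by exact_mod_cast (by omega : 0 < m)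
    exact (clasp_eq_zero_iff _ _).2 ⟨k, hk, by field_simp⟩
  constructor
  · intro h
    obtain ⟨q, j, u, hj, hj', h0, h1, rfl⟩ := exists_tenth x
    rw [flypeLoop_eq_iff l p n q hj hj' h0 h1] at h
    refine ⟨q, ?_⟩
    rcases h with ⟨hq, rfl, hc⟩ | ⟨hq, rfl, hc⟩ | ⟨hq, rfl, hc⟩ <;>
      obtain ⟨k, hk, hku⟩ := (clasp_eq_zero_iff _ _).1 hc
    · refine ⟨k, by rw [fanTails_first l p n hk, (zmod_three_eq_zero_iff q).2 hq], ?_⟩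
      rw [fanOffset_first l p n hk, hu hk hku]
      push_cast; ring
    · refine ⟨l + p + k, by rw [fanTails_third l p n hk, (zmod_three_eq_zero_iff q).2 hq], ?_⟩
      rw [fanOffset_third l p n hk, hu hk hku]
      push_cast; ring
    · refine ⟨l + k, by rw [fanTails_second l p n hk, (zmod_three_eq_two_iff q).2 hq], ?_⟩
      rw [fanOffset_second l p n hk, hu hk hku]
      push_cast; ring
  · rintro ⟨q, r, hr, rfl⟩
    have hlt : r < l + p + n := by
      have := (List.getElem?_eq_some_iff.1 hr).1
      rwa [length_fanTails] at this
    have hone : ∀ {m k : ℕ}, k < m → ((k : ℝ) + 1 / 2) / m < 1 := fun h =>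
      (clasp_zero_mem (hu' h)).2
    have hnn : ∀ {m k : ℕ}, k < m → 0 ≤ ((k : ℝ) + 1 / 2) / m := fun h => (div_mem_unit h).1
    obtain h | ⟨k, h, rfl⟩ | ⟨k, h, rfl⟩ | rfl := fan_cases l p n (hlt.trans (Nat.lt_succ_self _))
    · rw [fanTails_first l p n h, Option.some.injEq, eq_comm, zmod_three_eq_zero_iff] at hr
      have := (flypeLoop_eq_iff l p n q (j := 0) le_rfl (by norm_num) (hnn h) (hone h)).2
        (Or.inl ⟨hr, rfl, hu' h⟩)
      rw [fanOffset_first l p n h]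
      convert this using 3 <;> push_cast <;> ring
    · rw [fanTails_second l p n h, Option.some.injEq, eq_comm, zmod_three_eq_two_iff] at hr
      have := (flypeLoop_eq_iff l p n q (j := 3) (by norm_num) (by norm_num) (hnn h) (hone h)).2
        (Or.inr (Or.inr ⟨hr, rfl, hu' h⟩))
      rw [fanOffset_second l p n h]
      convert this using 3 <;> push_cast <;> ring
    · rw [fanTails_third l p n h, Option.some.injEq, eq_comm, zmod_three_eq_zero_iff] at hr
      have := (flypeLoop_eq_iff l p n q (j := 7) (by norm_num) (by norm_num) (hnn h) (hone h)).2
        (Or.inr (Or.inl ⟨hr, rfl, hu' h⟩))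
      rw [fanOffset_third l p n h]
      convert this using 3 <;> push_cast <;> ring
    · omega

theorem flypeLoop_fanTime_eq_iff (x : ℝ) :
    flypeLoop l p n (fanTime l p n x + 1) = flypeLoop l p n (fanTime l p n x) ↔
      triCurve (fanTails l p n) (x + 1) = triCurve (fanTails l p n) x := by
  rw [flypeLoop_eq_iff', triCurve_eq_iff', length_fanTails]
  refine exists_congr fun q => exists_congr fun r => and_congr_right fun hr => ?_
  have hlt : r < l + p + n + 1 := by
    have := (List.getElem?_eq_some_iff.1 hr).1
    rw [length_fanTails] at this
    omega
  rw [← fanTime_half l p n q hlt, (fanTime_isReparam l p n).strictMono.injective.eq_iff]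

/-- The interval runs between the middles of two successive last tenths, where the transition has
the value `1 / 2`. In between, the direction stays within `π / 6` of its mean, except in the last
tenths, where half of the turn of `2π/3` is counted. -/
theorem flypeAngle_bounds (q : ℤ) {x : ℝ} (h0 : 10 * (q : ℝ) - 1 / 2 ≤ 10 * x)
    (h1 : 10 * x ≤ 10 * q + 19 / 2) : -(5 * Real.pi / 6) ≤ flypeAngle x - 2 * Real.pi / 3 * q ∧
      flypeAngle x - 2 * Real.pi / 3 * q ≤ -(Real.pi / 6) := by
  have hpi := Real.pi_pos
  obtain ⟨k, j, u, hj, hj', hu0, hu1, rfl⟩ := exists_tenth x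
  rw [flypeAngle_slot k hj hj' hu0 hu1.le]
  rw [mul_div_cancel₀ _ (by norm_num)] at h0 h1
  have hS0 := Real.smoothTransition.nonneg u
  have hS1 := Real.smoothTransition.le_one u
  by_cases h8 : j ≤ 8
  · obtain ⟨b0, b1⟩ := flypeSlotAngle_small hj h8 u
    have hk : k = q := by
      have a1 : (10 * q - 1 / 2 : ℝ) < ((10 * k + j : ℤ) : ℝ) + 1 := by linarith
      have a2 : ((10 * k + j : ℤ) : ℝ) ≤ 10 * q + 19 / 2 := by linarith
      have a1 : (10 * q - 2 : ℤ) < (10 * k + j) := by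
        have : ((10 * q - 2 : ℤ) : ℝ) < ((10 * k + j : ℤ) : ℝ) := by push_cast at a1 ⊢; linarith
        exact_mod_cast this
      have a2 : (10 * k + j) < (10 * q + 10 : ℤ) := by
        have : ((10 * k + j : ℤ) : ℝ) < ((10 * q + 10 : ℤ) : ℝ) := by push_cast at a2 ⊢; linarith
        exact_mod_cast this
      omega
    subst hk
    constructor <;> linarith
  · obtain rfl : j = 9 := by omega
    have e : flypeSlotAngle 9 u = Real.pi / 6 + 2 * Real.pi / 3 * Real.smoothTransition u := by
      simp [flypeSlotAngle]
    rw [e]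
    push_cast at h0 h1
    have hk : k = q - 1 ∨ k = q := by
      have a1 : (10 * (q - 2) : ℤ) < 10 * k := by
        have : ((10 * (q - 2) : ℤ) : ℝ) < ((10 * k : ℤ) : ℝ) := by push_cast; linarith
        exact_mod_cast this
      have a2 : 10 * k < (10 * q + 1 : ℤ) := by
        have : ((10 * k : ℤ) : ℝ) < ((10 * q + 1 : ℤ) : ℝ) := by push_cast; linarith
        exact_mod_cast this
      omega
    rcases hk with rfl | rfl
    · push_cast at h0 ⊢
      have : 1 / 2 ≤ Real.smoothTransition u := by
        rcases (show 1 / 2 ≤ u by linarith).eq_or_lt with h | h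
        · rw [← h, smoothTransition_half]
        · exact (half_lt_smoothTransition h).le
      constructor <;> nlinarith
    · have : Real.smoothTransition u ≤ 1 / 2 := by
        rcases (show u ≤ 1 / 2 by linarith).eq_or_lt with h | h
        · rw [h, smoothTransition_half]
        · exact (smoothTransition_lt_half h).le
      constructor <;> nlinarith

theorem triAngle_last (w : List (ZMod 3)) (q : ℤ) :
    triAngle w ((q * (w.length + 1 : ℕ) + w.length + 1 / 2) / (w.length + 1 : ℕ)) =
      2 * Real.pi / 3 * q := by
  have := triAngle_apply w (q * (w.length + 1 : ℕ) + w.length) (u := 1 / 2) (by norm_num)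
    (by norm_num)
  rw [blockSym_mul_add w q (by omega), List.getElem?_eq_none le_rfl, if_pos rfl,
    smoothTransition_half, Int.add_comm, Int.add_mul_ediv_right _ _ (by positivity),
    Int.ediv_eq_zero_of_lt (by omega) (by omega), zero_add] at this
  push_cast at this ⊢
  rw [add_comm ((w.length : ℝ)) (q * _)] at this
  rw [this]
  ring

/-- The middles of the closing braids are matched with the middles of the last tenths. Between two
of them `triAngle` grows from `2π/3 * (q - 1)` to `2π/3 * q`, and `flypeAngle_bounds` keeps the
other direction between `2π/3 * q - 5π/6` and `2π/3 * q - π/6`. The difference lies between `-5π/6`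
and `π/2`. -/
theorem fanTime_angle (x : ℝ) :
    |flypeAngle (fanTime l p n x) - triAngle (fanTails l p n) x| < Real.pi := by
  have hpi := Real.pi_pos
  have hN : (0 : ℝ) < (l + p + n + 1 : ℕ) := by positivity
  have hmono := triAngle_monotone (fanTails l p n)
  have hlast := triAngle_last (fanTails l p n)
  rw [length_fanTails] at hlast
  have htm := (fanTime_isReparam l p n).strictMono.monotone
  have hhalf := fun q => fanTime_half l p n q (r := l + p + n) (by omega)
  rw [fanOffset_last] at hhalf
  generalize triAngle (fanTails l p n) = ψ at *
  obtain ⟨q, v, hv0, hv1, hx⟩ := exists_int_add (x + 1 / 2 / (l + p + n + 1 : ℕ))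
  have e1 : ((q - 1 : ℤ) * (l + p + n + 1 : ℕ) + (l + p + n : ℕ) + 1 / 2 : ℝ) / (l + p + n + 1 : ℕ) ≤ x := by
    rw [div_le_iff₀ hN]
    have : x = q + v - 1 / 2 / (l + p + n + 1 : ℕ) := by linarith
    rw [this, sub_mul, div_mul_cancel₀ _ hN.ne']
    push_cast at hN ⊢
    nlinarith
  have e2 : x ≤ (q * (l + p + n + 1 : ℕ) + (l + p + n : ℕ) + 1 / 2 : ℝ) / (l + p + n + 1 : ℕ) := by
    rw [le_div_iff₀ hN]
    have : x = q + v - 1 / 2 / (l + p + n + 1 : ℕ) := by linarith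
    rw [this, sub_mul, div_mul_cancel₀ _ hN.ne']
    push_cast at hN ⊢
    nlinarith
  have h1 := hmono e1
  have h2 := hmono e2
  have h3 := htm e1
  have h4 := htm e2
  rw [hlast] at h1 h2
  rw [hhalf] at h3 h4
  push_cast at h1 h3
  obtain ⟨h5, h6⟩ := flypeAngle_bounds q (x := fanTime l p n x) (by linarith) (by linarith)
  rw [abs_lt]
  constructor <;> linarith

theorem flypeLoop_isotopic : SingularIsotopic (braidKnot (triCurve (fanTails l p n)))
    (braidKnot (flypeLoop l p n)) ∧ IsBraidLoop (flypeLoop l p n) := by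
  obtain ⟨φ, hφ, h1, h2⟩ := (fanTime_isReparam l p n).exists_inverse
  refine SingularIsotopic.of_aligned (triCurve_isBraidLoop _) (triCurve_aligned _)
    (contDiff_flypeLoop l p n) (flypeLoop_add_three l p n) (flypeLoop_aligned l p n)
    (contDiff_triAngle _) contDiff_flypeAngle hφ (fun x => ?_)
    (fun x => by rw [flypeAngle_add_one, triAngle_add_one]; ring) (fun x => ?_)
  · have := flypeLoop_fanTime_eq_iff l p n (φ x)
    rwa [h2] at this
  · have := fanTime_angle l p n (φ x)
    rwa [h2] at this

end Fan

/-! ### Coincidences during the flype -/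

theorem exists_int_add_of_mem {a b : ℤ} (hab : a < b) {x : ℝ} (h0 : a ≤ x) (h1 : x ≤ b) :
    ∃ (j : ℤ) (u : ℝ), a ≤ j ∧ j < b ∧ 0 ≤ u ∧ u ≤ 1 ∧ x = j + u := by
  rcases h1.eq_or_lt with rfl | h1
  · exact ⟨b - 1, 1, by omega, by omega, zero_le_one, le_rfl, by push_cast; ring⟩
  · exact ⟨⌊x⌋, Int.fract x, Int.le_floor.2 h0, Int.floor_lt.2 h1, Int.fract_nonneg x,
      (Int.fract_lt_one x).le, (Int.floor_add_fract x).symm⟩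

section Regions

variable (l p n : ℕ)

theorem flypeCurve_zero_add {u : ℝ} (h0 : 0 ≤ u) (h1 : u ≤ 1) :
    flypeCurve l p n u = Complex.I / 2 * clasp l u := by
  have := flypeCurve_apply l p n 0 h0 h1
  simpa [flypeBlock, halfBlock] using this

theorem flypeCurve_three_add {u : ℝ} (h0 : 0 ≤ u) (h1 : u ≤ 1) :
    flypeCurve l p n (3 + u) = 1 + Complex.I / 2 * clasp p u := by
  have := flypeCurve_apply l p n 3 h0 h1
  simpa [flypeBlock, halfBlock] using this

theorem flypeCurve_seven_add {u : ℝ} (h0 : 0 ≤ u) (h1 : u ≤ 1) :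
    flypeCurve l p n (7 + u) = -1 + Complex.I / 2 * clasp n u := by
  have := flypeCurve_apply l p n 7 h0 h1
  simpa [flypeBlock, halfBlock] using this

theorem flypeCurve_arch {u : ℝ} (h0 : 0 ≤ u) (h1 : u ≤ 1) : flypeCurve l p n (5 + u) =
    ⟨Real.cos (Real.pi * Real.smoothTransition u),
      1 / 2 + Real.sin (Real.pi * Real.smoothTransition u)⟩ := by
  have := flypeCurve_apply l p n 5 h0 h1
  simpa [flypeBlock, halfBlock] using this

/-- Up to the arch the curve lies in the strip `0 ≤ im ≤ 1 / 2` and touches the real axis only at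
double points, at 0 or at 1. Branches on opposite sides of the real axis can thus meet at double
points only. -/
theorem flypeCurve_start {x : ℝ} (h0 : 0 ≤ x) (h1 : x ≤ 5) :
    -(1 / 4) ≤ (flypeCurve l p n x).re ∧ 0 ≤ (flypeCurve l p n x).im ∧
    (flypeCurve l p n x).im ≤ 1 / 2 ∧ ((flypeCurve l p n x).im = 0 →
      x ≤ 1 ∧ clasp l x = 0 ∧ flypeCurve l p n x = 0 ∨
      ∃ v, x = 3 + v ∧ clasp p v = 0 ∧ flypeCurve l p n x = 1) := by
  obtain ⟨j, u, hj, hj', hu0, hu1, rfl⟩ := exists_int_add_of_mem (a := 0) (b := 5) (by norm_num)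
    (by simpa using h0) (by simpa using h1)
  rw [flypeCurve_apply l p n j hu0 hu1]
  have hS0 := Real.smoothTransition.nonneg u
  have hcr := fun m => clasp_re_nonneg m u
  have hcr' := fun m => clasp_re_le m u
  have hci := fun m => le_clasp_im m u
  have hci' := fun m => clasp_im_le m u
  have hc0 : ∀ m, (clasp m u).re = 0 → clasp m u = 0 := by
    intro m h
    by_contra h'
    exact (clasp_re_pos h').ne' h
  refine ⟨?_, ?_, ?_, ?_⟩
  · interval_cases j <;> simp [flypeBlock, halfBlock] <;> linarith [hci' l, hci' p]
  · interval_cases j <;> simp [flypeBlock, halfBlock] <;> linarith [hcr l, hcr p]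
  · interval_cases j <;> simp [flypeBlock, halfBlock] <;> linarith [hcr' l, hcr' p]
  · intro h
    interval_cases j <;> simp [flypeBlock, halfBlock] at h ⊢
    · left
      exact ⟨hu1, hc0 l h⟩
    · right
      exact hc0 p h

theorem flypeCurve_end {x : ℝ} (h0 : 6 ≤ x) (h1 : x ≤ 9) :
    (flypeCurve l p n x).re ≤ -(3 / 4) ∧ 0 ≤ (flypeCurve l p n x).im ∧
    (flypeCurve l p n x).im ≤ 1 / 2 ∧ ((flypeCurve l p n x).im = 0 →
      ∃ v, x = 7 + v ∧ clasp n v = 0 ∧ flypeCurve l p n x = -1) := by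
  obtain ⟨j, u, hj, hj', hu0, hu1, rfl⟩ := exists_int_add_of_mem (a := 6) (b := 9) (by norm_num)
    (by simpa using h0) (by simpa using h1)
  rw [flypeCurve_apply l p n j hu0 hu1]
  have hcr := clasp_re_nonneg n u
  have hcr' := clasp_re_le n u
  have hci := le_clasp_im n u
  have hc0 : (clasp n u).re = 0 → clasp n u = 0 := by
    intro h
    by_contra h'
    exact (clasp_re_pos h').ne' h
  refine ⟨?_, ?_, ?_, ?_⟩
  · interval_cases j <;> simp [flypeBlock, halfBlock] <;> linarith
  · interval_cases j <;> simp [flypeBlock, halfBlock] <;> linarith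
  · interval_cases j <;> simp [flypeBlock, halfBlock] <;> linarith
  · intro h
    interval_cases j <;> simp [flypeBlock, halfBlock] at h ⊢
    exact hc0 h

theorem flypeCurve_turn {x : ℝ} (h0 : 9 < x) (h1 : x < 10) :
    (flypeCurve l p n x).re + (flypeCurve l p n x).im = -(1 / 2) ∧ -1 < (flypeCurve l p n x).re ∧
      (flypeCurve l p n x).re < 0 := by
  have := flypeCurve_apply l p n 9 (u := x - 9) (by linarith) (by linarith)
  push_cast at this
  rw [add_sub_cancel] at this
  have hS0 := smoothTransition_pos (x := x - 9) (by linarith)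
  have hS1 := smoothTransition_lt_one (x := x - 9) (by linarith)
  rw [this]
  simp [flypeBlock, halfBlock]
  exact ⟨by ring, hS0, by linarith⟩

theorem flypeCurve_sub_ten (x : ℝ) : flypeCurve l p n x = -flypeCurve l n p (x - 10) := by
  rw [← flypeCurve_add_ten, sub_add_cancel]

theorem flypeCurve_eq_add_ten (x : ℝ) : flypeCurve l p n x = -flypeCurve l n p (x + 10) := by
  rw [flypeCurve_add_ten, neg_neg]

/-- Outside the upper arch the curve is at most at the height `1 / 2`, above which the interior of
the arch lies. This keeps the arch disjoint from the rest while it crosses the braid axis. -/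
theorem flypeCurve_im_le {x : ℝ} (h0 : -4 ≤ x) (h1 : x ≤ 16) (h : x ≤ 5 ∨ 6 ≤ x) :
    (flypeCurve l p n x).im ≤ 1 / 2 := by
  rcases le_or_gt x (-1) with h2 | h2
  · rw [flypeCurve_eq_add_ten, Complex.neg_im]
    linarith [(flypeCurve_end l n p (x := x + 10) (by linarith) (by linarith)).2.1]
  rcases lt_or_ge x 0 with h3 | h3
  · have := flypeCurve_turn l n p (x := x + 10) (by linarith) (by linarith)
    rw [flypeCurve_eq_add_ten, Complex.neg_im]
    linarith
  rcases le_or_gt x 5 with h4 | h4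
  · exact (flypeCurve_start l p n h3 h4).2.2.1
  rcases le_or_gt x 9 with h5 | h5
  · exact (flypeCurve_end l p n (by rcases h with h | h <;> linarith) h5).2.2.1
  rcases lt_or_ge x 10 with h6 | h6
  · have := flypeCurve_turn l p n h5 h6
    linarith
  rw [flypeCurve_sub_ten, Complex.neg_im]
  rcases le_or_gt x 15 with h7 | h7
  · linarith [(flypeCurve_start l n p (x := x - 10) (by linarith) (by linarith)).2.1]
  · rw [show x - 10 = 5 + (x - 15) by ring, flypeCurve_arch l n p (by linarith) (by linarith)]
    have := Real.sin_nonneg_of_nonneg_of_le_pi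
      (x := Real.pi * Real.smoothTransition (x - 15))
      (mul_nonneg Real.pi_pos.le (Real.smoothTransition.nonneg _))
      (mul_le_of_le_one_right Real.pi_pos.le (Real.smoothTransition.le_one _))
    simp only
    linarith

end Regions

/-- The number of tenths of a turn passed by the upper strands during the flype. -/
noncomputable def flypeLeft (s x : ℝ) : ℝ := (1 - s) * flypeTime x + s * (flypeTime (x + 10) - 10)

/-- The number of tenths of a turn passed by the lower strands during the flype. -/
noncomputable def flypeRight (s x : ℝ) : ℝ := flypeLeft (1 - s) (x - 10) + 10

theorem flypeRight_eq (s x : ℝ) :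
    flypeRight s x = (1 - s) * flypeTime x + s * (flypeTime (x - 10) + 10) := by
  rw [flypeRight, flypeLeft, sub_add_cancel]
  ring

theorem flypeLeft_add (s x : ℝ) : flypeLeft s (x + 20) = flypeLeft s x + 30 := by
  rw [flypeLeft, flypeLeft, flypeTime_add, show x + 20 + 10 = x + 10 + 20 by ring, flypeTime_add]
  ring

theorem flypeLeft_one_sub (s x : ℝ) : flypeLeft (1 - s) x = flypeRight s (x + 10) - 10 := by
  rw [flypeRight, add_sub_cancel_right, add_sub_cancel_right]

theorem flypeRight_one_sub (s x : ℝ) : flypeRight (1 - s) x = flypeLeft s (x + 10) - 20 := by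
  rw [flypeRight, sub_sub_cancel, show x + 10 = x - 10 + 20 by ring, flypeLeft_add]
  ring

theorem flypeTime_block {j : ℤ} {c : ℝ} (hc : flypeNode j = c) (hc' : flypeNode (j + 1) = c + 1)
    {v : ℝ} (h0 : 0 ≤ v) (h1 : v ≤ 1) : flypeTime (j + v) = c + v := by
  rw [flypeTime_of_gap (by rw [hc, hc']; ring) h0 h1, hc]

section Blocks

variable {v : ℝ} (h0 : 0 ≤ v) (h1 : v ≤ 1)

include h0 h1

theorem flypeLeft_zero_add (s : ℝ) : flypeLeft s v = v := by
  have e1 := flypeTime_block (j := 0) (c := 0) (by norm_num [flypeNode]) (by norm_num [flypeNode]) h0 h1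
  have e2 := flypeTime_block (j := 10) (c := 10) (by norm_num [flypeNode]) (by norm_num [flypeNode])
    h0 h1
  push_cast at e1 e2
  rw [zero_add] at e1
  rw [flypeLeft, add_comm v, e1, e2]
  ring

/-- The clasp `p` travels from the third to the seventh tenth. Its other branch, in
`flypeLeft_neg_three_add`, is shifted by the same `4 * s`, so the double points persist. The clasp
`l` does not move. -/
theorem flypeLeft_three_add (s : ℝ) : flypeLeft s (3 + v) = 3 + 4 * s + v := by
  have e1 := flypeTime_block (j := 3) (c := 3) (by norm_num [flypeNode]) (by norm_num [flypeNode]) h0 h1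
  have e2 := flypeTime_block (j := 13) (c := 17) (by norm_num [flypeNode]) (by norm_num [flypeNode])
    h0 h1
  push_cast at e1 e2
  rw [flypeLeft, show 3 + v + 10 = 13 + v by ring, e1, e2]
  ring

theorem flypeLeft_neg_three_add (s : ℝ) : flypeLeft s (-3 + v) = -7 + 4 * s + v := by
  have e1 := flypeTime_block (j := -3) (c := -7) (by norm_num [flypeNode]) (by norm_num [flypeNode])
    h0 h1
  have e2 := flypeTime_block (j := 7) (c := 7) (by norm_num [flypeNode]) (by norm_num [flypeNode])
    h0 h1
  push_cast at e1 e2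
  rw [flypeLeft, show -3 + v + 10 = 7 + v by ring, e1, e2]
  ring

theorem flypeRight_ten_add (s : ℝ) : flypeRight s (10 + v) = 10 + v := by
  rw [flypeRight, add_sub_cancel_left, flypeLeft_zero_add h0 h1, add_comm]

end Blocks

theorem contDiff_flypeLeft : ContDiff ℝ ∞ fun x : ℝ × ℝ => flypeLeft x.1 x.2 :=
  ((contDiff_const.sub contDiff_fst).mul (contDiff_flypeTime.comp contDiff_snd)).add
    (contDiff_fst.mul ((contDiff_flypeTime.comp (contDiff_snd.add contDiff_const)).sub contDiff_const))

theorem contDiff_flypeRight : ContDiff ℝ ∞ fun x : ℝ × ℝ => flypeRight x.1 x.2 :=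
  (contDiff_flypeLeft.comp ((contDiff_const.sub contDiff_fst).prodMk
    (contDiff_snd.sub contDiff_const))).add contDiff_const

theorem flypeLeft_int_sub (s : ℝ) (a b : ℤ) : flypeLeft s b - flypeLeft s a =
    (1 - s) * (flypeNode b - flypeNode a) + s * (flypeNode (b + 10) - flypeNode (a + 10)) := by
  have e : ∀ j : ℤ, (j : ℝ) + 10 = (j + 10 : ℤ) := fun j => by push_cast; rfl
  rw [flypeLeft, flypeLeft, e, e, flypeTime_int, flypeTime_int, flypeTime_int, flypeTime_int]
  ring

section Coincidence

variable {s : ℝ} (hs0 : 0 ≤ s) (hs1 : s ≤ 1)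

include hs0 hs1

theorem flypeLeft_deriv_pos (x : ℝ) : ∃ r, 0 < r ∧ HasDerivAt (flypeLeft s) r x := by
  have hd : ∀ y, HasDerivAt flypeTime (deriv flypeTime y) y := fun y =>
    (contDiff_flypeTime.differentiable (by simp) y).hasDerivAt
  refine ⟨_, ?_, ((hd x).const_mul (1 - s)).add
    ((((hd (x + 10)).comp_add_const x 10).sub_const 10).const_mul s)⟩
  have h1 := flypeTime_deriv_pos x
  have h2 := flypeTime_deriv_pos (x + 10)
  rcases hs0.eq_or_lt with rfl | h
  · simpa using h1
  · have := mul_pos h h2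
    have := mul_nonneg (sub_nonneg.2 hs1) h1.le
    linarith

theorem flypeLeft_strictMono : StrictMono (flypeLeft s) := by
  apply strictMono_of_deriv_pos
  intro x
  obtain ⟨r, hr, h⟩ := flypeLeft_deriv_pos hs0 hs1 x
  rwa [h.deriv]

/-- From `-1` to `5` the strand makes `(1 - s) * 6 + s * 10` tenths, never more than one turn. As
`-1` itself is excluded, no place of the circle is passed twice. -/
theorem flypeLeft_inj_start {x y : ℝ} (hx : -1 < x) (hxy : x < y) (hy : y ≤ 5) :
    turn (flypeLeft s x / 10) ≠ turn (flypeLeft s y / 10) := by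
  intro h
  have hm := flypeLeft_strictMono hs0 hs1
  obtain ⟨k, hk⟩ := (turn_eq_turn_iff _ _).1 h.symm
  have h2 := hm hx
  have h1 := hm hxy
  have h3 := hm.monotone hy
  have h4 := flypeLeft_int_sub s (-1) 5
  norm_num [flypeNode] at h4
  have k1 : (k : ℝ) < 1 := by linarith
  have k2 : (0 : ℝ) < k := by linarith
  have : k < 1 := by exact_mod_cast k1
  have : 0 < k := by exact_mod_cast k2
  omega

theorem flypeLeft_inj_end {x y : ℝ} (hx : -4 ≤ x) (hxy : x < y) (hy : y < 0) :
    turn (flypeLeft s x / 10) ≠ turn (flypeLeft s y / 10) := by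
  intro h
  have hm := flypeLeft_strictMono hs0 hs1
  obtain ⟨k, hk⟩ := (turn_eq_turn_iff _ _).1 h.symm
  have h2 := hm.monotone hx
  have h1 := hm hxy
  have h3 := hm hy
  have h4 := flypeLeft_int_sub s (-4) 0
  norm_num [flypeNode] at h4
  have k1 : (k : ℝ) < 1 := by linarith
  have k2 : (0 : ℝ) < k := by linarith
  have : k < 1 := by exact_mod_cast k1
  have : 0 < k := by exact_mod_cast k2
  omega

variable (l p n : ℕ)

/-- Neither `flypeLeft_inj_start` nor `flypeLeft_inj_end` can apply, so `x` comes before `-1` and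
`y` after 0. The curve is in the lower half plane at `x`, to the right of `3 / 4`, and in the upper
one at `y`. Both points are therefore on the real axis, and only the clasp at 1 is left. -/
theorem flype_left_coincidence {x y : ℝ} (hx : -4 ≤ x) (hxy : x < y) (hy : y ≤ 5)
    (hz : flypeCurve l p n x = flypeCurve l p n y)
    (ht : turn (flypeLeft s x / 10) = turn (flypeLeft s y / 10)) :
    ∃ v, clasp p v = 0 ∧ x = -3 + v ∧ y = 3 + v := by
  have hx1 : x ≤ -1 := by
    by_contra h
    exact flypeLeft_inj_start hs0 hs1 (not_le.1 h) hxy hy ht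
  have hy0 : 0 ≤ y := by
    by_contra h
    exact flypeLeft_inj_end hs0 hs1 hx hxy (not_le.1 h) ht
  obtain ⟨a1, a2, -, a3⟩ := flypeCurve_end l n p (x := x + 10) (by linarith) (by linarith)
  obtain ⟨b1, b2, -, b3⟩ := flypeCurve_start l p n hy0 hy
  have e := flypeCurve_eq_add_ten l p n x
  have ei := congrArg Complex.im e
  have er := congrArg Complex.re e
  rw [Complex.neg_im, hz] at ei
  rw [Complex.neg_re, hz] at er
  obtain ⟨v, hxv, hv, -⟩ := a3 (by linarith)
  obtain ⟨-, -, h0⟩ | ⟨v', hyv, hv', -⟩ := b3 (by linarith)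
  · rw [h0, Complex.zero_re] at er
    linarith
  have hvm := clasp_zero_mem hv
  have hvm' := clasp_zero_mem hv'
  have hx' : x = -3 + v := by linarith
  refine ⟨v, hv, hx', ?_⟩
  rw [hx', hyv, flypeLeft_neg_three_add hvm.1.le hvm.2.le,
    flypeLeft_three_add hvm'.1.le hvm'.2.le, turn_eq_turn_iff] at ht
  obtain ⟨k, hk⟩ := ht
  have k1 : (-2 : ℝ) < k := by linarith
  have k2 : (k : ℝ) < 0 := by linarith
  have k1 : -2 < k := by exact_mod_cast k1
  have k2 : k < 0 := by exact_mod_cast k2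
  -- The branches are one turn apart: `-7 + 4 * s + v` and `3 + 4 * s + v'` agree modulo ten tenths
  -- only for `v = v'`.
  obtain rfl : k = -1 := by omega
  push_cast at hk
  linarith

theorem flype_right_coincidence {x y : ℝ} (hx : 6 ≤ x) (hxy : x < y) (hy : y ≤ 15)
    (hz : flypeCurve l p n x = flypeCurve l p n y)
    (ht : turn (flypeRight s x / 10) = turn (flypeRight s y / 10)) :
    ∃ v, clasp n v = 0 ∧ x = 7 + v ∧ y = 13 + v := by
  rw [flypeRight, flypeRight, add_div, add_div, div_self (by norm_num), turn_add_one,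
    turn_add_one] at ht
  rw [flypeCurve_sub_ten l p n x, flypeCurve_sub_ten l p n y, neg_inj] at hz
  obtain ⟨v, hv, h1, h2⟩ := flype_left_coincidence (s := 1 - s) (by linarith) (by linarith) l n p
    (x := x - 10) (y := y - 10) (by linarith) (by linarith) (by linarith) hz ht
  exact ⟨v, hv, by linarith, by linarith⟩

end Coincidence

/-- The two groups of strands move at different speeds, so they have to be separated in the plane.
The clasps near 1 and -1 are too far to the right and to the left, and the passages between the
halves run on the lines where `re + im` is `1 / 2` or `-(1 / 2)`. What remains lies on opposite
sides of the real axis and meets only at 0, in the resting clasp `l`. -/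
theorem flype_mixed_coincidence {s : ℝ} (l p n : ℕ) {x y : ℝ} (hx : -4 ≤ x) (hx' : x ≤ 5) (hy : 6 ≤ y) (hy' : y ≤ 15)
    (hz : flypeCurve l p n x = flypeCurve l p n y)
    (ht : turn (flypeLeft s x / 10) = turn (flypeRight s y / 10)) :
    ∃ v, clasp l v = 0 ∧ x = v ∧ y = 10 + v := by
  have er := congrArg Complex.re hz
  have ei := congrArg Complex.im hz
  have ey := flypeCurve_sub_ten l p n y
  have eyr := congrArg Complex.re ey
  have eyi := congrArg Complex.im ey
  have ex := flypeCurve_eq_add_ten l p n x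
  have exr := congrArg Complex.re ex
  have exi := congrArg Complex.im ex
  rw [Complex.neg_re] at eyr exr
  rw [Complex.neg_im] at eyi exi
  have hx0 : 0 ≤ x := by
    by_contra h
    have key : 0 < (flypeCurve l p n x).re ∧ (3 / 4 ≤ (flypeCurve l p n x).re ∨
        (flypeCurve l p n x).re + (flypeCurve l p n x).im = 1 / 2) := by
      rcases le_or_gt x (-1) with h2 | h2
      · obtain ⟨a1, a2, -, a3⟩ := flypeCurve_end l n p (x := x + 10) (by linarith) (by linarith)
        exact ⟨by linarith, Or.inl (by linarith)⟩
      · have := flypeCurve_turn l n p (x := x + 10) (by linarith) (by linarith)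
        exact ⟨by linarith, Or.inr (by linarith)⟩
    rcases le_or_gt y 9 with h2 | h2
    · linarith [(flypeCurve_end l p n hy h2).1]
    rcases lt_or_ge y 10 with h3 | h3
    · linarith [(flypeCurve_turn l p n h2 h3).2.2]
    obtain ⟨b1, b2, -, b3⟩ := flypeCurve_start l n p (x := y - 10) (by linarith) (by linarith)
    rcases key.2 with h4 | h4 <;> linarith
  obtain ⟨a1, a2, -, a3⟩ := flypeCurve_start l p n hx0 hx'
  have hy10 : 10 ≤ y := by
    by_contra h
    rcases le_or_gt y 9 with h2 | h2
    · linarith [(flypeCurve_end l p n hy h2).1]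
    · linarith [flypeCurve_turn l p n h2 (not_le.1 h)]
  obtain ⟨b1, b2, -, b3⟩ := flypeCurve_start l n p (x := y - 10) (by linarith) (by linarith)
  have hxz := a3 (by linarith)
  have hyz := b3 (by linarith)
  rcases hxz with ⟨hx1, hcx, hxz⟩ | ⟨v, -, -, hxz⟩
  · rcases hyz with ⟨hy1, hcy, hyz⟩ | ⟨v, -, -, hyz⟩
    · refine ⟨x, hcx, rfl, ?_⟩
      obtain ⟨w, rfl⟩ : ∃ w, y = 10 + w := ⟨y - 10, by ring⟩
      rw [add_sub_cancel_left] at hcy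
      have hvm := clasp_zero_mem hcx
      have hvm' := clasp_zero_mem hcy
      rw [flypeLeft_zero_add hvm.1.le hvm.2.le, flypeRight_ten_add hvm'.1.le hvm'.2.le,
        turn_eq_turn_iff] at ht
      obtain ⟨k, hk⟩ := ht
      have k1 : (-2 : ℝ) < k := by linarith
      have k2 : (k : ℝ) < 0 := by linarith
      have k1 : -2 < k := by exact_mod_cast k1
      have k2 : k < 0 := by exact_mod_cast k2
      obtain rfl : k = -1 := by omega
      push_cast at hk
      linarith
    · rw [hyz] at eyr
      rw [hxz] at er
      simp at er eyr
      linarith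
  · rw [hxz] at er
    simp at er
    linarith

/-! ### The isotopy for the flype -/

/-- Tells on which side of the braid axis the strands move during the flype. -/
noncomputable def flypeMixNode (j : ℤ) : ℝ := if (j + 4) % 20 ≤ 9 then 0 else 1

/-- A cutoff function that is `0` on the upper and `1` on the lower strands. -/
noncomputable def flypeMix : ℝ → ℝ := interp flypeMixNode 0

theorem contDiff_flypeMix : ContDiff ℝ ∞ flypeMix := contDiff_interp

theorem flypeMix_apply (j : ℤ) {u : ℝ} (h0 : 0 ≤ u) (h1 : u ≤ 1) : flypeMix (j + u) =
    flypeMixNode j + (flypeMixNode (j + 1) - flypeMixNode j) * Real.smoothTransition u := by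
  rw [flypeMix, interp_int_add j h0 h1, interpPiece]
  ring

theorem flypeMix_add_ten (x : ℝ) : flypeMix (x + 10) = 1 - flypeMix x := by
  obtain ⟨j, u, h0, h1, rfl⟩ := exists_int_add x
  have e : ∀ j, flypeMixNode (j + 10) = 1 - flypeMixNode j := by
    intro j
    unfold flypeMixNode
    split_ifs
    · omega
    · norm_num
    · norm_num
    · omega
  have := flypeMix_apply (j + 10) h0 h1.le
  rw [show (j : ℝ) + u + 10 = (j + 10 : ℤ) + u by push_cast; ring, this, flypeMix_apply j h0 h1.le,
    show j + 10 + 1 = j + 1 + 10 by ring, e, e]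
  ring

theorem flypeMix_add_twenty (x : ℝ) : flypeMix (x + 20) = flypeMix x := by
  rw [show x + 20 = x + 10 + 10 by ring, flypeMix_add_ten, flypeMix_add_ten, sub_sub_cancel]

theorem flypeMix_nonneg (x : ℝ) : 0 ≤ flypeMix x := by
  obtain ⟨j, u, h0, h1, rfl⟩ := exists_int_add x
  have hS0 := Real.smoothTransition.nonneg u
  have hS1 := Real.smoothTransition.le_one u
  rw [flypeMix_apply j h0 h1.le, flypeMixNode, flypeMixNode]
  split_ifs <;> linarith

theorem flypeMix_le_one (x : ℝ) : flypeMix x ≤ 1 := by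
  have := flypeMix_nonneg (x + 10)
  rw [flypeMix_add_ten] at this
  linarith

theorem flypeMix_of_le {x : ℝ} (h0 : -4 ≤ x) (h1 : x ≤ 5) : flypeMix x = 0 := by
  obtain ⟨j, u, hj, hj', hu0, hu1, rfl⟩ := exists_int_add_of_mem (a := -4) (b := 5) (by norm_num)
    (by simpa using h0) (by simpa using h1)
  have e : ∀ i, -4 ≤ i → i ≤ 5 → flypeMixNode i = 0 := fun i _ _ => if_pos (by omega)
  rw [flypeMix_apply j hu0 hu1, e _ (by omega) (by omega), e _ (by omega) (by omega)]
  ring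

theorem flypeMix_of_ge {x : ℝ} (h0 : 6 ≤ x) (h1 : x ≤ 15) : flypeMix x = 1 := by
  rw [← sub_add_cancel x 10, flypeMix_add_ten, flypeMix_of_le (by linarith) (by linarith), sub_zero]

/-- The direction from the braid axis during the flype. -/
noncomputable def flypeBase (s x : ℝ) : ℂ :=
  (1 - flypeMix x : ℝ) * turn (flypeLeft s x / 10) + flypeMix x * turn (flypeRight s x / 10)

theorem contDiff_flypeBase : ContDiff ℝ ∞ fun x : ℝ × ℝ => flypeBase x.1 x.2 := by
  have h := contDiff_flypeMix.comp (contDiff_snd : ContDiff ℝ ∞ (Prod.snd : ℝ × ℝ → ℝ))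
  have hl := contDiff_turn.comp (contDiff_flypeLeft.div_const 10)
  have hr := contDiff_turn.comp (contDiff_flypeRight.div_const 10)
  exact ((Complex.ofRealCLM.contDiff.comp (contDiff_const.sub h)).mul hl).add
    ((Complex.ofRealCLM.contDiff.comp h).mul hr)

theorem flypeBase_of_left {s x : ℝ} (h : flypeMix x = 0) : flypeBase s x = turn (flypeLeft s x / 10) := by
  simp [flypeBase, h]

theorem flypeBase_of_right {s x : ℝ} (h : flypeMix x = 1) :
    flypeBase s x = turn (flypeRight s x / 10) := by
  simp [flypeBase, h]

theorem norm_flypeBase_le (s x : ℝ) : ‖flypeBase s x‖ ≤ 1 := by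
  have h0 := flypeMix_nonneg x
  have h1 := flypeMix_le_one x
  refine (norm_add_le _ _).trans ?_
  rw [norm_mul, norm_mul, norm_turn, norm_turn, Complex.norm_real, Complex.norm_real,
    Real.norm_of_nonneg h0, Real.norm_of_nonneg (by linarith)]
  linarith

theorem norm_flypeBase {s x : ℝ} (h0 : -4 ≤ x) (h1 : x ≤ 15) (h : x ≤ 5 ∨ 6 ≤ x) :
    ‖flypeBase s x‖ = 1 := by
  rcases h with h | h
  · rw [flypeBase_of_left (flypeMix_of_le h0 h), norm_turn]
  · rw [flypeBase_of_right (flypeMix_of_ge h h1), norm_turn]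

theorem turn_div_ten_add (x : ℝ) (k : ℤ) : turn ((x + 10 * k) / 10) = turn (x / 10) := by
  rw [add_div, mul_div_cancel_left₀ _ (by norm_num), turn_add_int]

/-- Half a period exchanges the two groups of strands and reverses the deformation. So the stage `s
= 1` is the stage `s = 0` shifted by half a period. -/
theorem flypeBase_add_ten (s x : ℝ) : flypeBase s (x + 10) = flypeBase (1 - s) x := by
  have e1 : turn (flypeLeft s (x + 10) / 10) = turn (flypeRight (1 - s) x / 10) := by
    have := turn_div_ten_add (flypeRight (1 - s) x) 2
    rw [← this, flypeRight_one_sub]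
    congr 2
    push_cast
    ring
  have e2 : turn (flypeRight s (x + 10) / 10) = turn (flypeLeft (1 - s) x / 10) := by
    have := turn_div_ten_add (flypeLeft (1 - s) x) 1
    rw [← this, flypeLeft_one_sub]
    congr 2
    push_cast
    ring
  rw [flypeBase, flypeBase, flypeMix_add_ten, e1, e2, sub_sub_cancel]
  ring

theorem flypeBase_add_twenty (s x : ℝ) : flypeBase s (x + 20) = flypeBase s x := by
  rw [show x + 20 = x + 10 + 10 by ring, flypeBase_add_ten, flypeBase_add_ten, sub_sub_cancel]

theorem flypeBase_zero (x : ℝ) : flypeBase 0 x = turn (flypeTime x / 10) := by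
  have h1 : flypeLeft 0 x = flypeTime x := by simp [flypeLeft]
  have h2 : flypeRight 0 x = flypeTime x := by simp [flypeRight_eq]
  rw [flypeBase, h1, h2, ← add_mul]
  simp

section Pairs

variable (l p n : ℕ)

/-- The pairs of times of the double points of the curve for the flype. -/
def FlypePair (x y : ℝ) : Prop := ∃ v, clasp l v = 0 ∧ x = v ∧ y = 10 + v ∨
  clasp p v = 0 ∧ x = -3 + v ∧ y = 3 + v ∨ clasp n v = 0 ∧ x = 7 + v ∧ y = 13 + v

theorem ray_eq_of_arch {s x y c : ℝ} (hx : 5 < x) (hx' : x < 6) (hy : -4 ≤ y) (hy' : y < 16)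
    (hc : 0 < c) (hb : flypeBase s x = c * flypeBase s y)
    (hz : flypeCurve l p n x = c * flypeCurve l p n y) : x = y := by
  have harch : ∀ (l p n : ℕ) (w : ℝ), 5 < w → w < 6 → (flypeCurve l p n w).re =
      Real.cos (Real.pi * Real.smoothTransition (w - 5)) ∧ (flypeCurve l p n w).im =
      1 / 2 + Real.sin (Real.pi * Real.smoothTransition (w - 5)) ∧
      0 < Real.sin (Real.pi * Real.smoothTransition (w - 5)) := by
    intro l p n w h0 h1
    have := flypeCurve_arch l p n (u := w - 5) (by linarith) (by linarith)
    rw [add_sub_cancel] at this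
    have hS0 := smoothTransition_pos (x := w - 5) (by linarith)
    have hS1 := smoothTransition_lt_one (x := w - 5) (by linarith)
    rw [this]
    refine ⟨rfl, rfl, Real.sin_pos_of_pos_of_lt_pi (by positivity) ?_⟩
    have := Real.pi_pos
    nlinarith
  obtain ⟨x1, x2, x3⟩ := harch l p n x hx hx'
  have hre := congrArg Complex.re hz
  have him := congrArg Complex.im hz
  rw [Complex.re_ofReal_mul] at hre
  rw [Complex.im_ofReal_mul] at him
  by_cases h1 : 5 < y ∧ y < 6
  · obtain ⟨y1, y2, y3⟩ := harch l p n y h1.1 h1.2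
    rw [x1, y1] at hre
    rw [x2, y2] at him
    have hS : ∀ a ∈ Set.Icc (0 : ℝ) 1, ∀ b ∈ Set.Icc (0 : ℝ) 1, Real.smoothTransition a =
        Real.smoothTransition b → a = b := fun a ha b hb h => smoothTransition_strictMonoOn.injOn ha hb h
    have hpi := Real.pi_pos
    have hmem : ∀ w : ℝ, 0 ≤ Real.pi * Real.smoothTransition w ∧
        Real.pi * Real.smoothTransition w ≤ Real.pi := fun w =>
      ⟨mul_nonneg hpi.le (Real.smoothTransition.nonneg w),
        mul_le_of_le_one_right hpi.le (Real.smoothTransition.le_one w)⟩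
    have hx5 := hmem (x - 5)
    have hy5 := hmem (y - 5)
    have e : Real.pi * Real.smoothTransition (x - 5) = Real.pi * Real.smoothTransition (y - 5) := by
      generalize Real.pi * Real.smoothTransition (x - 5) = φ at *
      generalize Real.pi * Real.smoothTransition (y - 5) = ψ at *
      -- Two points of the arch on one ray from the origin have cross product 0; its two terms have
      -- the same sign, and the first vanishes only for equal angles.
      have hcross : (Real.cos φ - Real.cos ψ) / 2 + Real.sin (ψ - φ) = 0 := by
        rw [Real.sin_sub, hre]
        linear_combination -Real.cos ψ * him
      rcases lt_trichotomy φ ψ with h | h | h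
      · have a1 := Real.cos_lt_cos_of_nonneg_of_le_pi hx5.1 hy5.2 h
        have a2 : 0 ≤ Real.sin (ψ - φ) :=
          Real.sin_nonneg_of_nonneg_of_le_pi (by linarith) (by linarith)
        linarith
      · exact h
      · have a1 := Real.cos_lt_cos_of_nonneg_of_le_pi hy5.1 hx5.2 h
        have a2 : 0 ≤ Real.sin (φ - ψ) :=
          Real.sin_nonneg_of_nonneg_of_le_pi (by linarith) (by linarith)
        rw [← neg_sub φ ψ, Real.sin_neg] at hcross
        linarith
    have := hS (x - 5) ⟨by linarith, by linarith⟩ (y - 5) ⟨by linarith [h1.1], by linarith [h1.2]⟩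
      (mul_left_cancel₀ hpi.ne' e)
    linarith
  exfalso
  rcases le_or_gt y 15 with h2 | h2
  · have h3 : y ≤ 5 ∨ 6 ≤ y := by
      rcases le_or_gt y 5 with h | h
      · exact Or.inl h
      · exact Or.inr (not_lt.1 fun h' => h1 ⟨h, h'⟩)
    -- The base has norm 1 at `y` and at most 1 at `x`, so `c ≤ 1`. Then the height at `x` would be
    -- at most `c / 2`, below the arch.
    have hn := congrArg norm hb
    rw [norm_mul, norm_flypeBase hy h2 h3, Complex.norm_real, Real.norm_of_nonneg hc.le] at hn
    have h4 := norm_flypeBase_le s x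
    have h5 := flypeCurve_im_le l p n hy hy'.le h3
    nlinarith
  · obtain ⟨y1, y2, y3⟩ := harch l n p (y - 10) (by linarith) (by linarith)
    have h6 := congrArg Complex.im (flypeCurve_sub_ten l p n y)
    rw [Complex.neg_im] at h6
    nlinarith

theorem ray_eq_of_mix {s x y c : ℝ} (hx' : x < 16) (hy : -4 ≤ y) (hy' : y < 16)
    (h : 5 < x ∧ x < 6 ∨ 15 < x) (hc : 0 < c) (hb : flypeBase s x = c * flypeBase s y)
    (hz : flypeCurve l p n x = c * flypeCurve l p n y) : x = y := by
  rcases h with h | h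
  · exact ray_eq_of_arch l p n h.1 h.2 hy hy' hc hb hz
  have hbs : ∀ w, flypeBase s w = flypeBase (1 - s) (w - 10) := by
    intro w
    rw [← flypeBase_add_ten, sub_add_cancel]
  rw [flypeCurve_sub_ten l p n x] at hz
  rw [hbs x] at hb
  rcases le_or_gt 6 y with h6 | h6
  · rw [flypeCurve_sub_ten l p n y, mul_neg, neg_inj] at hz
    rw [hbs y] at hb
    have := ray_eq_of_arch l n p (s := 1 - s) (by linarith) (by linarith) (by linarith) (by linarith)
      hc hb hz
    linarith
  · rw [flypeCurve_eq_add_ten l p n y, mul_neg, neg_inj] at hz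
    rw [show flypeBase s y = flypeBase (1 - s) (y + 10) by
      rw [flypeBase_add_ten, sub_sub_cancel]] at hb
    have := ray_eq_of_arch l n p (s := 1 - s) (by linarith) (by linarith) (by linarith) (by linarith)
      hc hb hz
    linarith

/-- The points of the two arches, where the base may shrink or vanish, are settled by
`ray_eq_of_mix`. Everywhere else the base has norm 1, hence `c = 1`, and the coincidence is one of
strands of a genuine braid position. -/
theorem flypePair_of_ray_eq {s x y c : ℝ} (hs0 : 0 ≤ s) (hs1 : s ≤ 1) (hx : -4 ≤ x) (hx' : x < 16)
    (hy : -4 ≤ y) (hy' : y < 16) (hc : 0 < c) (hb : flypeBase s x = c * flypeBase s y)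
    (hz : flypeCurve l p n x = c * flypeCurve l p n y) :
    x = y ∨ FlypePair l p n x y ∨ FlypePair l p n y x := by
  by_cases h1 : 5 < x ∧ x < 6 ∨ 15 < x
  · exact Or.inl (ray_eq_of_mix l p n hx' hy hy' h1 hc hb hz)
  by_cases h2 : 5 < y ∧ y < 6 ∨ 15 < y
  · have hc' : ((c⁻¹ : ℝ) : ℂ) * c = 1 := by
      rw [← Complex.ofReal_mul, inv_mul_cancel₀ hc.ne', Complex.ofReal_one]
    refine Or.inl (ray_eq_of_mix l p n (s := s) (c := c⁻¹) hy' hx hx' h2 (inv_pos.2 hc) ?_ ?_).symm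
    · rw [hb, ← mul_assoc, hc', one_mul]
    · rw [hz, ← mul_assoc, hc', one_mul]
  have key : ∀ w : ℝ, ¬(5 < w ∧ w < 6 ∨ 15 < w) → w ≤ 15 ∧ (w ≤ 5 ∨ 6 ≤ w) := by
    intro w hw
    push Not at hw
    refine ⟨hw.2, ?_⟩
    rcases le_or_gt w 5 with h | h
    · exact Or.inl h
    · exact Or.inr (hw.1 h)
  obtain ⟨x15, hx56⟩ := key x h1
  obtain ⟨y15, hy56⟩ := key y h2
  have hn := congrArg norm hb
  rw [norm_mul, norm_flypeBase hx x15 hx56, norm_flypeBase hy y15 hy56, Complex.norm_real,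
    Real.norm_of_nonneg hc.le, mul_one] at hn
  rw [← hn, Complex.ofReal_one, one_mul] at hb hz
  rcases hx56 with h5 | h6 <;> rcases hy56 with h5' | h6'
  · rw [flypeBase_of_left (flypeMix_of_le hx h5), flypeBase_of_left (flypeMix_of_le hy h5')] at hb
    rcases lt_trichotomy x y with h | h | h
    · obtain ⟨v, hv⟩ := flype_left_coincidence hs0 hs1 l p n hx h h5' hz hb
      exact Or.inr (Or.inl ⟨v, Or.inr (Or.inl hv)⟩)
    · exact Or.inl h
    · obtain ⟨v, hv⟩ := flype_left_coincidence hs0 hs1 l p n hy h h5 hz.symm hb.symm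
      exact Or.inr (Or.inr ⟨v, Or.inr (Or.inl hv)⟩)
  · rw [flypeBase_of_left (flypeMix_of_le hx h5), flypeBase_of_right (flypeMix_of_ge h6' y15)] at hb
    obtain ⟨v, hv⟩ := flype_mixed_coincidence l p n hx h5 h6' y15 hz hb
    exact Or.inr (Or.inl ⟨v, Or.inl hv⟩)
  · rw [flypeBase_of_right (flypeMix_of_ge h6 x15), flypeBase_of_left (flypeMix_of_le hy h5')] at hb
    obtain ⟨v, hv⟩ := flype_mixed_coincidence l p n hy h5' h6 x15 hz.symm hb.symm
    exact Or.inr (Or.inr ⟨v, Or.inl hv⟩)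
  · rw [flypeBase_of_right (flypeMix_of_ge h6 x15), flypeBase_of_right (flypeMix_of_ge h6' y15)] at hb
    rcases lt_trichotomy x y with h | h | h
    · obtain ⟨v, hv⟩ := flype_right_coincidence hs0 hs1 l p n h6 h y15 hz hb
      exact Or.inr (Or.inl ⟨v, Or.inr (Or.inr hv)⟩)
    · exact Or.inl h
    · obtain ⟨v, hv⟩ := flype_right_coincidence hs0 hs1 l p n h6' h x15 hz.symm hb.symm
      exact Or.inr (Or.inr ⟨v, Or.inr (Or.inr hv)⟩)

theorem eventually_unit {x₀ v : ℝ} (h0 : 0 < v) (h1 : v < 1) {P : ℝ → Prop}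
    (h : ∀ u, 0 ≤ u → u ≤ 1 → P (x₀ + u)) : ∀ᶠ x in nhds (x₀ + v), P x := by
  have hU : Set.Ioo x₀ (x₀ + 1) ∈ nhds (x₀ + v) := isOpen_Ioo.mem_nhds ⟨by linarith, by linarith⟩
  filter_upwards [hU] with x hx
  have := h (x - x₀) (by linarith [hx.1]) (by linarith [hx.2])
  rwa [add_sub_cancel] at this

theorem hasDerivAt_of_clasp {Z : ℝ → ℂ} {x₀ v r : ℝ} {c : ℂ} {m : ℕ} (hm : clasp m v = 0)
    (hr : HasDerivAt (clasp m) (r * Complex.I) v)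
    (hZ : ∀ u, 0 ≤ u → u ≤ 1 → Z (x₀ + u) = c + Complex.I / 2 * clasp m u) :
    HasDerivAt Z (-r / 2) (x₀ + v) := by
  obtain ⟨h0, h1⟩ := clasp_zero_mem hm
  have hev : Z =ᶠ[nhds (x₀ + v)] fun x => c + Complex.I / 2 * clasp m (x - x₀) :=
    eventually_unit h0 h1 fun u hu0 hu1 => by
      simp only [hZ u hu0 hu1, add_sub_cancel_left]
  have hr' : HasDerivAt (clasp m) (r * Complex.I) (x₀ + v - x₀) := by rwa [add_sub_cancel_left]
  refine (((hr'.comp_sub_const (x₀ + v) x₀).const_mul (Complex.I / 2)).const_add c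
    |>.congr_of_eventuallyEq hev).congr_deriv ?_
  linear_combination (r / 2 : ℂ) * Complex.I_mul_I

theorem hasDerivAt_flypeCurve_neg {x : ℝ} {d : ℂ} (h : HasDerivAt (flypeCurve l n p) d x) :
    HasDerivAt (flypeCurve l p n) (-d) (x + 10) := by
  have hf : flypeCurve l p n = fun y => -flypeCurve l n p (y - 10) := by
    funext y; exact flypeCurve_sub_ten l p n y
  rw [hf]
  have : HasDerivAt (flypeCurve l n p) d (x + 10 - 10) := by rwa [add_sub_cancel_right]
  exact (this.comp_sub_const (x + 10) 10).neg

theorem hasDerivAt_flypeCurve_neg' {x : ℝ} {d : ℂ} (h : HasDerivAt (flypeCurve l n p) d (x + 10)) :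
    HasDerivAt (flypeCurve l p n) (-d) x := by
  have hf : flypeCurve l p n = fun y => -flypeCurve l n p (y + 10) := by
    funext y; exact flypeCurve_eq_add_ten l p n y
  rw [hf]
  exact (h.comp_add_const x 10).neg

/-- By the symmetry `z ↦ -z` the two branches of a clasp at 0 pass it with opposite velocities. The
same holds at 1 and -1, because one branch is the mirror image of the other and the velocity is
horizontal with opposite orientation. -/
theorem FlypePair.curve {x y : ℝ} (h : FlypePair l p n x y) :
    flypeCurve l p n x = flypeCurve l p n y ∧ ∃ d : ℂ, d ≠ 0 ∧
      HasDerivAt (flypeCurve l p n) d x ∧ HasDerivAt (flypeCurve l p n) (-d) y := by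
  have h00 : ∀ l p n u, 0 ≤ u → u ≤ 1 →
      flypeCurve l p n (0 + u) = 0 + Complex.I / 2 * clasp l u := fun l p n u h0 h1 => by
    rw [zero_add, zero_add, flypeCurve_zero_add l p n h0 h1]
  have h3 := fun l p n u (h0 : 0 ≤ u) (h1 : u ≤ 1) => flypeCurve_three_add l p n h0 h1
  have h7 := fun l p n u (h0 : 0 ≤ u) (h1 : u ≤ 1) => flypeCurve_seven_add l p n h0 h1
  obtain ⟨v, ⟨hc, rfl, rfl⟩ | ⟨hc, rfl, rfl⟩ | ⟨hc, rfl, rfl⟩⟩ := h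
  · obtain ⟨r, hr, hd⟩ := clasp_hasDerivAt hc
    obtain ⟨v0, v1⟩ := clasp_zero_mem hc
    have d1 := hasDerivAt_of_clasp hc hd (h00 l p n)
    have d2 := hasDerivAt_flypeCurve_neg l p n (hasDerivAt_of_clasp hc hd (h00 l n p))
    rw [zero_add] at d1 d2
    rw [add_comm x] at d2
    refine ⟨?_, -r / 2, by simpa using hr.ne', d1, d2⟩
    rw [add_comm (10 : ℝ), flypeCurve_add_ten, flypeCurve_zero_add l p n v0.le v1.le,
      flypeCurve_zero_add l n p v0.le v1.le, hc]
    simp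
  · obtain ⟨r, hr, hd⟩ := clasp_hasDerivAt hc
    obtain ⟨v0, v1⟩ := clasp_zero_mem hc
    have d1 := hasDerivAt_of_clasp hc hd (h3 l p n)
    have d2 := hasDerivAt_of_clasp hc hd (h7 l n p)
    rw [show 7 + v = -3 + v + 10 by ring] at d2
    refine ⟨?_, -(-r / 2), by simpa using hr.ne', hasDerivAt_flypeCurve_neg' l p n d2,
      by rwa [neg_neg]⟩
    rw [flypeCurve_eq_add_ten, show -3 + v + 10 = 7 + v by ring, h7 l n p v v0.le v1.le,
      h3 l p n v v0.le v1.le, hc]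
    simp
  · obtain ⟨r, hr, hd⟩ := clasp_hasDerivAt hc
    obtain ⟨v0, v1⟩ := clasp_zero_mem hc
    have d1 := hasDerivAt_of_clasp hc hd (h7 l p n)
    have d2 := hasDerivAt_flypeCurve_neg l p n (hasDerivAt_of_clasp hc hd (h3 l n p))
    rw [show 3 + v + 10 = 13 + v by ring] at d2
    refine ⟨?_, -r / 2, by simpa using hr.ne', d1, d2⟩
    rw [flypeCurve_sub_ten l p n (13 + v), show 13 + v - 10 = 3 + v by ring,
      h3 l n p v v0.le v1.le, h7 l p n v v0.le v1.le, hc]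
    simp

/-- A pair of double points is passed at the same speed around the axis. -/
theorem flypeBase_hasDerivAt_of_left {s x₀ c v : ℝ} (h0 : 0 < v) (h1 : v < 1) (hx : -4 ≤ x₀)
    (hx' : x₀ ≤ 4) (h : ∀ u, 0 ≤ u → u ≤ 1 → flypeLeft s (x₀ + u) = c + u) :
    HasDerivAt (flypeBase s) (Real.pi / 5 * Complex.I * flypeBase s (x₀ + v)) (x₀ + v) := by
  have e : ∀ u, 0 ≤ u → u ≤ 1 → flypeBase s (x₀ + u) = turn ((c + u) / 10) := fun u hu0 hu1 => by
    rw [flypeBase_of_left (flypeMix_of_le (by linarith) (by linarith)), h u hu0 hu1]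
  have hev : flypeBase s =ᶠ[nhds (x₀ + v)] fun x => turn ((c + (x - x₀)) / 10) :=
    eventually_unit h0 h1 fun u hu0 hu1 => by
      simp only [e u hu0 hu1, add_sub_cancel_left]
  have hd : HasDerivAt (fun x : ℝ => (c + (x - x₀)) / 10) (1 / 10) (x₀ + v) :=
    (((hasDerivAt_id _).sub_const x₀).const_add c).div_const 10
  have := (HasDerivAt.scomp (h := fun x : ℝ => (c + (x - x₀)) / 10) (x₀ + v) (turn_hasDerivAt _) hd)
  refine (HasDerivAt.congr_of_eventuallyEq this hev).congr_deriv ?_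
  rw [e v h0.le h1.le, add_sub_cancel_left, Complex.real_smul]
  push_cast
  ring

theorem FlypePair.base {x y : ℝ} (h : FlypePair l p n x y) (s : ℝ) :
    flypeBase s x = flypeBase s y ∧ flypeBase s x ≠ 0 ∧
      HasDerivAt (flypeBase s) (Real.pi / 5 * Complex.I * flypeBase s x) x ∧
      HasDerivAt (flypeBase s) (Real.pi / 5 * Complex.I * flypeBase s x) y := by
  have hl : ∀ s x, -4 ≤ x → x ≤ 5 → flypeBase s x = turn (flypeLeft s x / 10) := fun s x h0 h1 =>
    flypeBase_of_left (flypeMix_of_le h0 h1)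
  have hbs : ∀ w, flypeBase s (w + 10) = flypeBase (1 - s) w := flypeBase_add_ten s
  have hsh : ∀ {x : ℝ} {d : ℂ}, HasDerivAt (flypeBase (1 - s)) d x →
      HasDerivAt (flypeBase s) d (x + 10) := by
    intro x d hd
    have hf : flypeBase s = fun y => flypeBase (1 - s) (y - 10) := by
      funext y; rw [← hbs, sub_add_cancel]
    rw [hf]
    have : HasDerivAt (flypeBase (1 - s)) d (x + 10 - 10) := by rwa [add_sub_cancel_right]
    exact this.comp_sub_const (x + 10) 10
  have l0 : ∀ s u, 0 ≤ u → u ≤ 1 → flypeLeft s (0 + u) = 0 + u := fun s u h0 h1 => by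
    rw [zero_add]; exact flypeLeft_zero_add h0 h1 s
  have l3 := fun s u (h0 : 0 ≤ u) (h1 : u ≤ 1) => flypeLeft_three_add h0 h1 s
  have l7 := fun s u (h0 : 0 ≤ u) (h1 : u ≤ 1) => flypeLeft_neg_three_add h0 h1 s
  obtain ⟨v, ⟨hc, rfl, rfl⟩ | ⟨hc, rfl, rfl⟩ | ⟨hc, rfl, rfl⟩⟩ := h
  · obtain ⟨v0, v1⟩ := clasp_zero_mem hc
    have e : flypeBase s x = flypeBase s (10 + x) := by
      rw [add_comm, hbs, hl _ x (by linarith) (by linarith), hl _ x (by linarith) (by linarith),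
        flypeLeft_zero_add v0.le v1.le, flypeLeft_zero_add v0.le v1.le]
    have d1 := flypeBase_hasDerivAt_of_left v0 v1 (by norm_num) (by norm_num) (l0 s)
    have d2 := hsh (flypeBase_hasDerivAt_of_left v0 v1 (by norm_num) (by norm_num) (l0 (1 - s)))
    rw [zero_add] at d1 d2
    rw [← hbs, add_comm x, ← e] at d2
    exact ⟨e, by rw [hl _ x (by linarith) (by linarith)]; exact turn_ne_zero _, d1, d2⟩
  · obtain ⟨v0, v1⟩ := clasp_zero_mem hc
    have e : flypeBase s (-3 + v) = flypeBase s (3 + v) := by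
      rw [hl _ _ (by linarith) (by linarith), hl _ _ (by linarith) (by linarith),
        l3 s v v0.le v1.le, l7 s v v0.le v1.le, turn_eq_turn_iff]
      exact ⟨-1, by push_cast; ring⟩
    have d1 := flypeBase_hasDerivAt_of_left v0 v1 (by norm_num) (by norm_num) (l7 s)
    have d2 := flypeBase_hasDerivAt_of_left v0 v1 (by norm_num) (by norm_num) (l3 s)
    rw [← e] at d2
    exact ⟨e, by rw [hl _ _ (by linarith) (by linarith)]; exact turn_ne_zero _, d1, d2⟩
  · obtain ⟨v0, v1⟩ := clasp_zero_mem hc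
    have e7 : 7 + v = -3 + v + 10 := by ring
    have e13 : 13 + v = 3 + v + 10 := by ring
    have e : flypeBase s (7 + v) = flypeBase s (13 + v) := by
      rw [e7, e13, hbs, hbs, hl _ _ (by linarith) (by linarith), hl _ _ (by linarith) (by linarith),
        l3 _ v v0.le v1.le, l7 _ v v0.le v1.le, turn_eq_turn_iff]
      exact ⟨-1, by push_cast; ring⟩
    have d1 := hsh (flypeBase_hasDerivAt_of_left v0 v1 (by norm_num) (by norm_num) (l7 (1 - s)))
    have d2 := hsh (flypeBase_hasDerivAt_of_left v0 v1 (by norm_num) (by norm_num) (l3 (1 - s)))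
    rw [← hbs, ← e7] at d1
    rw [← hbs, ← e13, ← e] at d2
    refine ⟨e, ?_, d1, d2⟩
    rw [e7, hbs, hl _ _ (by linarith) (by linarith)]
    exact turn_ne_zero _

end Pairs

section FlypeFamily

variable (l p n : ℕ)

/-- In the arch the base gives no control, so the plane curve alone must be immersed modulo rays and
avoid 0. The origin lies inside the circle of the arch, hence no tangent of it is radial. -/
theorem flypeCurve_arch_immersed {x : ℝ} (h0 : 5 < x) (h1 : x < 6) :
    flypeCurve l p n x ≠ 0 ∧ ∀ c : ℝ, deriv (flypeCurve l p n) x ≠ c * flypeCurve l p n x := by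
  obtain ⟨v, rfl⟩ : ∃ v, x = 5 + v := ⟨x - 5, by ring⟩
  have hv0 : 0 < v := by linarith
  have hv1 : v < 1 := by linarith
  obtain ⟨r, hr, hS⟩ := smoothTransition_hasDerivAt_pos hv0 hv1
  set φ : ℝ := Real.pi * Real.smoothTransition v with hφ
  have hpi := Real.pi_pos
  have hsin : 0 < Real.sin φ := Real.sin_pos_of_pos_of_lt_pi
    (mul_pos hpi (smoothTransition_pos hv0)) (by
      have := smoothTransition_lt_one hv1
      nlinarith)
  have hZ := flypeCurve_arch l p n hv0.le hv1.le
  have hS' : HasDerivAt (fun u : ℝ => Real.pi * Real.smoothTransition (u - 5)) (Real.pi * r) (5 + v) := by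
    have : HasDerivAt Real.smoothTransition r (5 + v - 5) := by rwa [add_sub_cancel_left]
    exact (this.comp_sub_const (5 + v) 5).const_mul _
  have hc := hS'.cos.ofReal_comp
  have hs := (hS'.sin.ofReal_comp.const_add (1 / 2 : ℂ)).mul_const Complex.I
  have hd := hc.add hs
  have hev : flypeCurve l p n =ᶠ[nhds (5 + v)] fun u : ℝ =>
      ((Real.cos (Real.pi * Real.smoothTransition (u - 5)) : ℝ) : ℂ) +
        (1 / 2 + (Real.sin (Real.pi * Real.smoothTransition (u - 5)) : ℝ)) * Complex.I :=
    eventually_unit hv0 hv1 fun u hu0 hu1 => by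
      rw [flypeCurve_arch l p n hu0 hu1]
      apply Complex.ext <;>
        simp [-Complex.ofReal_cos, -Complex.ofReal_sin]
  have hder := (hd.congr_of_eventuallyEq hev).deriv
  rw [add_sub_cancel_left, ← hφ] at hder
  rw [hZ, hder, ← hφ]
  refine ⟨fun h => ?_, fun c h => ?_⟩
  · have := congrArg Complex.im h
    simp at this
    linarith
  · have h2 := congrArg Complex.im h
    have h3 := congrArg Complex.re h
    simp [-Complex.ofReal_cos, -Complex.ofReal_sin] at h2 h3
    have h5 := Real.sin_sq_add_cos_sq φ
    have h6 : Real.pi * r * (1 + Real.sin φ / 2) = 0 := by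
      linear_combination Real.cos φ * h2 - (1 / 2 + Real.sin φ) * h3 + (- Real.pi * r) * h5
    have : 0 < Real.pi * r * (1 + Real.sin φ / 2) := by positivity
    linarith

theorem exists_add_twenty (x : ℝ) : ∃ (y : ℝ) (k : ℤ), -4 ≤ y ∧ y < 16 ∧ x = y + 20 * k := by
  refine ⟨x - 20 * ⌊(x + 4) / 20⌋, ⌊(x + 4) / 20⌋, ?_, ?_, by ring⟩
  · have := Int.floor_le ((x + 4) / 20)
    linarith
  · have := Int.lt_floor_add_one ((x + 4) / 20)
    linarith

theorem add_twenty_mul {E : Type*} {f : ℝ → E} (h : ∀ x, f (x + 20) = f x) (x : ℝ) (k : ℤ) :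
    f (x + 20 * k) = f x := by
  have : Function.Periodic f 20 := h
  have := this.int_mul k x
  rwa [mul_comm] at this

theorem deriv_add_twenty {f : ℝ → ℂ} (h : ∀ x, f (x + 20) = f x) (x : ℝ) :
    deriv f (x + 20) = deriv f x := by
  rw [← deriv_comp_add_const]
  congr 1
  funext y
  exact h y

theorem flypeCurve_immersed {x : ℝ} (h0 : flypeMix x ≠ 0) (h1 : flypeMix x ≠ 1) :
    flypeCurve l p n x ≠ 0 ∧ ∀ c : ℝ, deriv (flypeCurve l p n) x ≠ c * flypeCurve l p n x := by
  obtain ⟨y, k, hy, hy', rfl⟩ := exists_add_twenty x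
  rw [add_twenty_mul flypeMix_add_twenty] at h0 h1
  rw [add_twenty_mul (flypeCurve_add_twenty l p n),
    add_twenty_mul (deriv_add_twenty (flypeCurve_add_twenty l p n))]
  have h5 : 5 < y := by
    by_contra h
    exact h0 (flypeMix_of_le hy (not_lt.1 h))
  rcases lt_or_ge y 6 with h6 | h6
  · exact flypeCurve_arch_immersed l p n h5 h6
  have h15 : 15 < y := by
    by_contra h
    exact h1 (flypeMix_of_ge h6 (not_lt.1 h))
  obtain ⟨e1, e2⟩ := flypeCurve_arch_immersed l n p (x := y - 10) (by linarith) (by linarith)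
  have hd := hasDerivAt_flypeCurve_neg l p n (x := y - 10)
    ((contDiff_flypeCurve l n p).differentiable (by simp) _).hasDerivAt
  rw [sub_add_cancel] at hd
  rw [hd.deriv, flypeCurve_sub_ten l p n y]
  refine ⟨neg_ne_zero.2 e1, fun c h => e2 c ?_⟩
  rw [mul_neg, neg_inj] at h
  exact h

theorem turn_hasDerivAt_ne {f : ℝ → ℝ} {r x : ℝ} (hr : 0 < r) (hf : HasDerivAt f r x) :
    ∃ d, HasDerivAt (fun x => turn (f x / 10)) d x ∧ ∀ c : ℝ, d ≠ c * turn (f x / 10) := by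
  refine ⟨_, HasDerivAt.scomp (h := fun x : ℝ => f x / 10) x (turn_hasDerivAt _) (hf.div_const 10),
    fun c h => ?_⟩
  rw [Complex.real_smul, ← mul_assoc] at h
  have := congrArg Complex.im (mul_right_cancel₀ (turn_ne_zero _) h)
  simp at this
  exact hr.ne' (by simpa [Real.pi_ne_zero] using this)

theorem flypeBase_deriv_ne {s : ℝ} (hs0 : 0 ≤ s) (hs1 : s ≤ 1) {x : ℝ}
    (h : flypeMix x = 0 ∨ flypeMix x = 1) (c : ℝ) : deriv (flypeBase s) x ≠ c * flypeBase s x := by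
  have hm := (contDiff_flypeMix.differentiable (by simp) x).hasDerivAt
  -- The values 0 and 1 are extreme for `flypeMix`, so its derivative vanishes there and only one of
  -- the two rotations contributes.
  have hm0 : deriv flypeMix x = 0 := by
    rcases h with h | h
    · apply IsLocalMin.deriv_eq_zero
      exact Filter.Eventually.of_forall fun y => by rw [h]; exact flypeMix_nonneg y
    · apply IsLocalMax.deriv_eq_zero
      exact Filter.Eventually.of_forall fun y => by rw [h]; exact flypeMix_le_one y
  rw [hm0] at hm
  obtain ⟨r, hr, hl⟩ := flypeLeft_deriv_pos hs0 hs1 x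
  obtain ⟨r', hr', hl'⟩ := flypeLeft_deriv_pos (s := 1 - s) (by linarith) (by linarith) (x - 10)
  have hright : HasDerivAt (flypeRight s) r' x := (hl'.comp_sub_const x 10).add_const 10
  obtain ⟨d, hd, hne⟩ := turn_hasDerivAt_ne hr hl
  obtain ⟨d', hd', hne'⟩ := turn_hasDerivAt_ne hr' hright
  have hb : HasDerivAt (flypeBase s) _ x :=
    (((hm.const_sub 1).ofReal_comp).mul hd).add (hm.ofReal_comp.mul hd')
  rw [hb.deriv]
  rcases h with h | h
  · rw [flypeBase_of_left h, h]
    simpa using hne c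
  · rw [flypeBase_of_right h, h]
    simpa using hne' c

/-- The flype in homogeneous coordinates. -/
noncomputable def flypeFamily (s t : ℝ) : ℂ × ℂ := (flypeBase s (20 * t), flypeCurve l p n (20 * t))

theorem contDiff_flypeFamily : ContDiff ℝ ∞ fun x : ℝ × ℝ => flypeFamily l p n x.1 x.2 := by
  have h : ContDiff ℝ ∞ fun x : ℝ × ℝ => 20 * x.2 := contDiff_const.mul contDiff_snd
  exact (contDiff_flypeBase.comp (contDiff_fst.prodMk h)).prodMk ((contDiff_flypeCurve l p n).comp h)

theorem contDiff_flypeBase_right (s : ℝ) : ContDiff ℝ ∞ (flypeBase s) := by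
  have h : ContDiff ℝ ∞ fun x : ℝ => (s, x) := contDiff_const.prodMk contDiff_id
  have h' := contDiff_flypeBase
  generalize flypeBase = f at *
  exact h'.comp h

theorem flypeFamily_deriv (s t : ℝ) : deriv (flypeFamily l p n s) t =
    (20 * deriv (flypeBase s) (20 * t), 20 * deriv (flypeCurve l p n) (20 * t)) := by
  have h : HasDerivAt (fun t : ℝ => 20 * t) 20 t := by
    simpa using (hasDerivAt_id t).const_mul (20 : ℝ)
  have h1 := ((contDiff_flypeBase_right s).differentiable (by simp) (20 * t)).hasDerivAt.scomp t h
  have h2 := ((contDiff_flypeCurve l p n).differentiable (by simp) (20 * t)).hasDerivAt.scomp t h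
  have : HasDerivAt (flypeFamily l p n s) _ t := h1.prodMk h2
  rw [this.deriv]
  simp

/-- The pairs of parameters identified during the flype. -/
def FlypeCoincide (t u : ℝ) : Prop := (∃ k : ℤ, t = u + k) ∨ ∃ (x y : ℝ) (k k' : ℤ),
  20 * t = x + 20 * k ∧ 20 * u = y + 20 * k' ∧ (FlypePair l p n x y ∨ FlypePair l p n y x)

theorem flypeFamily_ray_iff {s : ℝ} (hs0 : 0 ≤ s) (hs1 : s ≤ 1) (t u : ℝ) :
    (∃ c : ℝ, 0 < c ∧ flypeFamily l p n s t = c • flypeFamily l p n s u) ↔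
      FlypeCoincide l p n t u := by
  constructor
  · rintro ⟨c, hc, h⟩
    have hb : flypeBase s (20 * t) = c • flypeBase s (20 * u) := congrArg Prod.fst h
    have hz : flypeCurve l p n (20 * t) = c • flypeCurve l p n (20 * u) := congrArg Prod.snd h
    obtain ⟨x, k, hx, hx', ht⟩ := exists_add_twenty (20 * t)
    obtain ⟨y, k', hy, hy', hu⟩ := exists_add_twenty (20 * u)
    rw [ht, hu, add_twenty_mul (flypeBase_add_twenty s), add_twenty_mul (flypeBase_add_twenty s),
      Complex.real_smul] at hb
    rw [ht, hu, add_twenty_mul (flypeCurve_add_twenty l p n),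
      add_twenty_mul (flypeCurve_add_twenty l p n), Complex.real_smul] at hz
    rcases flypePair_of_ray_eq l p n hs0 hs1 hx hx' hy hy' hc hb hz with rfl | h
    · exact Or.inl ⟨k - k', by push_cast; linarith⟩
    · exact Or.inr ⟨x, y, k, k', ht, hu, h⟩
  · rintro (⟨k, rfl⟩ | ⟨x, y, k, k', ht, hu, h⟩)
    · refine ⟨1, one_pos, ?_⟩
      rw [one_smul, flypeFamily, flypeFamily, mul_add, add_twenty_mul (flypeBase_add_twenty s),
        add_twenty_mul (flypeCurve_add_twenty l p n)]
    · refine ⟨1, one_pos, ?_⟩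
      rw [one_smul, flypeFamily, flypeFamily, ht, hu, add_twenty_mul (flypeBase_add_twenty s),
        add_twenty_mul (flypeCurve_add_twenty l p n), add_twenty_mul (flypeBase_add_twenty s),
        add_twenty_mul (flypeCurve_add_twenty l p n)]
      rcases h with h | h
      · rw [h.curve.1, (h.base l p n s).1]
      · rw [h.curve.1, (h.base l p n s).1]

theorem flypeFamily_transverse (s : ℝ) {t u : ℝ} (h : FlypeCoincide l p n t u)
    (hk : ¬∃ k : ℤ, t = u + k) {a b c : ℝ} (e : a • deriv (flypeFamily l p n s) t +
      b • deriv (flypeFamily l p n s) u = c • flypeFamily l p n s t) : a = 0 ∧ b = 0 := by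
  rcases h with h | ⟨x, y, k, k', ht, hu, h⟩
  · exact absurd h hk
  rw [flypeFamily_deriv, flypeFamily_deriv, flypeFamily, ht, hu,
    add_twenty_mul (flypeBase_add_twenty s), add_twenty_mul (flypeCurve_add_twenty l p n),
    add_twenty_mul (deriv_add_twenty (flypeBase_add_twenty s)),
    add_twenty_mul (deriv_add_twenty (flypeBase_add_twenty s)),
    add_twenty_mul (deriv_add_twenty (flypeCurve_add_twenty l p n)),
    add_twenty_mul (deriv_add_twenty (flypeCurve_add_twenty l p n))] at e
  have e1 : a • (20 * deriv (flypeBase s) x) + b • (20 * deriv (flypeBase s) y) = c • flypeBase s x :=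
    congrArg Prod.fst e
  have e2 : a • (20 * deriv (flypeCurve l p n) x) + b • (20 * deriv (flypeCurve l p n) y) =
    c • flypeCurve l p n x := congrArg Prod.snd e
  obtain ⟨d, hd, hdx, hdy, hB, hBx, hBy⟩ : ∃ d : ℂ, d ≠ 0 ∧ deriv (flypeCurve l p n) x = d ∧
      deriv (flypeCurve l p n) y = -d ∧ flypeBase s x ≠ 0 ∧
      deriv (flypeBase s) x = Real.pi / 5 * Complex.I * flypeBase s x ∧
      deriv (flypeBase s) y = Real.pi / 5 * Complex.I * flypeBase s x := by
    rcases h with h | h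
    · obtain ⟨-, d, hd, h1, h2⟩ := h.curve
      obtain ⟨-, h3, h4, h5⟩ := h.base l p n s
      exact ⟨d, hd, h1.deriv, h2.deriv, h3, h4.deriv, h5.deriv⟩
    · obtain ⟨-, d, hd, h1, h2⟩ := h.curve
      obtain ⟨h0, h3, h4, h5⟩ := h.base l p n s
      rw [h0] at h3 h4 h5
      exact ⟨-d, neg_ne_zero.2 hd, h2.deriv, by rw [h1.deriv, neg_neg], h3, h5.deriv, h4.deriv⟩
  rw [hBx, hBy] at e1
  rw [hdx, hdy] at e2
  simp only [Complex.real_smul] at e1 e2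
  have e3 : (a + b) * (4 * Real.pi * Complex.I) = (c : ℂ) :=
    mul_right_cancel₀ hB (by linear_combination e1)
  have e4 := congrArg Complex.im e3
  have e5 := congrArg Complex.re e3
  simp [Real.pi_ne_zero] at e4 e5
  rw [← e5, Complex.ofReal_zero, zero_mul] at e2
  -- The common speed around the axis has given `a + b = 0` and `c = 0`; the opposite velocities in
  -- the plane give `a = b`.
  have e6 : ((a : ℂ) - b) * (20 * d) = 0 := by linear_combination e2
  rcases mul_eq_zero.1 e6 with h6 | h6
  · have : a - b = 0 := by exact_mod_cast h6
    constructor <;> linarith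
  · simp [hd] at h6

theorem flypeFamily_zero (t : ℝ) : radialProj (flypeFamily l p n 0 t) =
    braidKnot (flypeLoop l p n) (flypeTime (20 * t) / 30) := by
  rw [braidKnot, braidCurve, flypeFamily, flypeBase_zero,
    show 3 * (flypeTime (20 * t) / 30) = flypeTime (20 * t) / 10 by ring, flypeLoop_time]

theorem flypeFamily_isotopic : SingularIsotopic (fun t => radialProj (flypeFamily l p n 0 t))
    (fun t => radialProj (flypeFamily l p n 1 t)) := by
  have hknot : IsSingularKnot fun t => radialProj (flypeFamily l p n 0 t) := by
    simp only [flypeFamily_zero]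
    exact (flypeLoop_isotopic l p n).2.isSingularKnot.comp_reparam flypeTime_isReparam
  apply SingularIsotopic.of_family (Γ := flypeFamily l p n) (contDiff_flypeFamily l p n)
  · intro s hs t h
    have h1 : flypeBase s (20 * t) = 0 := congrArg Prod.fst h
    have h2 : flypeCurve l p n (20 * t) = 0 := congrArg Prod.snd h
    -- The base can vanish only where the cutoff is strictly between 0 and 1, that is, in an arch,
    -- where `z` does not vanish.
    by_cases hm : flypeMix (20 * t) = 0
    · rw [flypeBase_of_left hm] at h1
      exact turn_ne_zero _ h1
    by_cases hm' : flypeMix (20 * t) = 1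
    · rw [flypeBase_of_right hm'] at h1
      exact turn_ne_zero _ h1
    · exact (flypeCurve_immersed l p n hm hm').1 h2
  · intro s hs t
    rw [flypeFamily, flypeFamily, mul_add, mul_one, flypeBase_add_twenty, flypeCurve_add_twenty]
  · intro s hs t c h
    rw [flypeFamily_deriv] at h
    have h1 : 20 * deriv (flypeBase s) (20 * t) = c • flypeBase s (20 * t) := congrArg Prod.fst h
    have h2 : 20 * deriv (flypeCurve l p n) (20 * t) = c • flypeCurve l p n (20 * t) :=
      congrArg Prod.snd h
    have key : ∀ v w : ℂ, 20 * v = c • w → v = ((c / 20 : ℝ) : ℂ) * w := by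
      intro v w hvw
      rw [Complex.real_smul] at hvw
      push_cast
      linear_combination hvw / 20
    by_cases hm : flypeMix (20 * t) = 0 ∨ flypeMix (20 * t) = 1
    · exact flypeBase_deriv_ne hs.1 hs.2 hm _ (key _ _ h1)
    · push Not at hm
      exact (flypeCurve_immersed l p n hm.1 hm.2).2 _ (key _ _ h2)
  · intro s hs t u
    rw [flypeFamily_ray_iff l p n hs.1 hs.2, flypeFamily_ray_iff l p n le_rfl zero_le_one]
  · intro s hs t u h hk a b c e
    exact flypeFamily_transverse l p n s ((flypeFamily_ray_iff l p n hs.1 hs.2 t u).1 h) hk e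
  · exact hknot.finite
  · exact hknot.double

end FlypeFamily

/-- A rotation by π is beyond the reach of `SingularIsotopic.of_rotation`; the rigid rotations by
all smaller angles are used as the path. -/
theorem IsBraidLoop.neg {z : ℝ → ℂ} (hz : IsBraidLoop z) :
    SingularIsotopic (braidKnot z) (braidKnot fun x => -z x) := by
  have h : ContDiff ℝ ∞ fun x : ℝ × ℝ => turn (x.1 / 2) * z x.2 :=
    (contDiff_turn.comp (contDiff_fst.div_const 2)).mul (hz.smooth.comp contDiff_snd)
  have e0 : turn (0 / 2) = 1 := by simp [turn]
  have e1 : turn (1 / 2) = -1 := by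
    rw [turn, show (2 * Real.pi * ((1 / 2 : ℝ) : ℂ) * Complex.I : ℂ) = Real.pi * Complex.I by
      push_cast; ring, Complex.exp_pi_mul_I]
  have := (SingularIsotopic.of_braid_family (z := fun s x => turn (s / 2) * z x)
    (by simpa only [e0, one_mul] using hz) h (fun s _ x => by rw [hz.add_three])
    (fun s _ x => by
      simp only [e0, one_mul]
      exact (mul_right_injective₀ (turn_ne_zero _)).eq_iff)
    (fun s _ x e => by
      have hd : ∀ y, deriv (fun x => turn (s / 2) * z x) y = turn (s / 2) * deriv z y := fun y =>
        ((hz.smooth.differentiable (by simp) y).hasDerivAt.const_mul _).deriv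
      simp only [hd]
      intro h'
      exact hz.transverse x (mul_left_cancel₀ (turn_ne_zero _) e)
        (mul_left_cancel₀ (turn_ne_zero _) h'))).1
  simpa only [e0, e1, one_mul, neg_one_mul] using this

/-- A shift by half a period brings the base back to the stage 0 and turns `z` into `-z` for the
exchanged numbers of pinches. -/
theorem radialProj_flypeFamily_one (l p n : ℕ) (t : ℝ) : radialProj (flypeFamily l p n 1 t) =
    braidKnot (fun x => -flypeLoop l n p x) (flypeTime (20 * (t + 1 / 2)) / 30) := by
  rw [braidKnot, braidCurve, flypeFamily,
    show 3 * (flypeTime (20 * (t + 1 / 2)) / 30) = flypeTime (20 * (t + 1 / 2)) / 10 by ring,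
    flypeLoop_time, ← flypeBase_zero, show 20 * (t + 1 / 2) = 20 * t + 10 by ring, flypeBase_add_ten,
    sub_zero, ← flypeCurve_eq_add_ten]

/-- The triangular curve passes to the braid form of the flype curve, through the flype to its
negative with `p` and `n` exchanged, through a rotation by π, and back to a triangular curve. -/
theorem fanTails_isotopic (l p n : ℕ) : SingularIsotopic (braidKnot (triCurve (fanTails l p n)))
    (braidKnot (triCurve (fanTails l n p))) := by
  have h1 := (flypeLoop_isotopic l p n).1
  have h2 := flypeFamily_isotopic l p n
  simp only [flypeFamily_zero, radialProj_flypeFamily_one] at h2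
  have hs : IsReparam fun t : ℝ => flypeTime (20 * (t + 1 / 2)) / 30 := by
    have : IsReparam fun t : ℝ => t + 1 / 2 :=
      ⟨contDiff_id.add contDiff_const, fun t => by simp, fun t => by ring⟩
    exact flypeTime_isReparam.comp this
  have h3 : SingularIsotopic _ (braidKnot (flypeLoop l p n)) :=
    SingularIsotopic.of_reparam h2.left flypeTime_isReparam fun _ => rfl
  have h4 : SingularIsotopic _ (braidKnot fun x => -flypeLoop l n p x) :=
    SingularIsotopic.of_reparam h2.right hs fun _ => rfl
  exact h1.trans (h3.symm.trans (h2.trans (h4.trans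
    ((flypeLoop_isotopic l n p).2.neg.symm.trans (flypeLoop_isotopic l n p).1.symm))))

theorem fanWord_tails (l p n : ℕ) : (fanWord l p n).tails = fanTails l p n := by
  simp [fanWord, ChordWord.tails, fanTails, Chord.tail]

/-- Exchanging the two last blocks of a fan does not change the isotopy type. -/
theorem fanWord_isotopic (l p n : ℕ) : SingularIsotopic (braidKnot (triCurve (fanWord l p n).tails))
    (braidKnot (triCurve (fanWord l n p).tails)) := by
  rw [fanWord_tails, fanWord_tails]
  exact fanTails_isotopic l p n

/-! ### Standard braids up to conjugation -/

theorem sbWord_append {m : ℕ} (v w : List (Letter m)) : sbWord (v ++ w) = sbWord v * sbWord w := by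
  simp [sbWord]

theorem ClosedBraidEquiv.of_mul {m : ℕ} (u v : SingularBraidMonoid m) :
    ClosedBraidEquiv (u * v) (v * u) := .rel _ _ ⟨u, v, rfl, rfl⟩

section ThreeBraids

local notation "s₁" => sbGen (Letter.pos (m := 3) 0)
local notation "s₂" => sbGen (Letter.pos (m := 3) 1)
local notation "r₁" => sbGen (Letter.neg (m := 3) 0)
local notation "r₂" => sbGen (Letter.neg (m := 3) 1)
local notation "t₁" => sbGen (Letter.sing (m := 3) 0)
local notation "t₂" => sbGen (Letter.sing (m := 3) 1)

theorem sb_pos_neg (i : Fin 2) : sbGen (Letter.pos (m := 3) i) * sbGen (.neg i) = 1 :=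
  (PresentedMonoid.mk_eq_mk_of_rel (SingularBraidRel.pos_neg (m := 3) i) :)

theorem sb_neg_pos (i : Fin 2) : sbGen (Letter.neg (m := 3) i) * sbGen (.pos i) = 1 :=
  (PresentedMonoid.mk_eq_mk_of_rel (SingularBraidRel.neg_pos (m := 3) i) :)

theorem sb_pos_neg_mul (i : Fin 2) (y : SingularBraidMonoid 3) :
    sbGen (.pos i) * (sbGen (.neg i) * y) = y := by rw [← mul_assoc, sb_pos_neg, one_mul]

theorem sb_neg_pos_mul (i : Fin 2) (y : SingularBraidMonoid 3) :
    sbGen (.neg i) * (sbGen (.pos i) * y) = y := by rw [← mul_assoc, sb_neg_pos, one_mul]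

theorem sb_pos_sing (i : Fin 2) :
    sbGen (Letter.pos (m := 3) i) * sbGen (.sing i) = sbGen (.sing i) * sbGen (.pos i) :=
  (PresentedMonoid.mk_eq_mk_of_rel (SingularBraidRel.pos_sing (m := 3) i) :)

/-- The smashed full twist of two neighbouring strands. -/
def sbTwist (i : Fin 2) : SingularBraidMonoid 3 := sbGen (.pos i) * sbGen (.sing i)

theorem sbTwist_pos (i : Fin 2) : sbTwist i * sbGen (.pos i) = sbGen (.pos i) * sbTwist i := by
  rw [sbTwist, mul_assoc, ← sb_pos_sing]

theorem sbTwist_neg (i : Fin 2) : sbTwist i * sbGen (.neg i) = sbGen (.neg i) * sbTwist i := by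
  rw [sbTwist, sb_pos_sing, mul_assoc, sb_pos_neg, ← sb_pos_sing, sb_neg_pos_mul, mul_one]

theorem sbTwist_braid {i j : Fin 2} (h : i.1 + 1 = j.1 ∨ j.1 + 1 = i.1) :
    sbGen (.pos i) * (sbGen (.pos j) * sbTwist i) =
      sbTwist j * (sbGen (.pos i) * sbGen (.pos j)) := by
  have h1 : sbGen (.pos i) * sbGen (.pos j) * sbGen (.sing i) =
      sbGen (Letter.sing (m := 3) j) * sbGen (.pos i) * sbGen (.pos j) :=
    (PresentedMonoid.mk_eq_mk_of_rel (SingularBraidRel.braid_sing (m := 3) i j h) :)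
  have h2 : sbGen (.pos i) * sbGen (.pos j) * sbGen (.pos i) =
      sbGen (Letter.pos (m := 3) j) * sbGen (.pos i) * sbGen (.pos j) :=
    (PresentedMonoid.mk_eq_mk_of_rel (SingularBraidRel.braid (m := 3) i j h) :)
  rw [sbTwist, sb_pos_sing, ← mul_assoc, ← mul_assoc, h1, mul_assoc, mul_assoc,
    ← mul_assoc (sbGen (Letter.pos (m := 3) i)), h2, sbTwist, sb_pos_sing]
  simp only [mul_assoc]

/-- The smashed generator with a given tail. -/
def sbChord (c : ZMod 3) : SingularBraidMonoid 3 :=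
  if c = 0 then sbTwist 0 else if c = 1 then sbTwist 1 else r₂ * sbTwist 0 * s₂

theorem sbWord_chunkWord_some (c : ZMod 3) (b : Bool) :
    sbWord (chunkWord (some c) b) = sbChord c := by
  obtain rfl | rfl | rfl := zmod_three_cases c
  all_goals cases b <;> simp [sbWord, chunkWord, sbChord, sbTwist, mul_assoc,
    ← mul_assoc (sbGen (.pos 0)) (sbGen (.sing 0)), sb_pos_sing, show (2 : ZMod 3) ≠ 0 from by decide, show (2 : ZMod 3) ≠ 1 from by decide]

theorem sbWord_standardBraid (W : ChordWord 3) (q : ℕ → Bool) :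
    sbWord (standardBraid W q) = (W.tails.map sbChord).prod * (r₂ * r₁) := by
  rw [standardBraid, sbWord_append]
  congr 1
  -- The choices `q` disappear because `σ` and `τ` of the same index commute; the offset `k` is
  -- needed for the induction only.
  suffices h : ∀ k, sbWord ((W.zipIdx k).flatMap fun g => g.1.smashed (q g.2)) =
      (W.tails.map sbChord).prod from h 0
  induction W with
  | nil => intro k; simp [sbWord, ChordWord.tails]
  | cons g W ih =>
    intro k
    rw [List.zipIdx_cons, List.flatMap_cons, sbWord_append, ih, g.smashed_eq,
      sbWord_chunkWord_some]
    simp [ChordWord.tails]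

/-- The chord between the outer strands can be conjugated past either side of the middle one. This
second form shows the twist of the last two strands, as the block `R` of a flype requires. -/
theorem sbChord_two : sbChord 2 = s₁ * (sbTwist 1 * r₁) := by
  have h := sbTwist_braid (i := 1) (j := 0) (.inr rfl)
  have h' : sbTwist 0 * s₂ = s₂ * (s₁ * (sbTwist 1 * r₁)) := by
    rw [← mul_one (_ * s₂), ← sb_pos_neg 0, mul_assoc, ← mul_assoc s₂, ← mul_assoc, ← h]
    simp only [mul_assoc]
  rw [sbChord, if_neg (by decide), if_neg (by decide), mul_assoc, h', sb_neg_pos_mul]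

/-- The algebraic form of a cyclic move: a chord that slides through the closing braid has its tail
increased by one, modulo 3. -/
theorem sbChord_mul_closing (c : ZMod 3) :
    sbChord c * (r₂ * r₁) = r₂ * r₁ * sbChord (c + 1) := by
  obtain rfl | rfl | rfl := zmod_three_cases c
  · have h := sbTwist_braid (i := 0) (j := 1) (.inl rfl)
    rw [zero_add, show sbChord 0 = sbTwist 0 from rfl, show sbChord 1 = sbTwist 1 from rfl]
    calc _ = r₂ * (r₁ * (s₁ * (s₂ * sbTwist 0))) * (r₂ * r₁) := by
          rw [sb_neg_pos_mul, sb_neg_pos_mul]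
      _ = _ := by rw [h]; simp only [mul_assoc, sb_pos_neg_mul, sb_pos_neg, mul_one]
  · rw [show (1 + 1 : ZMod 3) = 2 from rfl, sbChord_two, mul_assoc, sb_neg_pos_mul, ← mul_assoc,
      ← mul_assoc, ← sbTwist_neg]
    rfl
  · rw [show (2 + 1 : ZMod 3) = 0 from rfl, show sbChord 0 = sbTwist 0 from rfl,
      show sbChord 2 = r₂ * sbTwist 0 * s₂ from rfl, mul_assoc, sb_pos_neg_mul, mul_assoc,
      sbTwist_neg, mul_assoc]

theorem CyclicEquiv.closedBraidEquiv {V W : ChordWord 3} (h : CyclicEquiv V W) (q q' : ℕ → Bool) :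
    ClosedBraidEquiv (sbWord (standardBraid V q)) (sbWord (standardBraid W q')) := by
  rw [sbWord_standardBraid, sbWord_standardBraid]
  induction h with
  | rel V W h =>
    obtain ⟨W', g, rfl, rfl⟩ := h
    have := ClosedBraidEquiv.of_mul ((W'.tails.map sbChord).prod * (r₂ * r₁)) (sbChord (g.tail + 1))
    rw [mul_assoc, ← sbChord_mul_closing] at this
    simpa [ChordWord.tails, Chord.tail_slide, mul_assoc] using this
  | refl V => exact .refl _
  | symm _ _ _ ih => exact .symm _ _ ih
  | trans _ _ _ _ _ ih ih' => exact .trans _ _ _ ih ih'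

theorem sbChord_pow_mul_closing (c : ZMod 3) (n : ℕ) :
    sbChord c ^ n * (r₂ * r₁) = r₂ * r₁ * sbChord (c + 1) ^ n := by
  induction n with
  | zero => simp
  | succ n ih => rw [pow_succ, mul_assoc, sbChord_mul_closing, ← mul_assoc, ih, pow_succ, mul_assoc]

theorem sbWord_fanWord (l p n : ℕ) (q : ℕ → Bool) : sbWord (standardBraid (fanWord l p n) q) =
    sbTwist 0 ^ l * sbChord 2 ^ p * sbTwist 0 ^ n * (r₂ * r₁) := by
  rw [sbWord_standardBraid]
  simp only [fanWord, ChordWord.tails, List.map_append, List.map_replicate, List.prod_append,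
    List.prod_replicate]
  rfl

theorem braidFlype_of_fanWord {V W : ChordWord 3} {l p n : ℕ} (hV : CyclicEquiv V (fanWord l p n))
    (hW : CyclicEquiv W (fanWord l n p)) (q q' : ℕ → Bool) :
    BraidFlype (sbWord (standardBraid V q)) (sbWord (standardBraid W q')) := by
  have mem : ∀ {i : Fin 2}, sbTwist i ∈ Submonoid.closure
      {sbGen (.pos i), sbGen (.neg i), sbGen (.sing i)} := fun {i} =>
    mul_mem (Submonoid.subset_closure (by simp)) (Submonoid.subset_closure (by simp))
  refine ⟨sbTwist 0 ^ l, pow_mem mem l, r₁ * sbTwist 0 ^ n,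
    mul_mem (Submonoid.subset_closure (by simp)) (pow_mem mem n), sbTwist 1 ^ p, pow_mem mem p,
    r₂, by simp, ?_, ?_⟩
  · refine .trans _ _ _ (hV.closedBraidEquiv q q) ?_
    have hp : sbChord 2 ^ p = s₁ * (sbTwist 1 ^ p * r₁) := by
      clear hV hW
      induction p with
      | zero => simp [sb_pos_neg]
      | succ p ih =>
        rw [pow_succ, ih, sbChord_two, pow_succ]
        simp only [mul_assoc, sb_neg_pos_mul]
    -- The last `r₁` of the closing braid is conjugated to the top, where it commutes with the
    -- twists and cancels the `s₁` from `sbChord_two`. This leaves `X R Y σ₂⁻¹` with `Y = r₁ *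
    -- sbTwist 0 ^ n`.
    have hl : r₁ * (sbTwist 0 ^ l * s₁) = sbTwist 0 ^ l := by
      rw [(Commute.pow_left (sbTwist_pos 0) l : _ = _), sb_neg_pos_mul]
    have := ClosedBraidEquiv.of_mul (sbTwist 0 ^ l * s₁ * (sbTwist 1 ^ p * r₁ * sbTwist 0 ^ n * r₂)) r₁
    rw [← mul_assoc r₁, hl] at this
    rw [sbWord_fanWord, hp]
    simpa only [ClosedBraidEquiv, mul_assoc] using this
  · refine .trans _ _ _ (hW.closedBraidEquiv q' q') ?_
    -- Here no conjugation of the fan is needed: moving the closing braid up past `a^p` and `c^n`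
    -- produces `X σ₂⁻¹ Y R` literally.
    have h0 : ∀ k, sbTwist 0 ^ k * (r₂ * r₁) = r₂ * r₁ * sbTwist 1 ^ k := sbChord_pow_mul_closing 0
    have h2 : sbChord 2 ^ n * (r₂ * r₁) = r₂ * r₁ * sbTwist 0 ^ n := sbChord_pow_mul_closing 2 n
    rw [sbWord_fanWord, mul_assoc, h0, ← mul_assoc, mul_assoc _ _ (r₂ * r₁), h2]
    simpa only [mul_assoc] using Relation.EqvGen.refl _

end ThreeBraids

/-! ### The chord diagram of a standard knot -/

theorem respects_of_pairs {γ : ℝ → ℂ × ℂ} (l : Name) (P : List (ℕ × ℝ)) (hl : P.map Prod.fst = l.1)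
    (hs : P.Pairwise fun g h => g.2 < h.2) (h01 : ∀ g ∈ P, g.2 ∈ Set.Ico (0 : ℝ) 1)
    (h : ∀ u ∈ Set.Ico (0 : ℝ) 1, ∀ v ∈ Set.Ico (0 : ℝ) 1, u < v →
      (γ u = γ v ↔ ∃ k, (k, u) ∈ P ∧ (k, v) ∈ P)) : Respects γ (Quotient.mk _ l) := by
  obtain ⟨l, hn⟩ := l
  obtain rfl : P.map Prod.fst = l := hl
  let t : Fin (P.map Prod.fst).length → ℝ := fun i => (P[i.1]'(by simpa using i.2)).2
  have ht : StrictMono t := fun i j hij =>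
    List.pairwise_iff_getElem.1 hs i j _ _ hij
  refine ⟨⟨_, hn⟩, rfl, t, ht, fun i => h01 _ (List.getElem_mem _), fun u hu v hv => ?_⟩
  have key : (u ≠ v ∧ γ u = γ v) ↔ u ≠ v ∧ ∃ k, (k, u) ∈ P ∧ (k, v) ∈ P := by
    refine and_congr_right fun hne => ?_
    rcases hne.lt_or_gt with hlt | hlt
    · exact h u hu v hv hlt
    · rw [eq_comm, h v hv u hu hlt]
      exact exists_congr fun _ => and_comm
  rw [key]
  constructor
  · rintro ⟨hne, k, h1, h2⟩
    obtain ⟨i, hi, hi'⟩ := List.getElem_of_mem h1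
    obtain ⟨j, hj, hj'⟩ := List.getElem_of_mem h2
    refine ⟨⟨i, by simpa using hi⟩, ⟨j, by simpa using hj⟩, ?_, by simp [hi', hj'],
      by simp [t, hi'], by simp [t, hj']⟩
    rintro hij
    rw [Fin.mk.injEq] at hij
    subst hij
    rw [hi'] at hj'
    exact hne (Prod.ext_iff.1 hj').2
  · rintro ⟨i, j, hij, hk, rfl, rfl⟩
    refine ⟨fun e => hij (ht.injective e), (P.map Prod.fst).get i, ?_, ?_⟩
    · simp [t]
    · rw [hk]; simp [t]

/-- On two neighbouring strands the tail is on the first. The only strands at distance 2 are `0` and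
`2`, where the cyclic order makes `2` the tail. -/
theorem Chord.mem_iff_tail (g : Chord 3) {a b : Fin 3} (h : a < b) :
    ((g.i = a ∨ g.j = a) ∧ (g.i = b ∨ g.j = b)) ↔
      (b.1 = a.1 + 1 ∧ g.tail = (a.1 : ZMod 3)) ∨ (b.1 = a.1 + 2 ∧ g.tail = (b.1 : ZMod 3)) := by
  rcases g.cases_three with rfl | rfl | rfl <;> revert a b <;> decide

/-- The label and the time of the endpoints of the chords of a word. -/
noncomputable def endpointTimes (W : ChordWord 3) (φ : ℝ → ℝ) : List (ℕ × ℝ) :=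
  (List.finRange 3).flatMap fun p => (W.zipIdx.filter fun g => g.1.i = p ∨ g.1.j = p).map fun g =>
    (g.2, φ (p + (g.2 + 1 / 2) / (W.length + 1)) / 3)

/-- Since `φ` is increasing and fixes 0 and 3, the endpoints on one period occur strand by strand,
and on each strand from top to bottom, which is the order of `readName`. -/
theorem respects_braidKnot (W : ChordWord 3) {z : ℝ → ℂ} (h3 : ∀ x, z (x + 3) = z x) {φ : ℝ → ℝ}
    (hφ : IsReparam φ) (h0 : φ 0 = 0) (hz : ∀ y, z (φ y + 1) = z (φ y) ↔
      triCurve W.tails (y + 1) = triCurve W.tails y) : Respects (braidKnot z) W.diagram := by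
  have hφ3 : φ 3 = 3 := by simpa [h0] using hφ.add_int 0 3
  have hoff : ∀ r : ℕ, r < W.length → 0 ≤ ((r : ℝ) + 1 / 2) / (W.length + 1) ∧
      ((r : ℝ) + 1 / 2) / (W.length + 1) < 1 := fun r hr => by
    have : (r : ℝ) + 1 ≤ W.length := by exact_mod_cast hr
    refine ⟨by positivity, ?_⟩
    rw [div_lt_one (by positivity)]
    linarith
  have hmem : ∀ k u, (k, u) ∈ endpointTimes W φ ↔ ∃ p : Fin 3, ∃ g, W[k]? = some g ∧
      (g.i = p ∨ g.j = p) ∧ φ (p.1 + (k + 1 / 2) / (W.length + 1)) / 3 = u := by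
    intro k u
    simp only [endpointTimes, List.mem_flatMap, List.mem_finRange, true_and, List.mem_map,
      List.mem_filter, decide_eq_true_eq, Prod.exists, List.mem_zipIdx_iff_getElem?, Prod.mk.injEq]
    constructor
    · rintro ⟨p, g, k, ⟨h1, h2⟩, rfl, h3⟩
      exact ⟨p, g, h1, h2, h3⟩
    · rintro ⟨p, g, h1, h2, h3⟩
      exact ⟨p, g, k, ⟨h1, h2⟩, rfl, h3⟩
  refine respects_of_pairs _ (endpointTimes W φ) ?_ ?_ ?_ ?_
  · simp only [endpointTimes, List.map_flatMap, List.map_map]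
    rfl
  · rw [endpointTimes, List.pairwise_flatMap]
    have hmono : ∀ {x y : ℝ}, x < y → φ x / 3 < φ y / 3 := fun h =>
      div_lt_div_of_pos_right (hφ.strictMono h) (by norm_num)
    constructor
    · intro p _
      rw [List.pairwise_map]
      refine List.Pairwise.filter _ (List.Pairwise.imp (R := fun g h => g.2 < h.2) ?_ ?_)
      · intro g h hgh
        apply hmono
        have : (g.2 : ℝ) < h.2 := by exact_mod_cast hgh
        gcongr
      · rw [← List.pairwise_map (f := Prod.snd) (R := (· < ·)), List.zipIdx_map_snd]
        exact List.pairwise_lt_range'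
    · refine (List.pairwise_lt_finRange 3).imp ?_
      intro p p' hp x hx y hy
      simp only [List.mem_map, List.mem_filter, Prod.exists, List.mem_zipIdx_iff_getElem?] at hx hy
      obtain ⟨g, r, ⟨h1, -⟩, rfl⟩ := hx
      obtain ⟨g', r', ⟨h1', -⟩, rfl⟩ := hy
      apply hmono
      have := hoff r (List.getElem?_eq_some_iff.1 h1).1
      have := hoff r' (List.getElem?_eq_some_iff.1 h1').1
      have : (p.1 : ℝ) + 1 ≤ p'.1 := by exact_mod_cast hp
      linarith
  · rintro ⟨k, u⟩ h
    obtain ⟨p, g, h1, h2, rfl⟩ := (hmem k u).1 h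
    have := hoff k (List.getElem?_eq_some_iff.1 h1).1
    have hp : (p.1 : ℝ) + 1 ≤ 3 := by exact_mod_cast p.2
    have h4 : φ 0 ≤ φ (p.1 + (k + 1 / 2) / (W.length + 1)) :=
      hφ.strictMono.monotone (add_nonneg (by positivity) (by linarith))
    have h5 : φ (p.1 + (k + 1 / 2) / (W.length + 1)) < φ 3 := hφ.strictMono (by linarith)
    exact ⟨by dsimp only; linarith, by dsimp only; linarith⟩
  · intro u hu v hv huv
    obtain ⟨x, hx⟩ := hφ.surjective (3 * u)
    obtain ⟨y, hy⟩ := hφ.surjective (3 * v)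
    have hxy : x < y := by rw [← hφ.strictMono.lt_iff_lt]; linarith
    have hx0 : 0 ≤ x := by rw [← hφ.strictMono.le_iff_le]; linarith [hu.1]
    have hy3 : y < 3 := by rw [← hφ.strictMono.lt_iff_lt]; linarith [hv.2]
    have hpinch : ∀ y, z (φ y + 1) = z (φ y) ↔ ∃ (p : ℤ) (r : ℕ) (g : Chord 3),
        W[r]? = some g ∧ g.tail = p ∧ y = p + (r + 1 / 2) / (W.length + 1) := by
      intro y
      rw [hz, triCurve_eq_iff', ChordWord.length_tails]
      refine exists_congr fun p => exists_congr fun r => ?_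
      have e : ((p : ℝ) * (W.length + 1 : ℕ) + r + 1 / 2) / (W.length + 1 : ℕ) =
          p + (r + 1 / 2) / (W.length + 1) := by push_cast; field_simp; ring
      rw [e, ChordWord.tails, List.getElem?_map, Option.map_eq_some_iff, ← exists_and_right]
      simp only [and_assoc]
    have hu' : ∀ x', φ x' / 3 = u ↔ x' = x := fun x' => by
      rw [← hφ.strictMono.injective.eq_iff (b := x), hx]
      constructor <;> intro h <;> linarith
    have hv' : ∀ x', φ x' / 3 = v ↔ x' = y := fun x' => by
      rw [← hφ.strictMono.injective.eq_iff (b := y), hy]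
      constructor <;> intro h <;> linarith
    -- Within one period two points over the same place of the circle are one or two turns apart; in
    -- the latter case the period 3 makes the later one the first strand.
    have hbk : braidKnot z u = braidKnot z v ↔ (y = x + 1 ∧ z (φ x + 1) = z (φ x)) ∨
        (y = x + 2 ∧ z (φ y + 1) = z (φ y)) := by
      rw [eq_comm, braidKnot_eq_iff, ← hx, ← hy]
      have e : ∀ k : ℤ, φ y = φ x + k ↔ y = x + k := fun k => by
        rw [← hφ.add_int, hφ.strictMono.injective.eq_iff]
      have h2 : y = x + 2 → (z (φ y + 1) = z (φ y) ↔ z (φ x + 2) = z (φ x)) := fun h => by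
        have := (e 2).2 (by exact_mod_cast h)
        rw [this, show φ x + (2 : ℤ) + 1 = φ x + 3 by push_cast; ring, h3, eq_comm]
        norm_cast
      constructor
      · rintro ⟨k, hk, hk'⟩
        rw [e] at hk
        have k1 : 0 < k := by exact_mod_cast (by linarith : (0 : ℝ) < k)
        have k2 : k < 3 := by exact_mod_cast (by linarith : (k : ℝ) < 3)
        obtain rfl | rfl : k = 1 ∨ k = 2 := by omega
        · exact .inl ⟨by exact_mod_cast hk, by exact_mod_cast hk'⟩
        · have hk : y = x + 2 := by exact_mod_cast hk
          exact .inr ⟨hk, (h2 hk).2 (by exact_mod_cast hk')⟩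
      · rintro (⟨hk, hk'⟩ | ⟨hk, hk'⟩)
        · exact ⟨1, (e 1).2 (by exact_mod_cast hk), by exact_mod_cast hk'⟩
        · exact ⟨2, (e 2).2 (by exact_mod_cast hk), by exact_mod_cast (h2 hk).1 hk'⟩
    rw [hbk, hpinch, hpinch]
    simp only [hmem, hu', hv']
    constructor
    · have hfin : ∀ (p : ℤ) (r : ℕ), 0 ≤ p + ((r : ℝ) + 1 / 2) / (W.length + 1) →
          p + ((r : ℝ) + 1 / 2) / (W.length + 1) < 3 → r < W.length → 0 ≤ p ∧ p < 3 := by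
        intro p r h1 h2 hr
        have := hoff r hr
        have h3 : (-1 : ℝ) < p := by linarith
        have h4 : (p : ℝ) < 3 := by linarith
        exact ⟨by have : (-1 : ℤ) < p := by exact_mod_cast h3
                  omega, by exact_mod_cast h4⟩
      rintro (⟨hk, p, r, g, hr, hg, rfl⟩ | ⟨hk, p, r, g, hr, hg, rfl⟩)
      · have hlt := (List.getElem?_eq_some_iff.1 hr).1
        obtain ⟨p0, -⟩ := hfin p r hx0 (by linarith) hlt
        obtain ⟨-, p3⟩ := hfin (p + 1) r (by push_cast; linarith) (by push_cast; linarith) hlt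
        lift p to ℕ using p0
        have := (g.mem_iff_tail (a := ⟨p, by omega⟩) (b := ⟨p + 1, by omega⟩)
          (by simp [Fin.lt_def])).2 (.inl ⟨rfl, by simpa using hg⟩)
        refine ⟨r, ⟨_, g, hr, this.1, by simp⟩, ⟨_, g, hr, this.2, ?_⟩⟩
        rw [hk]; push_cast; ring
      · have hlt := (List.getElem?_eq_some_iff.1 hr).1
        obtain ⟨-, p3⟩ := hfin p r (by linarith) hy3 hlt
        obtain ⟨p0, -⟩ := hfin (p - 2) r (by push_cast; linarith) (by push_cast; linarith) hlt
        obtain rfl : p = 2 := by omega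
        have := (g.mem_iff_tail (a := 0) (b := 2) (by decide)).2 (.inr ⟨rfl, by simpa using hg⟩)
        refine ⟨r, ⟨_, g, hr, this.1, ?_⟩, ⟨_, g, hr, this.2, by simp⟩⟩
        simp only [Fin.val_zero, Nat.cast_zero, Int.cast_ofNat] at hk ⊢
        linarith
    · rintro ⟨r, ⟨a, g, hr, ha, rfl⟩, ⟨b, g', hr', hb, rfl⟩⟩
      obtain rfl : g = g' := Option.some.inj (hr.symm.trans hr')
      have hab : a < b := by
        have : (a.1 : ℝ) < b.1 := by linarith
        exact_mod_cast this
      rcases (g.mem_iff_tail hab).1 ⟨ha, hb⟩ with ⟨h1, h2⟩ | ⟨h1, h2⟩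
      · refine .inl ⟨?_, a.1, r, g, hr, by simpa using h2, by simp⟩
        rw [h1]; push_cast; ring
      · refine .inr ⟨?_, b.1, r, g, hr, by simpa using h2, by simp⟩
        rw [h1]; push_cast; ring

theorem respects_standardKnot (W : ChordWord 3) (q : ℕ → Bool) :
    Respects (standardKnot W q) W.diagram := by
  rw [standardKnot_eq]
  refine respects_braidKnot W (letterCurve_add_three W q) (letterTime_isReparam W q) ?_ fun y => ?_
  · rw [letterTime, mul_zero, ← Int.cast_zero, interp_int]
    rw [blockNode, blockStart]
    simp [chunkStart, chunkNode]
  · obtain ⟨j, u, h0, h1, rfl⟩ := exists_block W.tails y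
    rw [letterCurve_eq_iff W q j h0 h1, triCurve_eq_iff W.tails j h0 h1]

/-! ### Words with the same chord diagram -/

theorem List.IsRotated.exists_append {α : Type*} {l l' : List α} (h : l ~r l') :
    ∃ P Q, l = P ++ Q ∧ l' = Q ++ P := by
  obtain ⟨n, hn, rfl⟩ := List.isRotated_iff_mod.1 h
  exact ⟨l.take n, l.drop n, by simp, List.rotate_eq_drop_append_take hn⟩

/-- The letter `x` occurs only once in the first list, so a rotation that brings it to the front
again is trivial. -/
theorem List.IsRotated.cons_eq {α : Type*} {x : α} {A B : List α} (h : x :: A ~r x :: B)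
    (hA : x ∉ A) : A = B := by
  obtain ⟨P, Q, h1, h2⟩ := h.exists_append
  rcases P with _ | ⟨y, P⟩
  · rw [List.nil_append] at h1
    rw [List.append_nil] at h2
    exact (List.cons.inj (h1.trans h2.symm)).2
  rcases Q with _ | ⟨z, Q⟩
  · rw [List.append_nil] at h1
    rw [List.nil_append] at h2
    exact (List.cons.inj (h1.trans h2.symm)).2
  · simp_all

theorem List.append_cons_inj_of_notMem_left {α : Type*} {x : α} {A A' B B' : List α}
    (h : A ++ x :: B = A' ++ x :: B') (hA : x ∉ A) (hA' : x ∉ A') : A = A' ∧ B = B' := by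
  rcases List.append_eq_append_iff.1 h with ⟨C, h1, h2⟩ | ⟨C, h1, h2⟩ <;> rcases C with _ | ⟨y, C⟩ <;>
    simp_all

theorem List.eq_or_exists_ne_mark {D E : List (ℕ × Bool)} (h : D.map Prod.fst = E.map Prod.fst) :
    D = E ∨ ∃ k b X Y X' Y', D = X ++ (k, b) :: Y ∧ E = X' ++ (k, !b) :: Y' ∧
      X.map Prod.fst = X'.map Prod.fst ∧ Y.map Prod.fst = Y'.map Prod.fst := by
  induction D generalizing E with
  | nil => simp_all
  | cons d D ih =>
    rcases E with _ | ⟨e, E⟩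
    · simp at h
    obtain ⟨k, b⟩ := d
    obtain ⟨k', b'⟩ := e
    simp only [List.map_cons, List.cons.injEq] at h
    obtain ⟨rfl, h⟩ := h
    by_cases hb : b' = !b
    · exact .inr ⟨k, b, [], D, [], E, by simp, by simp [hb], rfl, h⟩
    · obtain rfl : b' = b := by cases b <;> cases b' <;> simp_all
      rcases ih h with rfl | ⟨k', b', X, Y, X', Y', rfl, rfl, h1, h2⟩
      · exact .inl rfl
      · exact .inr ⟨k', b', (k, _) :: X, Y, (k, _) :: X', Y', rfl, rfl, by simp [h1], h2⟩

/-! ### Labelled words with marked tails -/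

/-- The chord with a given tail. -/
def Chord.ofTail (c : ZMod 3) : Chord 3 :=
  if c = 0 then ⟨0, 1, by decide⟩ else if c = 1 then ⟨1, 2, by decide⟩ else ⟨0, 2, by decide⟩

theorem Chord.ofTail_tail (g : Chord 3) : ofTail g.tail = g := by
  rcases g.cases_three with rfl | rfl | rfl <;> rfl

theorem Chord.slide_ofTail (c : ZMod 3) : (ofTail c).slide = ofTail (c + 1) := by
  obtain rfl | rfl | rfl := zmod_three_cases c
  all_goals rfl

/-- Words in the tails of chords, with labels. -/
abbrev LabelledWord := List (ZMod 3 × ℕ)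

namespace LabelledWord

/-- The underlying word. -/
def word (L : LabelledWord) : ChordWord 3 := L.map fun x => Chord.ofTail x.1

/-- The endpoints on a strand, with the labels of the chords; tails are marked. -/
def strand (L : LabelledWord) (p : ZMod 3) : List (ℕ × Bool) :=
  (L.filter fun x => x.1 = p ∨ x.1 + 1 = p).map fun x => (x.2, decide (x.1 = p))

/-- The name of the closure, with marked tails. -/
def name (L : LabelledWord) : List (ℕ × Bool) := L.strand 0 ++ L.strand 1 ++ L.strand 2

def labels (L : LabelledWord) : List ℕ := L.map Prod.snd

def slideLetter (x : ZMod 3 × ℕ) : ZMod 3 × ℕ := (x.1 + 1, x.2)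

theorem strand_append (L M : LabelledWord) (p : ZMod 3) :
    strand (L ++ M) p = L.strand p ++ M.strand p := by simp [strand]

theorem strand_cons (x : ZMod 3 × ℕ) (L : LabelledWord) (p : ZMod 3) :
    strand (x :: L) p = (if x.1 = p ∨ x.1 + 1 = p then [(x.2, decide (x.1 = p))] else []) ++
      L.strand p := by
  by_cases h : x.1 = p ∨ x.1 + 1 = p <;> simp [strand, h]

theorem strand_nil (p : ZMod 3) : strand [] p = [] := rfl

theorem mem_labels_of_mem_strand {L : LabelledWord} {p : ZMod 3} {x : ℕ × Bool}
    (h : x ∈ L.strand p) : x.1 ∈ L.labels := by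
  obtain ⟨y, hy, rfl⟩ := List.mem_map.1 h
  exact List.mem_map_of_mem (List.mem_filter.1 hy).1

/-- The relation that cyclic moves generate, with what it preserves. -/
structure Cyclic (L M : LabelledWord) : Prop where
  word : CyclicEquiv L.word M.word
  name : L.name ~r M.name
  labels : L.labels.Perm M.labels

namespace Cyclic

variable {L M N : LabelledWord}

theorem symm (h : Cyclic L M) : Cyclic M L := ⟨h.1.symm, h.2.symm, h.3.symm⟩

theorem trans (h : Cyclic L M) (h' : Cyclic M N) : Cyclic L N :=
  ⟨h.1.trans _ _ _ h'.1, h.2.trans h'.2, h.3.trans h'.3⟩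

theorem move (L : LabelledWord) (x : ZMod 3 × ℕ) : Cyclic (L ++ [x]) (slideLetter x :: L) := by
  refine ⟨.rel _ _ ⟨L.word, .ofTail x.1, by simp [LabelledWord.word],
    by simp [LabelledWord.word, Chord.slide_ofTail, slideLetter]⟩, ?_,
    by simp [LabelledWord.labels, slideLetter, List.perm_append_singleton]⟩
  obtain ⟨c, k⟩ := x
  simp only [LabelledWord.name, strand_append, strand_cons, strand_nil, slideLetter]
  obtain rfl | rfl | rfl := zmod_three_cases c
  · simp +decide [List.IsRotated.refl]
  · simp +decide only [List.append_nil, List.nil_append, if_true, if_false, ← List.append_assoc]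
    simpa using List.isRotated_append (l := L.strand 0 ++ L.strand 1 ++ [(k, true)] ++ L.strand 2)
      (l' := [(k, false)])
  · simp +decide only [List.append_nil, List.nil_append, if_true, if_false, ← List.append_assoc]
    simpa using List.isRotated_append (l := L.strand 0 ++ [(k, false)] ++ L.strand 1 ++ L.strand 2)
      (l' := [(k, true)])

theorem refl (L : LabelledWord) : Cyclic L L := ⟨.refl _, .refl _, .refl _⟩

theorem moves (A B : LabelledWord) : Cyclic (A ++ B) (B.map slideLetter ++ A) := by
  induction B using List.reverseRecOn generalizing A with
  | nil => simpa using refl A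
  | append_singleton B x ih =>
    rw [← List.append_assoc]
    exact (move _ x).trans (by simpa using ih (slideLetter x :: A))

/-- Once the chord has been brought to the front, sliding the whole word around the closure
increases all tails by one. After at most two such rounds the tail is 0. -/
theorem exists_front {c : ZMod 3} {k : ℕ} (h : (c, k) ∈ L) : ∃ L' : LabelledWord, Cyclic L ((0, k) :: L') := by
  have turn : ∀ {c L'}, Cyclic L ((c, k) :: L') → Cyclic L ((c + 1, k) :: L'.map slideLetter) :=
    fun h => h.trans (by simpa [slideLetter] using moves [] ((_, k) :: _))
  obtain ⟨A, B, rfl⟩ := List.append_of_mem h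
  have h1 : Cyclic _ ((c + 1, k) :: (B.map slideLetter ++ A)) := moves A ((c, k) :: B)
  obtain rfl | rfl | rfl := zmod_three_cases c
  · exact ⟨_, turn (turn h1)⟩
  · exact ⟨_, turn h1⟩
  · exact ⟨_, h1⟩

end Cyclic

/-- Two edges of a triangle always share a vertex, so there is a strand on which the first letters
of both words are visible. Their labels and marks agree there, and on that strand the mark
determines the tail. -/
theorem eq_of_strand_eq {L M : LabelledWord} (h : ∀ p, L.strand p = M.strand p) : L = M := by
  induction L generalizing M with
  | nil =>
    rcases M with _ | ⟨x, M⟩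
    · rfl
    · simpa [strand_cons, strand_nil] using h x.1
  | cons x L ih =>
    rcases M with _ | ⟨y, M⟩
    · simpa [strand_cons, strand_nil] using h x.1
    obtain ⟨c, k⟩ := x
    obtain ⟨d, k'⟩ := y
    obtain ⟨p, hp, hp', hcd⟩ : ∃ p, (c = p ∨ c + 1 = p) ∧ (d = p ∨ d + 1 = p) ∧
        (decide (c = p) = decide (d = p) → c = d) := by clear h ih; revert c d; decide
    have h0 := h p
    simp only [strand_cons, hp, hp', if_true, List.singleton_append, List.cons.injEq,
      Prod.mk.injEq] at h0
    obtain rfl := h0.1.1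
    obtain rfl := hcd h0.1.2
    rw [ih fun p => by simpa [strand_cons] using h p]

/-- A name displays the strands 1 and 2 without a separation. Once the marked strand 0 is known,
this count finds the lengths of both. -/
theorem length_strand (L : LabelledWord) : (L.strand 0).length + (L.strand 1).length =
    (L.strand 2).length + 2 * ((L.strand 0).filter Prod.snd).length := by
  induction L with
  | nil => rfl
  | cons x L ih =>
    obtain ⟨c, k⟩ := x
    simp only [strand_cons, List.length_append, List.filter_append]
    obtain rfl | rfl | rfl := zmod_three_cases c
    all_goals simp +decide
    all_goals omega

theorem name_zero_cons (k : ℕ) (L : LabelledWord) : name ((0, k) :: L) =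
    (k, true) :: (L.strand 0 ++ (k, false) :: (L.strand 1 ++ L.strand 2)) := by
  simp +decide [name, strand_cons]

/-- The two endpoints of the first chord fix the starting point and cut off the strand 0; the
remainder is cut by `length_strand`, and the strands determine the word. -/
theorem eq_of_isRotated {k : ℕ} {v w : LabelledWord} (hv : k ∉ v.labels) (hw : k ∉ w.labels)
    (h : name ((0, k) :: v) ~r name ((0, k) :: w)) : v = w := by
  have nv : ∀ p b, (k, b) ∉ v.strand p := fun p b h => hv (mem_labels_of_mem_strand h)
  have nw : ∀ p b, (k, b) ∉ w.strand p := fun p b h => hw (mem_labels_of_mem_strand h)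
  rw [name_zero_cons, name_zero_cons] at h
  obtain ⟨h0, h12⟩ := List.append_cons_inj_of_notMem_left (h.cons_eq (by simp [nv])) (nv _ _)
    (nw _ _)
  have hl := congrArg List.length h12
  have l1 := length_strand v
  have l2 := length_strand w
  rw [List.length_append, List.length_append] at hl
  rw [h0] at l1
  obtain ⟨h1, h2⟩ := List.append_inj h12 (by omega)
  refine eq_of_strand_eq fun p => ?_
  obtain rfl | rfl | rfl := zmod_three_cases p
  exacts [h0, h1, h2]

theorem map_fst_strand (L : LabelledWord) (p : ZMod 3) :
    (L.strand p).map Prod.fst = (L.filter fun x => x.1 = p ∨ x.1 + 1 = p).map Prod.snd := by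
  simp [strand]

/-- A word without letters of tail `1` is given by its labels and by the set of those of tail `0`. -/
theorem exists_mark {v w : LabelledWord} (hv : v.labels.Nodup) (hw : w.labels.Nodup)
    (h : ((v.strand 1).map Prod.fst) ++ (v.strand 2).map Prod.fst = (w.strand 0).map Prod.fst) :
    ∃ f : ℕ → Bool, v = v.labels.map (fun x => (if f x then 0 else 2, x)) ∧
      (v.strand 0).map Prod.fst = v.labels ∧
      (v.strand 1).map Prod.fst = v.labels.filter f ∧
      (v.strand 2).map Prod.fst = v.labels.filter fun x => !f x := by
  -- A chord of tail 1 would have its label on both strands 1 and 2, hence twice on the strand 0 of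
  -- the other word, where labels are distinct.
  have hb : ∀ x ∈ v, x.1 ≠ 1 := by
    intro x hx h1
    have hnd : ((w.strand 0).map Prod.fst).Nodup := by
      rw [map_fst_strand]
      exact (List.filter_sublist.map _).nodup hw
    rw [← h, List.nodup_append, map_fst_strand, map_fst_strand] at hnd
    exact hnd.2.2 x.2 (List.mem_map_of_mem (List.mem_filter.2 ⟨hx, by simp [h1]⟩)) x.2
      (List.mem_map_of_mem (List.mem_filter.2 ⟨hx, by simp [h1]; decide⟩)) rfl
  have hf : ∀ x ∈ v, (0, x.2) ∈ v ↔ x.1 = 0 := by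
    intro x hx
    refine ⟨fun h0 => ?_, fun h0 => by rwa [← h0]⟩
    rw [← List.inj_on_of_nodup_map hv h0 hx rfl]
  have hx : ∀ x ∈ v, x.1 = if decide ((0, x.2) ∈ v) then 0 else 2 := by
    intro x hx
    simp only [hf x hx, decide_eq_true_eq]
    have := hb x hx
    split_ifs with h
    · exact h
    · generalize x.1 = c at *
      revert c; decide
  have hfil : ∀ (p : ZMod 3) (P : ℕ → Bool), (∀ x ∈ v, P x.2 = decide (x.1 = p ∨ x.1 + 1 = p)) →
      (v.strand p).map Prod.fst = v.labels.filter P := fun p P hP => by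
    rw [map_fst_strand, labels, List.filter_map, List.filter_congr (q := P ∘ Prod.snd)]
    exact fun x hx => (hP x hx).symm
  refine ⟨fun k => decide ((0, k) ∈ v), ?_, ?_, hfil 1 _ ?_, hfil 2 _ ?_⟩
  · rw [labels, List.map_map]
    conv_lhs => rw [← List.map_id v]
    exact List.map_congr_left fun x h => Prod.ext (hx x h) rfl
  · rw [hfil 0 (fun _ => true), List.filter_true]
    intro x h
    have := hb x h
    generalize x.1 = c at *
    revert c; decide
  all_goals
    intro x h
    simp only [hf x h]
    have := hb x h
    generalize x.1 = c at *
    revert c; decide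

/-- Let `S` and `T` be the orders of the labels in `v` and `w`, and `f` and `g` the marks of the
letters `a`. The hypotheses say that each order is the other one sorted by its marks. With `X` and
`Y` the parts of `T` where `g` is true or false, `S = X ++ Y`, and `T` is this list sorted by `f`.
Each of `X` and `Y` must then be sorted by `f` already. So `v` has the form `a c a c` and `w` as
well, with the two middle blocks exchanged. -/
theorem exists_fan {k : ℕ} {v w : LabelledWord} (hv : v.labels.Nodup) (hw : w.labels.Nodup)
    (h : (v.strand 1).map Prod.fst ++ (v.strand 2).map Prod.fst = (w.strand 0).map Prod.fst)
    (h' : (w.strand 1).map Prod.fst ++ (w.strand 2).map Prod.fst = (v.strand 0).map Prod.fst) :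
    ∃ l p n, CyclicEquiv (word ((0, k) :: v)) (fanWord l p n) ∧
      CyclicEquiv (word ((0, k) :: w)) (fanWord l n p) := by
  obtain ⟨f, ev, v0, v1, v2⟩ := exists_mark hv hw h
  obtain ⟨g, ew, w0, w1, w2⟩ := exists_mark hw hv h'
  rw [v1, v2, w0] at h
  rw [w1, w2, v0] at h'
  generalize v.labels = S at *
  generalize w.labels = T at *
  -- The last block, of letters `c`, slides around the closure and becomes a block of letters `a` in
  -- front; together with the leading chord and the block `A` it makes up `a^l`.
  have fan : ∀ (f : ℕ → Bool) (A B C E : List ℕ), (∀ x ∈ A, f x) → (∀ x ∈ B, ¬ f x) →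
      (∀ x ∈ C, f x) → (∀ x ∈ E, ¬ f x) →
      CyclicEquiv (word ((0, k) :: (A ++ B ++ C ++ E).map fun x => (if f x then 0 else 2, x)))
        (fanWord (E.length + 1 + A.length) B.length C.length) := by
    intro f A B C E hA hB hC hE
    have := (Cyclic.moves ((0, k) :: (A ++ B ++ C).map fun x => (if f x then 0 else 2, x))
      (E.map fun x => (if f x then 0 else 2, x))).word
    convert this using 1
    · simp
    · have cst : ∀ (l : List ℕ) (F : ℕ → Chord 3) (c : Chord 3), (∀ x ∈ l, F x = c) →
          l.map F = List.replicate l.length c := fun l F c h => by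
        rw [List.eq_replicate_iff]; simpa using h
      simp only [word, fanWord, List.map_append, List.map_cons, List.map_map]
      rw [cst A _ ⟨0, 1, by decide⟩, cst B _ ⟨0, 2, by decide⟩, cst C _ ⟨0, 1, by decide⟩,
        cst E _ ⟨0, 1, by decide⟩, List.replicate_add, List.replicate_succ']
      · simp [Chord.ofTail]
      · intro x hx; simp [slideLetter, hE x hx]; rfl
      · intro x hx; simp [hC x hx]; rfl
      · intro x hx; simp [hB x hx]; rfl
      · intro x hx; simp [hA x hx]; rfl
  subst h'
  generalize hX : T.filter g = X at *
  generalize hY : (T.filter fun x => !g x) = Y at *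
  have gX : ∀ x ∈ X, g x := fun x hx => by rw [← hX] at hx; exact (List.mem_filter.1 hx).2
  have gY : ∀ x ∈ Y, ¬ g x := fun x hx => by
    rw [← hY] at hx; simpa using (List.mem_filter.1 hx).2
  rw [List.filter_append, List.filter_append] at h
  have fX : ∀ P : ℕ → Bool, (X.filter P).filter g = X.filter P ∧
      (X.filter P).filter (fun x => !g x) = [] := fun P =>
    ⟨List.filter_eq_self.2 fun x hx => gX x (List.mem_filter.1 hx).1,
      List.filter_eq_nil_iff.2 fun x hx => by simp [gX x (List.mem_filter.1 hx).1]⟩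
  have fY : ∀ P : ℕ → Bool, (Y.filter P).filter g = [] ∧
      (Y.filter P).filter (fun x => !g x) = Y.filter P := fun P =>
    ⟨List.filter_eq_nil_iff.2 fun x hx => gY x (List.mem_filter.1 hx).1,
      List.filter_eq_self.2 fun x hx => by simp [gY x (List.mem_filter.1 hx).1]⟩
  -- Restricting the order `T`, sorted by `f`, to the labels marked by `g` gives `X` back.
  have e1 : X.filter f ++ X.filter (fun x => !f x) = X := by
    conv_rhs => rw [← hX, ← h]
    simp only [List.filter_append, fX, fY, List.append_nil]
  have e2 : Y.filter f ++ Y.filter (fun x => !f x) = Y := by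
    conv_rhs => rw [← hY, ← h]
    simp only [List.filter_append, fX, fY, List.nil_append]
  have pos : ∀ (P : ℕ → Bool) (l : List ℕ), ∀ x ∈ l.filter P, P x := fun P l x hx =>
    (List.mem_filter.1 hx).2
  have neg : ∀ (P : ℕ → Bool) (l : List ℕ), ∀ x ∈ l.filter (fun x => !P x), ¬ P x :=
    fun P l x hx => by simpa using (List.mem_filter.1 hx).2
  refine ⟨((Y.filter fun x => !f x).length + 1 + (X.filter f).length),
    (X.filter fun x => !f x).length, (Y.filter f).length, ?_, ?_⟩
  · have := fan f _ _ _ _ (pos f X) (neg f X) (pos f Y) (neg f Y)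
    rwa [List.append_assoc (_ ++ _), e1, e2, ← ev] at this
  · have := fan g (X.filter f) (Y.filter f) (X.filter fun x => !f x) (Y.filter fun x => !f x)
      (fun x hx => gX x (List.mem_filter.1 hx).1) (fun x hx => gY x (List.mem_filter.1 hx).1)
      (fun x hx => gX x (List.mem_filter.1 hx).1) (fun x hx => gY x (List.mem_filter.1 hx).1)
    rwa [List.append_assoc (_ ++ _), h, ← ew] at this

end LabelledWord

/-! ### The dichotomy for two words with the same name -/

namespace LabelledWord

theorem mem_of_mem_name {L : LabelledWord} {k : ℕ} {b : Bool} (h : (k, b) ∈ L.name) :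
    ∃ c, (c, k) ∈ L := by
  simp only [name, List.mem_append] at h
  have : k ∈ L.labels := by
    rcases h with (h | h) | h <;> exact mem_labels_of_mem_strand h
  obtain ⟨x, hx, rfl⟩ := List.mem_map.1 this
  exact ⟨x.1, hx⟩

theorem Cyclic.nodup {L M : LabelledWord} (h : Cyclic L M) (hL : L.labels.Nodup) :
    M.labels.Nodup := h.labels.nodup_iff.1 hL

/-- A chord with different directions in two words with the same name. -/
theorem exists_fan_of_mark_ne {L M : LabelledWord} (hL : L.labels.Nodup) (hM : M.labels.Nodup)
    {k : ℕ} {X Y X' Y' : List (ℕ × Bool)} (h : L.name ~r (k, true) :: (Y ++ X))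
    (h' : M.name ~r (k, false) :: (Y' ++ X')) (hX : X.map Prod.fst = X'.map Prod.fst)
    (hY : Y.map Prod.fst = Y'.map Prod.fst) :
    ∃ l p n, CyclicEquiv L.word (fanWord l p n) ∧ CyclicEquiv M.word (fanWord l n p) := by
  obtain ⟨c, hc⟩ := mem_of_mem_name (h.mem_iff.2 List.mem_cons_self)
  obtain ⟨c', hc'⟩ := mem_of_mem_name (h'.mem_iff.2 List.mem_cons_self)
  obtain ⟨v, hv⟩ := Cyclic.exists_front hc
  obtain ⟨w, hw⟩ := Cyclic.exists_front hc'
  have nv := List.nodup_cons.1 (hv.nodup hL)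
  have nw := List.nodup_cons.1 (hw.nodup hM)
  have kv : ∀ p, k ∉ (v.strand p).map Prod.fst := fun p hk => by
    obtain ⟨x, hx, rfl⟩ := List.mem_map.1 hk
    exact nv.1 (mem_labels_of_mem_strand hx)
  have kw : ∀ p, k ∉ (w.strand p).map Prod.fst := fun p hk => by
    obtain ⟨x, hx, rfl⟩ := List.mem_map.1 hk
    exact nw.1 (mem_labels_of_mem_strand hx)
  have kv' : ∀ p b, (k, b) ∉ v.strand p := fun p b hk => kv p (List.mem_map_of_mem hk)
  have kw' : ∀ p b, (k, b) ∉ w.strand p := fun p b hk => kw p (List.mem_map_of_mem hk)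
  have h1 := hv.name.symm.trans h
  -- In the second word the endpoint in question is the head of the chord; starting from there puts
  -- the strands 1 and 2 of `w` opposite the strand 0 of `v`.
  have hr : name ((0, k) :: w) ~r ((k, false) :: (w.strand 1 ++ w.strand 2 ++
      (k, true) :: w.strand 0)) := by
    simpa [name_zero_cons] using List.isRotated_append (l := (k, true) :: w.strand 0)
      (l' := (k, false) :: (w.strand 1 ++ w.strand 2))
  have h2 := hr.symm.trans (hw.name.symm.trans h')
  rw [name_zero_cons] at h1
  have e1 := congrArg (List.map Prod.fst) (h1.cons_eq (by simp [kv']))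
  have e2 := congrArg (List.map Prod.fst) (h2.cons_eq (by simp [kw']))
  rw [List.map_append (l₁ := Y), hX, hY, ← List.map_append (l₁ := Y'), ← e2] at e1
  simp only [List.map_append, List.map_cons] at e1
  obtain ⟨e3, e4⟩ := List.append_cons_inj_of_notMem_left e1 (kv 0)
    (by rw [List.mem_append, not_or]; exact ⟨kw 1, kw 2⟩)
  obtain ⟨l, p, n, h5, h6⟩ := exists_fan (k := k) nv.2 nw.2 e4 e3.symm
  exact ⟨l, p, n, hv.word.trans _ _ _ h5, hw.word.trans _ _ _ h6⟩

theorem cyclicEquiv_or_exists_fan {L M : LabelledWord} (hL : L.labels.Nodup) (hM : M.labels.Nodup)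
    (h : L.name.map Prod.fst ~r M.name.map Prod.fst) : CyclicEquiv L.word M.word ∨
      ∃ l p n, CyclicEquiv L.word (fanWord l p n) ∧ CyclicEquiv M.word (fanWord l n p) := by
  obtain ⟨P, Q, h1, h2⟩ := h.symm.exists_append
  obtain ⟨P', Q', h3, rfl, rfl⟩ := List.map_eq_append_iff.1 h1
  have hrot : M.name ~r Q' ++ P' := h3 ▸ List.isRotated_append
  rw [← List.map_append] at h2
  rcases List.eq_or_exists_ne_mark h2 with e | ⟨k, b, X, Y, X', Y', e, e', hX, hY⟩
  · rw [← e] at hrot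
    rcases L with _ | ⟨⟨c, k⟩, L⟩
    -- The empty word is separate, since it has no chord to be moved to the front.
    · have hM0 : M.name = [] := List.isRotated_nil_iff.1 hrot
      rcases M with _ | ⟨⟨c, k⟩, M⟩
      · exact .inl (.refl _)
      · simp only [name, List.append_eq_nil_iff, strand_cons] at hM0
        rcases zmod_three_cases c with rfl | rfl | rfl <;> revert hM0 <;> simp +decide
    · obtain ⟨v, hv⟩ := Cyclic.exists_front (L := (c, k) :: L) List.mem_cons_self
      have hk : (k, true) ∈ M.name := by
        rw [hrot.mem_iff, hv.name.mem_iff, name_zero_cons]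
        exact List.mem_cons_self
      obtain ⟨c', hc'⟩ := mem_of_mem_name hk
      obtain ⟨w, hw⟩ := Cyclic.exists_front hc'
      obtain rfl := eq_of_isRotated (List.nodup_cons.1 (hv.nodup hL)).1
        (List.nodup_cons.1 (hw.nodup hM)).1 (hv.name.symm.trans (hrot.symm.trans hw.name))
      exact .inl (hv.trans hw.symm).word
  · right
    have r1 : L.name ~r (k, b) :: (Y ++ X) := by
      rw [e]; exact List.isRotated_append
    have r2 : M.name ~r (k, !b) :: (Y' ++ X') := by
      refine hrot.trans ?_
      rw [e']; exact List.isRotated_append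
    -- If the marked endpoint is a head in `L`, the words change roles, and with them `p` and `n`.
    cases b
    · obtain ⟨l, p, n, h1, h2⟩ := exists_fan_of_mark_ne hM hL r2 r1 hX.symm hY.symm
      exact ⟨l, n, p, h2, h1⟩
    · exact exists_fan_of_mark_ne hL hM r1 r2 hX hY

end LabelledWord

theorem Chord.tail_eq_or_iff (g : Chord 3) {p : Fin 3} {c : ZMod 3} (h : c.val = p.val) :
    g.tail = c ∨ g.tail + 1 = c ↔ g.i = p ∨ g.j = p := by
  rcases g.cases_three with rfl | rfl | rfl <;> revert p c <;> decide

/-- A word with the labels of its chords. -/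
def ChordWord.labelled (W : ChordWord 3) (f : ℕ → ℕ) : LabelledWord :=
  W.zipIdx.map fun g => (g.1.tail, f g.2)

theorem ChordWord.word_labelled (W : ChordWord 3) (f : ℕ → ℕ) : (W.labelled f).word = W := by
  rw [LabelledWord.word, labelled, List.map_map]
  conv_rhs => rw [← List.zipIdx_map_fst 0 W]
  exact List.map_congr_left fun g _ => Chord.ofTail_tail g.1

theorem ChordWord.name_labelled (W : ChordWord 3) (f : ℕ → ℕ) :
    (W.labelled f).name.map Prod.fst = W.readName.map f := by
  have key : ∀ (p : Fin 3) (c : ZMod 3), c.val = p.val →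
      ((W.labelled f).strand c).map Prod.fst = (W.strandLabels p).map f := by
    intro p c hpc
    rw [LabelledWord.map_fst_strand, labelled, strandLabels, List.filter_map, List.map_map,
      List.map_map, List.filter_congr]
    · rfl
    · exact fun g _ => decide_eq_decide.2 (g.1.tail_eq_or_iff hpc)
  have e : W.readName = W.strandLabels 0 ++ W.strandLabels 1 ++ W.strandLabels 2 := by
    simp [readName, List.finRange_succ]
  simp only [LabelledWord.name, e, List.map_append, key 0 0 rfl, key 1 1 rfl, key 2 2 rfl]

theorem ChordWord.nodup_labelled (W : ChordWord 3) {f : ℕ → ℕ} (hf : f.Injective) :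
    (W.labelled f).labels.Nodup := by
  have e : (W.labelled f).labels = (W.zipIdx.map Prod.snd).map f := by
    rw [LabelledWord.labels, labelled, List.map_map, List.map_map]
    rfl
  rw [e, List.zipIdx_map_snd]
  exact (List.nodup_range' ..).map hf

theorem ChordWord.cyclicEquiv_or_exists_fan {V W : ChordWord 3} (h : V.diagram = W.diagram) :
    CyclicEquiv V W ∨
      ∃ l p n, CyclicEquiv V (fanWord l p n) ∧ CyclicEquiv W (fanWord l n p) := by
  obtain ⟨f, hf⟩ := Quotient.exact h
  have := LabelledWord.cyclicEquiv_or_exists_fan (V.nodup_labelled f.injective)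
    (W.nodup_labelled Function.injective_id)
    (by rw [name_labelled, name_labelled, List.map_id]; exact hf)
  rwa [word_labelled, word_labelled] at this

/-- Let `V` and `W` be 3-braidings of a chord diagram `D`. Their standard knots are singular knots
that respect `D`, and they are isotopic: either `V` and `W` are cyclically equivalent and the standard
knots are the same closed singular 3-braid, or `V` and `W` are cyclically equivalent to
`a^l c^p a^n` and `a^l c^n a^p` and the standard knots are related by a braid-preserving flype. -/
theorem corollary4p3 (D : ChordDiagram) (V W : ChordWord 3) (hV : V.diagram = D)
    (hW : W.diagram = D) (q q' : ℕ → Bool) :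
    (IsSingularKnot (standardKnot V q) ∧ Respects (standardKnot V q) D) ∧
    (IsSingularKnot (standardKnot W q') ∧ Respects (standardKnot W q') D) ∧
    SingularIsotopic (standardKnot V q) (standardKnot W q') ∧
    ((CyclicEquiv V W ∧
        ClosedBraidEquiv (sbWord (standardBraid V q)) (sbWord (standardBraid W q'))) ∨
      ∃ l p n : ℕ, CyclicEquiv V (fanWord l p n) ∧ CyclicEquiv W (fanWord l n p) ∧
        BraidFlype (sbWord (standardBraid V q)) (sbWord (standardBraid W q'))) := by
  refine ⟨⟨standardKnot_isSingularKnot V q, hV ▸ respects_standardKnot V q⟩,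
    ⟨standardKnot_isSingularKnot W q', hW ▸ respects_standardKnot W q'⟩, ?_⟩
  have hV' := (triCurve_isotopic_standardKnot V q).symm
  have hW' := triCurve_isotopic_standardKnot W q'
  rcases ChordWord.cyclicEquiv_or_exists_fan (hV.trans hW.symm) with h | ⟨l, p, n, h, h'⟩
  · exact ⟨(hV'.trans h.isotopic).trans hW', .inl ⟨h, h.closedBraidEquiv q q'⟩⟩
  · exact ⟨(hV'.trans ((h.isotopic.trans (fanWord_isotopic l p n)).trans h'.isotopic.symm)).trans hW',
      .inr ⟨l, p, n, h, h', braidFlype_of_fanWord h h' q q'⟩⟩
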